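/- Let $N\ge 1$ and $m>N+1$ be integers, let $\mathbb{T}^N=\mathbb{R}^N/\mathbb{Z}^N$, and let $F=H^{2m}(\mathbb{T}^N;\mathbb{R}^N)$ with the norm $\|\mathbf e\|_F=\big(\sum_{|\alpha|\le 2m}\sum_{i=1}^N\|\partial^\alpha \mathbf e_i\|_{L^2(\mathbb{T}^N)}^2\big)^{1/2}$. Let $T>0$ and let $t\mapsto E(t,\cdot)$, $t\ge 0$, be a càdlàg function with values in $F$. Consider the kinetic Fokker–Planck equation $$\partial_t f+v\cdot\nabla_x f+E(t,x)\cdot\nabla_v f=\mathrm{div}_v(\nabla_v f+vf),\qquad (x,v)\in\mathbb{T}^N\times\mathbb{R}^N. \tag{1}$$ For $t>0$ let $K_t(\cdot\,;y,w)$ be the density, with respect to the Lebesgue measure on $\mathbb{T}^N\times\mathbb{R}^N$, of the law at time $t$ of the solution of $dX_t=V_t\,dt$, $dV_t=-V_t\,dt+\sqrt2\,dB_t$, $(X_0,V_0)=(y,w)$. Explicitly, $$K_t(x,v;y,w)=\sum_{\xi\in\mathbb{R}^N,\ \xi\equiv x-y \ (\mathrm{mod}\ \mathbb{Z}^N)}\gamma_t\big(\xi-(1-e^{-t})w,\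 v-e^{-t}w\big),$$ where $\gamma_t$ is the density of the centred Gaussian law on $\mathbb{R}^N\times\mathbb{R}^N$ with covariance matrix $$2\begin{pmatrix}\int_0^t(1-e^{-s})^2ds&\int_0^te^{-s}(1-e^{-s})ds\\ \int_0^te^{-s}(1-e^{-s})ds&\int_0^te^{-2s}ds\end{pmatrix}\otimes I_N .$$ Set $K_tf(x,v)=\iint K_t(x,v;y,w)f(y,w)\,dy\,dw$ for $t>0$, $K_0f=f$, and $\nabla_wK_t[g](x,v)=\iint\nabla_wK_t(x,v;y,w)\cdot g(y,w)\,dy\,dw$ for $\mathbb{R}^N$-valued $g$. For $p\in[1,\infty)$ and $f_{\mathrm{in}}\in L^p(\mathbb{T}^N\times\mathbb{R}^N)$, a mild solution of (1) in $L^p$ with initial datum $f_{\mathrm{in}}$ is a continuous function $f:[0,T]\to L^p(\mathbb{T}^N\times\mathbb{R}^N)$ such that, for all $t\in[0,T]$, $$f(t)=K_tf_{\mathrm{in}}+\int_0^t\nabla_wK_{t-s}[E(s)f(s)]\,ds$$ (almost everywhere on $\mathbb{T}^N\times\mathbb{R}^N$, with absolutely convergent time integral). Let $\|f\|_{W^{k,p}}=\sum_{|\alpha|\le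 k}\|\partial^\alpha f\|_{L^p(\mathbb{T}^N\times\mathbb{R}^N)}$ (weak derivatives in $x$ and $v$), and for $l\in\mathbb{N}$ let $G_l$ be the set of $f\in L^1(\mathbb{T}^N\times\mathbb{R}^N)$ with $\iint|v|^l|f|\,dx\,dv<\infty$. **Proposition (Cauchy problem, FP case).** Let $p\in[1,\infty)$ and $f_{\mathrm{in}}\in L^p(\mathbb{T}^N\times\mathbb{R}^N)$. Then (1) has a unique mild solution $f$ in $L^p$ on $[0,T]$ with initial datum $f_{\mathrm{in}}$. Moreover: 1. if $f_{\mathrm{in}}\ge0$, then $f(t)\ge0$ for all $t\in[0,T]$; 2. for every $k\in\{0,1,2\}$ and every $R\ge 0$ there is a constant $C$, depending only on $k$, $T$, $N$, $R$ and on the choice of $m$ in the definition of $F$ (in particular not on $p$, $f_{\mathrm{in}}$ or $E$), such that, if $\sup_{t\in[0,T]}\|E(t,\cdot)\|_F\le R$ and $f_{\mathrm{in}}\in W^{k,p}(\mathbb{T}^N\times\mathbb{R}^N)$, then $f(t)\in W^{k,p}(\mathbb{T}^N\times\mathbb{R}^N)$ for all $t\in[0,T]$ and $$\sup_{t\in[0,T]}\|f(t)\|_{W^{k,p}}\le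 C\,\|f_{\mathrm{in}}\|_{W^{k,p}};$$ 3. if $p=1$ and $f_{\mathrm{in}}\ge0$, then $\|f(t)\|_{L^1}=\|f_{\mathrm{in}}\|_{L^1}$ for all $t\in[0,T]$; 4. if $p=1$ (with no sign condition on $f_{\mathrm{in}}$), then $\|f(t)\|_{L^1}\le\|f_{\mathrm{in}}\|_{L^1}$ for all $t\in[0,T]$; 5. for every $l\in\mathbb{N}$, if $f_{\mathrm{in}}\in G_l$, then $f(t)\in G_l$ for all $t\in[0,T]$. -/

import Mathlib

open MeasureTheory Filter Topology Set

open scoped ENNReal NNReal ContDiff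

noncomputable section

namespace KineticFP

/-! ### The phase space -/

/-- The torus `𝕋^N = ℝ^N / ℤ^N`. -/
abbrev Torus (N : ℕ) : Type := UnitAddTorus (Fin N)

/-- The space `ℝ^N` with its Euclidean norm. -/
abbrev Vel (N : ℕ) : Type := EuclideanSpace ℝ (Fin N)

/-- The phase space `𝕋^N × ℝ^N`, with the product Lebesgue measure `volume`. -/
abbrev Phase (N : ℕ) : Type := Torus N × Vel N

/-- The projection `ℝ^N → 𝕋^N`. -/
def toTorus {N : ℕ} (ξ : Vel N) : Torus N := fun i => (ξ i : UnitAddCircle)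

/-- The projection `ℝ^N × ℝ^N → 𝕋^N × ℝ^N`. -/
def toPhase {N : ℕ} (ζ : Vel N × Vel N) : Phase N := (toTorus ζ.1, ζ.2)

/-- The coordinate directions of `ℝ^N`. -/
def torusDir {N : ℕ} (i : Fin N) : Vel N := EuclideanSpace.single i 1

/-- The coordinate directions of `ℝ^N × ℝ^N`: first the `x_i`, then the `v_i`. -/
def phaseDir {N : ℕ} : Fin N ⊕ Fin N → Vel N × Vel N :=
  Sum.elim (fun i => (EuclideanSpace.single i 1, 0)) (fun i => (0, EuclideanSpace.single i 1))

/-! ### Weak derivatives and Sobolev norms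

These are written for a space `G` covered by a normed space `V` through `π : V → G`; they are used
for `G = 𝕋^N`, `V = ℝ^N` and for `G = 𝕋^N × ℝ^N`, `V = ℝ^N × ℝ^N`. -/

/-- The classical derivative of `φ : G → ℝ` in the direction `e`. -/
def dirDeriv {V G : Type*} [SMul ℝ V] [Add G] (π : V → G) (e : V) (φ : G → ℝ) (x : G) : ℝ :=
  deriv (fun s : ℝ => φ (x + π (s • e))) 0

/-- The classical derivative `∂^α φ`, with `α i` derivatives in the direction `e i`
(only applied to smooth functions, for which the order of the derivatives is irrelevant). -/
def multiDeriv {V G ι : Type*} [SMul ℝ V] [Add G] [Fintype ι] (π : V → G) (e : ι → V)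
    (α : ι → ℕ) (φ : G → ℝ) : G → ℝ :=
  (Finset.univ : Finset ι).toList.foldr (fun i ψ => (dirDeriv π (e i))^[α i] ψ) φ

/-- Test functions: smooth functions on `G` with compact support. -/
def IsTestFunction {V G : Type*} [NormedAddCommGroup V] [NormedSpace ℝ V] [TopologicalSpace G]
    (π : V → G) (φ : G → ℝ) : Prop :=
  ContDiff ℝ ∞ (φ ∘ π) ∧ HasCompactSupport φ

/-- `g` is the weak derivative `∂^α f`. -/
def HasWeakDeriv {V G ι : Type*} [NormedAddCommGroup V] [NormedSpace ℝ V] [TopologicalSpace G]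
    [Add G] [MeasureSpace G] [Fintype ι] (π : V → G) (e : ι → V) (α : ι → ℕ)
    (f g : G → ℝ) : Prop :=
  LocallyIntegrable f ∧ LocallyIntegrable g ∧
    ∀ φ : G → ℝ, IsTestFunction π φ →
      ∫ x, f x * multiDeriv π e α φ x = (-1) ^ (∑ i, α i) * ∫ x, g x * φ x

/-- The norm `‖∂^α f‖_{L^p}` of the weak derivative, equal to `∞` if there is no weak derivative.
(A weak derivative is unique up to null sets, so that the infimum is over equal numbers.) -/
def weakDerivNorm {V G ι : Type*} [NormedAddCommGroup V] [NormedSpace ℝ V] [TopologicalSpace G]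
    [Add G] [MeasureSpace G] [Fintype ι] (π : V → G) (e : ι → V) (α : ι → ℕ) (p : ℝ≥0∞)
    (f : G → ℝ) : ℝ≥0∞ :=
  ⨅ (g : G → ℝ) (_ : HasWeakDeriv π e α f g), eLpNorm g p volume

/-- The norm `∑_{|α| ≤ k} ‖∂^α f‖_{L^p}` of `W^{k,p}(𝕋^N × ℝ^N)`; it is finite if and only if `f`
belongs to this space. -/
def sobolevNorm {N : ℕ} (k : ℕ) (p : ℝ≥0∞) (f : Phase N → ℝ) : ℝ≥0∞ :=
  ∑ n ∈ Finset.range (k + 1), ∑ α ∈ Finset.piAntidiag (Finset.univ : Finset (Fin N ⊕ Fin N)) n,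
    weakDerivNorm toPhase phaseDir α p f

/-! ### The force space `F = H^{2m}(𝕋^N; ℝ^N)` -/

/-- The norm `(∑_{|α| ≤ 2m} ∑_i ‖∂^α e_i‖²_{L²})^{1/2}` of `F`; it is finite if and only if
`e` belongs to `F`. -/
def forceNorm {N : ℕ} (m : ℕ) (e : Torus N → Vel N) : ℝ≥0∞ :=
  (∑ n ∈ Finset.range (2 * m + 1), ∑ α ∈ Finset.piAntidiag (Finset.univ : Finset (Fin N)) n,
    ∑ i : Fin N, weakDerivNorm toTorus torusDir α 2 (fun x => e x i) ^ 2) ^ (1 / 2 : ℝ)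

/-- `t ↦ E t`, `t ≥ 0`, is a càdlàg function with values in `F`. -/
def IsCadlagForce {N : ℕ} (m : ℕ) (E : ℝ → Torus N → Vel N) : Prop :=
  (∀ t, 0 ≤ t → forceNorm m (E t) < ⊤) ∧
  (∀ t, 0 ≤ t → Tendsto (fun s => forceNorm m (E s - E t)) (𝓝[>] t) (𝓝 0)) ∧
  (∀ t, 0 < t → ∃ l : Torus N → Vel N, forceNorm m l < ⊤ ∧
    Tendsto (fun s => forceNorm m (E s - l)) (𝓝[<] t) (𝓝 0))

/-! ### The kinetic Fokker–Planck kernel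

For `dX = V dt`, `dV = -V dt + √2 dB` with `(X_0, V_0) = (y, w)`, the position (before projection
to the torus) and the velocity are
`y + (1 - e^{-t}) w + √2 ∫₀ᵗ (1 - e^{-(t-s)}) dB_s` and `e^{-t} w + √2 ∫₀ᵗ e^{-(t-s)} dB_s`. The
fluctuation is a centred Gaussian vector with covariance matrix
`[covXX t, covXV t; covXV t, covVV t] ⊗ I_N`. -/

def covXX (t : ℝ) : ℝ := 2 * ∫ s in (0 : ℝ)..t, (1 - Real.exp (-s)) ^ 2

def covXV (t : ℝ) : ℝ := 2 * ∫ s in (0 : ℝ)..t, Real.exp (-s) * (1 - Real.exp (-s))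

def covVV (t : ℝ) : ℝ := 2 * ∫ s in (0 : ℝ)..t, Real.exp (-2 * s)

def covDet (t : ℝ) : ℝ := covXX t * covVV t - covXV t ^ 2

/-- The density of the centred Gaussian law on `ℝ^N × ℝ^N` with the covariance above. -/
def gaussDensity {N : ℕ} (t : ℝ) (ξ η : Vel N) : ℝ :=
  ((2 * Real.pi) ^ N * Real.sqrt (covDet t) ^ N)⁻¹ *
    Real.exp (-(covVV t * ‖ξ‖ ^ 2 - 2 * covXV t * inner ℝ ξ η + covXX t * ‖η‖ ^ 2) /
      (2 * covDet t))

/-- The kernel `K_t(x, v; y, w)`, `t > 0`: the density at `(x, v)` of the law of `(X_t, V_t)` on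
`𝕋^N × ℝ^N`. The sum is over all the lifts `ξ ∈ ℝ^N` of `x - y ∈ 𝕋^N`. -/
def kernel {N : ℕ} (t : ℝ) (x : Torus N) (v : Vel N) (y : Torus N) (w : Vel N) : ℝ :=
  ∑' ξ : {ξ : Vel N // toTorus ξ = x - y},
    gaussDensity t (ξ.1 - (1 - Real.exp (-t)) • w) (v - Real.exp (-t) • w)

/-- `K_t f (x, v) = ∬ K_t(x, v; y, w) f(y, w) dy dw` for `t > 0`, and `K_0 f = f`. -/
def kernelOp {N : ℕ} (t : ℝ) (f : Phase N → ℝ) (z : Phase N) : ℝ :=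
  if t = 0 then f z else ∫ z' : Phase N, kernel t z.1 z.2 z'.1 z'.2 * f z'

/-- `∇_w K_t [g] (x, v) = ∬ ∇_w K_t(x, v; y, w) · g(y, w) dy dw`. -/
def gradKernelOp {N : ℕ} (t : ℝ) (g : Phase N → Vel N) (z : Phase N) : ℝ :=
  ∫ z' : Phase N, inner ℝ (gradient (fun w => kernel t z.1 z.2 z'.1 w) z'.2) (g z')

/-! ### Mild solutions and moments -/

/-- `f ∈ C([0,T]; L^p)` is a mild solution of
`∂_t f + v · ∇_x f + E · ∇_v f = div_v (∇_v f + v f)` with initial datum `fin`: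
`f(t) = K_t fin + ∫₀ᵗ ∇_w K_{t-s} [E(s) f(s)] ds` in `L^p` for all `t ∈ [0,T]`. -/
def IsMildSolution {N : ℕ} {p : ℝ≥0∞} [Fact (1 ≤ p)] (T : ℝ) (E : ℝ → Torus N → Vel N)
    (fin : Lp ℝ p (volume : Measure (Phase N)))
    (f : ℝ → Lp ℝ p (volume : Measure (Phase N))) : Prop :=
  ContinuousOn f (Icc 0 T) ∧
  ∀ t ∈ Icc 0 T, ∀ᵐ z : Phase N,
    IntervalIntegrable (fun s => gradKernelOp (t - s) (fun z' => f s z' • E s z'.1) z)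
      volume 0 t ∧
    f t z = kernelOp t fin z +
      ∫ s in (0 : ℝ)..t, gradKernelOp (t - s) (fun z' => f s z' • E s z'.1) z

/-- `f ∈ G_l`: `∬ |f| dx dv + ∬ |v|^l |f| dx dv < ∞`. -/
def MemG {N : ℕ} (l : ℕ) (f : Phase N → ℝ) : Prop :=
  Integrable f ∧ Integrable (fun z : Phase N => ‖z.2‖ ^ l * f z)

end KineticFP

end

/-! The equation is solved as a linear Volterra equation in L^p with a kernel of size τ^{-1/2}, and
each assertion is a structural property of that kernel.

The law of (X_t, V_t) is the free flow (y, w) ↦ (y + (1 - e^{-t})w, e^{-t}w) followed by an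
independent Gaussian displacement. Hence K_t is a Gaussian average of the transport operators f ↦
e^{Nt} f(flow_{-t}(· - a)) (`kineticOp`). Shifting the initial velocity amounts to shifting the
Gaussian variable (`gaussMap_scoreDir`), so that Gaussian integration by parts represents ∇_w K_t by
the same average with a linear weight, the score (`dirKineticOp`, `gradOp`). The score coefficients
are O(t^{-1/2}) (`score_le`) and each transport operator has norm at most e^{N|t|} on every L^p, so
that ‖∇_w K_t‖ ≤ C t^{-1/2} with C independent of p. Unfolding the torus and Fubini identify the
pointwise formulation, with its lattice-sum kernel, with the equation `MildEq` in L^p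
(`isMildSolution_iff`).

Since 2m - 3 > N, the norm of F controls ∑ (1 + |n|)³ |c_n| for the Fourier coefficients of the
force (`weight_mul_fourierCoeffs_le`). So E(s) is almost everywhere a continuous function, with
enough bounded derivatives, and the càdlàg property gives measurability and boundedness in time.
Existence is a contraction for the norm sup e^{-λt}‖u(t)‖, because ∫ τ^{-1/2} e^{-λτ} dτ = √(π/λ) is
small for large λ; uniqueness and stability are the corresponding Gronwall inequality. The fixed
point stays in every closed family of sets that the Volterra map preserves
(`SingularKernel.exists_solution`).

Moments: the sets where truncated moments are at most 2De^{λt} form such a family. Mass: transport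
preserves the integral and the score has mean zero, so K_t preserves mass and ∇_w K_t produces none.

Positivity is hidden in the Duhamel formula, since ∇_w K_t is not a positive operator. Split E into
positive and negative parts, attached to opposite directions, and replace the derivative by a
difference quotient of step h. The resulting operator is bounded and becomes positive after adding
λ·Id, while K_t is replaced by e^{-λt}K_t (`kineticOp_duhamel_tilt`); so the approximate solutions
are nonnegative. Their kernels K_t∘(difference quotient) are bounded by C t^{-1/2} uniformly in h
(`singularKernel_shiftOp`), and they converge to the solution. For nonnegative data the L¹ norm is
the mass; the general L¹ bound follows by splitting the datum into its positive and negative parts.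

Regularity: K_t and ∇_w K_t intertwine the translation by b with the translation by the flowed
vector `linFlow t b`. A translated solution thus solves the equation with a translated force.
Differentiating with respect to the size of the translation, once or twice, gives mild equations for
the derivatives, with source terms bounded by the derivatives of the force; the stability estimate
bounds them uniformly in p. Finally, translation derivatives in L^p, p < ∞, are the same as weak
derivatives up to sign. -/

noncomputable section

namespace KineticFP

/-! ### Volterra equations with a weakly singular kernel -/

section Volterra

variable {X Y : Type*} [NormedAddCommGroup X] [NormedSpace ℝ X] [NormedAddCommGroup Y]
  [NormedSpace ℝ Y]

/-- A strongly continuous operator kernel with a singularity of order `τ^{-1/2}` at `τ = 0`. -/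
structure SingularKernel (T C : ℝ) (G : ℝ → Y →L[ℝ] X) : Prop where
  cont : ContinuousOn (fun q : ℝ × Y => G q.1 q.2) (Ioi 0 ×ˢ univ)
  bound : ∀ τ ∈ Ioc 0 T, ‖G τ‖ ≤ C * τ ^ (-(1 / 2) : ℝ)

/-- Strong continuity and local bounds give joint continuity. -/
theorem continuousOn_uncurry_of_strong {G : ℝ → Y →L[ℝ] X} {S : Set ℝ} {B : ℝ → ℝ}
    (hB : ContinuousOn B S) (hG : ∀ τ ∈ S, ‖G τ‖ ≤ B τ)
    (hc : ∀ y, ContinuousOn (fun τ => G τ y) S) :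
    ContinuousOn (fun q : ℝ × Y => G q.1 q.2) (S ×ˢ univ) := by
  rintro ⟨τ, y⟩ ⟨hτ, -⟩
  have h1 : Tendsto (fun q : ℝ × Y => B q.1 * ‖q.2 - y‖ + ‖G q.1 y - G τ y‖)
      (𝓝[S ×ˢ univ] (τ, y)) (𝓝 (B τ * ‖y - y‖ + ‖G τ y - G τ y‖)) := by
    have hfst : Tendsto (Prod.fst : ℝ × Y → ℝ) (𝓝[S ×ˢ univ] (τ, y)) (𝓝[S] τ) := by
      rw [nhdsWithin_prod_eq]; exact tendsto_fst
    have hsnd : Tendsto (Prod.snd : ℝ × Y → Y) (𝓝[S ×ˢ univ] (τ, y)) (𝓝 y) :=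
      (continuous_snd.tendsto (τ, y)).mono_left nhdsWithin_le_nhds
    exact (((hB τ hτ).tendsto.comp hfst).mul (hsnd.sub_const y).norm).add
      ((((hc y τ hτ).tendsto.comp hfst).sub_const _).norm)
  simp only [sub_self, norm_zero, mul_zero, add_zero] at h1
  refine tendsto_iff_norm_sub_tendsto_zero.2
    (squeeze_zero' (Eventually.of_forall fun _ => norm_nonneg _) ?_ h1)
  filter_upwards [self_mem_nhdsWithin] with q hq
  calc ‖G q.1 q.2 - G τ y‖ = ‖G q.1 (q.2 - y) + (G q.1 y - G τ y)‖ := by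
        rw [map_sub]; congr 1; abel
    _ ≤ ‖G q.1 (q.2 - y)‖ + ‖G q.1 y - G τ y‖ := norm_add_le _ _
    _ ≤ _ := by
        gcongr
        exact (ContinuousLinearMap.le_opNorm _ _).trans
          (mul_le_mul_of_nonneg_right (hG _ hq.1) (norm_nonneg _))

set_option linter.unusedSectionVars false

variable {T C : ℝ} {G : ℝ → Y →L[ℝ] X}

/-- Joint continuity is only known for τ > 0. Writing τ = exp (log τ) gives a globally continuous
function of (log τ, y), which can be composed with a measurable curve. -/
theorem SingularKernel.aestronglyMeasurable (hG : SingularKernel T C G) {r : ℝ → Y}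
    (hr : AEStronglyMeasurable r (volume.restrict (Ioc 0 T))) {t : ℝ} (ht : t ≤ T) :
    AEStronglyMeasurable (fun s => G (t - s) (r s)) (volume.restrict (Ioc 0 t)) := by
  rw [← restrict_Ioo_eq_restrict_Ioc]
  have hr' : AEStronglyMeasurable r (volume.restrict (Ioo 0 t)) :=
    hr.mono_measure (Measure.restrict_mono
      (Ioo_subset_Ioc_self.trans (Ioc_subset_Ioc_right ht)) le_rfl)
  have hcont : Continuous fun q : ℝ × Y => G (Real.exp q.1) q.2 := by
    have : Continuous fun q : ℝ × Y => ((Real.exp q.1, q.2) : ℝ × Y) := by fun_prop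
    exact hG.cont.comp_continuous this fun q => ⟨Real.exp_pos _, mem_univ _⟩
  have hlog : AEStronglyMeasurable (fun s => Real.log (t - s)) (volume.restrict (Ioo 0 t)) :=
    (Real.measurable_log.comp (measurable_const.sub measurable_id)).aestronglyMeasurable
  refine (hcont.comp_aestronglyMeasurable (hlog.prodMk hr')).congr ?_
  filter_upwards [ae_restrict_mem measurableSet_Ioo] with s hs
  rw [Real.exp_log (sub_pos.2 hs.2)]

theorem intervalIntegrable_singular (t : ℝ) :
    IntervalIntegrable (fun s => (t - s) ^ (-(1 / 2) : ℝ)) volume 0 t := by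
  have := (intervalIntegral.intervalIntegrable_rpow' (a := 0) (b := t)
    (r := (-(1 / 2) : ℝ)) (by norm_num)).comp_sub_left t
  simpa using this.symm

/-- The substitution τ = t - s factors out e^{λt}; the remaining integral is at most its value over
(0, ∞), which is Γ(1/2) λ^{-1/2}. Its decay in λ is the source of every contraction below. -/
theorem integral_singular_exp_le {lam : ℝ} (hl : 0 < lam) {t : ℝ} (ht : 0 ≤ t) :
    ∫ s in (0 : ℝ)..t, (t - s) ^ (-(1 / 2) : ℝ) * Real.exp (lam * s) ≤
      √(Real.pi / lam) * Real.exp (lam * t) := by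
  have h0 : IntegrableOn (fun τ : ℝ => τ ^ (-(1 / 2) : ℝ) * Real.exp (-lam * τ)) (Ioi 0) := by
    have := integrableOn_rpow_mul_exp_neg_mul_rpow (s := (-(1 / 2) : ℝ)) (p := 1) (b := lam)
      (by norm_num) zero_lt_one hl
    simpa using this
  have h1 : ∫ τ in Ioi (0 : ℝ), τ ^ (-(1 / 2) : ℝ) * Real.exp (-lam * τ) = √(Real.pi / lam) := by
    have := Real.integral_rpow_mul_exp_neg_mul_Ioi (a := 1 / 2) (r := lam) (by norm_num) hl
    rw [Real.Gamma_one_half_eq, ← Real.sqrt_eq_rpow, ← Real.sqrt_mul (by positivity)] at this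
    rw [show Real.pi / lam = 1 / lam * Real.pi by ring, ← this]
    norm_num
  have h2 : ∫ s in (0 : ℝ)..t, (t - s) ^ (-(1 / 2) : ℝ) * Real.exp (lam * s) =
      (∫ τ in (0 : ℝ)..t, τ ^ (-(1 / 2) : ℝ) * Real.exp (-lam * τ)) * Real.exp (lam * t) := by
    rw [← intervalIntegral.integral_mul_const]
    have := intervalIntegral.integral_comp_sub_left (a := 0) (b := t)
      (fun τ : ℝ => τ ^ (-(1 / 2) : ℝ) * Real.exp (-lam * τ) * Real.exp (lam * t)) t
    simp only [sub_zero, sub_self] at this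
    rw [← this]
    refine intervalIntegral.integral_congr fun s _ => ?_
    rw [mul_assoc, ← Real.exp_add]
    congr 2; ring
  rw [h2, ← h1, intervalIntegral.integral_of_le ht]
  gcongr
  · filter_upwards [ae_restrict_mem measurableSet_Ioi] with τ hτ
    have : (0 : ℝ) < τ := hτ
    positivity
  · exact Ioc_subset_Ioi_self

theorem intervalIntegrable_of_singular_bound {Z : Type*} [NormedAddCommGroup Z]
    {h : ℝ → Z} {t B : ℝ} (ht : 0 ≤ t)
    (hm : AEStronglyMeasurable h (volume.restrict (Ioc 0 t)))
    (hb : ∀ s ∈ Ioo 0 t, ‖h s‖ ≤ B * (t - s) ^ (-(1 / 2) : ℝ)) :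
    IntervalIntegrable h volume 0 t := by
  rw [intervalIntegrable_iff_integrableOn_Ioc_of_le ht]
  have := ((intervalIntegrable_iff_integrableOn_Ioc_of_le ht).1
    ((intervalIntegrable_singular t).const_mul B))
  refine Integrable.mono' this hm ?_
  rw [← restrict_Ioo_eq_restrict_Ioc]
  filter_upwards [ae_restrict_mem measurableSet_Ioo] with s hs using hb s hs

theorem norm_integral_le_of_singular_bound {Z : Type*} [NormedAddCommGroup Z] [NormedSpace ℝ Z]
    {h : ℝ → Z} {t B lam : ℝ} (ht : 0 ≤ t) (hl : 0 < lam) (hB : 0 ≤ B)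
    (hb : ∀ s ∈ Ioo 0 t, ‖h s‖ ≤ B * ((t - s) ^ (-(1 / 2) : ℝ) * Real.exp (lam * s))) :
    ‖∫ s in (0 : ℝ)..t, h s‖ ≤ B * √(Real.pi / lam) * Real.exp (lam * t) := by
  have hi : IntervalIntegrable
      (fun s => B * ((t - s) ^ (-(1 / 2) : ℝ) * Real.exp (lam * s))) volume 0 t :=
    ((intervalIntegrable_singular t).mul_continuousOn (by fun_prop)).const_mul B
  calc ‖∫ s in (0 : ℝ)..t, h s‖
      ≤ ∫ s in (0 : ℝ)..t, B * ((t - s) ^ (-(1 / 2) : ℝ) * Real.exp (lam * s)) := by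
        refine intervalIntegral.norm_integral_le_of_norm_le ht ?_ hi
        filter_upwards [Measure.ae_ne volume t] with s hst hs
        exact hb s ⟨hs.1, lt_of_le_of_ne hs.2 hst⟩
    _ = B * ∫ s in (0 : ℝ)..t, (t - s) ^ (-(1 / 2) : ℝ) * Real.exp (lam * s) := by
        rw [intervalIntegral.integral_const_mul]
    _ ≤ B * (√(Real.pi / lam) * Real.exp (lam * t)) := by
        gcongr; exact integral_singular_exp_le hl ht
    _ = _ := by ring

/-- An exponential rate that makes a kernel `C τ^{-1/2}` contract by `1/2`. -/
def gronwallRate (C : ℝ) : ℝ := 4 * C ^ 2 * Real.pi + 1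

theorem gronwallRate_pos (C : ℝ) : 0 < gronwallRate C := by
  unfold gronwallRate; positivity

/-- After squaring, this asks for 4C²π ≤ λ. The summand 1 in the rate keeps λ positive when C = 0.
-/
theorem mul_sqrt_gronwallRate_le (C : ℝ) : C * √(Real.pi / gronwallRate C) ≤ 1 / 2 := by
  refine le_trans (le_abs_self _) ?_
  rw [abs_mul, abs_of_nonneg (Real.sqrt_nonneg _), ← Real.sqrt_sq_eq_abs,
    ← Real.sqrt_mul (sq_nonneg C), Real.sqrt_le_left (by norm_num)]
  have h := gronwallRate_pos C
  rw [← mul_div_assoc, div_le_iff₀ h]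
  unfold gronwallRate
  linarith

/-- A singular Gronwall inequality. -/
theorem norm_le_of_singular_gronwall {w : ℝ → X} (hw : ContinuousOn w (Icc 0 T)) {a : ℝ}
    (ha : 0 ≤ a) (hC : 0 ≤ C)
    (h : ∀ t ∈ Icc 0 T, ‖w t‖ ≤ a + C * ∫ s in (0 : ℝ)..t, (t - s) ^ (-(1 / 2) : ℝ) * ‖w s‖) :
    ∀ t ∈ Icc 0 T, ‖w t‖ ≤ 2 * a * Real.exp (gronwallRate C * t) := by
  intro t ht
  set lam := gronwallRate C with hlam
  have hl : 0 < lam := gronwallRate_pos C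
  -- At a maximum point of the weighted norm, the hypothesis gives M ≤ a + M/2, which can be
  -- absorbed because M is finite.
  obtain ⟨t₀, ht₀, hmax⟩ := isCompact_Icc.exists_isMaxOn ⟨t, ht⟩
    (f := fun s => Real.exp (-lam * s) * ‖w s‖)
    ((Continuous.continuousOn (by fun_prop)).mul hw.norm)
  set M := Real.exp (-lam * t₀) * ‖w t₀‖ with hM
  have hM0 : 0 ≤ M := by positivity
  have hle : ∀ s ∈ Icc 0 T, ‖w s‖ ≤ M * Real.exp (lam * s) := fun s hs => by
    have : Real.exp (-lam * s) * ‖w s‖ ≤ M := hmax hs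
    calc ‖w s‖ = Real.exp (-lam * s) * ‖w s‖ * Real.exp (lam * s) := by
          rw [mul_right_comm, ← Real.exp_add]; simp
      _ ≤ M * Real.exp (lam * s) := by gcongr
  have h1 : ∫ s in (0 : ℝ)..t₀, (t₀ - s) ^ (-(1 / 2) : ℝ) * ‖w s‖ ≤
      M * √(Real.pi / lam) * Real.exp (lam * t₀) := by
    refine (Real.le_norm_self _).trans (norm_integral_le_of_singular_bound ht₀.1 hl hM0 ?_)
    intro s hs
    have h2 : 0 ≤ (t₀ - s) ^ (-(1 / 2) : ℝ) := Real.rpow_nonneg (sub_pos.2 hs.2).le _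
    rw [norm_mul, norm_norm, Real.norm_of_nonneg h2]
    calc _ ≤ (t₀ - s) ^ (-(1 / 2) : ℝ) * (M * Real.exp (lam * s)) := by
          gcongr; exact hle s ⟨hs.1.le, hs.2.le.trans ht₀.2⟩
      _ = _ := by ring
  have h3 : M ≤ a + M / 2 := by
    have h4 := h t₀ ht₀
    calc M ≤ Real.exp (-lam * t₀) * (a + C * (M * √(Real.pi / lam) * Real.exp (lam * t₀))) := by
          rw [hM]; gcongr; exact h4.trans (by gcongr)
      _ = Real.exp (-lam * t₀) * a + M * (C * √(Real.pi / lam)) *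
            (Real.exp (-lam * t₀) * Real.exp (lam * t₀)) := by ring
      _ ≤ 1 * a + M * (1 / 2) * 1 := by
          gcongr
          · exact Real.exp_le_one_iff.2 (by have := ht₀.1; nlinarith)
          · exact mul_sqrt_gronwallRate_le C
          · rw [← Real.exp_add]; simp
      _ = a + M / 2 := by ring
  refine (hle t ht).trans ?_
  gcongr
  linarith

theorem SingularKernel.intervalIntegrable (hG : SingularKernel T C G) (hC : 0 ≤ C) {r : ℝ → Y}
    (hr : AEStronglyMeasurable r (volume.restrict (Ioc 0 T))) {B : ℝ}
    (hB : ∀ s ∈ Icc 0 T, ‖r s‖ ≤ B) {t : ℝ} (ht : t ∈ Icc 0 T) :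
    IntervalIntegrable (fun s => G (t - s) (r s)) volume 0 t := by
  refine intervalIntegrable_of_singular_bound (B := C * B) ht.1
    (hG.aestronglyMeasurable hr ht.2) fun s hs => ?_
  have h2 : 0 ≤ (t - s) ^ (-(1 / 2) : ℝ) := Real.rpow_nonneg (sub_pos.2 hs.2).le _
  calc _ ≤ ‖G (t - s)‖ * ‖r s‖ := ContinuousLinearMap.le_opNorm _ _
    _ ≤ C * (t - s) ^ (-(1 / 2) : ℝ) * B := by
        gcongr
        · exact hG.bound _ ⟨sub_pos.2 hs.2, by linarith [hs.1, ht.2]⟩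
        · exact hB s ⟨hs.1.le, hs.2.le.trans ht.2⟩
    _ = _ := by ring

theorem SingularKernel.norm_integral_le (hG : SingularKernel T C G) (hC : 0 ≤ C) {r : ℝ → Y}
    {B lam : ℝ} (hl : 0 < lam) (hB0 : 0 ≤ B)
    (hB : ∀ s ∈ Icc 0 T, ‖r s‖ ≤ B * Real.exp (lam * s)) {t : ℝ} (ht : t ∈ Icc 0 T) :
    ‖∫ s in (0 : ℝ)..t, G (t - s) (r s)‖ ≤ C * B * √(Real.pi / lam) * Real.exp (lam * t) := by
  refine norm_integral_le_of_singular_bound ht.1 hl (by positivity) fun s hs => ?_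
  have h2 : 0 ≤ (t - s) ^ (-(1 / 2) : ℝ) := Real.rpow_nonneg (sub_pos.2 hs.2).le _
  calc _ ≤ ‖G (t - s)‖ * ‖r s‖ := ContinuousLinearMap.le_opNorm _ _
    _ ≤ C * (t - s) ^ (-(1 / 2) : ℝ) * (B * Real.exp (lam * s)) := by
        gcongr
        · exact hG.bound _ ⟨sub_pos.2 hs.2, by linarith [hs.1, ht.2]⟩
        · exact hB s ⟨hs.1.le, hs.2.le.trans ht.2⟩
    _ = _ := by ring

theorem integral_singular_Ioc {a b : ℝ} (_hab : a ≤ b) :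
    ∫ s in a..b, (b - s) ^ (-(1 / 2) : ℝ) = 2 * √(b - a) := by
  have := intervalIntegral.integral_comp_sub_left (a := a) (b := b)
      (fun τ : ℝ => τ ^ (-(1 / 2) : ℝ)) b
  rw [this, integral_rpow (Or.inl (by norm_num)), Real.sqrt_eq_rpow]
  norm_num
  ring

/-- The Volterra integral is continuous in time. -/
theorem SingularKernel.continuousOn_integral (hG : SingularKernel T C G) (hC : 0 ≤ C)
    {r : ℝ → Y} (hr : AEStronglyMeasurable r (volume.restrict (Ioc 0 T))) {B : ℝ}
    (hB : ∀ s ∈ Icc 0 T, ‖r s‖ ≤ B) :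
    ContinuousOn (fun t => ∫ s in (0 : ℝ)..t, G (t - s) (r s)) (Icc 0 T) := by
  rcases lt_or_ge T 0 with hT | hT
  · simp [Icc_eq_empty_of_lt hT]
  have hB0 : 0 ≤ B := (norm_nonneg _).trans (hB 0 ⟨le_rfl, hT⟩)
  -- the integral up to time `t - δ`
  let J : ℝ → ℝ → X := fun δ t =>
    ∫ s in Ioc 0 T, (Iio (t - δ)).indicator (fun s => G (t - s) (r s)) s
  -- Away from the diagonal the kernel is at most C δ^{-1/2}, so dominated convergence applies. The
  -- integrand is continuous at t₀ for every s except s = t₀ - δ, where the indicator jumps.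
  have hJc : ∀ δ > 0, ContinuousOn (J δ) (Icc 0 T) := by
    intro δ hδ t₀ ht₀
    refine continuousWithinAt_of_dominated (bound := fun _ => C * δ ^ (-(1 / 2) : ℝ) * B)
      ?_ ?_ (integrable_const _) ?_
    · filter_upwards [self_mem_nhdsWithin] with t ht
      have h1 := (hG.aestronglyMeasurable hr ht.2)
      refine (aestronglyMeasurable_indicator_iff measurableSet_Iio).2 ?_
      rw [Measure.restrict_restrict measurableSet_Iio]
      exact h1.mono_measure (Measure.restrict_mono (fun s (hs : s ∈ Iio (t - δ) ∩ Ioc 0 T) =>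
        (⟨hs.2.1, by have : s < t - δ := hs.1; linarith⟩ : s ∈ Ioc 0 t)) le_rfl)
    · filter_upwards [self_mem_nhdsWithin] with t ht
      filter_upwards [ae_restrict_mem measurableSet_Ioc] with s hs
      by_cases hst : s ∈ Iio (t - δ)
      · rw [indicator_of_mem hst]
        have hst' : s < t - δ := hst
        calc _ ≤ ‖G (t - s)‖ * ‖r s‖ := ContinuousLinearMap.le_opNorm _ _
          _ ≤ C * (t - s) ^ (-(1 / 2) : ℝ) * B := by
            have h2 : 0 ≤ (t - s) ^ (-(1 / 2) : ℝ) := Real.rpow_nonneg (by linarith) _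
            exact mul_le_mul (hG.bound _ ⟨by linarith, by linarith [hs.1, ht.2]⟩)
              (hB s ⟨hs.1.le, hs.2⟩) (norm_nonneg _) (by positivity)
          _ ≤ _ := by
            gcongr ?_ * B
            gcongr C * ?_
            exact Real.rpow_le_rpow_of_nonpos hδ (by linarith) (by norm_num)
      · rw [indicator_of_notMem hst, norm_zero]; positivity
    · filter_upwards [ae_restrict_of_ae (Measure.ae_ne volume (t₀ - δ))] with s hs
      rcases lt_or_gt_of_ne hs with hlt | hgt
      · have hev : ∀ᶠ t in 𝓝[Icc 0 T] t₀, G (t - s) (r s) =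
            (Iio (t - δ)).indicator (fun s => G (t - s) (r s)) s := by
          have : ∀ᶠ t in 𝓝 t₀, s < t - δ :=
            (continuous_id.sub continuous_const).continuousAt.eventually (lt_mem_nhds hlt)
          filter_upwards [nhdsWithin_le_nhds this] with t ht
          rw [indicator_of_mem (by exact ht)]
        refine ContinuousWithinAt.congr_of_eventuallyEq ?_ (hev.mono fun t h => h.symm) ?_
        · have hq : ContinuousAt (fun q : ℝ × Y => G q.1 q.2) (t₀ - s, r s) :=
            hG.cont.continuousAt ((isOpen_Ioi.prod isOpen_univ).mem_nhds
              ⟨by simp only [mem_Ioi]; linarith, mem_univ _⟩)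
          exact (ContinuousAt.comp (f := fun t : ℝ => ((t - s, r s) : ℝ × Y)) hq
            (by fun_prop)).continuousWithinAt
        · rw [indicator_of_mem (by exact hlt)]
      · have hev : ∀ᶠ t in 𝓝[Icc 0 T] t₀,
            (Iio (t - δ)).indicator (fun s => G (t - s) (r s)) s = 0 := by
          have : ∀ᶠ t in 𝓝 t₀, t - δ < s :=
            (continuous_id.sub continuous_const).continuousAt.eventually (gt_mem_nhds hgt)
          filter_upwards [nhdsWithin_le_nhds this] with t ht
          rw [indicator_of_notMem (by simpa using ht.le)]
        refine ContinuousWithinAt.congr_of_eventuallyEq (continuousWithinAt_const (b := (0 : X)))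
          hev ?_
        rw [indicator_of_notMem (by simpa using le_of_lt hgt)]
  -- The discarded part lives on [max 0 (t - δ), t] and is at most 2CB√δ, whatever t is.
  have hunif : TendstoUniformlyOn J (fun t => ∫ s in (0 : ℝ)..t, G (t - s) (r s))
      (𝓝[>] 0) (Icc 0 T) := by
    rw [Metric.tendstoUniformlyOn_iff]
    intro ε hε
    have hlim : Tendsto (fun δ : ℝ => C * B * (2 * √δ)) (𝓝[>] 0) (𝓝 (C * B * (2 * √0))) :=
      (Continuous.tendsto (by fun_prop) 0).mono_left nhdsWithin_le_nhds
    rw [Real.sqrt_zero, mul_zero, mul_zero] at hlim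
    filter_upwards [hlim.eventually (gt_mem_nhds hε), self_mem_nhdsWithin] with δ hδ hδ0 t ht
    have hδ0' : (0 : ℝ) < δ := hδ0
    refine lt_of_le_of_lt ?_ hδ
    have hii := hG.intervalIntegrable hC hr hB ht
    set c := max 0 (t - δ) with hc
    have hc0 : 0 ≤ c := le_max_left _ _
    have hct : c ≤ t := max_le ht.1 (by linarith)
    have hJ : J δ t = ∫ s in (0 : ℝ)..c, G (t - s) (r s) := by
      simp only [J]
      rw [setIntegral_indicator measurableSet_Iio, intervalIntegral.integral_of_le hc0,
        integral_Ioc_eq_integral_Ioo]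
      congr 2
      ext s
      simp only [mem_inter_iff, mem_Ioc, mem_Iio, mem_Ioo, hc, lt_max_iff]
      constructor
      · rintro ⟨⟨h1, -⟩, h2⟩; exact ⟨h1, Or.inr h2⟩
      · rintro ⟨h1, h2 | h2⟩
        · exact absurd h1 h2.not_gt
        · exact ⟨⟨h1, by linarith [ht.2]⟩, h2⟩
    rw [dist_eq_norm, hJ, ← intervalIntegral.integral_add_adjacent_intervals
      (hii.mono_set (by rw [uIcc_of_le hc0, uIcc_of_le ht.1]; exact Icc_subset_Icc_right hct))
      (hii.mono_set (by rw [uIcc_of_le hct, uIcc_of_le ht.1]; exact Icc_subset_Icc_left hc0)),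
      add_sub_cancel_left]
    calc ‖∫ s in c..t, G (t - s) (r s)‖
        ≤ ∫ s in c..t, C * B * (t - s) ^ (-(1 / 2) : ℝ) := by
          refine intervalIntegral.norm_integral_le_of_norm_le hct ?_
            (((intervalIntegrable_singular t).mono_set (by
              rw [uIcc_of_le hct, uIcc_of_le ht.1]; exact Icc_subset_Icc_left hc0)).const_mul _)
          filter_upwards [Measure.ae_ne volume t] with s hst hs
          have hst' : s < t := lt_of_le_of_ne hs.2 hst
          have h2 : 0 ≤ (t - s) ^ (-(1 / 2) : ℝ) := Real.rpow_nonneg (sub_pos.2 hst').le _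
          calc _ ≤ ‖G (t - s)‖ * ‖r s‖ := ContinuousLinearMap.le_opNorm _ _
            _ ≤ C * (t - s) ^ (-(1 / 2) : ℝ) * B := by
              gcongr
              · exact hG.bound _ ⟨sub_pos.2 hst', by linarith [hs.1, ht.2]⟩
              · exact hB s ⟨hc0.trans hs.1.le, hs.2.trans ht.2⟩
            _ = _ := by ring
      _ = C * B * (2 * √(t - c)) := by
          rw [intervalIntegral.integral_const_mul, integral_singular_Ioc hct]
      _ ≤ C * B * (2 * √δ) := by
          gcongr
          linarith [le_max_right 0 (t - δ)]
  exact hunif.continuousOn (Eventually.frequently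
    (by filter_upwards [self_mem_nhdsWithin] with δ hδ using hJc δ hδ))

/-- Existence for a linear Volterra equation with a weakly singular kernel; the solution is
constructed inside any invariant family of closed sets. -/
theorem SingularKernel.exists_solution [CompleteSpace X] (hG : SingularKernel T C G) (hC : 0 ≤ C)
    (hT : 0 ≤ T) {m : ℝ → X →L[ℝ] Y} {M : ℝ} (hM0 : 0 ≤ M) (hM : ∀ s ∈ Icc 0 T, ‖m s‖ ≤ M)
    (hm : ∀ u : ℝ → X, ContinuousOn u (Icc 0 T) →
      AEStronglyMeasurable (fun s => m s (u s)) (volume.restrict (Ioc 0 T)))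
    {q : ℝ → Y} (hq : AEStronglyMeasurable q (volume.restrict (Ioc 0 T))) {Q : ℝ}
    (hQ : ∀ s ∈ Icc 0 T, ‖q s‖ ≤ Q)
    {u₀ : ℝ → X} (hu₀ : ContinuousOn u₀ (Icc 0 T)) (F : ℝ → Set X) (hF : ∀ t, IsClosed (F t))
    {v₀ : ℝ → X} (hv₀ : ContinuousOn v₀ (Icc 0 T)) (hv₀F : ∀ t ∈ Icc 0 T, v₀ t ∈ F t)
    (hinv : ∀ v : ℝ → X, ContinuousOn v (Icc 0 T) → (∀ t ∈ Icc 0 T, v t ∈ F t) →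
      ∀ t ∈ Icc 0 T, u₀ t + ∫ s in (0 : ℝ)..t, G (t - s) (m s (v s) + q s) ∈ F t) :
    ∃ u : ℝ → X, ContinuousOn u (Icc 0 T) ∧ (∀ t ∈ Icc 0 T, u t ∈ F t) ∧
      ∀ t ∈ Icc 0 T, u t = u₀ t + ∫ s in (0 : ℝ)..t, G (t - s) (m s (u s) + q s) := by
  set lam := gronwallRate (C * M) with hlam
  have hl : 0 < lam := gronwallRate_pos _
  -- extension and rescaling of a continuous function on the time interval
  let ext : C(Icc (0 : ℝ) T, X) → ℝ → X := fun v s =>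
    Real.exp (lam * s) • IccExtend hT v s
  have hext : ∀ v, Continuous (ext v) := fun v =>
    (Continuous.smul (by fun_prop) (v.continuous.Icc_extend'))
  have hrm : ∀ v : ℝ → X, ContinuousOn v (Icc 0 T) →
      AEStronglyMeasurable (fun s => m s (v s) + q s) (volume.restrict (Ioc 0 T)) :=
    fun v hv => (hm v hv).add hq
  have hrb : ∀ v : ℝ → X, ContinuousOn v (Icc 0 T) →
      ∃ B, ∀ s ∈ Icc 0 T, ‖m s (v s) + q s‖ ≤ B := by
    intro v hv
    obtain ⟨B, hB⟩ := isCompact_Icc.exists_bound_of_continuousOn hv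
    refine ⟨M * B + Q, fun s hs => (norm_add_le _ _).trans (add_le_add ?_ (hQ s hs))⟩
    exact ((m s).le_opNorm _).trans (mul_le_mul (hM s hs) (hB s hs) (norm_nonneg _) hM0)
  let Ψ : (ℝ → X) → ℝ → X := fun v t => u₀ t + ∫ s in (0 : ℝ)..t, G (t - s) (m s (v s) + q s)
  have hΨc : ∀ v : ℝ → X, ContinuousOn v (Icc 0 T) → ContinuousOn (Ψ v) (Icc 0 T) := by
    intro v hv
    obtain ⟨B, hB⟩ := hrb v hv
    exact hu₀.add (hG.continuousOn_integral hC (hrm v hv) hB)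
  -- Conjugation by e^{λt} turns the weighted norm into the plain sup norm, for which the Volterra
  -- map is a contraction of ratio 1/2.
  let Φ : C(Icc (0 : ℝ) T, X) → C(Icc (0 : ℝ) T, X) := fun v =>
    ⟨fun t => Real.exp (-lam * t) • Ψ (ext v) t,
      Continuous.smul (by fun_prop)
        (continuousOn_iff_continuous_domRestrict.1 (hΨc _ (hext v).continuousOn))⟩
  have hcontr : ContractingWith (1 / 2) Φ := by
    refine ⟨by rw [← NNReal.coe_lt_coe]; norm_num, LipschitzWith.of_dist_le_mul fun v w => ?_⟩
    rw [ContinuousMap.dist_le (by positivity)]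
    rintro ⟨t, ht⟩
    obtain ⟨Bv, hBv⟩ := hrb _ (hext v).continuousOn
    obtain ⟨Bw, hBw⟩ := hrb _ (hext w).continuousOn
    have h1 : Ψ (ext v) t - Ψ (ext w) t =
        ∫ s in (0 : ℝ)..t, G (t - s) (m s (ext v s - ext w s)) := by
      simp only [Ψ]
      rw [add_sub_add_left_eq_sub, ← intervalIntegral.integral_sub
        (hG.intervalIntegrable hC (hrm _ (hext v).continuousOn) hBv ht)
        (hG.intervalIntegrable hC (hrm _ (hext w).continuousOn) hBw ht)]
      refine intervalIntegral.integral_congr fun s _ => ?_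
      simp only [map_sub, map_add]
      abel
    have h2 : ∀ s ∈ Icc 0 T, ‖m s (ext v s - ext w s)‖ ≤
        (M * dist v w) * Real.exp (lam * s) := by
      intro s hs
      have h3 : ‖ext v s - ext w s‖ ≤ Real.exp (lam * s) * dist v w := by
        simp only [ext]
        rw [← smul_sub, norm_smul, Real.norm_of_nonneg (Real.exp_pos _).le,
          IccExtend_of_mem _ _ hs, IccExtend_of_mem _ _ hs, ← dist_eq_norm]
        gcongr
        exact ContinuousMap.dist_apply_le_dist _
      calc _ ≤ ‖m s‖ * ‖ext v s - ext w s‖ := (m s).le_opNorm _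
        _ ≤ M * (Real.exp (lam * s) * dist v w) :=
          mul_le_mul (hM s hs) h3 (norm_nonneg _) hM0
        _ = _ := by ring
    calc dist (Φ v ⟨t, ht⟩) (Φ w ⟨t, ht⟩)
        = Real.exp (-lam * t) * ‖∫ s in (0 : ℝ)..t, G (t - s) (m s (ext v s - ext w s))‖ := by
          rw [dist_eq_norm, ← h1]
          simp only [Φ, ContinuousMap.coe_mk]
          rw [← smul_sub, norm_smul, Real.norm_of_nonneg (Real.exp_pos _).le]
      _ ≤ Real.exp (-lam * t) * (C * (M * dist v w) * √(Real.pi / lam) * Real.exp (lam * t)) := by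
          gcongr
          exact hG.norm_integral_le hC hl (by positivity) h2 ht
      _ = (C * M * √(Real.pi / lam)) * dist v w *
            (Real.exp (-lam * t) * Real.exp (lam * t)) := by ring
      _ ≤ 1 / 2 * dist v w * 1 := by
          gcongr
          · exact mul_sqrt_gronwallRate_le (C * M)
          · rw [← Real.exp_add]; simp
      _ = _ := by simp
  -- The constraint in the rescaled unknown. It is closed and preserved by `Φ`, so it passes to the
  -- limit of the iterates started from the rescaled `v₀`.
  let S : Set C(Icc (0 : ℝ) T, X) := {v | ∀ t : Icc (0 : ℝ) T, Real.exp (lam * t) • v t ∈ F t}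
  have hS : IsClosed S := by
    have : S = ⋂ t : Icc (0 : ℝ) T, (fun v : C(Icc (0 : ℝ) T, X) =>
        Real.exp (lam * t) • v t) ⁻¹' F t := by ext; simp [S]
    rw [this]
    exact isClosed_iInter fun t => (hF t).preimage
      ((continuous_eval_const t).const_smul _)
  have hSinv : ∀ v ∈ S, Φ v ∈ S := by
    rintro v hv ⟨t, ht⟩
    have := hinv (ext v) (hext v).continuousOn (fun s hs => by
      simpa [ext, IccExtend_of_mem _ _ hs] using hv ⟨s, hs⟩) t ht
    simp only [Φ, ContinuousMap.coe_mk, smul_smul, ← Real.exp_add]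
    simpa [Ψ] using this
  let w₀ : C(Icc (0 : ℝ) T, X) := ⟨fun t => Real.exp (-lam * t) • v₀ t,
    Continuous.smul (by fun_prop) (continuousOn_iff_continuous_domRestrict.1 hv₀)⟩
  have hw₀ : w₀ ∈ S := by
    rintro ⟨t, ht⟩
    simp only [w₀, ContinuousMap.coe_mk, smul_smul, ← Real.exp_add]
    simpa using hv₀F t ht
  set v := hcontr.fixedPoint Φ with hv
  have hvS : v ∈ S := by
    refine hS.mem_of_tendsto (hcontr.tendsto_iterate_fixedPoint w₀) (Eventually.of_forall ?_)
    intro n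
    induction n with
    | zero => exact hw₀
    | succ n ih => rw [Function.iterate_succ_apply']; exact hSinv _ ih
  have hfix : Φ v = v := hcontr.fixedPoint_isFixedPt
  refine ⟨ext v, (hext v).continuousOn, fun t ht => ?_, fun t ht => ?_⟩
  · simpa [ext, IccExtend_of_mem _ _ ht] using hvS ⟨t, ht⟩
  · have h1 : Φ v ⟨t, ht⟩ = v ⟨t, ht⟩ := by rw [hfix]
    have h2 : ext v t = Real.exp (lam * t) • v ⟨t, ht⟩ := by
      simp only [ext, IccExtend_of_mem _ _ ht]
    rw [h2, ← h1]
    simp only [Φ, ContinuousMap.coe_mk, smul_smul, ← Real.exp_add]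
    simp [Ψ]

/-- The a priori bound for a linear Volterra equation. -/
theorem SingularKernel.norm_le (hG : SingularKernel T C G) (hC : 0 ≤ C)
    {m : ℝ → X →L[ℝ] Y} {M : ℝ} (hM0 : 0 ≤ M) (hM : ∀ s ∈ Icc 0 T, ‖m s‖ ≤ M)
    {q : ℝ → Y} {Q : ℝ} (hQ0 : 0 ≤ Q) (hQ : ∀ s ∈ Icc 0 T, ‖q s‖ ≤ Q)
    {u u₀ : ℝ → X} (hu : ContinuousOn u (Icc 0 T)) {a : ℝ} (ha : 0 ≤ a)
    (hu₀ : ∀ t ∈ Icc 0 T, ‖u₀ t‖ ≤ a)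
    (h : ∀ t ∈ Icc 0 T, u t = u₀ t + ∫ s in (0 : ℝ)..t, G (t - s) (m s (u s) + q s)) :
    ∀ t ∈ Icc 0 T, ‖u t‖ ≤
      2 * (a + 2 * C * Q * √T) * Real.exp (gronwallRate (C * M) * T) := by
  intro t ht
  have hT : 0 ≤ T := ht.1.trans ht.2
  refine (norm_le_of_singular_gronwall (a := a + 2 * C * Q * √T) (C := C * M) hu
    (by positivity) (by positivity) (fun t ht => ?_) t ht).trans ?_
  · rw [h t ht]
    refine (norm_add_le _ _).trans ?_
    rw [add_assoc]
    refine add_le_add (hu₀ t ht) ?_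
    have hi : IntervalIntegrable (fun s => (t - s) ^ (-(1 / 2) : ℝ) * ‖u s‖) volume 0 t :=
      (intervalIntegrable_singular t).mul_continuousOn
        ((hu.mono (by rw [uIcc_of_le ht.1]; exact Icc_subset_Icc_right ht.2)).norm)
    calc ‖∫ s in (0 : ℝ)..t, G (t - s) (m s (u s) + q s)‖
        ≤ ∫ s in (0 : ℝ)..t, (C * Q * (t - s) ^ (-(1 / 2) : ℝ) +
            C * M * ((t - s) ^ (-(1 / 2) : ℝ) * ‖u s‖)) := by
          refine intervalIntegral.norm_integral_le_of_norm_le ht.1 ?_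
            (((intervalIntegrable_singular t).const_mul _).add (hi.const_mul _))
          filter_upwards [Measure.ae_ne volume t] with s hst hs
          have hst' : s < t := lt_of_le_of_ne hs.2 hst
          have hsT : s ∈ Icc 0 T := ⟨hs.1.le, hs.2.trans ht.2⟩
          have h2 : 0 ≤ (t - s) ^ (-(1 / 2) : ℝ) := Real.rpow_nonneg (sub_pos.2 hst').le _
          have h3 : ‖m s (u s) + q s‖ ≤ M * ‖u s‖ + Q :=
            (norm_add_le _ _).trans (add_le_add (((m s).le_opNorm _).trans
              (mul_le_mul_of_nonneg_right (hM s hsT) (norm_nonneg _))) (hQ s hsT))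
          calc _ ≤ ‖G (t - s)‖ * ‖m s (u s) + q s‖ := ContinuousLinearMap.le_opNorm _ _
            _ ≤ C * (t - s) ^ (-(1 / 2) : ℝ) * (M * ‖u s‖ + Q) :=
                mul_le_mul (hG.bound _ ⟨sub_pos.2 hst', by linarith [hs.1, ht.2]⟩) h3
                  (norm_nonneg _) (by positivity)
            _ = _ := by ring
      _ = 2 * C * Q * √t + C * M * ∫ s in (0 : ℝ)..t, (t - s) ^ (-(1 / 2) : ℝ) * ‖u s‖ := by
          rw [intervalIntegral.integral_add ((intervalIntegrable_singular t).const_mul _)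
            (hi.const_mul _), intervalIntegral.integral_const_mul,
            intervalIntegral.integral_const_mul, integral_singular_Ioc ht.1, sub_zero]
          ring
      _ ≤ _ := by
          gcongr
          exact ht.2
  · have := gronwallRate_pos (C * M)
    gcongr
    exact ht.2

end Volterra

/-! ### Bochner integrals with values in `L^p` -/

section LpIntegral

variable {Ω α : Type*} [MeasurableSpace Ω] [MeasurableSpace α] {μ : Measure Ω} {ν : Measure α}
  {p : ℝ≥0∞} [Fact (1 ≤ p)]

/-- Integration over a set of finite measure, as a functional on `L^p`. -/
theorem exists_setIntegral_functional {S : Set α} (hS : MeasurableSet S) (hνS : ν S ≠ ⊤) :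
    ∃ φ : Lp ℝ p ν →L[ℝ] ℝ, ∀ f : Lp ℝ p ν, φ f = ∫ z in S, f z ∂ν := by
  have : ENNReal.HolderConjugate p p.conjExponent := .conjExponent Fact.out
  have : Fact (1 ≤ p.conjExponent) := ⟨ENNReal.HolderConjugate.one_le p.conjExponent p⟩
  refine ⟨((ContinuousLinearMap.mul ℝ ℝ).lpPairing ν p p.conjExponent).flip
    (indicatorConstLp p.conjExponent hS hνS 1), fun f => ?_⟩
  rw [ContinuousLinearMap.flip_apply, ContinuousLinearMap.lpPairing_eq_integral,
    ← integral_indicator hS]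
  refine integral_congr_ae ?_
  filter_upwards [indicatorConstLp_coeFn (p := p.conjExponent) (hs := hS) (hμs := hνS)
    (c := (1 : ℝ))] with z hz
  rw [hz]
  by_cases h : z ∈ S <;> simp [h]

theorem Lp.integrableOn_of_ne_top (f : Lp ℝ p ν) {S : Set α} (hνS : ν S ≠ ⊤) :
    IntegrableOn f S ν := by
  have : IsFiniteMeasure (ν.restrict S) := ⟨by simpa using hνS.lt_top⟩
  exact ((Lp.memLp f).restrict S).integrable Fact.out

/-- A Bochner integral in `L^p` may be computed pointwise. -/
theorem integral_Lp_ae_eq [SFinite μ] [SigmaFinite ν] {H : Ω → Lp ℝ p ν} (hH : Integrable H μ)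
    {h : Ω → α → ℝ} (hm : AEStronglyMeasurable (Function.uncurry h) (μ.prod ν))
    (hh : ∀ᵐ o ∂μ, h o =ᵐ[ν] H o) :
    ∀ᵐ z ∂ν, Integrable (fun o => h o z) μ ∧ ∫ o, h o z ∂μ = (∫ o, H o ∂μ : Lp ℝ p ν) z := by
  -- On a set of finite measure the integration functional φ applied to |H o| gives ∫_S |h o| ≤ ‖φ‖
  -- ‖H o‖. This makes h integrable on the product, as Fubini requires.
  have key : ∀ S, MeasurableSet S → ν S < ⊤ →
      Integrable (Function.uncurry h) (μ.prod (ν.restrict S)) := by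
    intro S hS hνS
    obtain ⟨φ, hφ⟩ := exists_setIntegral_functional (p := p) hS hνS.ne
    have hm' : AEStronglyMeasurable (Function.uncurry h) (μ.prod (ν.restrict S)) := by
      refine hm.mono_ac ?_
      exact Measure.AbsolutelyContinuous.prod .rfl Measure.absolutelyContinuous_restrict
    refine (integrable_prod_iff hm').2 ⟨?_, ?_⟩
    · filter_upwards [hh] with o ho
      exact (Lp.integrableOn_of_ne_top (H o) hνS.ne).congr (ae_restrict_of_ae ho.symm)
    · refine (hH.norm.const_mul ‖φ‖).mono' hm'.norm.integral_prod_right' ?_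
      filter_upwards [hh] with o ho
      have h1 : ∫ z, ‖Function.uncurry h (o, z)‖ ∂(ν.restrict S) = φ |H o| := by
        rw [hφ]
        refine integral_congr_ae (ae_restrict_of_ae ?_)
        filter_upwards [ho, Lp.coeFn_abs (H o)] with z h1 h2
        rw [h2, Function.uncurry_apply_pair, h1, Real.norm_eq_abs]
      rw [h1]
      refine (φ.le_opNorm _).trans ?_
      rw [norm_abs_eq_norm]
  have hint : ∀ᵐ z ∂ν, Integrable (fun o => h o z) μ := by
    refine ae_of_forall_measure_lt_top_ae_restrict _ fun S hS hνS => ?_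
    exact (integrable_prod_iff' (key S hS hνS).1).1 (key S hS hνS) |>.1
  -- Both functions have the same integral over every set of finite measure: φ commutes with the
  -- Bochner integral on one side, and Fubini applies on the other.
  have heq : (fun z => ∫ o, h o z ∂μ) =ᵐ[ν] (∫ o, H o ∂μ : Lp ℝ p ν) := by
    refine ae_eq_of_forall_setIntegral_eq_of_sigmaFinite (fun S hS hνS => ?_)
      (fun S _ hνS => Lp.integrableOn_of_ne_top _ hνS.ne) fun S hS hνS => ?_
    · exact (key S hS hνS).integral_prod_right
    · obtain ⟨φ, hφ⟩ := exists_setIntegral_functional (p := p) hS hνS.ne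
      rw [← hφ, ← φ.integral_comp_comm hH]
      have := integral_integral_swap (f := h) (key S hS hνS)
      rw [← this]
      refine integral_congr_ae ?_
      filter_upwards [hh] with o ho
      rw [hφ]
      exact integral_congr_ae (ae_restrict_of_ae ho)
  filter_upwards [hint, heq] with z h1 h2 using ⟨h1, h2⟩

end LpIntegral

/-! ### The free kinetic flow -/

section Flow

variable {N : ℕ}

instance : (volume : Measure (Phase N)).IsAddRightInvariant :=
  Measure.prod.instIsAddRightInvariant (μ := (volume : Measure (Torus N)))
    (ν := (volume : Measure (Vel N)))

instance : (volume : Measure (Vel N × Vel N)).IsAddHaarMeasure :=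
  Measure.prod.instIsAddHaarMeasure (volume : Measure (Vel N)) (volume : Measure (Vel N))

instance : IsProbabilityMeasure (volume : Measure (Torus N)) :=
  ⟨by rw [volume_pi, Measure.pi_univ]; simp⟩

theorem toTorus_add (ξ η : Vel N) : toTorus (ξ + η) = toTorus ξ + toTorus η := by
  ext i; simp [toTorus]

theorem toTorus_zero : toTorus (0 : Vel N) = 0 := by
  ext i; simp [toTorus]

theorem toTorus_neg (ξ : Vel N) : toTorus (-ξ) = -toTorus ξ := by
  ext i; simp [toTorus]

theorem toTorus_sub (ξ η : Vel N) : toTorus (ξ - η) = toTorus ξ - toTorus η := by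
  ext i; simp [toTorus]

theorem continuous_toTorus : Continuous (toTorus (N := N)) :=
  continuous_pi fun i => (AddCircle.continuous_mk' (1 : ℝ)).comp (by fun_prop)

theorem toPhase_add (a b : Vel N × Vel N) : toPhase (a + b) = toPhase a + toPhase b := by
  simp [toPhase, toTorus_add]

theorem toPhase_zero : toPhase (0 : Vel N × Vel N) = 0 := by
  simp [toPhase, toTorus_zero]

theorem continuous_toPhase : Continuous (toPhase (N := N)) :=
  (continuous_toTorus.comp continuous_fst).prodMk continuous_snd

/-- The free flow `(ξ, w) ↦ (ξ + (1 - e^{-t}) w, e^{-t} w)` on `ℝ^N × ℝ^N`. -/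
def linFlow (t : ℝ) (a : Vel N × Vel N) : Vel N × Vel N :=
  (a.1 + (1 - Real.exp (-t)) • a.2, Real.exp (-t) • a.2)

/-- The free flow `(y, w) ↦ (y + (1 - e^{-t}) w, e^{-t} w)` on the phase space. -/
def flow (t : ℝ) (z : Phase N) : Phase N :=
  (z.1 + toTorus ((1 - Real.exp (-t)) • z.2), Real.exp (-t) • z.2)

theorem linFlow_linFlow (t s : ℝ) (a : Vel N × Vel N) :
    linFlow t (linFlow s a) = linFlow (t + s) a := by
  have h : Real.exp (-(t + s)) = Real.exp (-t) * Real.exp (-s) := by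
    rw [← Real.exp_add]; congr 1; ring
  ext1
  · simp only [linFlow, smul_smul, h, add_assoc, ← add_smul]
    congr 2; ring
  · simp only [linFlow, smul_smul, h]

theorem flow_flow (t s : ℝ) (z : Phase N) : flow t (flow s z) = flow (t + s) z := by
  have h : Real.exp (-(t + s)) = Real.exp (-t) * Real.exp (-s) := by
    rw [← Real.exp_add]; congr 1; ring
  ext1
  · simp only [flow, smul_smul, h, add_assoc, ← toTorus_add, ← add_smul]
    congr 3; ring
  · simp only [flow, smul_smul, h]

theorem linFlow_zero (a : Vel N × Vel N) : linFlow 0 a = a := by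
  simp [linFlow]

theorem flow_zero (z : Phase N) : flow 0 z = z := by
  simp [flow, toTorus_zero]

theorem flow_add (t : ℝ) (z z' : Phase N) : flow t (z + z') = flow t z + flow t z' := by
  ext1
  · simp only [flow, Prod.fst_add, Prod.snd_add, smul_add, toTorus_add]; abel
  · simp [flow]

theorem linFlow_smul (t c : ℝ) (z : Vel N × Vel N) : linFlow t (c • z) = c • linFlow t z := by
  ext1
  · simp only [linFlow, Prod.smul_fst, Prod.smul_snd, smul_add]; rw [smul_comm]
  · simp only [linFlow, Prod.smul_snd]; rw [smul_comm]

theorem flow_toPhase (t : ℝ) (a : Vel N × Vel N) : flow t (toPhase a) = toPhase (linFlow t a) := by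
  simp [flow, toPhase, linFlow, toTorus_add]

theorem flow_neg (t : ℝ) (z : Phase N) : flow t (-z) = -flow t z := by
  rw [eq_neg_iff_add_eq_zero, ← flow_add, neg_add_cancel]
  simp [flow, toTorus_zero]

theorem flow_sub (t : ℝ) (z z' : Phase N) : flow t (z - z') = flow t z - flow t z' := by
  rw [sub_eq_add_neg, flow_add, flow_neg, sub_eq_add_neg]

theorem continuous_flow : Continuous fun q : ℝ × Phase N => flow q.1 q.2 := by
  unfold flow
  refine Continuous.prodMk ?_ (by fun_prop)
  exact Continuous.add (by fun_prop) (continuous_toTorus.comp (by fun_prop))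

theorem continuous_linFlow : Continuous fun q : ℝ × (Vel N × Vel N) => linFlow q.1 q.2 := by
  unfold linFlow
  fun_prop

/-- The flow is the contraction v ↦ e^{-t}v, of Jacobian e^{-Nt}, followed by a shear in the
position, which preserves volume. -/
theorem map_flow_volume (t : ℝ) :
    (volume : Measure (Phase N)).map (flow t) = ENNReal.ofReal (Real.exp (N * t)) • volume := by
  have hshear : MeasurePreserving
      (fun z : Vel N × Torus N => (z.1, z.2 + toTorus ((Real.exp t - 1) • z.1)))
      (volume.prod volume) (volume.prod volume) := by
    refine MeasurePreserving.skew_product (f := id) (g := fun (v : Vel N) (x : Torus N) =>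
      x + toTorus ((Real.exp t - 1) • v)) (MeasurePreserving.id _) ?_ ?_
    · exact (Continuous.add (by fun_prop) (continuous_toTorus.comp (by fun_prop))).measurable
    · exact Eventually.of_forall fun v => (measurePreserving_add_right (volume : Measure (Torus N)) _).map_eq
  have hshear' : MeasurePreserving
      (fun z : Phase N => (z.1 + toTorus ((Real.exp t - 1) • z.2), z.2)) volume volume :=
    (Measure.measurePreserving_swap.comp hshear).comp Measure.measurePreserving_swap
  have hscale : (volume : Measure (Phase N)).map (Prod.map id (fun v => Real.exp (-t) • v)) =
      ENNReal.ofReal (Real.exp (N * t)) • volume := by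
    rw [Measure.volume_eq_prod, ← Measure.map_prod_map _ _ measurable_id (by fun_prop),
      Measure.map_id, Measure.map_addHaar_smul _ (Real.exp_pos _).ne', Measure.prod_smul_right]
    congr 2
    rw [finrank_euclideanSpace_fin, ← Real.exp_nat_mul, ← Real.exp_neg,
      abs_of_pos (Real.exp_pos _)]
    congr 1; ring
  have hcomp : flow (N := N) t =
      (fun z : Phase N => (z.1 + toTorus ((Real.exp t - 1) • z.2), z.2)) ∘
        Prod.map id (fun v => Real.exp (-t) • v) := by
    ext1 z
    simp only [flow, Function.comp_apply, Prod.map_fst, Prod.map_snd, id, smul_smul]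
    congr 4
    rw [sub_mul, ← Real.exp_add]; simp
  rw [hcomp, ← Measure.map_map hshear'.measurable (by fun_prop), hscale, Measure.map_smul,
    hshear'.map_eq]

theorem measurable_flow (t : ℝ) : Measurable (flow (N := N) t) :=
  (continuous_flow.comp (by fun_prop : Continuous fun z : Phase N => (t, z))).measurable

/-- The inverse of `z ↦ flow t z + a`. -/
def backward (t : ℝ) (a : Vel N × Vel N) (z : Phase N) : Phase N := flow (-t) (z - toPhase a)

theorem continuous_backward :
    Continuous fun q : (ℝ × (Vel N × Vel N)) × Phase N => backward q.1.1 q.1.2 q.2 := by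
  unfold backward
  exact continuous_flow.comp (Continuous.prodMk (by fun_prop)
    (Continuous.sub (by fun_prop) (continuous_toPhase.comp (by fun_prop))))

theorem measurable_backward (t : ℝ) (a : Vel N × Vel N) : Measurable (backward (N := N) t a) :=
  (continuous_backward.comp
    (by fun_prop : Continuous fun z : Phase N => ((t, a), z))).measurable

theorem map_backward_volume (t : ℝ) (a : Vel N × Vel N) :
    (volume : Measure (Phase N)).map (backward t a) =
      ENNReal.ofReal (Real.exp (-(N * t))) • volume := by
  have h : backward (N := N) t a = flow (-t) ∘ fun z => z - toPhase a := rfl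
  have hsub : MeasurePreserving (fun z : Phase N => z - toPhase a) volume volume := by
    simpa only [sub_eq_add_neg] using
      measurePreserving_add_right (volume : Measure (Phase N)) (-toPhase a)
  rw [h, ← Measure.map_map (measurable_flow _) (by fun_prop),
    hsub.map_eq, map_flow_volume]
  congr 3; ring

/-- A displacement b made before a further time t arrives as `linFlow t b`. This composition law
underlies both the semigroup property and the translation covariance. -/
theorem backward_backward (t s : ℝ) (a b : Vel N × Vel N) (z : Phase N) :
    backward s b (backward t a z) = backward (t + s) (a + linFlow t b) z := by
  simp only [backward, flow_sub, flow_flow, toPhase_add, ← flow_toPhase, flow_add]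
  rw [show -s + -t = -(t + s) by ring, show -(t + s) + t = -s by ring]
  abel

theorem quasiMeasurePreserving_backward (t : ℝ) (a : Vel N × Vel N) :
    Measure.QuasiMeasurePreserving (backward (N := N) t a) volume volume :=
  ⟨measurable_backward t a, by
    rw [map_backward_volume]; exact Measure.smul_absolutelyContinuous⟩

end Flow

/-! ### Transport operators on `L^p` -/

section Transport

variable {N : ℕ} {p : ℝ≥0∞} [Fact (1 ≤ p)]

/-- The change of variables contributes e^{-Nt/p}, so the exact factor is e^{Nt(1 - 1/p)}. Since 0 ≤
1/p ≤ 1, it is at most e^{N|t|} for every p, and this is why no later constant depends on p. -/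
theorem eLpNorm_comp_backward_le (t : ℝ) (a : Vel N × Vel N) {f : Phase N → ℝ}
    (hf : AEStronglyMeasurable f) :
    eLpNorm (fun z => Real.exp (N * t) * f (backward t a z)) p volume ≤
      ENNReal.ofReal (Real.exp (N * |t|)) * eLpNorm f p volume := by
  have h0 : AEStronglyMeasurable f ((volume : Measure (Phase N)).map (backward t a)) := by
    rw [map_backward_volume]; exact hf.smul_measure _
  have h1 : eLpNorm (f ∘ backward t a) p volume =
      ENNReal.ofReal (Real.exp (-(N * t))) ^ (1 / p).toReal * eLpNorm f p volume := by
    rw [← eLpNorm_map_measure h0 (measurable_backward t a).aemeasurable, map_backward_volume,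
      eLpNorm_smul_measure_of_ne_zero (by simp [Real.exp_pos]), smul_eq_mul]
  have h2 : eLpNorm (fun z => Real.exp (N * t) * f (backward t a z)) p volume =
      ENNReal.ofReal (Real.exp (N * t)) * eLpNorm (f ∘ backward t a) p volume := by
    have := eLpNorm_const_smul (Real.exp (N * t)) (f ∘ backward t a) p
      (volume : Measure (Phase N))
    rw [Real.enorm_of_nonneg (Real.exp_pos _).le] at this
    exact this
  rw [h2, h1, ← mul_assoc]
  gcongr
  have hp1 : (1 / p).toReal ≤ 1 := by
    have : (1 : ℝ≥0∞) / p ≤ 1 := by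
      rw [one_div]; exact ENNReal.inv_le_one.2 Fact.out
    exact ENNReal.toReal_mono ENNReal.one_ne_top this
  have hp0 : 0 ≤ (1 / p).toReal := ENNReal.toReal_nonneg
  rw [ENNReal.ofReal_rpow_of_pos (Real.exp_pos _), ← ENNReal.ofReal_mul (Real.exp_pos _).le,
    ← Real.exp_mul, ← Real.exp_add]
  refine ENNReal.ofReal_le_ofReal (Real.exp_le_exp.2 ?_)
  have hN : (0 : ℝ) ≤ N := Nat.cast_nonneg N
  have h5 : (1 - (1 / p).toReal) * (N * t) ≤ 1 * (N * |t|) := by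
    refine (mul_le_mul_of_nonneg_left (mul_le_mul_of_nonneg_left (le_abs_self t) hN)
      (by linarith)).trans (mul_le_mul_of_nonneg_right (by linarith) (by positivity))
  linarith

theorem memLp_comp_backward (t : ℝ) (a : Vel N × Vel N) {f : Phase N → ℝ}
    (hf : MemLp f p volume) :
    MemLp (fun z => Real.exp (N * t) * f (backward t a z)) p volume :=
  ⟨(hf.1.comp_quasiMeasurePreserving (quasiMeasurePreserving_backward t a)).const_mul _,
    (eLpNorm_comp_backward_le t a hf.1).trans_lt (ENNReal.mul_lt_top (by simp) hf.2)⟩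

/-- The transport operator `f ↦ e^{Nt} f(flow (-t) (z - a))` on `L^p`. -/
def transport (p : ℝ≥0∞) [Fact (1 ≤ p)] (t : ℝ) (a : Vel N × Vel N) :
    Lp ℝ p (volume : Measure (Phase N)) →L[ℝ] Lp ℝ p (volume : Measure (Phase N)) :=
  LinearMap.mkContinuous
    { toFun := fun f => (memLp_comp_backward t a (Lp.memLp f)).toLp _
      map_add' := fun f g => by
        rw [← MemLp.toLp_add]
        refine MemLp.toLp_congr _ _ ?_
        filter_upwards [(quasiMeasurePreserving_backward t a).ae (Lp.coeFn_add f g)] with z hz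
        change Real.exp _ * (f + g) (backward t a z) = Real.exp _ * f _ + Real.exp _ * g _
        rw [hz, Pi.add_apply, mul_add]
      map_smul' := fun c f => by
        rw [RingHom.id_apply, ← MemLp.toLp_const_smul]
        refine MemLp.toLp_congr _ _ ?_
        filter_upwards [(quasiMeasurePreserving_backward t a).ae (Lp.coeFn_smul c f)] with z hz
        change Real.exp _ * (c • f) (backward t a z) = c * (Real.exp _ * f _)
        rw [hz, Pi.smul_apply, smul_eq_mul, mul_left_comm] }
    (Real.exp (N * |t|)) fun f => by
      have := eLpNorm_comp_backward_le (p := p) t a (Lp.memLp f).1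
      simp only [LinearMap.coe_mk, AddHom.coe_mk]
      rw [Lp.norm_toLp, Lp.norm_def]
      rw [← ENNReal.toReal_ofReal (Real.exp_pos (N * |t|)).le, ← ENNReal.toReal_mul]
      exact ENNReal.toReal_mono (ENNReal.mul_ne_top (by simp) (Lp.eLpNorm_ne_top f)) this

theorem coeFn_transport (t : ℝ) (a : Vel N × Vel N) (f : Lp ℝ p (volume : Measure (Phase N))) :
    transport p t a f =ᵐ[volume] fun z => Real.exp (N * t) * f (backward t a z) :=
  MemLp.coeFn_toLp (memLp_comp_backward t a (Lp.memLp f))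

theorem norm_transport_le (t : ℝ) (a : Vel N × Vel N) :
    ‖transport (N := N) p t a‖ ≤ Real.exp (N * |t|) :=
  LinearMap.mkContinuous_norm_le _ (Real.exp_pos _).le _

theorem transport_transport (t s : ℝ) (a b : Vel N × Vel N)
    (f : Lp ℝ p (volume : Measure (Phase N))) :
    transport p t a (transport p s b f) = transport p (t + s) (a + linFlow t b) f := by
  refine Lp.ext ?_
  filter_upwards [coeFn_transport t a (transport p s b f),
    (quasiMeasurePreserving_backward t a).ae (coeFn_transport s b f),
    coeFn_transport (t + s) (a + linFlow t b) f] with z h1 h2 h3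
  rw [h1, h2, h3, backward_backward, ← mul_assoc, ← Real.exp_add, mul_add]

theorem backward_zero_zero (z : Phase N) : backward 0 0 z = z := by
  simp [backward, toPhase_zero, flow_zero]

theorem transport_zero (f : Lp ℝ p (volume : Measure (Phase N))) : transport p 0 0 f = f := by
  refine Lp.ext ?_
  filter_upwards [coeFn_transport 0 0 f] with z h1
  simp [h1, backward_zero_zero]

theorem transport_nonneg (t : ℝ) (a : Vel N × Vel N) {f : Lp ℝ p (volume : Measure (Phase N))}
    (hf : 0 ≤ f) : 0 ≤ transport p t a f := by
  rw [← Lp.coeFn_nonneg] at hf ⊢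
  filter_upwards [coeFn_transport t a f, (quasiMeasurePreserving_backward t a).ae hf] with z h1 h2
  rw [h1]
  exact mul_nonneg (Real.exp_pos _).le h2

theorem flow_backward (t : ℝ) (a : Vel N × Vel N) (z : Phase N) :
    flow t (backward t a z) + toPhase a = z := by
  simp [backward, flow_flow, flow_zero]

instance : (volume : Measure (Phase N)).Regular :=
  Measure.Regular.of_sigmaCompactSpace_of_isLocallyFiniteMeasure _

/-- The transport operators depend continuously on the parameters, in the strong topology. -/
theorem continuous_transport (hp : p ≠ ⊤) (f : Lp ℝ p (volume : Measure (Phase N))) :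
    Continuous fun c : ℝ × (Vel N × Vel N) => transport p c.1 c.2 f := by
  have hp0 : p ≠ 0 := (zero_lt_one.trans_le Fact.out).ne'
  have hpr : 0 < p.toReal := ENNReal.toReal_pos hp0 hp
  -- compactly supported continuous functions
  have hcc : ∀ g : Phase N → ℝ, Continuous g → HasCompactSupport g → ∀ c₀ : ℝ × (Vel N × Vel N),
      Tendsto (fun c : ℝ × (Vel N × Vel N) => eLpNorm (fun z =>
        Real.exp (N * c.1) * g (backward c.1 c.2 z) -
          Real.exp (N * c₀.1) * g (backward c₀.1 c₀.2 z)) p volume) (𝓝 c₀) (𝓝 0) := by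
    intro g hg hgs c₀
    obtain ⟨B, hB⟩ := hg.bounded_above_of_compact_support hgs
    have hB0 : 0 ≤ B := (norm_nonneg _).trans (hB 0)
    -- For parameters within distance 1 of `c₀`, all the transported functions vanish outside this
    -- compact set; a constant on it is the dominating function.
    let Kc : Set (Phase N) := (fun q : (ℝ × (Vel N × Vel N)) × Phase N =>
      flow q.1.1 q.2 + toPhase q.1.2) '' (Metric.closedBall c₀ 1 ×ˢ tsupport g)
    have hK : IsCompact Kc := by
      refine ((isCompact_closedBall c₀ 1).prod hgs).image ?_
      exact (continuous_flow.comp (by fun_prop :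
        Continuous fun q : (ℝ × (Vel N × Vel N)) × Phase N => (q.1.1, q.2))).add
        (continuous_toPhase.comp (by fun_prop))
    have hsupp : ∀ c ∈ Metric.closedBall c₀ 1, ∀ z ∉ Kc, g (backward c.1 c.2 z) = 0 := by
      intro c hc z hz
      by_contra h
      exact hz ⟨(c, backward c.1 c.2 z), ⟨hc, subset_tsupport _ h⟩, flow_backward _ _ _⟩
    have hcont : Continuous fun q : (ℝ × (Vel N × Vel N)) × Phase N =>
        Real.exp (N * q.1.1) * g (backward q.1.1 q.1.2 q.2) :=
      Continuous.mul (by fun_prop) (hg.comp continuous_backward)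
    set D : ℝ := 2 * (Real.exp (N * (|c₀.1| + 1)) * B) with hD
    have hbd : ∀ c ∈ Metric.closedBall c₀ 1, ∀ z,
        |Real.exp (N * c.1) * g (backward c.1 c.2 z)| ≤ Real.exp (N * (|c₀.1| + 1)) * B := by
      intro c hc z
      rw [abs_mul, abs_of_pos (Real.exp_pos _)]
      gcongr
      · have h1 : dist c.1 c₀.1 ≤ 1 := (le_max_left _ _).trans (Metric.mem_closedBall.1 hc)
        rw [Real.dist_eq] at h1
        linarith [abs_le.1 h1, le_abs_self c₀.1]
      · exact hB _
    have hlim : Tendsto (fun c : ℝ × (Vel N × Vel N) => ∫⁻ z,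
        ‖Real.exp (N * c.1) * g (backward c.1 c.2 z) -
          Real.exp (N * c₀.1) * g (backward c₀.1 c₀.2 z)‖ₑ ^ p.toReal)
        (𝓝 c₀) (𝓝 (∫⁻ _ : Phase N, 0)) := by
      refine tendsto_lintegral_filter_of_dominated_convergence
        (Kc.indicator fun _ => (ENNReal.ofReal D) ^ p.toReal) ?_ ?_ ?_ ?_
      · refine Eventually.of_forall fun c => ?_
        have h1 : Continuous fun z => Real.exp (N * c.1) * g (backward c.1 c.2 z) :=
          hcont.comp (by fun_prop : Continuous fun z : Phase N => (c, z))
        have h2 : Continuous fun z => Real.exp (N * c₀.1) * g (backward c₀.1 c₀.2 z) :=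
          hcont.comp (by fun_prop : Continuous fun z : Phase N => (c₀, z))
        exact ((h1.sub h2).measurable.enorm).pow_const _
      · filter_upwards [Metric.closedBall_mem_nhds c₀ one_pos] with c hc
        refine Eventually.of_forall fun z => ?_
        by_cases hz : z ∈ Kc
        · rw [indicator_of_mem hz]
          gcongr
          rw [Real.enorm_eq_ofReal_abs]
          refine ENNReal.ofReal_le_ofReal ((abs_sub _ _).trans ?_)
          have := hbd c hc z
          have := hbd c₀ (Metric.mem_closedBall_self zero_le_one) z
          linarith
        · rw [hsupp c hc z hz, hsupp c₀ (Metric.mem_closedBall_self zero_le_one) z hz]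
          simp [hpr, hz]
      · rw [lintegral_indicator hK.measurableSet, setLIntegral_const]
        exact ENNReal.mul_ne_top (by simp [hpr.le]) hK.measure_lt_top.ne
      · refine Eventually.of_forall fun z => ?_
        have h1 : Tendsto (fun c : ℝ × (Vel N × Vel N) =>
            Real.exp (N * c.1) * g (backward c.1 c.2 z) -
              Real.exp (N * c₀.1) * g (backward c₀.1 c₀.2 z)) (𝓝 c₀) (𝓝 0) := by
          have h2 : Continuous fun c : ℝ × (Vel N × Vel N) =>
            Real.exp (N * c.1) * g (backward c.1 c.2 z) :=
            hcont.comp (by fun_prop : Continuous fun c : ℝ × (Vel N × Vel N) => (c, z))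
          simpa using (h2.tendsto c₀).sub_const (Real.exp (N * c₀.1) * g (backward c₀.1 c₀.2 z))
        have h3 := (ENNReal.continuous_rpow_const (y := p.toReal)).tendsto 0 |>.comp
          (show Tendsto _ _ (𝓝 (0 : ℝ≥0∞)) by simpa using h1.enorm)
        rw [ENNReal.zero_rpow_of_pos hpr] at h3
        exact h3
    simp only [lintegral_zero] at hlim
    have h4 := (ENNReal.continuous_rpow_const (y := 1 / p.toReal)).tendsto 0 |>.comp hlim
    rw [ENNReal.zero_rpow_of_pos (by positivity)] at h4
    refine h4.congr fun c => ?_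
    rw [Function.comp_apply, eLpNorm_eq_lintegral_rpow_enorm_toReal hp0 hp]
  rw [continuous_iff_continuousAt]
  intro c₀
  rw [ContinuousAt, tendsto_iff_norm_sub_tendsto_zero, Metric.tendsto_nhds]
  intro ε hε
  set B := Real.exp (N * (|c₀.1| + 1)) with hBdef
  have hBpos : 0 < B := Real.exp_pos _
  -- The transport operators near `c₀` have norm at most B, so the approximation error contributes
  -- ε/4 at each of the two parameters, and ε/2 is left for the compactly supported function.
  obtain ⟨g, hgs, hfg, hg, hgL⟩ := (Lp.memLp f).exists_hasCompactSupport_eLpNorm_sub_le hp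
    (ε := ENNReal.ofReal (ε / (4 * B))) (by simp; positivity)
  set G : Lp ℝ p (volume : Measure (Phase N)) := hgL.toLp g with hG
  have hfG : ‖f - G‖ ≤ ε / (4 * B) := by
    rw [Lp.norm_def]
    refine ENNReal.toReal_le_of_le_ofReal (by positivity) (le_trans (le_of_eq ?_) hfg)
    refine eLpNorm_congr_ae ?_
    filter_upwards [Lp.coeFn_sub f G, hgL.coeFn_toLp] with z h1 h2
    rw [h1, Pi.sub_apply, Pi.sub_apply, hG, h2]
  have hTG : Tendsto (fun c : ℝ × (Vel N × Vel N) =>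
      ‖transport p c.1 c.2 G - transport p c₀.1 c₀.2 G‖) (𝓝 c₀) (𝓝 0) := by
    have h1 := (ENNReal.tendsto_toReal ENNReal.zero_ne_top).comp (hcc g hg hgs c₀)
    rw [ENNReal.toReal_zero] at h1
    refine h1.congr fun c => ?_
    rw [Function.comp_apply, Lp.norm_def]
    congr 1
    refine eLpNorm_congr_ae ?_
    filter_upwards [Lp.coeFn_sub (transport p c.1 c.2 G) (transport p c₀.1 c₀.2 G),
      coeFn_transport c.1 c.2 G, coeFn_transport c₀.1 c₀.2 G,
      (quasiMeasurePreserving_backward c.1 c.2).ae hgL.coeFn_toLp,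
      (quasiMeasurePreserving_backward c₀.1 c₀.2).ae hgL.coeFn_toLp] with z h1 h2 h3 h4 h5
    rw [h1, Pi.sub_apply, h2, h3, hG, h4, h5]
  filter_upwards [hTG.eventually (gt_mem_nhds (half_pos hε)),
    Metric.closedBall_mem_nhds c₀ one_pos] with c hc hc1
  have hnorm : ∀ c' ∈ Metric.closedBall c₀ 1, ‖transport (N := N) p c'.1 c'.2‖ ≤ B := by
    intro c' hc'
    refine (norm_transport_le _ _).trans ?_
    rw [hBdef]
    gcongr
    have h1 : dist c'.1 c₀.1 ≤ 1 := (le_max_left _ _).trans (Metric.mem_closedBall.1 hc')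
    rw [Real.dist_eq] at h1
    have := abs_sub_abs_le_abs_sub c'.1 c₀.1
    linarith
  have h5 : ∀ c' ∈ Metric.closedBall c₀ 1, ‖transport p c'.1 c'.2 (f - G)‖ ≤ ε / 4 := by
    intro c' hc'
    refine ((ContinuousLinearMap.le_opNorm _ _).trans (mul_le_mul (hnorm c' hc') hfG
      (norm_nonneg _) hBpos.le)).trans (le_of_eq ?_)
    field_simp
  have h6 : transport p c.1 c.2 f - transport p c₀.1 c₀.2 f =
      transport p c.1 c.2 (f - G) - transport p c₀.1 c₀.2 (f - G) +
        (transport p c.1 c.2 G - transport p c₀.1 c₀.2 G) := by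
    simp only [map_sub]; abel
  rw [Real.dist_eq, sub_zero, abs_norm, h6]
  calc _ ≤ ε / 4 + ε / 4 + ‖transport p c.1 c.2 G - transport p c₀.1 c₀.2 G‖ :=
        (norm_add_le _ _).trans (add_le_add ((norm_sub_le _ _).trans (add_le_add (h5 c hc1)
          (h5 c₀ (Metric.mem_closedBall_self zero_le_one)))) le_rfl)
    _ < ε := by linarith

end Transport

/-! ### The covariance -/

section Covariance

/-- With a = 1 - e^{-t}, the covariance entries become polynomials in t and a, and their
inequalities can be checked by differentiating from t = 0. -/
theorem covXX_eq (t : ℝ) :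
    covXX t = 2 * t - 2 * (1 - Real.exp (-t)) - (1 - Real.exp (-t)) ^ 2 := by
  have h : ∫ s in (0 : ℝ)..t, (1 - Real.exp (-s)) ^ 2 =
      (t + 2 * Real.exp (-t) - Real.exp (-t) ^ 2 / 2) -
        (0 + 2 * Real.exp (-0) - Real.exp (-0) ^ 2 / 2) := by
    refine intervalIntegral.integral_eq_sub_of_hasDerivAt
      (f := fun s : ℝ => s + 2 * Real.exp (-s) - Real.exp (-s) ^ 2 / 2) (fun s _ => ?_)
      (Continuous.intervalIntegrable (by fun_prop) _ _)
    have h1 : HasDerivAt (fun s : ℝ => Real.exp (-s)) (Real.exp (-s) * -1) s :=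
      (hasDerivAt_neg s).exp
    convert! ((hasDerivAt_id s).add (h1.const_mul 2)).sub ((h1.pow 2).div_const 2) using 1
    ring
  rw [covXX, h]
  simp only [neg_zero, Real.exp_zero]
  ring

theorem covXV_eq (t : ℝ) : covXV t = (1 - Real.exp (-t)) ^ 2 := by
  have h : ∫ s in (0 : ℝ)..t, Real.exp (-s) * (1 - Real.exp (-s)) =
      (-Real.exp (-t) + Real.exp (-t) ^ 2 / 2) - (-Real.exp (-0) + Real.exp (-0) ^ 2 / 2) := by
    refine intervalIntegral.integral_eq_sub_of_hasDerivAt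
      (f := fun s : ℝ => -Real.exp (-s) + Real.exp (-s) ^ 2 / 2) (fun s _ => ?_)
      (Continuous.intervalIntegrable (by fun_prop) _ _)
    have h1 : HasDerivAt (fun s : ℝ => Real.exp (-s)) (Real.exp (-s) * -1) s :=
      (hasDerivAt_neg s).exp
    convert! h1.neg.add ((h1.pow 2).div_const 2) using 1
    ring
  rw [covXV, h]
  simp only [neg_zero, Real.exp_zero]
  ring

theorem covVV_eq (t : ℝ) : covVV t = 2 * (1 - Real.exp (-t)) - (1 - Real.exp (-t)) ^ 2 := by
  have h : ∫ s in (0 : ℝ)..t, Real.exp (-2 * s) =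
      (-Real.exp (-2 * t) / 2) - (-Real.exp (-2 * 0) / 2) := by
    refine intervalIntegral.integral_eq_sub_of_hasDerivAt
      (f := fun s : ℝ => -Real.exp (-2 * s) / 2) (fun s _ => ?_)
      (Continuous.intervalIntegrable (by fun_prop) _ _)
    have h1 : HasDerivAt (fun s : ℝ => Real.exp (-2 * s)) (Real.exp (-2 * s) * -2) s := by
      simpa using ((hasDerivAt_id s).const_mul (-2)).exp
    convert! h1.neg.div_const 2 using 1
    ring
  rw [covVV, h, show -2 * t = -t + -t by ring, Real.exp_add]
  simp only [mul_zero, Real.exp_zero]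
  ring

theorem covDet_eq (t : ℝ) : covDet t = 2 * (1 - Real.exp (-t)) *
    (2 * t - t * (1 - Real.exp (-t)) - 2 * (1 - Real.exp (-t))) := by
  rw [covDet, covXX_eq, covXV_eq, covVV_eq]; ring

theorem one_sub_exp_neg_pos {t : ℝ} (ht : 0 < t) : 0 < 1 - Real.exp (-t) := by
  have := Real.exp_lt_one_iff.2 (neg_lt_zero.2 ht)
  linarith

/-- Positivity of a function that vanishes at `0` and has a positive derivative on `(0, ∞)`. -/
theorem pos_of_hasDerivAt_pos {g g' : ℝ → ℝ} (h0 : g 0 = 0) (hg : ∀ s, HasDerivAt g (g' s) s)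
    (hg' : ∀ s, 0 < s → 0 < g' s) {t : ℝ} (ht : 0 < t) : 0 < g t := by
  have := strictMonoOn_of_deriv_pos (convex_Ici (0 : ℝ)) (f := g)
    (fun s _ => (hg s).continuousAt.continuousWithinAt) (fun s hs => by
      rw [interior_Ici] at hs
      rw [(hg s).deriv]; exact hg' s hs)
  have h1 := this (mem_Ici.2 le_rfl) (mem_Ici.2 ht.le) ht
  rwa [h0] at h1

theorem hasDerivAt_exp_neg (s : ℝ) : HasDerivAt (fun s : ℝ => Real.exp (-s)) (-Real.exp (-s)) s := by
  simpa using (hasDerivAt_neg s).exp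

theorem one_sub_exp_neg_mul_pos {s : ℝ} (hs : 0 < s) :
    0 < 1 - Real.exp (-s) - s * Real.exp (-s) := by
  have h1 := Real.add_one_lt_exp hs.ne'
  have h2 : Real.exp s * Real.exp (-s) = 1 := by rw [← Real.exp_add]; simp
  nlinarith [Real.exp_pos (-s)]

theorem covXX_pos {t : ℝ} (ht : 0 < t) : 0 < covXX t := by
  rw [covXX_eq]
  refine pos_of_hasDerivAt_pos (g := fun t => 2 * t - 2 * (1 - Real.exp (-t)) -
    (1 - Real.exp (-t)) ^ 2) (g' := fun s => 2 * (1 - Real.exp (-s)) ^ 2) (by simp)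
    (fun s => ?_) (fun s hs => ?_) ht
  · have h1 := (hasDerivAt_exp_neg s).const_sub 1
    convert! (((hasDerivAt_id s).const_mul 2).sub (h1.const_mul 2)).sub (h1.pow 2) using 1
    ring
  · have := one_sub_exp_neg_pos hs
    positivity

theorem covDet_pos {t : ℝ} (ht : 0 < t) : 0 < covDet t := by
  rw [covDet_eq]
  refine mul_pos (mul_pos two_pos (one_sub_exp_neg_pos ht)) ?_
  refine pos_of_hasDerivAt_pos (g := fun t => 2 * t - t * (1 - Real.exp (-t)) -
    2 * (1 - Real.exp (-t))) (g' := fun s => 1 - Real.exp (-s) - s * Real.exp (-s)) (by simp)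
    (fun s => ?_) (fun s hs => one_sub_exp_neg_mul_pos hs) ht
  have h1 := (hasDerivAt_exp_neg s).const_sub 1
  convert! (((hasDerivAt_id s).const_mul 2).sub ((hasDerivAt_id s).mul h1)).sub
    (h1.const_mul 2) using 1
  simp only [id]; ring

/-- The entries of a square root of the covariance matrix. -/
def cholR (t : ℝ) : ℝ := √(covXX t)

/-- The factor is lower triangular, [cholR, 0; cholQ, cholD]. At t = 0 the divisions by zero return
0, which is the correct entry, so the identities below hold for all t ≥ 0. -/
def cholQ (t : ℝ) : ℝ := covXV t / √(covXX t)

def cholD (t : ℝ) : ℝ := √(covDet t / covXX t)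

theorem covXX_nonneg {t : ℝ} (ht : 0 ≤ t) : 0 ≤ covXX t := by
  rcases ht.eq_or_lt with rfl | h
  · simp [covXX]
  · exact (covXX_pos h).le

theorem cholR_sq {t : ℝ} (ht : 0 ≤ t) : cholR t ^ 2 = covXX t := Real.sq_sqrt (covXX_nonneg ht)

theorem cholR_mul_cholQ {t : ℝ} (ht : 0 ≤ t) : cholR t * cholQ t = covXV t := by
  rcases ht.eq_or_lt with rfl | h
  · simp [cholR, covXX, covXV]
  · have := (Real.sqrt_pos.2 (covXX_pos h)).ne'
    rw [cholR, cholQ]; field_simp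

theorem cholQ_sq_add {t : ℝ} (ht : 0 ≤ t) : cholQ t ^ 2 + cholD t ^ 2 = covVV t := by
  rcases ht.eq_or_lt with rfl | h
  · simp [cholQ, cholD, covXX, covVV]
  · have hX := covXX_pos h
    rw [cholQ, cholD, div_pow, Real.sq_sqrt hX.le,
      Real.sq_sqrt (div_nonneg (covDet_pos h).le hX.le), covDet]
    field_simp
    ring

theorem cholR_mul_cholD {t : ℝ} (ht : 0 < t) : cholR t * cholD t = √(covDet t) := by
  rw [cholR, cholD, ← Real.sqrt_mul (covXX_pos ht).le, mul_div_cancel₀ _ (covXX_pos ht).ne']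

theorem cholR_pos {t : ℝ} (ht : 0 < t) : 0 < cholR t := Real.sqrt_pos.2 (covXX_pos ht)

theorem cholD_pos {t : ℝ} (ht : 0 < t) : 0 < cholD t :=
  Real.sqrt_pos.2 (div_pos (covDet_pos ht) (covXX_pos ht))

theorem continuous_covXX : Continuous covXX := by
  rw [show covXX = _ from funext covXX_eq]; fun_prop

theorem continuous_covXV : Continuous covXV := by
  rw [show covXV = _ from funext covXV_eq]; fun_prop

theorem continuous_covVV : Continuous covVV := by
  rw [show covVV = _ from funext covVV_eq]; fun_prop

theorem continuous_covDet : Continuous covDet := by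
  rw [show covDet = _ from funext covDet_eq]; fun_prop

theorem continuousOn_cholR : ContinuousOn cholR (Ici 0) :=
  (continuous_covXX.sqrt).continuousOn

theorem covVV_zero : covVV 0 = 0 := by simp [covVV]

theorem cholQ_zero : cholQ 0 = 0 := by simp [cholQ, covXX]

theorem cholD_zero : cholD 0 = 0 := by simp [cholD, covXX]

theorem cholR_zero : cholR 0 = 0 := by simp [cholR, covXX]

/-- The formulas for the entries are 0/0 at t = 0, so continuity there is obtained by squeezing with
√(covVV t), which tends to 0. -/
theorem continuousOn_of_sq_le_covVV {g : ℝ → ℝ} (h0 : g 0 = 0)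
    (hg : ∀ t, 0 ≤ t → g t ^ 2 ≤ covVV t) (hc : ContinuousOn g (Ioi 0)) :
    ContinuousOn g (Ici 0) := by
  intro t ht
  rcases (mem_Ici.1 ht).eq_or_lt with rfl | h
  · have h1 : Tendsto (fun t => √(covVV t)) (𝓝[Ici 0] 0) (𝓝 0) := by
      have := (continuous_covVV.sqrt.tendsto 0).mono_left
        (nhdsWithin_le_nhds (s := Ici (0 : ℝ)))
      simpa [covVV_zero] using this
    rw [ContinuousWithinAt, h0]
    refine squeeze_zero_norm' ?_ h1
    filter_upwards [self_mem_nhdsWithin] with s hs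
    exact Real.abs_le_sqrt (hg s hs)
  · exact (hc.continuousAt (Ioi_mem_nhds h)).continuousWithinAt

theorem continuousOn_cholQ : ContinuousOn cholQ (Ici 0) := by
  refine continuousOn_of_sq_le_covVV cholQ_zero (fun t ht => ?_) ?_
  · rw [← cholQ_sq_add ht]; nlinarith [sq_nonneg (cholD t)]
  · exact continuous_covXV.continuousOn.div continuous_covXX.sqrt.continuousOn
      fun t ht => (Real.sqrt_pos.2 (covXX_pos ht)).ne'

theorem continuousOn_cholD : ContinuousOn cholD (Ici 0) := by
  refine continuousOn_of_sq_le_covVV cholD_zero (fun t ht => ?_) ?_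
  · rw [← cholQ_sq_add ht]; nlinarith [sq_nonneg (cholQ t)]
  · exact (continuous_covDet.continuousOn.div continuous_covXX.continuousOn
      fun t ht => (covXX_pos ht).ne').sqrt

/-- The coefficients of the score in a velocity direction. -/
def scoreA (t : ℝ) : ℝ := (1 - Real.exp (-t)) / cholR t

/-- The pair (scoreA, scoreB) is obtained by forward substitution: the Cholesky factor maps it to (1
- e^{-t}, e^{-t}), the derivative of the mean in the initial velocity. -/
def scoreB (t : ℝ) : ℝ := (Real.exp (-t) - cholQ t * scoreA t) / cholD t

theorem cholR_mul_scoreA {t : ℝ} (ht : 0 < t) : cholR t * scoreA t = 1 - Real.exp (-t) := by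
  have := (cholR_pos ht).ne'
  rw [scoreA]; field_simp

theorem cholQ_mul_scoreA_add {t : ℝ} (ht : 0 < t) :
    cholQ t * scoreA t + cholD t * scoreB t = Real.exp (-t) := by
  have := (cholD_pos ht).ne'
  rw [scoreB]; field_simp; ring

theorem continuousOn_scoreA : ContinuousOn scoreA (Ioi 0) :=
  ContinuousOn.div (by fun_prop) (continuousOn_cholR.mono Ioi_subset_Ici_self)
    fun _ ht => (cholR_pos ht).ne'

theorem continuousOn_scoreB : ContinuousOn scoreB (Ioi 0) :=
  ContinuousOn.div (ContinuousOn.sub (by fun_prop)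
    ((continuousOn_cholQ.mono Ioi_subset_Ici_self).mul continuousOn_scoreA))
    (continuousOn_cholD.mono Ioi_subset_Ici_self) fun _ ht => (cholD_pos ht).ne'

/-- The left side is the inverse covariance evaluated at the vector (1 - e^{-t}, e^{-t}), the Fisher
information in the initial velocity. The inverse covariance has entries of order t^{-3}, but the
position component of this vector is only of order t, which leaves a bound of order t^{-1}. -/
theorem score_sq_le {t : ℝ} (ht : 0 < t) :
    scoreA t ^ 2 + scoreB t ^ 2 ≤ 2 / (1 - Real.exp (-t)) := by
  have hX := covXX_pos ht
  have hD := covDet_pos ht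
  have ha := one_sub_exp_neg_pos ht
  set a := 1 - Real.exp (-t) with ha'
  have he : Real.exp (-t) = 1 - a := by rw [ha']; ring
  have h1 : scoreA t ^ 2 + scoreB t ^ 2 =
      (covVV t * a ^ 2 - 2 * covXV t * a * (1 - a) + covXX t * (1 - a) ^ 2) / covDet t := by
    have hq : cholQ t * scoreA t = covXV t * a / covXX t := by
      rw [cholQ, scoreA, cholR, ← ha', div_mul_div_comm, Real.mul_self_sqrt hX.le]
    rw [scoreB, hq, scoreA, div_pow, div_pow, cholD, Real.sq_sqrt (div_nonneg hD.le hX.le),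
      cholR_sq ht.le, ← ha', he]
    rw [div_add_div _ _ hX.ne' (div_pos hD hX).ne', div_eq_div_iff (by positivity) hD.ne']
    rw [covDet] at *
    field_simp
    ring
  -- After clearing denominators, the difference of the two sides of the claim is a times this
  -- expression, which vanishes at t = 0 and has a positive derivative.
  have h2 : 0 < t * (6 - 2 * a ^ 2) - 6 * a - 3 * a ^ 2 := by
    rw [ha']
    refine pos_of_hasDerivAt_pos (g := fun t => t * (6 - 2 * (1 - Real.exp (-t)) ^ 2) -
      6 * (1 - Real.exp (-t)) - 3 * (1 - Real.exp (-t)) ^ 2)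
      (g' := fun s => 4 * (1 - Real.exp (-s)) * (1 - Real.exp (-s) - s * Real.exp (-s)))
      (by simp) (fun s => ?_) (fun s hs => ?_) ht
    · have h3 := (hasDerivAt_exp_neg s).const_sub 1
      convert! (((hasDerivAt_id s).mul (((h3.pow 2).const_mul 2).const_sub 6)).sub
        (h3.const_mul 6)).sub ((h3.pow 2).const_mul 3) using 1
      simp only [id, Nat.cast_ofNat, Nat.add_one_sub_one, pow_one, neg_neg, Pi.pow_apply]; ring
    · have := one_sub_exp_neg_pos hs
      have := one_sub_exp_neg_mul_pos hs
      positivity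
  rw [h1, div_le_div_iff₀ hD ha, covDet_eq, covXX_eq, covXV_eq, covVV_eq, ← ha']
  nlinarith

/-- This is the origin of the t^{-1/2} singularity. The bound t e^{-T} ≤ 1 - e^{-t} converts the
preceding estimate, and each coefficient is bounded separately, hence the factor 2. -/
theorem score_le {T t : ℝ} (ht : t ∈ Ioc 0 T) :
    |scoreA t| + |scoreB t| ≤ 2 * √(2 * Real.exp T) * t ^ (-(1 / 2) : ℝ) := by
  have h1 : 2 / (1 - Real.exp (-t)) ≤ 2 * Real.exp T / t := by
    have ha := one_sub_exp_neg_mul_pos ht.1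
    have h2 : Real.exp (-T) ≤ Real.exp (-t) := Real.exp_le_exp.2 (by linarith [ht.2])
    have h3 : Real.exp T * Real.exp (-T) = 1 := by rw [← Real.exp_add]; simp
    rw [div_le_div_iff₀ (one_sub_exp_neg_pos ht.1) ht.1]
    have h4 : t * Real.exp (-T) ≤ 1 - Real.exp (-t) := by
      have := mul_le_mul_of_nonneg_left h2 ht.1.le; linarith
    have h5 := mul_le_mul_of_nonneg_left h4 (Real.exp_pos T).le
    have h6 : Real.exp T * (t * Real.exp (-T)) = t := by rw [mul_left_comm, h3, mul_one]
    linarith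
  have hs := (score_sq_le ht.1).trans h1
  have h3 : √(2 * Real.exp T / t) = √(2 * Real.exp T) * t ^ (-(1 / 2) : ℝ) := by
    rw [Real.sqrt_div (by positivity), Real.sqrt_eq_rpow t, Real.rpow_neg ht.1.le,
      div_eq_mul_inv]
  have hA : |scoreA t| ≤ √(2 * Real.exp T / t) := Real.abs_le_sqrt (by nlinarith [sq_nonneg (scoreB t)])
  have hB : |scoreB t| ≤ √(2 * Real.exp T / t) := Real.abs_le_sqrt (by nlinarith [sq_nonneg (scoreA t)])
  rw [mul_assoc, ← h3]
  linarith

/-- The fluctuation over a time t + s is the fluctuation over t plus an independent one over s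
carried along by `linFlow t`. This identity and the next two are the corresponding addition of
covariances. -/
theorem covXX_add (t s : ℝ) : covXX (t + s) = covXX t + covXX s +
    2 * (1 - Real.exp (-t)) * covXV s + (1 - Real.exp (-t)) ^ 2 * covVV s := by
  have h : Real.exp (-(t + s)) = Real.exp (-t) * Real.exp (-s) := by
    rw [← Real.exp_add]; congr 1; ring
  simp only [covXX_eq, covXV_eq, covVV_eq, h]
  ring

theorem covXV_add (t s : ℝ) : covXV (t + s) = covXV t +
    Real.exp (-t) * (covXV s + (1 - Real.exp (-t)) * covVV s) := by
  have h : Real.exp (-(t + s)) = Real.exp (-t) * Real.exp (-s) := by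
    rw [← Real.exp_add]; congr 1; ring
  simp only [covXV_eq, covVV_eq, h]
  ring

theorem covVV_add (t s : ℝ) : covVV (t + s) = covVV t + Real.exp (-t) ^ 2 * covVV s := by
  have h : Real.exp (-(t + s)) = Real.exp (-t) * Real.exp (-s) := by
    rw [← Real.exp_add]; congr 1; ring
  simp only [covVV_eq, h]
  ring

end Covariance

/-! ### The Gaussian law -/

section GaussianLaw

-- Both measures are finite, so it suffices that their characteristic functions agree, and this is
-- the Gaussian Fourier integral.
open ProbabilityTheory Complex in
theorem stdGaussian_eq_withDensity (N : ℕ) : stdGaussian (Vel N) =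
    volume.withDensity fun z : Vel N =>
      ENNReal.ofReal (((2 * Real.pi) ^ (N / 2 : ℝ))⁻¹ * Real.exp (-‖z‖ ^ 2 / 2)) := by
  have hpos : (0 : ℝ) < (2 * Real.pi) ^ (N / 2 : ℝ) := by positivity
  have hint0 : Integrable fun z : Vel N => Real.exp (-‖z‖ ^ 2 / 2) := by
    have := GaussianFourier.integrable_cexp_neg_mul_sq_norm_add (V := Vel N) (b := 1 / 2)
      (by norm_num) 0 0
    convert! this.re using 2 with z
    simp only [zero_mul, add_zero, RCLike.re_to_complex]
    rw [show (-(1 / 2) * (‖z‖ : ℂ) ^ 2) = ((-‖z‖ ^ 2 / 2 : ℝ) : ℂ) by push_cast; ring,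
      ← Complex.ofReal_exp, Complex.ofReal_re]
  have hint : Integrable fun z : Vel N =>
      ((2 * Real.pi) ^ (N / 2 : ℝ))⁻¹ * Real.exp (-‖z‖ ^ 2 / 2) := hint0.const_mul _
  have : IsFiniteMeasure (volume.withDensity fun z : Vel N =>
      ENNReal.ofReal (((2 * Real.pi) ^ (N / 2 : ℝ))⁻¹ * Real.exp (-‖z‖ ^ 2 / 2))) :=
    isFiniteMeasure_withDensity_ofReal hint.2
  refine Measure.ext_of_charFun (funext fun u => ?_)
  rw [charFun_stdGaussian, charFun_apply, integral_withDensity_eq_integral_toReal_smul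
    (by fun_prop) (Eventually.of_forall fun _ => ENNReal.ofReal_lt_top)]
  have h1 := GaussianFourier.integral_cexp_neg_mul_sq_norm_add (V := Vel N) (b := 1 / 2)
    (by norm_num) I u
  rw [finrank_euclideanSpace_fin] at h1
  have h2 : ∀ z : Vel N, (ENNReal.ofReal (((2 * Real.pi) ^ (N / 2 : ℝ))⁻¹ *
      Real.exp (-‖z‖ ^ 2 / 2))).toReal • cexp ((inner ℝ z u : ℝ) * I) =
      (((2 * Real.pi) ^ (N / 2 : ℝ))⁻¹ : ℝ) *
        cexp (-(1 / 2) * (‖z‖ : ℂ) ^ 2 + I * (inner ℝ u z : ℝ)) := by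
    intro z
    rw [ENNReal.toReal_ofReal (by positivity), Complex.real_smul, Complex.exp_add,
      real_inner_comm u z]
    push_cast
    rw [mul_assoc]
    congr 2
    · congr 1; ring
    · congr 1; ring
  simp_rw [h2]
  rw [integral_const_mul, h1]
  have h3 : ((Real.pi : ℂ) / (1 / 2)) ^ ((N : ℂ) / 2) = (((2 * Real.pi) ^ (N / 2 : ℝ) : ℝ) : ℂ) := by
    rw [Complex.ofReal_cpow (by positivity)]
    push_cast
    congr 1; ring
  rw [h3, ← mul_assoc, ← Complex.ofReal_mul, inv_mul_cancel₀ hpos.ne', Complex.ofReal_one, one_mul]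
  congr 1
  rw [I_sq]; ring

/-- The standard Gaussian law on `ℝ^N × ℝ^N`. -/
def gaussLaw (N : ℕ) : Measure (Vel N × Vel N) :=
  (ProbabilityTheory.stdGaussian (Vel N)).prod (ProbabilityTheory.stdGaussian (Vel N))

instance (N : ℕ) : IsProbabilityMeasure (gaussLaw N) := by unfold gaussLaw; infer_instance

instance (N : ℕ) : ProbabilityTheory.IsGaussian (gaussLaw N) := by
  unfold gaussLaw; infer_instance

/-- The density of the standard Gaussian law. -/
def gaussRho {N : ℕ} (z : Vel N × Vel N) : ℝ :=
  ((2 * Real.pi) ^ N)⁻¹ * Real.exp (-(‖z.1‖ ^ 2 + ‖z.2‖ ^ 2) / 2)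

theorem gaussRho_pos {N : ℕ} (z : Vel N × Vel N) : 0 < gaussRho z := by
  unfold gaussRho; positivity

theorem continuous_gaussRho {N : ℕ} : Continuous (gaussRho (N := N)) := by
  unfold gaussRho; fun_prop

theorem gaussLaw_eq (N : ℕ) :
    gaussLaw N = volume.withDensity fun z => ENNReal.ofReal (gaussRho z) := by
  rw [gaussLaw, stdGaussian_eq_withDensity, prod_withDensity (by fun_prop) (by fun_prop),
    ← Measure.volume_eq_prod]
  congr 1
  ext1 z
  rw [← ENNReal.ofReal_mul (by positivity), gaussRho]
  congr 1
  rw [mul_mul_mul_comm, ← Real.exp_add, ← mul_inv, ← Real.rpow_add (by positivity)]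
  congr 2
  · rw [add_halves, Real.rpow_natCast]
  · ring

theorem integrable_norm_pow_gaussLaw (N k : ℕ) : Integrable (fun z => ‖z‖ ^ k) (gaussLaw N) := by
  have h := ProbabilityTheory.IsGaussian.memLp_id (gaussLaw N) k (ENNReal.natCast_ne_top k)
  exact h.integrable_norm_pow'

/-- The linear map that sends the standard Gaussian law to the law of the fluctuation. -/
def gaussMap {N : ℕ} (t : ℝ) : Vel N × Vel N →L[ℝ] Vel N × Vel N :=
  (cholR t • ContinuousLinearMap.fst ℝ _ _).prod
    (cholQ t • ContinuousLinearMap.fst ℝ _ _ + cholD t • ContinuousLinearMap.snd ℝ _ _)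

theorem gaussMap_apply {N : ℕ} (t : ℝ) (z : Vel N × Vel N) :
    gaussMap t z = (cholR t • z.1, cholQ t • z.1 + cholD t • z.2) := rfl

theorem gaussMap_zero {N : ℕ} (z : Vel N × Vel N) : gaussMap 0 z = 0 := by
  simp [gaussMap_apply, cholR_zero, cholQ_zero, cholD_zero]

theorem continuousOn_gaussMap {N : ℕ} :
    ContinuousOn (fun q : ℝ × (Vel N × Vel N) => gaussMap q.1 q.2) (Ici 0 ×ˢ univ) := by
  have hf : MapsTo (Prod.fst : ℝ × (Vel N × Vel N) → ℝ) (Ici 0 ×ˢ univ) (Ici 0) := fun q hq => hq.1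
  simp only [gaussMap_apply]
  have h1 := continuousOn_cholR.comp continuousOn_fst hf
  have h2 := continuousOn_cholQ.comp continuousOn_fst hf
  have h3 := continuousOn_cholD.comp continuousOn_fst hf
  exact (h1.smul (by fun_prop)).prodMk ((h2.smul (by fun_prop)).add (h3.smul (by fun_prop)))

def linFlowL {N : ℕ} (t : ℝ) : Vel N × Vel N →L[ℝ] Vel N × Vel N :=
  ContinuousLinearMap.prod
    (ContinuousLinearMap.fst ℝ _ _ + (1 - Real.exp (-t)) • ContinuousLinearMap.snd ℝ _ _)
    (Real.exp (-t) • ContinuousLinearMap.snd ℝ _ _)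

theorem linFlowL_apply {N : ℕ} (t : ℝ) (z : Vel N × Vel N) : linFlowL t z = linFlow t z := rfl

-- The product ℝ^N × ℝ^N carries the sup norm rather than an inner product, so the functional is
-- described by the vectors that represent its restrictions to the two factors.
open ProbabilityTheory Complex in
theorem charFunDual_gaussLaw {N : ℕ} (L : StrongDual ℝ (Vel N × Vel N)) (u w : Vel N)
    (hu : ∀ x, L (x, 0) = inner ℝ u x) (hw : ∀ x, L (0, x) = inner ℝ w x) :
    charFunDual (gaussLaw N) L = cexp (-((‖u‖ ^ 2 + ‖w‖ ^ 2 : ℝ) : ℂ) / 2) := by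
  have h1 : L.comp (.inl ℝ (Vel N) (Vel N)) = InnerProductSpace.toDual ℝ _ u := by
    ext x; simp [hu]
  have h2 : L.comp (.inr ℝ (Vel N) (Vel N)) = InnerProductSpace.toDual ℝ _ w := by
    ext x; simp [hw]
  rw [gaussLaw, charFunDual_prod, h1, h2, charFunDual_stdGaussian, charFunDual_stdGaussian,
    LinearIsometryEquiv.norm_map, LinearIsometryEquiv.norm_map, ← Complex.exp_add]
  congr 1
  push_cast; ring

open ProbabilityTheory in
/-- The laws of the fluctuations form a skew convolution semigroup. -/
theorem map_gaussMap_add {N : ℕ} {t s : ℝ} (ht : 0 ≤ t) (hs : 0 ≤ s) :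
    ((gaussLaw N).prod (gaussLaw N)).map
        (fun q => gaussMap t q.1 + linFlow t (gaussMap s q.2)) =
      (gaussLaw N).map (gaussMap (t + s)) := by
  let A : (Vel N × Vel N) × (Vel N × Vel N) →L[ℝ] Vel N × Vel N :=
    (gaussMap t).comp (ContinuousLinearMap.fst ℝ _ _) +
      ((linFlowL t).comp (gaussMap s)).comp (ContinuousLinearMap.snd ℝ _ _)
  have hA : (fun q : (Vel N × Vel N) × (Vel N × Vel N) =>
      gaussMap t q.1 + linFlow t (gaussMap s q.2)) = A := rfl
  rw [hA]
  have : IsProbabilityMeasure (((gaussLaw N).prod (gaussLaw N)).map A) :=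
    Measure.isProbabilityMeasure_map A.continuous.aemeasurable
  have : IsProbabilityMeasure ((gaussLaw N).map (gaussMap (N := N) (t + s))) :=
    Measure.isProbabilityMeasure_map (gaussMap (t + s)).continuous.aemeasurable
  refine Measure.ext_of_charFunDual (funext fun L => ?_)
  obtain ⟨u, hu⟩ := (InnerProductSpace.toDual ℝ (Vel N)).surjective (L.comp (.inl ℝ _ _))
  obtain ⟨w, hw⟩ := (InnerProductSpace.toDual ℝ (Vel N)).surjective (L.comp (.inr ℝ _ _))
  have hL : ∀ z : Vel N × Vel N, L z = inner ℝ u z.1 + inner ℝ w z.2 := by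
    intro z
    have h1 := DFunLike.congr_fun hu z.1
    have h2 := DFunLike.congr_fun hw z.2
    simp only [InnerProductSpace.toDual_apply_apply, ContinuousLinearMap.comp_apply,
      ContinuousLinearMap.inl_apply, ContinuousLinearMap.inr_apply] at h1 h2
    rw [h1, h2, ← map_add]; simp
  -- The vectors supplied here are (u, w) pulled back by the transposes of `gaussMap` and `linFlow`.
  -- Equality of the two exponents is then the additivity of the covariances, coefficient by
  -- coefficient in |u|², u·w and |w|².
  rw [charFunDual_map, charFunDual_map, charFunDual_prod,
    charFunDual_gaussLaw _ (cholR t • u + cholQ t • w) (cholD t • w),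
    charFunDual_gaussLaw _
      (cholR s • u + (1 - Real.exp (-t)) • cholQ s • u + Real.exp (-t) • cholQ s • w)
      ((1 - Real.exp (-t)) • cholD s • u + Real.exp (-t) • cholD s • w),
    charFunDual_gaussLaw _ (cholR (t + s) • u + cholQ (t + s) • w) (cholD (t + s) • w),
    ← Complex.exp_add]
  · congr 1
    rw [← add_div, ← neg_add, ← Complex.ofReal_add]
    congr 3
    have hexp : ∀ x y : Vel N, ‖x + y‖ ^ 2 = ‖x‖ ^ 2 + 2 * inner ℝ x y + ‖y‖ ^ 2 :=
      norm_add_sq_real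
    have hts : 0 ≤ t + s := add_nonneg ht hs
    have e1 := cholR_sq ht
    have e2 := cholR_mul_cholQ ht
    have e3 := cholQ_sq_add ht
    have f1 := cholR_sq hs
    have f2 := cholR_mul_cholQ hs
    have f3 := cholQ_sq_add hs
    have g1 := cholR_sq hts
    have g2 := cholR_mul_cholQ hts
    have g3 := cholQ_sq_add hts
    rw [covXX_add] at g1
    rw [covXV_add] at g2
    rw [covVV_add] at g3
    simp only [hexp, norm_smul, inner_smul_left, inner_smul_right, inner_add_left,
      mul_pow, Real.norm_eq_abs, sq_abs, conj_trivial, real_inner_self_eq_norm_sq]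
    generalize inner ℝ u w = iuw
    generalize ‖u‖ = nu
    generalize ‖w‖ = nw
    generalize Real.exp (-t) = e at *
    linear_combination nu ^ 2 * (e1 + f1 - g1 + 2 * (1 - e) * f2 + (1 - e) ^ 2 * f3) +
      2 * iuw * (e2 - g2 + e * f2 + e * (1 - e) * f3) + nw ^ 2 * (e3 - g3 + e ^ 2 * f3)
  all_goals
    intro x
    simp [A, hL, gaussMap_apply, linFlowL_apply, linFlow, inner_add_left, inner_add_right,
      inner_smul_left, inner_smul_right]
    try ring

/-- A linear change of variables on `ℝ^N × ℝ^N`. -/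
theorem map_lowerTriangular_volume {N : ℕ} {r d : ℝ} (hr : 0 < r) (hd : 0 < d) (q : ℝ) :
    (volume : Measure (Vel N × Vel N)).map (fun z => (r • z.1, q • z.1 + d • z.2)) =
      ENNReal.ofReal (((r * d) ^ N)⁻¹) • volume := by
  have hshear : MeasurePreserving (fun z : Vel N × Vel N => (z.1, z.2 + (q / r) • z.1))
      (volume.prod volume) (volume.prod volume) := by
    refine MeasurePreserving.skew_product (f := id) (g := fun (x : Vel N) (y : Vel N) =>
      y + (q / r) • x) (MeasurePreserving.id _) (by fun_prop) ?_
    exact Eventually.of_forall fun v =>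
      (measurePreserving_add_right (volume : Measure (Vel N)) _).map_eq
  have hscale : (volume : Measure (Vel N × Vel N)).map
      (Prod.map (fun v => r • v) (fun v => d • v)) =
      ENNReal.ofReal (((r * d) ^ N)⁻¹) • volume := by
    rw [Measure.volume_eq_prod, ← Measure.map_prod_map _ _ (by fun_prop) (by fun_prop),
      Measure.map_addHaar_smul _ hr.ne', Measure.map_addHaar_smul _ hd.ne',
      Measure.prod_smul_right, Measure.prod_smul_left, smul_smul, ← ENNReal.ofReal_mul (abs_nonneg _),
      ← abs_mul, ← mul_inv, ← mul_pow, finrank_euclideanSpace_fin, abs_of_nonneg (by positivity),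
      mul_comm d r]
  have hcomp : (fun z : Vel N × Vel N => (r • z.1, q • z.1 + d • z.2)) =
      (fun z : Vel N × Vel N => (z.1, z.2 + (q / r) • z.1)) ∘
        Prod.map (fun v => r • v) (fun v => d • v) := by
    ext1 z
    simp only [Function.comp_apply, Prod.map_fst, Prod.map_snd, smul_smul]
    rw [div_mul_cancel₀ _ hr.ne', add_comm]
  rw [hcomp, ← Measure.map_map hshear.measurable (by fun_prop), hscale, Measure.map_smul]
  rw [Measure.volume_eq_prod, hshear.map_eq]

/-- The law of the fluctuation has the density `gaussDensity`. -/
theorem map_gaussMap_eq_withDensity {N : ℕ} {t : ℝ} (ht : 0 < t) :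
    (gaussLaw N).map (gaussMap t) =
      volume.withDensity fun a => ENNReal.ofReal (gaussDensity t a.1 a.2) := by
  have hX := covXX_pos ht
  have hD := covDet_pos ht
  have hsD := Real.sqrt_pos.2 hD
  have hmeas : Measurable fun a : Vel N × Vel N => ENNReal.ofReal (gaussDensity t a.1 a.2) := by
    unfold gaussDensity; fun_prop
  -- Composed with the square root of the covariance, the quadratic form in `gaussDensity` becomes
  -- `covDet t` times |z|², so the two densities differ by the Jacobian only.
  have hrho : ∀ z : Vel N × Vel N, gaussRho z =
      √(covDet t) ^ N * gaussDensity t (gaussMap t z).1 (gaussMap t z).2 := by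
    intro z
    have h1 : covVV t * ‖(gaussMap t z).1‖ ^ 2 -
        2 * covXV t * inner ℝ (gaussMap t z).1 (gaussMap t z).2 +
        covXX t * ‖(gaussMap t z).2‖ ^ 2 = covDet t * (‖z.1‖ ^ 2 + ‖z.2‖ ^ 2) := by
      have e1 := cholR_sq ht.le
      have e2 := cholR_mul_cholQ ht.le
      have e3 := cholQ_sq_add ht.le
      simp only [gaussMap_apply, norm_add_sq_real, norm_smul, inner_smul_left, inner_smul_right,
        inner_add_right, mul_pow, Real.norm_eq_abs, sq_abs, conj_trivial,
        real_inner_self_eq_norm_sq]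
      rw [covDet, ← e1, ← e2, ← e3]
      ring
    rw [gaussDensity, gaussRho, h1, ← mul_assoc, mul_inv, mul_left_comm, mul_inv_cancel₀
      (by positivity), mul_one]
    congr 2
    field_simp
  refine Measure.ext fun S hS => ?_
  rw [Measure.map_apply (gaussMap t).continuous.measurable hS, gaussLaw_eq,
    withDensity_apply _ ((gaussMap t).continuous.measurable hS), withDensity_apply _ hS,
    ← lintegral_indicator ((gaussMap t).continuous.measurable hS), ← lintegral_indicator hS]
  set F : Vel N × Vel N → ℝ≥0∞ :=
    S.indicator fun a => ENNReal.ofReal (gaussDensity t a.1 a.2) with hF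
  have hFm : Measurable F := hmeas.indicator hS
  have h2 : ∀ z, ((gaussMap t) ⁻¹' S).indicator (fun z => ENNReal.ofReal (gaussRho z)) z =
      ENNReal.ofReal (√(covDet t) ^ N) * F (gaussMap t z) := by
    intro z
    by_cases h : gaussMap t z ∈ S
    · rw [indicator_of_mem (show z ∈ (gaussMap t) ⁻¹' S from h), hF, indicator_of_mem h, hrho,
        ENNReal.ofReal_mul (by positivity)]
    · rw [indicator_of_notMem (show z ∉ (gaussMap t) ⁻¹' S from h), hF, indicator_of_notMem h,
        mul_zero]
  have h3 : (volume : Measure (Vel N × Vel N)).map (gaussMap t) =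
      ENNReal.ofReal ((√(covDet t) ^ N)⁻¹) • volume := by
    rw [← cholR_mul_cholD ht]
    exact map_lowerTriangular_volume (cholR_pos ht) (cholD_pos ht) (cholQ t)
  simp_rw [h2]
  rw [lintegral_const_mul (f := fun z => F (gaussMap t z)) _
      (hFm.comp (gaussMap t).continuous.measurable),
    ← lintegral_map hFm (gaussMap t).continuous.measurable, h3, lintegral_smul_measure,
    smul_eq_mul, ← mul_assoc, ← ENNReal.ofReal_mul (by positivity),
    mul_inv_cancel₀ (by positivity), ENNReal.ofReal_one, one_mul]

/-! ### The shift formula -/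

variable {N : ℕ} {X : Type*} [NormedAddCommGroup X] [NormedSpace ℝ X]

theorem integrable_inner_gaussLaw (c : Vel N × Vel N) :
    Integrable (fun z : Vel N × Vel N => inner ℝ c.1 z.1 + inner ℝ c.2 z.2) (gaussLaw N) := by
  refine Integrable.mono' (((integrable_norm_pow_gaussLaw N 1)).const_mul (‖c.1‖ + ‖c.2‖))
    (Continuous.aestronglyMeasurable (by fun_prop)) (Eventually.of_forall fun z => ?_)
  rw [pow_one]
  calc _ ≤ ‖c.1‖ * ‖z.1‖ + ‖c.2‖ * ‖z.2‖ :=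
        (norm_add_le _ _).trans (add_le_add (norm_inner_le_norm _ _) (norm_inner_le_norm _ _))
    _ ≤ ‖c.1‖ * ‖z‖ + ‖c.2‖ * ‖z‖ := by
        gcongr
        · exact norm_fst_le z
        · exact norm_snd_le z
    _ = _ := by ring

theorem integral_gaussLaw (F : Vel N × Vel N → X) :
    ∫ z, F z ∂(gaussLaw N) = ∫ z, gaussRho z • F z := by
  rw [gaussLaw_eq, integral_withDensity_eq_integral_toReal_smul
    (continuous_gaussRho.measurable.ennreal_ofReal)
    (Eventually.of_forall fun _ => ENNReal.ofReal_lt_top)]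
  simp_rw [ENNReal.toReal_ofReal (gaussRho_pos _).le]

theorem integrable_gaussLaw_iff {F : Vel N × Vel N → X} :
    Integrable F (gaussLaw N) ↔ Integrable fun z => gaussRho z • F z := by
  rw [gaussLaw_eq, integrable_withDensity_iff_integrable_smul'
    (continuous_gaussRho.measurable.ennreal_ofReal)
    (Eventually.of_forall fun _ => ENNReal.ofReal_lt_top)]
  simp_rw [ENNReal.toReal_ofReal (gaussRho_pos _).le]

/-- Gaussian integration by parts, in integrated form. -/
theorem integral_shift_sub [CompleteSpace X] {F : Vel N × Vel N → X} (hF : Continuous F) {B : ℝ}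
    (hB : ∀ z, ‖F z‖ ≤ B) (c : Vel N × Vel N) {h : ℝ} (hh : 0 ≤ h) :
    ∫ z, F (z + h • c) ∂(gaussLaw N) - ∫ z, F z ∂(gaussLaw N) =
      ∫ θ in (0 : ℝ)..h, ∫ z, (inner ℝ c.1 z.1 + inner ℝ c.2 z.2) • F (z + θ • c)
        ∂(gaussLaw N) := by
  set s : Vel N × Vel N → ℝ := fun z => inner ℝ c.1 z.1 + inner ℝ c.2 z.2 with hs
  have hsc : Continuous s := by fun_prop
  have hint : ∀ θ : ℝ, Integrable (fun z => F (z + θ • c)) (gaussLaw N) := fun θ =>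
    Integrable.mono' (integrable_const B) (Continuous.aestronglyMeasurable (by fun_prop))
      (Eventually.of_forall fun z => hB _)
  have hderiv : ∀ (z : Vel N × Vel N) (θ : ℝ), HasDerivAt (fun θ : ℝ => gaussRho (z - θ • c))
      (s (z - θ • c) * gaussRho (z - θ • c)) θ := by
    intro z θ
    have h1 : HasDerivAt (fun θ : ℝ => z.1 - θ • c.1) (-((1 : ℝ) • c.1)) θ :=
      ((hasDerivAt_id θ).smul_const c.1).const_sub z.1
    have h2 : HasDerivAt (fun θ : ℝ => z.2 - θ • c.2) (-((1 : ℝ) • c.2)) θ :=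
      ((hasDerivAt_id θ).smul_const c.2).const_sub z.2
    have h3 := (((h1.norm_sq.add h2.norm_sq).neg.div_const 2).exp).const_mul ((2 * Real.pi) ^ N)⁻¹
    convert! h3 using 1
    simp only [gaussRho, hs, Prod.fst_sub, Prod.snd_sub, Prod.smul_fst, Prod.smul_snd, one_smul,
      inner_neg_right, Pi.add_apply, Pi.neg_apply]
    rw [real_inner_comm (z.1 - θ • c.1), real_inner_comm (z.2 - θ • c.2)]
    ring
  have hrs : Integrable fun z => s z * gaussRho z := by
    have := integrable_gaussLaw_iff.1 (integrable_inner_gaussLaw c)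
    simpa [mul_comm] using this
  -- The translation is moved from F to the smooth density and the fundamental theorem of calculus
  -- is applied there, so F need not be differentiable.
  have key : ∀ z, (gaussRho (z - h • c) - gaussRho z) • F z =
      ∫ θ in Ioc 0 h, (s (z - θ • c) * gaussRho (z - θ • c)) • F z := by
    intro z
    rw [integral_smul_const, ← intervalIntegral.integral_of_le hh,
      intervalIntegral.integral_eq_sub_of_hasDerivAt (fun θ _ => hderiv z θ)]
    · simp
    · refine Continuous.intervalIntegrable ?_ _ _
      exact (hsc.comp (by fun_prop)).mul (continuous_gaussRho.comp (by fun_prop))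
  have hcont2 : Continuous fun q : (Vel N × Vel N) × ℝ =>
      (s (q.1 - q.2 • c) * gaussRho (q.1 - q.2 • c)) • F q.1 :=
    Continuous.smul ((hsc.comp (by fun_prop)).mul (continuous_gaussRho.comp (by fun_prop)))
      (hF.comp continuous_fst)
  have hprod : Integrable (fun q : (Vel N × Vel N) × ℝ =>
      (s (q.1 - q.2 • c) * gaussRho (q.1 - q.2 • c)) • F q.1)
      (volume.prod (volume.restrict (Ioc 0 h))) := by
    rw [integrable_prod_iff' hcont2.aestronglyMeasurable]
    constructor
    · refine Eventually.of_forall fun θ => ?_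
      refine Integrable.mono' (((hrs.comp_sub_right (θ • c)).norm).mul_const B)
        (Continuous.aestronglyMeasurable (hcont2.comp (by fun_prop)))
        (Eventually.of_forall fun z => ?_)
      rw [norm_smul]
      gcongr
      exact hB z
    · refine Integrable.mono' (integrable_const ((∫ z, ‖s z * gaussRho z‖) * B))
        (hcont2.norm.aestronglyMeasurable.prod_swap.integral_prod_right')
        (Eventually.of_forall fun θ => ?_)
      rw [Real.norm_of_nonneg (integral_nonneg fun _ => norm_nonneg _)]
      calc _ ≤ ∫ z, ‖s (z - θ • c) * gaussRho (z - θ • c)‖ * B := by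
            refine integral_mono_of_nonneg (Eventually.of_forall fun _ => norm_nonneg _)
              (((hrs.comp_sub_right (θ • c)).norm).mul_const B)
              (Eventually.of_forall fun z => ?_)
            simp only [norm_smul]
            gcongr
            exact hB z
        _ = _ := by
            rw [integral_mul_const, integral_sub_right_eq_self (fun z => ‖s z * gaussRho z‖)]
  have e1 : ∀ θ : ℝ, ∫ z, F (z + θ • c) ∂(gaussLaw N) = ∫ z, gaussRho (z - θ • c) • F z := by
    intro θ
    rw [integral_gaussLaw, ← integral_sub_right_eq_self _ (θ • c)]
    simp
  have i1 : ∀ θ : ℝ, Integrable fun z => gaussRho (z - θ • c) • F z := by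
    intro θ
    have := (integrable_gaussLaw_iff.1 (hint θ)).comp_sub_right (θ • c)
    simpa using this
  have e2 := e1 0
  simp only [zero_smul, add_zero, sub_zero] at e2
  have i2 := i1 0
  simp only [zero_smul, sub_zero] at i2
  rw [e1, e2, ← integral_sub (i1 h) i2]
  simp_rw [← sub_smul, key]
  rw [integral_integral_swap hprod, intervalIntegral.integral_of_le hh]
  refine integral_congr_ae (Eventually.of_forall fun θ => ?_)
  simp only
  symm
  rw [integral_gaussLaw, ← integral_sub_right_eq_self _ (θ • c)]
  refine integral_congr_ae (Eventually.of_forall fun z => ?_)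
  simp only [sub_add_cancel, smul_smul]
  rw [mul_comm]

end GaussianLaw

/-! ### Gaussian averages of transport operators -/

/-- The space `L^p(𝕋^N × ℝ^N)`. -/
abbrev State (N : ℕ) (p : ℝ≥0∞) : Type := Lp ℝ p (volume : Measure (Phase N))

section GaussAvg

variable {N : ℕ} {p : ℝ≥0∞} [Fact (1 ≤ p)] [Fact (p ≠ ⊤)]

/-- The affine function `c₀ + c · z`. -/
def affScore (c₀ : ℝ) (c z : Vel N × Vel N) : ℝ := c₀ + (inner ℝ c.1 z.1 + inner ℝ c.2 z.2)

theorem continuous_affScore : Continuous fun q : (ℝ × (Vel N × Vel N)) × (Vel N × Vel N) =>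
    affScore q.1.1 q.1.2 q.2 := by
  unfold affScore; fun_prop

theorem abs_affScore_le (c₀ : ℝ) (c z : Vel N × Vel N) :
    |affScore c₀ c z| ≤ |c₀| + (‖c.1‖ + ‖c.2‖) * ‖z‖ := by
  unfold affScore
  refine (abs_add_le _ _).trans (add_le_add le_rfl ((abs_add_le _ _).trans ?_))
  have h1 : |inner ℝ c.1 z.1| ≤ ‖c.1‖ * ‖z‖ :=
    (abs_real_inner_le_norm _ _).trans (mul_le_mul_of_nonneg_left (norm_fst_le z) (norm_nonneg _))
  have h2 : |inner ℝ c.2 z.2| ≤ ‖c.2‖ * ‖z‖ :=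
    (abs_real_inner_le_norm _ _).trans (mul_le_mul_of_nonneg_left (norm_snd_le z) (norm_nonneg _))
  linarith

/-- The first absolute moment of the standard Gaussian law. -/
def gaussMoment (N : ℕ) : ℝ := ∫ z, ‖z‖ ∂(gaussLaw N)

theorem gaussMoment_nonneg (N : ℕ) : 0 ≤ gaussMoment N := integral_nonneg fun _ => norm_nonneg _

theorem integrable_norm_gaussLaw (N : ℕ) : Integrable (fun z => ‖z‖) (gaussLaw N) := by
  simpa using integrable_norm_pow_gaussLaw N 1

theorem continuous_transport_gaussMap (t : ℝ) (f : State N p) :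
    Continuous fun z : Vel N × Vel N => transport p t (gaussMap t z) f :=
  (continuous_transport Fact.out f).comp (by fun_prop : Continuous fun z : Vel N × Vel N =>
    ((t, gaussMap t z) : ℝ × (Vel N × Vel N)))

theorem norm_transport_apply_le (t : ℝ) (a : Vel N × Vel N) (f : State N p) :
    ‖transport p t a f‖ ≤ Real.exp (N * |t|) * ‖f‖ :=
  (ContinuousLinearMap.le_opNorm _ _).trans
    (mul_le_mul_of_nonneg_right (norm_transport_le t a) (norm_nonneg _))

theorem norm_affScore_smul_transport_le (t c₀ : ℝ) (c z a : Vel N × Vel N) (f : State N p) :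
    ‖affScore c₀ c z • transport p t a f‖ ≤
      (|c₀| + (‖c.1‖ + ‖c.2‖) * ‖z‖) * (Real.exp (N * |t|) * ‖f‖) := by
  rw [norm_smul, Real.norm_eq_abs]
  exact mul_le_mul (abs_affScore_le _ _ _) (norm_transport_apply_le _ _ _) (norm_nonneg _)
    (by positivity)

theorem continuous_affScore_smul_transport (t c₀ : ℝ) (c : Vel N × Vel N) (f : State N p) :
    Continuous fun z : Vel N × Vel N => affScore c₀ c z • transport p t (gaussMap t z) f :=
  (continuous_affScore.comp (by fun_prop : Continuous fun z : Vel N × Vel N => ((c₀, c), z))).smul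
    (continuous_transport_gaussMap t f)

theorem integrable_affScore_bound (a b c : ℝ) :
    Integrable (fun z => (a + b * ‖z‖) * c) (gaussLaw N) :=
  ((integrable_const a).add ((integrable_norm_gaussLaw N).const_mul b)).mul_const c

theorem integrable_gaussAvg (t c₀ : ℝ) (c : Vel N × Vel N) (f : State N p) :
    Integrable (fun z => affScore c₀ c z • transport p t (gaussMap t z) f) (gaussLaw N) :=
  (integrable_affScore_bound _ _ _).mono'
    (continuous_affScore_smul_transport t c₀ c f).aestronglyMeasurable
    (Eventually.of_forall fun z => norm_affScore_smul_transport_le t c₀ c z _ f)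

/-- The operator `f ↦ 𝔼[(c₀ + c · Z) f(flow (-t) (· - gaussMap t Z))] e^{Nt}`. -/
def gaussAvg (p : ℝ≥0∞) [Fact (1 ≤ p)] [Fact (p ≠ ⊤)] (t c₀ : ℝ) (c : Vel N × Vel N) :
    State N p →L[ℝ] State N p :=
  LinearMap.mkContinuous
    { toFun := fun f => ∫ z, affScore c₀ c z • transport p t (gaussMap t z) f ∂(gaussLaw N)
      map_add' := fun f g => by
        rw [← integral_add (integrable_gaussAvg t c₀ c f) (integrable_gaussAvg t c₀ c g)]
        simp only [map_add, smul_add]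
      map_smul' := fun r f => by
        rw [RingHom.id_apply, ← integral_smul]
        simp only [map_smul, smul_comm r] }
    (Real.exp (N * |t|) * (|c₀| + (‖c.1‖ + ‖c.2‖) * gaussMoment N)) fun f => by
      refine (norm_integral_le_of_norm_le (integrable_affScore_bound _ _ _)
        (Eventually.of_forall fun z => norm_affScore_smul_transport_le t c₀ c z _ f)).trans
        (le_of_eq ?_)
      rw [integral_mul_const, integral_add (integrable_const _)
        ((integrable_norm_gaussLaw N).const_mul _), integral_const_mul, integral_const,
        probReal_univ, one_smul, gaussMoment]
      ring

theorem gaussAvg_apply (t c₀ : ℝ) (c : Vel N × Vel N) (f : State N p) :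
    gaussAvg p t c₀ c f =
      ∫ z, affScore c₀ c z • transport p t (gaussMap t z) f ∂(gaussLaw N) := rfl

theorem norm_gaussAvg_le (t c₀ : ℝ) (c : Vel N × Vel N) :
    ‖gaussAvg p t c₀ c‖ ≤ Real.exp (N * |t|) * (|c₀| + (‖c.1‖ + ‖c.2‖) * gaussMoment N) :=
  LinearMap.mkContinuous_norm_le _ (by have := gaussMoment_nonneg N; positivity) _

theorem continuousOn_gaussAvg {S : Set ℝ} (hS : S ⊆ Ici 0) {c₀ : ℝ → ℝ} {c : ℝ → Vel N × Vel N}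
    (hc₀ : ContinuousOn c₀ S) (hc : ContinuousOn c S) (f : State N p) :
    ContinuousOn (fun t => gaussAvg p t (c₀ t) (c t) f) S := by
  intro t₀ ht₀
  have hev : ∀ᶠ t in 𝓝[S] t₀, |t| < |t₀| + 1 ∧ |c₀ t| < |c₀ t₀| + 1 ∧
      ‖(c t).1‖ + ‖(c t).2‖ < ‖(c t₀).1‖ + ‖(c t₀).2‖ + 1 := by
    have hc' : ContinuousWithinAt (fun t => ‖(c t).1‖ + ‖(c t).2‖) S t₀ :=
      ((hc t₀ ht₀).fst.norm.add (hc t₀ ht₀).snd.norm)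
    exact ((continuous_abs.continuousWithinAt (x := t₀)).eventually
      (gt_mem_nhds (lt_add_one _))).and (((hc₀ t₀ ht₀).abs.eventually
      (gt_mem_nhds (lt_add_one _))).and (hc'.eventually (gt_mem_nhds (lt_add_one _))))
  simp only [gaussAvg_apply]
  refine continuousWithinAt_of_dominated (bound := fun z => ((|c₀ t₀| + 1) +
    (‖(c t₀).1‖ + ‖(c t₀).2‖ + 1) * ‖z‖) * (Real.exp (N * (|t₀| + 1)) * ‖f‖)) ?_ ?_
    (integrable_affScore_bound _ _ _) ?_
  · exact Eventually.of_forall fun t =>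
      (continuous_affScore_smul_transport t _ _ f).aestronglyMeasurable
  · filter_upwards [hev] with t ht
    refine Eventually.of_forall fun z => (norm_affScore_smul_transport_le _ _ _ _ _ _).trans ?_
    have h1 := ht.2.1.le
    have h2 := ht.2.2.le
    have h3 := ht.1.le
    refine mul_le_mul (add_le_add h1 (mul_le_mul_of_nonneg_right h2 (norm_nonneg _))) ?_
      (by positivity) (by positivity)
    gcongr
  · refine Eventually.of_forall fun z => ?_
    have h1 : ContinuousOn (fun t => gaussMap t z) S :=
      continuousOn_gaussMap.comp (f := fun t : ℝ => ((t, z) : ℝ × (Vel N × Vel N)))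
        (Continuous.continuousOn (by fun_prop)) fun t ht => ⟨hS ht, mem_univ _⟩
    have h2 : ContinuousOn (fun t => transport p t (gaussMap t z) f) S :=
      (continuous_transport Fact.out f).comp_continuousOn (continuousOn_id.prodMk h1)
    have h3 : ContinuousOn (fun t => affScore (c₀ t) (c t) z) S :=
      continuous_affScore.comp_continuousOn (g := fun q : (ℝ × (Vel N × Vel N)) × (Vel N × Vel N) =>
        affScore q.1.1 q.1.2 q.2) (f := fun t => ((c₀ t, c t), z)) ((hc₀.prodMk hc).prodMk continuousOn_const)
    exact (h3.smul h2) t₀ ht₀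

/-- Displacements add, so a translation of the datum commutes past the Gaussian displacement and is
only transformed by the flow. The propagation of regularity rests on this covariance. -/
theorem gaussAvg_transport (t c₀ : ℝ) (c b : Vel N × Vel N) (f : State N p) :
    gaussAvg p t c₀ c (transport p 0 b f) = transport p 0 (linFlow t b) (gaussAvg p t c₀ c f) := by
  rw [gaussAvg_apply, gaussAvg_apply, ← ContinuousLinearMap.integral_comp_comm _
    (integrable_gaussAvg t c₀ c f)]
  refine integral_congr_ae (Eventually.of_forall fun z => ?_)
  simp only [map_smul, transport_transport, linFlow_zero]
  rw [add_comm (gaussMap t z), add_zero, zero_add]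

/-! ### The kinetic semigroup and its velocity gradient -/

/-- The operator `K_t` on `L^p`. -/
def kineticOp (p : ℝ≥0∞) [Fact (1 ≤ p)] [Fact (p ≠ ⊤)] (t : ℝ) : State N p →L[ℝ] State N p :=
  gaussAvg p t 1 0

theorem kineticOp_apply (t : ℝ) (f : State N p) :
    kineticOp p t f = ∫ z, transport p t (gaussMap t z) f ∂(gaussLaw N) := by
  simp [kineticOp, gaussAvg_apply, affScore]

theorem integrable_kineticOp (t : ℝ) (f : State N p) :
    Integrable (fun z => transport p t (gaussMap t z) f) (gaussLaw N) := by
  simpa [affScore] using integrable_gaussAvg t 1 0 f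

theorem norm_kineticOp_le (t : ℝ) : ‖kineticOp (N := N) p t‖ ≤ Real.exp (N * |t|) := by
  simpa [kineticOp] using norm_gaussAvg_le (p := p) t 1 (0 : Vel N × Vel N)

theorem continuousOn_kineticOp (f : State N p) :
    ContinuousOn (fun t => kineticOp p t f) (Ici 0) :=
  continuousOn_gaussAvg subset_rfl continuousOn_const continuousOn_const f

theorem kineticOp_zero (f : State N p) : kineticOp p 0 f = f := by
  simp [kineticOp_apply, gaussMap_zero, transport_zero]

/-- The compatibility of order and scalars that makes Bochner integrals of nonnegative elements of
L^p nonnegative. -/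
instance {α : Type*} [MeasurableSpace α] {ν : Measure α} : IsOrderedModule ℝ (Lp ℝ p ν) where
  smul_le_smul_of_nonneg_left c hc f g hfg := by
    rw [← Lp.coeFn_le] at hfg ⊢
    filter_upwards [hfg, Lp.coeFn_smul c f, Lp.coeFn_smul c g] with z h1 h2 h3
    rw [h2, h3, Pi.smul_apply, Pi.smul_apply]
    exact mul_le_mul_of_nonneg_left h1 hc
  smul_le_smul_of_nonneg_right f hf c d hcd := by
    rw [← Lp.coeFn_nonneg] at hf
    rw [← Lp.coeFn_le]
    filter_upwards [hf, Lp.coeFn_smul c f, Lp.coeFn_smul d f] with z h1 h2 h3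
    rw [h2, h3, Pi.smul_apply, Pi.smul_apply]
    exact mul_le_mul_of_nonneg_right hcd h1

theorem kineticOp_nonneg (t : ℝ) {f : State N p} (hf : 0 ≤ f) : 0 ≤ kineticOp p t f := by
  rw [kineticOp_apply]
  exact integral_nonneg fun z => transport_nonneg _ _ hf

/-- A composition of transports has the displacement a + `linFlow t` b; by `map_gaussMap_add` its
law, for independent fluctuations, is that of the fluctuation at time t + s. -/
theorem kineticOp_kineticOp {t s : ℝ} (ht : 0 ≤ t) (hs : 0 ≤ s) (f : State N p) :
    kineticOp p t (kineticOp p s f) = kineticOp p (t + s) f := by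
  have hc : Continuous fun a : Vel N × Vel N => transport p (t + s) a f :=
    (continuous_transport Fact.out f).comp (by fun_prop : Continuous fun a : Vel N × Vel N =>
      ((t + s, a) : ℝ × (Vel N × Vel N)))
  have hm : Continuous fun q : (Vel N × Vel N) × (Vel N × Vel N) =>
      gaussMap t q.1 + linFlow t (gaussMap s q.2) := by
    simp only [← linFlowL_apply]; fun_prop
  have h1 : ∫ q, transport p (t + s) (gaussMap t q.1 + linFlow t (gaussMap s q.2)) f
      ∂((gaussLaw N).prod (gaussLaw N)) = kineticOp p (t + s) f := by
    rw [← integral_map (φ := fun q : (Vel N × Vel N) × (Vel N × Vel N) =>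
      gaussMap t q.1 + linFlow t (gaussMap s q.2)) (f := fun a => transport p (t + s) a f)
      hm.measurable.aemeasurable hc.aestronglyMeasurable, map_gaussMap_add ht hs,
      integral_map (by fun_prop) hc.aestronglyMeasurable, kineticOp_apply]
  have hint : Integrable (fun q : (Vel N × Vel N) × (Vel N × Vel N) =>
      transport p (t + s) (gaussMap t q.1 + linFlow t (gaussMap s q.2)) f)
      ((gaussLaw N).prod (gaussLaw N)) :=
    Integrable.of_bound (hc.comp hm).aestronglyMeasurable (Real.exp (N * |t + s|) * ‖f‖)
      (Eventually.of_forall fun q => norm_transport_apply_le _ _ _)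
  rw [← h1, integral_prod _ hint, kineticOp_apply]
  refine integral_congr_ae (Eventually.of_forall fun z => ?_)
  change transport p t (gaussMap t z) (kineticOp p s f) = _
  rw [kineticOp_apply, ← ContinuousLinearMap.integral_comp_comm _ (integrable_kineticOp s f)]
  simp only [transport_transport]

theorem kineticOp_transport (t : ℝ) (b : Vel N × Vel N) (f : State N p) :
    kineticOp p t (transport p 0 b f) = transport p 0 (linFlow t b) (kineticOp p t f) :=
  gaussAvg_transport t 1 0 b f

/-- The score of the Gaussian fluctuation in the velocity direction `e`. -/
def scoreDir (t : ℝ) (e : Vel N) : Vel N × Vel N := (scoreA t • e, scoreB t • e)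

/-- Shifting the Gaussian variable along `scoreDir t e` moves the endpoint exactly as shifting the
initial velocity along e does. This lets integration by parts replace the derivative in the initial
velocity. -/
theorem gaussMap_scoreDir {t : ℝ} (ht : 0 < t) (e : Vel N) :
    gaussMap t (scoreDir t e) = linFlow t (0, e) := by
  simp only [gaussMap_apply, scoreDir, linFlow, smul_smul, ← add_smul, cholR_mul_scoreA ht,
    cholQ_mul_scoreA_add ht, zero_add]

/-- The derivative of `K_t` with respect to the initial velocity. -/
def dirKineticOp (p : ℝ≥0∞) [Fact (1 ≤ p)] [Fact (p ≠ ⊤)] (t : ℝ) (e : Vel N) :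
    State N p →L[ℝ] State N p :=
  gaussAvg p t 0 (scoreDir t e)

theorem norm_dirKineticOp_le (t : ℝ) (e : Vel N) : ‖dirKineticOp p t e‖ ≤
    Real.exp (N * |t|) * ((|scoreA t| + |scoreB t|) * ‖e‖ * gaussMoment N) := by
  refine (norm_gaussAvg_le (p := p) t 0 (scoreDir t e)).trans (le_of_eq ?_)
  simp only [scoreDir, norm_smul, Real.norm_eq_abs, abs_zero, zero_add]
  ring

theorem continuousOn_dirKineticOp (e : Vel N) (f : State N p) :
    ContinuousOn (fun t => dirKineticOp p t e f) (Ioi 0) :=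
  continuousOn_gaussAvg Ioi_subset_Ici_self continuousOn_const
    ((continuousOn_scoreA.smul continuousOn_const).prodMk
      (continuousOn_scoreB.smul continuousOn_const)) f

/-- The fundamental theorem of calculus for velocity translations, with no regularity of f. It shows
that `dirKineticOp` is the derivative of K_t in the initial velocity and makes difference quotients
available for the proof of positivity. -/
theorem kineticOp_shift_sub {t : ℝ} (ht : 0 < t) (e : Vel N) (f : State N p) {h : ℝ} (hh : 0 ≤ h) :
    kineticOp p t (transport p 0 (h • ((0, e) : Vel N × Vel N)) f) - kineticOp p t f =
      ∫ θ in (0 : ℝ)..h,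
        dirKineticOp p t e (transport p 0 (θ • ((0, e) : Vel N × Vel N)) f) := by
  have key : ∀ (θ : ℝ) (z : Vel N × Vel N),
      transport p t (gaussMap t z) (transport p 0 (θ • ((0, e) : Vel N × Vel N)) f) =
        transport p t (gaussMap t (z + θ • scoreDir t e)) f := fun θ z => by
    rw [transport_transport, add_zero, map_add, map_smul, gaussMap_scoreDir ht, linFlow_smul]
  have := integral_shift_sub (continuous_transport_gaussMap t f)
    (fun z => norm_transport_apply_le t (gaussMap t z) f) (scoreDir t e) hh
  rw [kineticOp_apply, kineticOp_apply]
  simp only [key, this, dirKineticOp, gaussAvg_apply, affScore, zero_add]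

/-- The operator `∇_w K_t [·]` on `L^p`. -/
def gradOp (p : ℝ≥0∞) [Fact (1 ≤ p)] [Fact (p ≠ ⊤)] (t : ℝ) :
    (Fin N → State N p) →L[ℝ] State N p :=
  ∑ i, (dirKineticOp p t (torusDir i)).comp (ContinuousLinearMap.proj i)

theorem gradOp_apply (t : ℝ) (g : Fin N → State N p) :
    gradOp p t g = ∑ i, dirKineticOp p t (torusDir i) (g i) := by
  simp [gradOp]

theorem gradOp_transport (t : ℝ) (b : Vel N × Vel N) (g : Fin N → State N p) :
    gradOp p t (fun i => transport p 0 b (g i)) = transport p 0 (linFlow t b) (gradOp p t g) := by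
  simp only [gradOp_apply, map_sum, dirKineticOp, gaussAvg_transport]

theorem norm_torusDir (i : Fin N) : ‖(torusDir i : Vel N)‖ = 1 := by simp [torusDir]

/-- The constant of the estimate of `gradOp`. -/
def gradConst (N : ℕ) (T : ℝ) : ℝ :=
  N * (Real.exp (N * T) * (2 * √(2 * Real.exp T) * gaussMoment N))

theorem gradConst_nonneg (N : ℕ) (T : ℝ) : 0 ≤ gradConst N T := by
  have := gaussMoment_nonneg N
  unfold gradConst; positivity

theorem norm_gradOp_le {t T : ℝ} (ht : t ∈ Ioc 0 T) :
    ‖gradOp (N := N) p t‖ ≤ gradConst N T * t ^ (-(1 / 2) : ℝ) := by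
  have hm := gaussMoment_nonneg N
  refine ContinuousLinearMap.opNorm_le_bound _
    (mul_nonneg (gradConst_nonneg N T) (Real.rpow_nonneg ht.1.le _)) fun g => ?_
  rw [gradOp_apply]
  refine (norm_sum_le _ _).trans ?_
  have : ∀ i ∈ (Finset.univ : Finset (Fin N)), ‖dirKineticOp p t (torusDir i) (g i)‖ ≤
      Real.exp (N * T) * (2 * √(2 * Real.exp T) * t ^ (-(1 / 2) : ℝ) * gaussMoment N) * ‖g‖ := by
    intro i _
    refine (ContinuousLinearMap.le_opNorm _ _).trans (mul_le_mul ?_ (norm_le_pi_norm g i)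
      (norm_nonneg _) ?_)
    · refine (norm_dirKineticOp_le t _).trans ?_
      rw [norm_torusDir, mul_one, abs_of_pos ht.1]
      gcongr
      · exact ht.2
      · exact score_le ht
    · have := Real.rpow_nonneg ht.1.le (-(1 / 2) : ℝ)
      positivity
  refine (Finset.sum_le_sum this).trans (le_of_eq ?_)
  rw [Finset.sum_const, Finset.card_univ, Fintype.card_fin, nsmul_eq_mul, gradConst]
  ring

theorem continuousOn_exp_bound (N : ℕ) :
    Continuous fun t : ℝ => Real.exp (N * |t|) := by fun_prop

theorem singularKernel_gradOp (T : ℝ) :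
    SingularKernel T (gradConst N T) (gradOp (N := N) p) where
  cont := by
    let B : ℝ → ℝ := fun t =>
      N * (Real.exp (N * |t|) * ((|scoreA t| + |scoreB t|) * gaussMoment N))
    refine continuousOn_uncurry_of_strong (B := B) ?_ (fun t ht => ?_) fun g => ?_
    · exact continuousOn_const.mul ((continuousOn_exp_bound N).continuousOn.mul
        ((continuousOn_scoreA.abs.add continuousOn_scoreB.abs).mul continuousOn_const))
    · have hm := gaussMoment_nonneg N
      refine ContinuousLinearMap.opNorm_le_bound _ (by positivity) fun g => ?_
      rw [gradOp_apply]
      refine (norm_sum_le _ _).trans ((Finset.sum_le_sum fun i _ =>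
        (ContinuousLinearMap.le_opNorm _ _).trans (mul_le_mul (norm_dirKineticOp_le t _)
        (norm_le_pi_norm g i) (norm_nonneg _) (by positivity))).trans (le_of_eq ?_))
      simp only [norm_torusDir, Finset.sum_const, Finset.card_univ, Fintype.card_fin, nsmul_eq_mul,
        B]
      ring
    · simp only [gradOp_apply]
      exact continuousOn_finsetSum _ fun i _ => continuousOn_dirKineticOp _ _
  bound := fun t ht => norm_gradOp_le ht

/-- K_t is bounded and 1 ≤ √T t^{-1/2} on (0, T], so it fits the singular format and the Volterra
lemmas can be reused for K_t itself. -/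
theorem singularKernel_kineticOp (T : ℝ) :
    SingularKernel T (Real.exp (N * T) * √T) (kineticOp (N := N) p) where
  cont := (continuousOn_uncurry_of_strong (B := fun t => Real.exp (N * |t|)) (S := Ici 0)
    (continuousOn_exp_bound N).continuousOn (fun t _ => norm_kineticOp_le t)
    continuousOn_kineticOp).mono (prod_mono_left Ioi_subset_Ici_self)
  bound := fun t ht => by
    refine (norm_kineticOp_le t).trans ?_
    rw [abs_of_pos ht.1]
    have h1 : 1 ≤ √T * t ^ (-(1 / 2) : ℝ) := by
      rw [Real.rpow_neg ht.1.le, ← Real.sqrt_eq_rpow, ← div_eq_mul_inv,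
        one_le_div (Real.sqrt_pos.2 ht.1)]
      exact Real.sqrt_le_sqrt ht.2
    calc Real.exp (N * t) ≤ Real.exp (N * T) * 1 := by
          rw [mul_one]; gcongr; exact ht.2
      _ ≤ Real.exp (N * T) * (√T * t ^ (-(1 / 2) : ℝ)) := by gcongr
      _ = _ := by ring

/-- The score has mean zero. -/
theorem integral_affScore_zero (c : Vel N × Vel N) : ∫ z, affScore 0 c z ∂(gaussLaw N) = 0 := by
  have h : ((gaussLaw N).map fun z => -z) = gaussLaw N := by
    have : (volume : Measure (Vel N × Vel N)).Regular :=
      Measure.Regular.of_sigmaCompactSpace_of_isLocallyFiniteMeasure _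
    have hv : Measure.map (fun z : Vel N × Vel N => -z) volume = volume :=
      (Measure.measurePreserving_neg (volume : Measure (Vel N × Vel N))).map_eq
    have h0 : (fun z : Vel N × Vel N => ENNReal.ofReal (gaussRho z)) =
        (fun z => ENNReal.ofReal (gaussRho z)) ∘ fun z => -z := by
      ext1 z; simp [gaussRho]
    ext s hs
    rw [Measure.map_apply measurable_neg hs, gaussLaw_eq,
      withDensity_apply _ (measurable_neg hs), withDensity_apply _ hs]
    conv_rhs => rw [← hv]
    rw [setLIntegral_map hs continuous_gaussRho.measurable.ennreal_ofReal measurable_neg]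
    simp [gaussRho]
  have h2 : ∫ z, affScore 0 c z ∂(gaussLaw N) = ∫ z, affScore 0 c (-z) ∂(gaussLaw N) := by
    conv_lhs => rw [← h]
    rw [integral_map measurable_neg.aemeasurable]
    exact (continuous_affScore.comp (by fun_prop : Continuous fun z : Vel N × Vel N =>
      (((0 : ℝ), c), z))).aestronglyMeasurable
  have h3 : ∀ z, affScore 0 c (-z) = -affScore 0 c z := fun z => by
    simp [affScore]; ring
  simp only [h3, integral_neg] at h2
  linarith

end GaussAvg

/-! ### Multiplication by functions of the position -/

section Mul

variable {N : ℕ} {p : ℝ≥0∞} [Fact (1 ≤ p)]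

theorem aestronglyMeasurable_comp_fst (e : C(Torus N, ℝ)) :
    AEStronglyMeasurable (fun z : Phase N => e z.1) volume :=
  (e.continuous.comp continuous_fst).aestronglyMeasurable

theorem memLp_mul_continuous (e : C(Torus N, ℝ)) (f : State N p) :
    MemLp (fun z : Phase N => e z.1 * f z) p volume :=
  (Lp.memLp f).of_le_mul (c := ‖e‖) ((aestronglyMeasurable_comp_fst e).mul (Lp.aestronglyMeasurable f))
    (Eventually.of_forall fun z => by
      rw [norm_mul]; exact mul_le_mul_of_nonneg_right (e.norm_coe_le_norm _) (norm_nonneg _))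

/-- Multiplication by a continuous function of the position. -/
def mulOp (p : ℝ≥0∞) [Fact (1 ≤ p)] : C(Torus N, ℝ) →L[ℝ] State N p →L[ℝ] State N p :=
  LinearMap.mkContinuous₂
    (LinearMap.mk₂ ℝ (fun e f => (memLp_mul_continuous e f).toLp)
      (fun e e' f => by
        rw [← MemLp.toLp_add]
        refine MemLp.toLp_congr _ _ (Eventually.of_forall fun z => ?_)
        change (e z.1 + e' z.1) * f z = e z.1 * f z + e' z.1 * f z
        ring)
      (fun c e f => by
        rw [← MemLp.toLp_const_smul]
        refine MemLp.toLp_congr _ _ (Eventually.of_forall fun z => ?_)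
        change (c * e z.1) * f z = c * (e z.1 * f z)
        ring)
      (fun e f g => by
        rw [← MemLp.toLp_add]
        refine MemLp.toLp_congr _ _ ?_
        filter_upwards [Lp.coeFn_add f g] with z hz
        change e z.1 * (f + g) z = e z.1 * f z + e z.1 * g z
        rw [hz, Pi.add_apply, mul_add])
      (fun c e f => by
        rw [← MemLp.toLp_const_smul]
        refine MemLp.toLp_congr _ _ ?_
        filter_upwards [Lp.coeFn_smul c f] with z hz
        change e z.1 * (c • f) z = c * (e z.1 * f z)
        rw [hz, Pi.smul_apply, smul_eq_mul]; ring))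
    1 fun e f => by
      rw [one_mul]
      refine Lp.norm_le_mul_norm_of_ae_le_mul ?_
      filter_upwards [(memLp_mul_continuous e f).coeFn_toLp] with z hz
      change ‖((memLp_mul_continuous e f).toLp) z‖ ≤ _
      rw [hz, norm_mul]
      exact mul_le_mul_of_nonneg_right (e.norm_coe_le_norm _) (norm_nonneg _)

theorem coeFn_mulOp (e : C(Torus N, ℝ)) (f : State N p) :
    mulOp p e f =ᵐ[volume] fun z => e z.1 * f z :=
  (memLp_mul_continuous e f).coeFn_toLp

theorem norm_mulOp_apply_le (e : C(Torus N, ℝ)) (f : State N p) : ‖mulOp p e f‖ ≤ ‖e‖ * ‖f‖ := by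
  refine Lp.norm_le_mul_norm_of_ae_le_mul ?_
  filter_upwards [coeFn_mulOp e f] with z hz
  rw [hz, norm_mul]
  exact mul_le_mul_of_nonneg_right (e.norm_coe_le_norm _) (norm_nonneg _)

theorem mulOp_nonneg {e : C(Torus N, ℝ)} (he : 0 ≤ e) {f : State N p} (hf : 0 ≤ f) :
    0 ≤ mulOp p e f := by
  rw [← Lp.coeFn_nonneg] at hf ⊢
  filter_upwards [coeFn_mulOp e f, hf] with z h1 h2
  rw [h1]
  exact mul_nonneg (he z.1) h2

/-- Translation of a continuous function on the torus. -/
def torusShift (a : Vel N) (e : C(Torus N, ℝ)) : C(Torus N, ℝ) :=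
  ⟨fun x => e (x - toTorus a), by fun_prop⟩

theorem torusShift_zero (e : C(Torus N, ℝ)) : torusShift 0 e = e := by
  ext x; simp [torusShift, toTorus_zero]

theorem norm_torusShift_le (a : Vel N) (e : C(Torus N, ℝ)) : ‖torusShift a e‖ ≤ ‖e‖ :=
  (ContinuousMap.norm_le _ (norm_nonneg _)).2 fun x => e.norm_coe_le_norm _

theorem transport_mulOp (a : Vel N × Vel N) (e : C(Torus N, ℝ)) (f : State N p) :
    transport p 0 a (mulOp p e f) = mulOp p (torusShift a.1 e) (transport p 0 a f) := by
  refine Lp.ext ?_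
  filter_upwards [coeFn_transport 0 a (mulOp p e f),
    (quasiMeasurePreserving_backward 0 a).ae (coeFn_mulOp e f),
    coeFn_mulOp (torusShift a.1 e) (transport p 0 a f), coeFn_transport 0 a f] with z h1 h2 h3 h4
  rw [h1, h2, h3, h4]
  have : (backward 0 a z).1 = z.1 - toTorus a.1 := by
    simp [backward, flow, toTorus_zero, toPhase]
  simp only [this, torusShift, ContinuousMap.coe_mk]
  ring

end Mul

/-! ### The total mass -/

section Mass

variable {N : ℕ}

/-- The integral, as a functional on `L^1`. -/
def massOp (N : ℕ) : State N 1 →L[ℝ] ℝ := L1.integralCLM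

theorem massOp_apply (f : State N 1) : massOp N f = ∫ z, f z := by
  rw [← L1.integral_eq_integral, L1.integral_eq, massOp]

theorem massOp_eq_norm {f : State N 1} (hf : 0 ≤ f) : massOp N f = ‖f‖ := by
  rw [massOp_apply, L1.norm_eq_integral_norm]
  rw [← Lp.coeFn_nonneg] at hf
  refine integral_congr_ae ?_
  filter_upwards [hf] with z hz
  rw [Real.norm_of_nonneg hz]

/-- The factor e^{Nt} in the transport operator compensates the Jacobian of the backward flow. -/
theorem massOp_transport (t : ℝ) (a : Vel N × Vel N) (f : State N 1) :
    massOp N (transport 1 t a f) = massOp N f := by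
  rw [massOp_apply, massOp_apply, integral_congr_ae (coeFn_transport t a f), integral_const_mul]
  have h0 : AEStronglyMeasurable f ((volume : Measure (Phase N)).map (backward t a)) := by
    rw [map_backward_volume]; exact (Lp.aestronglyMeasurable f).smul_measure _
  have h1 := integral_map (measurable_backward t a).aemeasurable h0
  rw [map_backward_volume, integral_smul_measure,
    ENNReal.toReal_ofReal (Real.exp_pos _).le] at h1
  rw [← h1, smul_eq_mul, ← mul_assoc, ← Real.exp_add]
  simp

instance : Fact ((1 : ℝ≥0∞) ≠ ⊤) := ⟨ENNReal.one_ne_top⟩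

/-- Since every transport preserves mass, only the mean of the affine weight matters, and its linear
part has mean zero. With c₀ = 1 this is conservation of mass for K_t, with c₀ = 0 it says that
gradients carry no mass. -/
theorem massOp_gaussAvg (t c₀ : ℝ) (c : Vel N × Vel N) (f : State N 1) :
    massOp N (gaussAvg 1 t c₀ c f) = c₀ * massOp N f := by
  rw [gaussAvg_apply, ← ContinuousLinearMap.integral_comp_comm _ (integrable_gaussAvg t c₀ c f)]
  simp only [map_smul, massOp_transport, smul_eq_mul, integral_mul_const]
  congr 1
  have h0 := integral_affScore_zero c
  have h1 : ∀ z, affScore c₀ c z = c₀ + affScore 0 c z := fun z => by simp [affScore]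
  simp only [h1]
  rw [integral_add (integrable_const _), h0]
  · simp
  · exact (integrable_inner_gaussLaw c).congr (Eventually.of_forall fun z => by simp [affScore])

theorem massOp_kineticOp (t : ℝ) (f : State N 1) :
    massOp N (kineticOp 1 t f) = massOp N f := by
  rw [kineticOp, massOp_gaussAvg, one_mul]

theorem massOp_gradOp (t : ℝ) (g : Fin N → State N 1) : massOp N (gradOp 1 t g) = 0 := by
  rw [gradOp_apply, map_sum]
  exact Finset.sum_eq_zero fun i _ => by rw [dirKineticOp, massOp_gaussAvg, zero_mul]

end Mass

/-! ### Velocity moments -/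

section Moments

variable {N : ℕ} {p : ℝ≥0∞} [Fact (1 ≤ p)]

/-- The truncated weight `1_{|v| ≤ n} (1 + |v|)^l`. -/
def momWeight (l n : ℕ) (z : Phase N) : ℝ :=
  (univ ×ˢ Metric.closedBall (0 : Vel N) n).indicator (fun z => (1 + ‖z.2‖) ^ l) z

theorem momWeight_nonneg (l n : ℕ) (z : Phase N) : 0 ≤ momWeight l n z :=
  indicator_nonneg (fun _ _ => by positivity) _

theorem measurable_momWeight (l n : ℕ) : Measurable (momWeight (N := N) l n) :=
  Measurable.indicator (by fun_prop) (MeasurableSet.univ.prod Metric.isClosed_closedBall.measurableSet)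

theorem memLp_momWeight (l n : ℕ) (q : ℝ≥0∞) : MemLp (momWeight (N := N) l n) q volume := by
  have h1 : MemLp ((univ ×ˢ Metric.closedBall (0 : Vel N) n).indicator
      fun _ : Phase N => (1 : ℝ)) q volume := by
    refine memLp_indicator_const q
      (MeasurableSet.univ.prod Metric.isClosed_closedBall.measurableSet) 1 (Or.inr ?_)
    rw [Measure.volume_eq_prod, Measure.prod_prod, measure_univ, one_mul]
    exact measure_closedBall_lt_top.ne
  refine h1.of_le_mul (c := (1 + n) ^ l) (measurable_momWeight l n).aestronglyMeasurable
    (Eventually.of_forall fun z => ?_)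
  unfold momWeight
  by_cases hz : z ∈ (univ : Set (Torus N)) ×ˢ Metric.closedBall (0 : Vel N) n
  · rw [indicator_of_mem hz, indicator_of_mem hz]
    have : ‖z.2‖ ≤ n := by simpa using hz.2
    rw [norm_one, mul_one, Real.norm_of_nonneg (by positivity)]
    gcongr
  · simp [hz]

/-- Multiplication by the truncated weight, from `L^p` to `L^1`. -/
def momOp (p : ℝ≥0∞) [Fact (1 ≤ p)] (l n : ℕ) : State N p →L[ℝ] State N 1 :=
  have : ENNReal.HolderConjugate p p.conjExponent := .conjExponent Fact.out
  have : ENNReal.HolderConjugate p.conjExponent p := ENNReal.HolderConjugate.symm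
  have : Fact (1 ≤ p.conjExponent) := ⟨ENNReal.HolderConjugate.one_le p.conjExponent p⟩
  (ContinuousLinearMap.mul ℝ ℝ).holderL volume p.conjExponent p 1
    ((memLp_momWeight l n p.conjExponent).toLp)

theorem coeFn_momOp (l n : ℕ) (f : State N p) :
    momOp p l n f =ᵐ[volume] fun z => momWeight l n z * f z := by
  have : ENNReal.HolderConjugate p p.conjExponent := .conjExponent Fact.out
  have : ENNReal.HolderConjugate p.conjExponent p := ENNReal.HolderConjugate.symm
  have : Fact (1 ≤ p.conjExponent) := ⟨ENNReal.HolderConjugate.one_le p.conjExponent p⟩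
  have h := ContinuousLinearMap.coeFn_holder (r := 1) (ContinuousLinearMap.mul ℝ ℝ)
    ((memLp_momWeight (N := N) l n p.conjExponent).toLp) f
  filter_upwards [h, (memLp_momWeight (N := N) l n p.conjExponent).coeFn_toLp] with z h1 h2
  rw [← h2]
  exact h1

theorem enorm_momOp (l n : ℕ) (f : State N p) :
    ‖momOp p l n f‖ₑ = ∫⁻ z, ENNReal.ofReal (momWeight l n z) * ‖f z‖ₑ := by
  rw [Lp.enorm_def, eLpNorm_one_eq_lintegral_enorm]
  refine lintegral_congr_ae ?_
  filter_upwards [coeFn_momOp l n f] with z hz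
  rw [hz, enorm_mul, Real.enorm_of_nonneg (momWeight_nonneg l n z)]

/-- The velocity moment of order `l` of `f` is at most `b`. -/
def MomLe (l : ℕ) (b : ℝ) (f : State N p) : Prop := ∀ n, ‖momOp p l n f‖ ≤ b

/-- The truncations make each condition continuous on L^p, for any p; the moment itself is not
continuous. Closedness lets the bound survive the fixed point iteration. -/
theorem isClosed_momLe (l : ℕ) (b : ℝ) : IsClosed {f : State N p | MomLe l b f} := by
  simp only [MomLe, ofPred_forall]
  exact isClosed_iInter fun n => isClosed_le (by fun_prop) continuous_const

theorem MomLe.mono {l : ℕ} {b b' : ℝ} {f : State N p} (h : MomLe l b f) (hb : b ≤ b') :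
    MomLe l b' f := fun n => (h n).trans hb

theorem MomLe.add {l : ℕ} {b b' : ℝ} {f g : State N p} (h : MomLe l b f) (h' : MomLe l b' g) :
    MomLe l (b + b') (f + g) := fun n => by
  rw [map_add]; exact (norm_add_le _ _).trans (add_le_add (h n) (h' n))

theorem MomLe.smul {l : ℕ} {b : ℝ} {f : State N p} (h : MomLe l b f) (c : ℝ) :
    MomLe l (|c| * b) (c • f) := fun n => by
  rw [map_smul, norm_smul, Real.norm_eq_abs]
  exact mul_le_mul_of_nonneg_left (h n) (abs_nonneg _)

theorem MomLe.sum {ι : Type*} (s : Finset ι) {l : ℕ} {b : ι → ℝ} {f : ι → State N p}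
    (h : ∀ i ∈ s, MomLe l (b i) (f i)) : MomLe l (∑ i ∈ s, b i) (∑ i ∈ s, f i) := fun n => by
  rw [map_sum]; exact (norm_sum_le _ _).trans (Finset.sum_le_sum fun i hi => h i hi n)

theorem MomLe.integral {Ω : Type*} [MeasurableSpace Ω] {μ : Measure Ω} {l : ℕ} {b : Ω → ℝ}
    {H : Ω → State N p} (hH : Integrable H μ) (hb : Integrable b μ)
    (h : ∀ᵐ o ∂μ, MomLe l (b o) (H o)) : MomLe l (∫ o, b o ∂μ) (∫ o, H o ∂μ) := fun n => by
  rw [← ContinuousLinearMap.integral_comp_comm _ hH]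
  exact norm_integral_le_of_norm_le hb (h.mono fun o ho => ho n)

theorem MomLe.mulOp {l : ℕ} {b : ℝ} {f : State N p} (h : MomLe l b f) (e : C(Torus N, ℝ)) :
    MomLe l (‖e‖ * b) (mulOp p e f) := fun n => by
  refine le_trans ?_ (mul_le_mul_of_nonneg_left (h n) (norm_nonneg e))
  refine Lp.norm_le_mul_norm_of_ae_le_mul ?_
  filter_upwards [coeFn_momOp l n f, coeFn_momOp l n (KineticFP.mulOp p e f), coeFn_mulOp e f]
    with z h1 h2 h3
  rw [h1, h2, h3, norm_mul, norm_mul, norm_mul, mul_left_comm]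
  exact mul_le_mul_of_nonneg_right (e.norm_coe_le_norm _) (by positivity)

/-- The velocity after transport is e^{-t}w + a.2, so the weight grows by a factor of at most (1 +
|a.2|)^l. The cutoff is not preserved: a final velocity in the ball of radius n only puts w in the
ball of radius e^t(n + |a.2|), which explains the quantification over all truncations in `MomLe`. -/
theorem MomLe.transport {l : ℕ} {b : ℝ} {f : State N p} (h : MomLe l b f) {t : ℝ} (ht : 0 ≤ t)
    (a : Vel N × Vel N) : MomLe l ((1 + ‖a.2‖) ^ l * b) (transport p t a f) := by
  intro n
  have hb : 0 ≤ b := (norm_nonneg _).trans (h 0)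
  obtain ⟨n', hn'⟩ := exists_nat_ge (Real.exp t * (n + ‖a.2‖))
  have hw : ∀ z : Phase N, momWeight l n (flow t z + toPhase a) ≤
      (1 + ‖a.2‖) ^ l * momWeight l n' z := by
    intro z
    unfold momWeight
    by_cases hz : flow t z + toPhase a ∈ (univ : Set (Torus N)) ×ˢ Metric.closedBall (0 : Vel N) n
    · have h1 : ‖Real.exp (-t) • z.2 + a.2‖ ≤ n := by simpa [flow, toPhase] using hz.2
      have h2 : ‖Real.exp (-t) • z.2‖ = Real.exp (-t) * ‖z.2‖ := by
        rw [norm_smul, Real.norm_of_nonneg (Real.exp_pos _).le]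
      have h3 : Real.exp (-t) * ‖z.2‖ ≤ n + ‖a.2‖ := by
        have := norm_sub_le (Real.exp (-t) • z.2 + a.2) a.2
        rw [add_sub_cancel_right, h2] at this
        linarith
      have hz' : z ∈ (univ : Set (Torus N)) ×ˢ Metric.closedBall (0 : Vel N) n' := by
        refine ⟨mem_univ _, ?_⟩
        rw [mem_closedBall_zero_iff]
        refine le_trans ?_ hn'
        calc ‖z.2‖ = Real.exp t * (Real.exp (-t) * ‖z.2‖) := by
              rw [← mul_assoc, ← Real.exp_add]; simp
          _ ≤ _ := by gcongr
      rw [indicator_of_mem hz, indicator_of_mem hz', ← mul_pow]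
      have h4 : ‖Real.exp (-t) • z.2 + a.2‖ ≤ ‖z.2‖ + ‖a.2‖ := by
        refine (norm_add_le _ _).trans ?_
        rw [h2]
        have : Real.exp (-t) ≤ 1 := Real.exp_le_one_iff.2 (by linarith)
        nlinarith [norm_nonneg z.2]
      change (1 + ‖Real.exp (-t) • z.2 + a.2‖) ^ l ≤ _
      gcongr
      nlinarith [norm_nonneg z.2, norm_nonneg a.2]
    · rw [indicator_of_notMem hz]
      exact mul_nonneg (by positivity) (indicator_nonneg (fun _ _ => by positivity) _)
  have key : ‖momOp p l n (KineticFP.transport p t a f)‖ₑ ≤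
      ENNReal.ofReal ((1 + ‖a.2‖) ^ l) * ‖momOp p l n' f‖ₑ := by
    let F : Phase N → ℝ≥0∞ := fun z =>
      ENNReal.ofReal (momWeight l n (flow t z + toPhase a)) * ‖f z‖ₑ
    have hF : AEMeasurable F ((volume : Measure (Phase N)).map (backward t a)) := by
      rw [map_backward_volume]
      refine AEMeasurable.smul_measure ?_ _
      refine AEMeasurable.mul ?_ (Lp.aestronglyMeasurable f).enorm
      exact ((measurable_momWeight l n).comp
        ((measurable_flow t).add_const _)).ennreal_ofReal.aemeasurable
    have h1 : ∫⁻ z, F (backward t a z) = ENNReal.ofReal (Real.exp (-(N * t))) * ∫⁻ z, F z := by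
      rw [← lintegral_map' hF (measurable_backward t a).aemeasurable, map_backward_volume,
        lintegral_smul_measure, smul_eq_mul]
    have h2 : ‖momOp p l n (KineticFP.transport p t a f)‖ₑ = ∫⁻ z, F z := by
      have h3 : ∫⁻ z, F z = ENNReal.ofReal (Real.exp (N * t)) * ∫⁻ z, F (backward t a z) := by
        rw [h1, ← mul_assoc, ← ENNReal.ofReal_mul (Real.exp_pos _).le, ← Real.exp_add]
        simp
      rw [h3, enorm_momOp, ← lintegral_const_mul' _ _ ENNReal.ofReal_ne_top]
      refine lintegral_congr_ae ?_
      filter_upwards [coeFn_transport t a f] with z hz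
      simp only [F]
      rw [flow_backward, hz, enorm_mul, Real.enorm_of_nonneg (Real.exp_pos _).le]
      ring
    rw [h2, enorm_momOp, ← lintegral_const_mul' _ _ ENNReal.ofReal_ne_top]
    refine lintegral_mono fun z => ?_
    simp only [F]
    rw [← mul_assoc, ← ENNReal.ofReal_mul (by positivity)]
    gcongr
    exact hw z
  have h5 : ‖momOp p l n (KineticFP.transport p t a f)‖ ≤
      (1 + ‖a.2‖) ^ l * ‖momOp p l n' f‖ := by
    have h6 := ENNReal.toReal_mono (ENNReal.mul_ne_top ENNReal.ofReal_ne_top enorm_ne_top) key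
    rwa [ENNReal.toReal_mul, toReal_enorm, toReal_enorm,
      ENNReal.toReal_ofReal (by positivity)] at h6
  exact h5.trans (mul_le_mul_of_nonneg_left (h n') (by positivity))

/-- Monotone convergence as the truncation radius grows; the weight (1 + |v|)^l dominates both 1 and
|v|^l, so integrability of f comes along even when p > 1. -/
theorem memG_of_momLe {l : ℕ} {b : ℝ} {f : State N p} (h : MomLe l b f) : MemG l f := by
  have hfin : ∫⁻ z : Phase N, ENNReal.ofReal ((1 + ‖z.2‖) ^ l) * ‖f z‖ₑ < ⊤ := by
    have hmono : Monotone fun (n : ℕ) (z : Phase N) =>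
        ENNReal.ofReal (momWeight l n z) * ‖f z‖ₑ := by
      intro n n' hn z
      dsimp only
      gcongr
      refine indicator_le_indicator_of_subset ?_ (fun _ => by positivity) z
      exact prod_mono_right (Metric.closedBall_subset_closedBall (by exact_mod_cast hn))
    have hsup : ∀ z : Phase N, ⨆ n, ENNReal.ofReal (momWeight l n z) * ‖f z‖ₑ =
        ENNReal.ofReal ((1 + ‖z.2‖) ^ l) * ‖f z‖ₑ := by
      intro z
      refine le_antisymm (iSup_le fun n => ?_) ?_
      · gcongr
        exact indicator_le_self' (fun _ _ => by positivity) z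
      · obtain ⟨n, hn⟩ := exists_nat_ge ‖z.2‖
        refine le_iSup_of_le n (le_of_eq ?_)
        rw [momWeight, indicator_of_mem]
        exact ⟨mem_univ _, by simpa using hn⟩
    simp_rw [← hsup]
    rw [lintegral_iSup' (f := fun (n : ℕ) (z : Phase N) =>
      ENNReal.ofReal (momWeight l n z) * ‖f z‖ₑ) (fun n => ((measurable_momWeight l n).ennreal_ofReal.aemeasurable).mul
      (Lp.aestronglyMeasurable f).enorm) (Eventually.of_forall fun z n n' hn => hmono hn z)]
    refine (iSup_le fun n => ?_).trans_lt (ENNReal.ofReal_lt_top (r := b))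
    rw [← enorm_momOp, ← ofReal_norm]
    exact ENNReal.ofReal_le_ofReal (h n)
  constructor
  · refine ⟨Lp.aestronglyMeasurable f, lt_of_le_of_lt (lintegral_mono fun z => ?_) hfin⟩
    refine le_mul_of_one_le_left' ?_
    rw [ENNReal.one_le_ofReal]
    exact one_le_pow₀ (by linarith [norm_nonneg z.2])
  · refine ⟨(Continuous.aestronglyMeasurable (by fun_prop)).mul (Lp.aestronglyMeasurable f),
      lt_of_le_of_lt (lintegral_mono fun z => ?_) hfin⟩
    rw [enorm_mul, Real.enorm_of_nonneg (by positivity)]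
    gcongr
    linarith

theorem exists_momLe_of_memG {l : ℕ} {f : State N p} (h : MemG l f) : ∃ b, 0 ≤ b ∧ MomLe l b f := by
  have hint : Integrable fun z : Phase N => 2 ^ l * (‖f z‖ + ‖‖z.2‖ ^ l * f z‖) :=
    (h.1.norm.add h.2.norm).const_mul _
  refine ⟨∫ z, 2 ^ l * (‖f z‖ + ‖‖z.2‖ ^ l * f z‖), integral_nonneg fun z => by positivity,
    fun n => ?_⟩
  rw [L1.norm_eq_integral_norm]
  refine integral_mono_ae (L1.integrable_coeFn _).norm hint ?_
  filter_upwards [coeFn_momOp l n f] with z hz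
  have h1 : momWeight l n z ≤ (1 + ‖z.2‖) ^ l := indicator_le_self' (fun _ _ => by positivity) z
  have h2 : (1 + ‖z.2‖) ^ l ≤ 2 ^ l * (1 + ‖z.2‖ ^ l) := by
    have h3 : 1 + ‖z.2‖ ≤ 2 * max 1 ‖z.2‖ := by
      linarith [le_max_left 1 ‖z.2‖, le_max_right 1 ‖z.2‖]
    refine (pow_le_pow_left₀ (by positivity) h3 l).trans ?_
    rw [mul_pow]
    gcongr
    rcases max_cases 1 ‖z.2‖ with ⟨h, -⟩ | ⟨h, -⟩ <;> rw [h]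
    · rw [one_pow]; linarith [pow_nonneg (norm_nonneg z.2) l]
    · linarith
  rw [hz, norm_mul, norm_mul, Real.norm_of_nonneg (momWeight_nonneg l n z),
    Real.norm_of_nonneg (pow_nonneg (norm_nonneg z.2) l)]
  nlinarith [norm_nonneg (f z), h1.trans h2]

end Moments

/-! ### Moments under the kinetic semigroup and its gradient -/

section MomentsGauss

variable {N : ℕ} {p : ℝ≥0∞} [Fact (1 ≤ p)] [Fact (p ≠ ⊤)]

/-- A bound for the growth of the moments of order `l` under the Gaussian averages. -/
def momConst (N l : ℕ) : ℝ := ∫ z, (1 + ‖z‖) ^ (l + 1) ∂(gaussLaw N)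

theorem momConst_nonneg (N l : ℕ) : 0 ≤ momConst N l := integral_nonneg fun _ => by positivity

theorem integrable_one_add_norm_pow (N k : ℕ) :
    Integrable (fun z => (1 + ‖z‖) ^ k) (gaussLaw N) := by
  simp only [add_pow, one_pow, one_mul]
  exact integrable_finsetSum _ fun i _ => (integrable_norm_pow_gaussLaw N _).mul_const _

/-- The velocity variance is at most 1, so both entries of the velocity row of the square root lie
in [-1, 1], uniformly in time. -/
theorem norm_gaussMap_snd_le {t : ℝ} (ht : 0 ≤ t) (z : Vel N × Vel N) :
    1 + ‖(gaussMap t z).2‖ ≤ 4 * (1 + ‖z‖) := by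
  have h1 := cholQ_sq_add ht
  have h2 : covVV t ≤ 1 := by rw [covVV_eq]; nlinarith [sq_nonneg (Real.exp (-t))]
  have hq : |cholQ t| ≤ 1 := by
    rw [← sq_le_one_iff_abs_le_one]; nlinarith [sq_nonneg (cholD t)]
  have hd : |cholD t| ≤ 1 := by
    rw [← sq_le_one_iff_abs_le_one]; nlinarith [sq_nonneg (cholQ t)]
  have h3 : ‖(gaussMap t z).2‖ ≤ |cholQ t| * ‖z.1‖ + |cholD t| * ‖z.2‖ := by
    rw [gaussMap_apply]
    refine (norm_add_le _ _).trans (le_of_eq ?_)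
    rw [norm_smul, norm_smul, Real.norm_eq_abs, Real.norm_eq_abs]
  have h4 := norm_fst_le z
  have h5 := norm_snd_le z
  nlinarith [norm_nonneg z.1, norm_nonneg z.2, abs_nonneg (cholQ t), abs_nonneg (cholD t)]

/-- The Gaussian moment of order l + 1 enters: l powers come from the displacement of the velocity
weight and one from the affine score. -/
theorem MomLe.gaussAvg {l : ℕ} {b : ℝ} {f : State N p} (h : MomLe l b f) {t : ℝ} (ht : 0 ≤ t)
    (c₀ : ℝ) (c : Vel N × Vel N) : MomLe l ((|c₀| + ‖c.1‖ + ‖c.2‖) * (4 ^ l * momConst N l) * b)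
      (gaussAvg p t c₀ c f) := by
  have hb : 0 ≤ b := (norm_nonneg _).trans (h 0)
  have h1 := MomLe.integral (integrable_gaussAvg t c₀ c f)
    (b := fun z => (|c₀| + ‖c.1‖ + ‖c.2‖) * (4 ^ l * (1 + ‖z‖) ^ (l + 1)) * b)
    ((((integrable_one_add_norm_pow N (l + 1)).const_mul _).const_mul _).mul_const _)
    (l := l) (Eventually.of_forall fun z => ?_)
  · rwa [integral_mul_const, integral_const_mul, integral_const_mul] at h1
  · refine ((h.transport ht (gaussMap t z)).smul (affScore c₀ c z)).mono ?_
    rw [← mul_assoc]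
    refine mul_le_mul_of_nonneg_right ?_ hb
    have h2 : |affScore c₀ c z| ≤ (|c₀| + ‖c.1‖ + ‖c.2‖) * (1 + ‖z‖) := by
      refine (abs_affScore_le c₀ c z).trans ?_
      nlinarith [norm_nonneg z, norm_nonneg c.1, norm_nonneg c.2, abs_nonneg c₀,
        mul_nonneg (abs_nonneg c₀) (norm_nonneg z)]
    calc _ ≤ (|c₀| + ‖c.1‖ + ‖c.2‖) * (1 + ‖z‖) * (4 * (1 + ‖z‖)) ^ l := by
          gcongr
          exact norm_gaussMap_snd_le ht z
      _ = _ := by rw [mul_pow]; ring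

theorem MomLe.kineticOp {l : ℕ} {b : ℝ} {f : State N p} (h : MomLe l b f) {t : ℝ} (ht : 0 ≤ t) :
    MomLe l (4 ^ l * momConst N l * b) (kineticOp p t f) := by
  simpa [KineticFP.kineticOp] using h.gaussAvg ht 1 0

theorem MomLe.gradOp {l : ℕ} {b : ℝ} {g : Fin N → State N p} (h : ∀ i, MomLe l b (g i)) {t T : ℝ}
    (ht : t ∈ Ioc 0 T) : MomLe l (N * (2 * √(2 * Real.exp T) * (4 ^ l * momConst N l)) * b *
      t ^ (-(1 / 2) : ℝ)) (gradOp p t g) := by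
  rw [gradOp_apply]
  -- For N = 0 the family g is empty and says nothing about the sign of b; the operator is then
  -- zero.
  rcases Nat.eq_zero_or_pos N with rfl | hN
  · intro n; simp
  have hb : 0 ≤ b := (norm_nonneg _).trans (h ⟨0, hN⟩ 0)
  refine (MomLe.sum Finset.univ fun i _ => (h i).gaussAvg ht.1.le 0 (scoreDir t (torusDir i))).mono
    ?_
  have hm := momConst_nonneg N l
  simp only [scoreDir, norm_smul, norm_torusDir, abs_zero, zero_add, mul_one, Real.norm_eq_abs,
    Finset.sum_const, Finset.card_univ, Fintype.card_fin, nsmul_eq_mul]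
  calc _ ≤ N * ((2 * √(2 * Real.exp T) * t ^ (-(1 / 2) : ℝ)) * (4 ^ l * momConst N l) * b) := by
        gcongr
        exact score_le ht
    _ = _ := by ring

end MomentsGauss

/-! ### Unfolding integrals over the torus -/

section Unfolding

variable {N : ℕ}

instance : (volume : Measure UnitAddCircle).IsNegInvariant := inferInstance

instance : (volume : Measure (Torus N)).IsNegInvariant := Pi.isNegInvariant_volume

/-- The points of `ℤ^N` in `ℝ^N`. -/
def latVec (k : Fin N → ℤ) : Vel N := WithLp.toLp 2 fun i => (k i : ℝ)

theorem latVec_apply (k : Fin N → ℤ) (i : Fin N) : latVec k i = k i := rfl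

theorem toTorus_latVec (k : Fin N → ℤ) : toTorus (latVec k) = 0 := by
  ext i
  simp only [toTorus, latVec_apply, Pi.zero_apply]
  exact (AddCircle.coe_eq_zero_iff 1).2 ⟨k i, by simp⟩

/-- The lifts of a point of the torus. -/
def liftsEquiv (ξ : Vel N) {u : Torus N} (h : toTorus ξ = u) :
    (Fin N → ℤ) ≃ {ξ' : Vel N // toTorus ξ' = u} :=
  Equiv.ofBijective (fun k => ⟨ξ + latVec k, by rw [toTorus_add, toTorus_latVec, add_zero, h]⟩) <| by
    constructor
    · intro k k' hk
      have h1 : ξ + latVec k = ξ + latVec k' := congrArg Subtype.val hk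
      have h2 := add_left_cancel h1
      ext i
      have h3 := congrFun (congrArg WithLp.ofLp h2) i
      exact Int.cast_injective (α := ℝ) h3
    · rintro ⟨ξ', hξ'⟩
      have h1 : ∀ i, ∃ n : ℤ, (n : ℝ) = ξ' i - ξ i := fun i => by
        have h2 : ((ξ' i - ξ i : ℝ) : UnitAddCircle) = 0 := by
          rw [AddCircle.coe_sub, sub_eq_zero]
          exact congrFun (hξ'.trans h.symm) i
        obtain ⟨n, hn⟩ := (AddCircle.coe_eq_zero_iff 1).1 h2
        exact ⟨n, by simpa using hn⟩
      choose k hk using h1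
      refine ⟨k, Subtype.ext ?_⟩
      ext i
      simp [latVec_apply, hk]

theorem liftsEquiv_apply (ξ : Vel N) {u : Torus N} (h : toTorus ξ = u) (k : Fin N → ℤ) :
    (liftsEquiv ξ h k : Vel N) = ξ + latVec k := rfl

/-- A measurable section of the projection `ℝ^N → 𝕋^N`, with values in `(0, 1]^N`. -/
def torusSection (u : Torus N) : Vel N := WithLp.toLp 2 fun i => (AddCircle.equivIoc 1 0 (u i)).1

theorem toTorus_torusSection (u : Torus N) : toTorus (torusSection u) = u := by
  ext i; simp [toTorus, torusSection]

/-- The cube `(0, 1]^N`. -/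
def unitCube (N : ℕ) : Set (Vel N) := {ξ | ∀ i, ξ i ∈ Ioc (0 : ℝ) 1}

theorem measurePreserving_torusSection :
    MeasurePreserving (torusSection (N := N)) volume (volume.restrict (unitCube N)) := by
  have h1 : MeasurePreserving (fun u : UnitAddCircle => (AddCircle.equivIoc 1 0 u).1) volume
      (volume.restrict (Ioc (0 : ℝ) 1)) := by
    have h2 := AddCircle.measurePreserving_equivIoc (T := 1) (a := 0)
    have h3 : MeasurePreserving (Subtype.val : Ioc (0 : ℝ) (0 + 1) → ℝ)
        (Measure.comap Subtype.val volume) (volume.restrict (Ioc (0 : ℝ) (0 + 1))) :=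
      ⟨measurable_subtype_coe, map_comap_subtype_coe measurableSet_Ioc volume⟩
    have h4 := h3.comp h2
    have h5 : volume.restrict (Ioc (0 : ℝ) (0 + 1)) = volume.restrict (Ioc (0 : ℝ) 1) := by
      rw [zero_add]
    exact ⟨h4.measurable, h4.map_eq.trans h5⟩
  have h2 := measurePreserving_pi (fun _ : Fin N => (volume : Measure UnitAddCircle))
    (fun _ : Fin N => (volume : Measure ℝ).restrict (Ioc (0 : ℝ) 1)) (fun _ => h1)
  rw [← Measure.restrict_pi_pi] at h2
  have h3 := (EuclideanSpace.volume_preserving_symm_measurableEquiv_toLp (Fin N)).symm.restrict_preimage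
    (s := unitCube N) (by
      have : unitCube N = ⋂ i, (fun ξ : Vel N => ξ i) ⁻¹' Ioc (0 : ℝ) 1 := by
        ext; simp [unitCube]
      rw [this]
      exact MeasurableSet.iInter fun i => measurableSet_Ioc.preimage (by fun_prop))
  refine MeasurePreserving.comp (g := fun a : Fin N → ℝ => (WithLp.toLp 2 a : Vel N)) ?_ h2
  convert! h3 using 2
  ext a; simp [unitCube, Set.mem_pi]

theorem measurable_toTorus : Measurable (toTorus (N := N)) := continuous_toTorus.measurable

theorem measurableSet_unitCube : MeasurableSet (unitCube N) := by
  have : unitCube N = ⋂ i, (fun ξ : Vel N => ξ i) ⁻¹' Ioc (0 : ℝ) 1 := by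
    ext; simp [unitCube]
  rw [this]
  exact MeasurableSet.iInter fun i => measurableSet_Ioc.preimage (by fun_prop)

theorem torusSection_toTorus {ξ : Vel N} (hξ : ξ ∈ unitCube N) : torusSection (toTorus ξ) = ξ := by
  ext i
  simp only [torusSection, toTorus]
  exact AddCircle.equivIoc_coe_of_mem (by simpa using hξ i)

theorem range_torusSection : range (torusSection (N := N)) = unitCube N := by
  ext ξ
  constructor
  · rintro ⟨u, rfl⟩ i
    simpa [torusSection] using (AddCircle.equivIoc 1 0 (u i)).2
  · exact fun h => ⟨_, torusSection_toTorus h⟩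

theorem measurableEmbedding_torusSection : MeasurableEmbedding (torusSection (N := N)) :=
  MeasurableEmbedding.of_measurable_inverse measurePreserving_torusSection.measurable
    (by rw [range_torusSection]; exact measurableSet_unitCube) measurable_toTorus
    toTorus_torusSection

/-- The cells of the tiling of `ℝ^N × ℝ^N` by the translates of `(0, 1]^N × ℝ^N`. -/
def latCell (k : Fin N → ℤ) : Set (Vel N × Vel N) := {a | a.1 - latVec k ∈ unitCube N}

theorem measurableSet_latCell (k : Fin N → ℤ) : MeasurableSet (latCell k) :=
  measurableSet_unitCube.preimage (by fun_prop)

theorem pairwise_disjoint_latCell : Pairwise (Function.onFun Disjoint (latCell (N := N))) := by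
  intro k k' hk
  refine Set.disjoint_left.2 fun a ha ha' => hk ?_
  have h1 := torusSection_toTorus ha
  have h2 := torusSection_toTorus ha'
  rw [toTorus_sub, toTorus_latVec] at h1 h2
  have h3 := h1.symm.trans h2
  ext i
  have h4 := congrFun (congrArg WithLp.ofLp h3) i
  simp only [WithLp.ofLp_sub, Pi.sub_apply, latVec_apply] at h4
  exact_mod_cast (sub_right_injective h4 : (k i : ℝ) = k' i)

/-- The index is ⌈a_i⌉ - 1 rather than a floor, because the cells are open on the left and closed on
the right. -/
theorem iUnion_latCell : ⋃ k, latCell (N := N) k = univ := by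
  refine eq_univ_of_forall fun a => mem_iUnion.2 ⟨fun i => ⌈a.1 i⌉ - 1, fun i => ?_⟩
  have h1 := Int.ceil_lt_add_one (a.1 i)
  have h2 := Int.le_ceil (a.1 i)
  simp only [PiLp.sub_apply, latVec_apply, Int.cast_sub, Int.cast_one]
  exact ⟨by linarith, by linarith⟩

/-- Reflection through x preserves the measure of the torus, the section identifies the torus with
the unit cube, and the translates of the cube tile ℝ^N. Integrability of ψ justifies exchanging the
lattice sum with the integral. -/
theorem integral_tsum_lifts (x : Torus N) {ψ : Vel N × Vel N → ℝ} (hψ : Integrable ψ) :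
    ∫ z : Phase N, ∑' ξ : {ξ : Vel N // toTorus ξ = x - z.1}, ψ (ξ, z.2) = ∫ a, ψ a := by
  let Φ : Phase N → ℝ := fun z => ∑' ξ : {ξ : Vel N // toTorus ξ = z.1}, ψ (ξ, z.2)
  let Ξ : Vel N × Vel N → ℝ := fun a => ∑' k : Fin N → ℤ, ψ (a + (latVec k, 0))
  let D : Set (Vel N × Vel N) := unitCube N ×ˢ univ
  have hpre : ∀ k : Fin N → ℤ,
      (fun a : Vel N × Vel N => a + (latVec k, 0)) ⁻¹' latCell k = D := fun k => by
    ext a; simp [latCell, D]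
  have hmp : ∀ k : Fin N → ℤ, MeasurePreserving (fun a : Vel N × Vel N => a + (latVec k, 0))
      volume volume := fun k => measurePreserving_add_right _ _
  have hemb : ∀ k : Fin N → ℤ,
      MeasurableEmbedding (fun a : Vel N × Vel N => a + (latVec k, 0)) := fun k =>
    measurableEmbedding_addRight _
  have h1 : ∫ z : Phase N, Φ (x - z.1, z.2) = ∫ z, Φ z :=
    ((Measure.measurePreserving_sub_left (volume : Measure (Torus N)) x).prod
      (MeasurePreserving.id (volume : Measure (Vel N)))).integral_comp
      ((MeasurableEquiv.subLeft x).prodCongr (.refl _)).measurableEmbedding Φ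
  have h2 : ∀ z, Φ z = Ξ (torusSection z.1, z.2) := fun z => by
    simp only [Φ, Ξ]
    rw [← (liftsEquiv (torusSection z.1) (toTorus_torusSection z.1)).tsum_eq]
    simp only [liftsEquiv_apply, Prod.mk_add_mk, add_zero]
  have h3 : ∫ z, Φ z = ∫ a in D, Ξ a := by
    simp only [h2]
    have h4 := (measurePreserving_torusSection (N := N)).prod
      (MeasurePreserving.id (volume : Measure (Vel N)))
    have h5 : (volume.restrict (unitCube N)).prod (volume : Measure (Vel N)) =
        (volume : Measure (Vel N × Vel N)).restrict D := by
      rw [Measure.volume_eq_prod, ← Measure.prod_restrict, Measure.restrict_univ]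
    rw [h5] at h4
    exact h4.integral_comp (measurableEmbedding_torusSection.prodMap .id) Ξ
  have h6 : ∀ k : Fin N → ℤ, ∫⁻ a in D, ‖ψ (a + (latVec k, 0))‖ₑ = ∫⁻ a in latCell k, ‖ψ a‖ₑ :=
    fun k => by
      rw [← hpre k]
      exact (hmp k).setLIntegral_comp_preimage_emb (hemb k) (fun a => ‖ψ a‖ₑ) _
  have h7 : ∀ k : Fin N → ℤ, ∫ a in D, ψ (a + (latVec k, 0)) = ∫ a in latCell k, ψ a := fun k => by
    rw [← hpre k]
    exact (hmp k).setIntegral_preimage_emb (hemb k) ψ _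
  have h8 : ∫ a in D, Ξ a = ∑' k : Fin N → ℤ, ∫ a in D, ψ (a + (latVec k, 0)) := by
    refine integral_tsum (fun k => ?_) ?_
    · exact (hψ.1.comp_measurePreserving (hmp k)).restrict
    · simp only [h6]
      rw [← lintegral_iUnion measurableSet_latCell pairwise_disjoint_latCell, iUnion_latCell,
        Measure.restrict_univ]
      exact hψ.2.ne
  calc _ = ∫ z : Phase N, Φ (x - z.1, z.2) := rfl
    _ = _ := by
      rw [h1, h3, h8]
      simp only [h7]
      rw [← integral_iUnion measurableSet_latCell pairwise_disjoint_latCell hψ.integrableOn,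
        iUnion_latCell, Measure.restrict_univ]

end Unfolding

/-! ### Lattice sums of Gaussian densities -/

section Lattice

variable {N : ℕ}

theorem summable_latVec {n : ℕ} (hn : N < n) (x : Vel N) :
    Summable fun k : Fin N → ℤ => (‖latVec k - x‖ ^ n)⁻¹ := by
  let b : Module.Basis (Fin N) ℝ (Vel N) := (EuclideanSpace.basisFun (Fin N) ℝ).toBasis
  let L : Submodule ℤ (Vel N) := Submodule.span ℤ (range b)
  have hL : Module.finrank ℤ L = N := by
    rw [ZLattice.rank ℝ L, finrank_euclideanSpace_fin]
  have h := ZLattice.summable_norm_sub_inv_pow L n (by rw [hL]; exact hn) x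
  have hmem : ∀ k : Fin N → ℤ, latVec k ∈ L := fun k => by
    rw [b.mem_span_iff_repr_mem ℤ]
    intro i
    exact ⟨k i, by simp [b, latVec]⟩
  have hinj : Function.Injective fun k : Fin N → ℤ => (⟨latVec k, hmem k⟩ : L) := by
    intro k k' hk
    have h1 : latVec k = latVec k' := congrArg Subtype.val hk
    ext i
    exact Int.cast_injective (α := ℝ) (congrFun (congrArg WithLp.ofLp h1) i)
  simpa [Function.comp_def] using h.comp_injective hinj

theorem summable_one_add_latVec {n : ℕ} (hn : N < n) (x : Vel N) :
    Summable fun k : Fin N → ℤ => ((1 + ‖latVec k - x‖) ^ n)⁻¹ := by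
  refine Summable.of_norm_bounded_eventually (summable_latVec hn x) ?_
  have hfin : {k : Fin N → ℤ | latVec k = x}.Finite := by
    refine Set.Subsingleton.finite fun k hk k' hk' => ?_
    have h1 : latVec k = latVec k' := hk.trans hk'.symm
    ext i
    exact Int.cast_injective (α := ℝ) (congrFun (congrArg WithLp.ofLp h1) i)
  filter_upwards [hfin.compl_mem_cofinite] with k hk
  have h1 : 0 < ‖latVec k - x‖ := norm_pos_iff.2 (sub_ne_zero.2 hk)
  rw [Real.norm_of_nonneg (by positivity)]
  gcongr
  linarith

theorem gaussDensity_nonneg (t : ℝ) (ξ η : Vel N) : 0 ≤ gaussDensity t ξ η := by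
  unfold gaussDensity; positivity

/-- The Gaussian density decays faster than any power. -/
theorem exists_gaussDensity_mul_pow_le {t : ℝ} (ht : 0 < t) (k : ℕ) :
    ∃ C, 0 ≤ C ∧ ∀ ξ η : Vel N, gaussDensity t ξ η * (1 + ‖ξ‖ + ‖η‖) ^ k ≤ C := by
  have hA := covXX_pos ht
  have hD := covDet_pos ht
  have hB : 0 < covVV t := by
    rw [covDet] at hD
    by_contra h
    nlinarith [sq_nonneg (covXV t)]
  set A := covXX t
  set B := covVV t
  set Q := covXV t
  have hDdef : covDet t = A * B - Q ^ 2 := rfl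
  set c : ℝ := ((2 * Real.pi) ^ N * √(covDet t) ^ N)⁻¹ with hc
  have hc0 : 0 ≤ c := by positivity
  -- The 6 is the factor 2 in the denominator of the exponent times the 3 in (1 + x + y)² ≤ 3(1 + x²
  -- + y²).
  set δ : ℝ := 1 / (6 * (A + B)) with hδ
  have hδ0 : 0 < δ := by positivity
  refine ⟨c * (Real.exp (3 * δ) * (k.factorial / δ ^ k)), by positivity, fun ξ η => ?_⟩
  set R := 1 + ‖ξ‖ + ‖η‖ with hR
  have hR1 : 1 ≤ R := by rw [hR]; linarith [norm_nonneg ξ, norm_nonneg η]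
  have hq : δ * R ^ 2 - 3 * δ ≤
      (B * ‖ξ‖ ^ 2 - 2 * Q * inner ℝ ξ η + A * ‖η‖ ^ 2) / (2 * covDet t) := by
    have h1 : |inner ℝ ξ η| ≤ ‖ξ‖ * ‖η‖ := abs_real_inner_le_norm ξ η
    have h2 : Q * inner ℝ ξ η ≤ |Q| * (‖ξ‖ * ‖η‖) := by
      refine (le_abs_self _).trans ?_
      rw [abs_mul]
      exact mul_le_mul_of_nonneg_left h1 (abs_nonneg _)
    have h3 : R ^ 2 ≤ 3 * (1 + ‖ξ‖ ^ 2 + ‖η‖ ^ 2) := by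
      rw [hR]
      nlinarith [sq_nonneg (1 - ‖ξ‖), sq_nonneg (1 - ‖η‖), sq_nonneg (‖ξ‖ - ‖η‖)]
    -- The largest eigenvalue of the covariance is at most its trace A + B, so the inverse quadratic
    -- form is at least |·|²/(A + B).
    have h4 : (‖ξ‖ ^ 2 + ‖η‖ ^ 2) * covDet t ≤
        (A + B) * (B * ‖ξ‖ ^ 2 - 2 * Q * inner ℝ ξ η + A * ‖η‖ ^ 2) := by
      have h5 : (A + B) * (B * ‖ξ‖ ^ 2 - 2 * (|Q| * (‖ξ‖ * ‖η‖)) + A * ‖η‖ ^ 2) ≤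
          (A + B) * (B * ‖ξ‖ ^ 2 - 2 * Q * inner ℝ ξ η + A * ‖η‖ ^ 2) :=
        mul_le_mul_of_nonneg_left (by linarith) (by linarith)
      refine le_trans ?_ h5
      rw [hDdef]
      nlinarith [sq_nonneg (B * ‖ξ‖ - |Q| * ‖η‖), sq_nonneg (A * ‖η‖ - |Q| * ‖ξ‖), sq_abs Q]
    have h6 : (‖ξ‖ ^ 2 + ‖η‖ ^ 2) / (2 * (A + B)) ≤
        (B * ‖ξ‖ ^ 2 - 2 * Q * inner ℝ ξ η + A * ‖η‖ ^ 2) / (2 * covDet t) := by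
      rw [div_le_div_iff₀ (by positivity) (by positivity)]
      linarith
    refine le_trans ?_ h6
    have h7 : (‖ξ‖ ^ 2 + ‖η‖ ^ 2) / (2 * (A + B)) = δ * (3 * (‖ξ‖ ^ 2 + ‖η‖ ^ 2)) := by
      rw [hδ]; field_simp; ring
    rw [h7]
    nlinarith
  have hexp : Real.exp (-(B * ‖ξ‖ ^ 2 - 2 * Q * inner ℝ ξ η + A * ‖η‖ ^ 2) / (2 * covDet t)) ≤
      Real.exp (3 * δ) * (Real.exp (δ * R ^ 2))⁻¹ := by
    rw [← Real.exp_neg, ← Real.exp_add]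
    refine Real.exp_le_exp.2 ?_
    rw [neg_div]; linarith
  have hpow : R ^ k * (Real.exp (δ * R ^ 2))⁻¹ ≤ k.factorial / δ ^ k := by
    have h1 := Real.pow_div_factorial_le_exp (δ * R ^ 2) (by positivity) k
    rw [div_le_iff₀ (by positivity), mul_pow] at h1
    rw [← div_eq_mul_inv, div_le_div_iff₀ (Real.exp_pos _) (by positivity)]
    have h2 : R ^ k ≤ (R ^ 2) ^ k := by
      rw [← pow_mul, mul_comm 2 k, pow_mul]
      nlinarith [one_le_pow₀ hR1 (n := k)]
    calc R ^ k * δ ^ k ≤ (R ^ 2) ^ k * δ ^ k := by gcongr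
      _ ≤ _ := by linarith
  calc gaussDensity t ξ η * R ^ k
      = c * (Real.exp (-(B * ‖ξ‖ ^ 2 - 2 * Q * inner ℝ ξ η + A * ‖η‖ ^ 2) / (2 * covDet t)) *
          R ^ k) := by rw [gaussDensity, mul_assoc]
    _ ≤ c * (Real.exp (3 * δ) * (Real.exp (δ * R ^ 2))⁻¹ * R ^ k) := by gcongr
    _ = c * (Real.exp (3 * δ) * (R ^ k * (Real.exp (δ * R ^ 2))⁻¹)) := by ring
    _ ≤ _ := by gcongr

/-- The coefficients of the logarithmic derivative of the density in the initial velocity. -/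
def driftX (t : ℝ) : ℝ := (covVV t * (1 - Real.exp (-t)) - covXV t * Real.exp (-t)) / covDet t

def driftV (t : ℝ) : ℝ := (covXX t * Real.exp (-t) - covXV t * (1 - Real.exp (-t))) / covDet t

/-- The pair (driftX, driftV) is the inverse covariance applied to (1 - e^{-t}, e^{-t}). The
transpose of the square root maps it to (scoreA, scoreB), so the logarithmic derivative of the
kernel is the score of the standard Gaussian variable; the next lemma is the other component. -/
theorem driftV_mul_cholD {t : ℝ} (ht : 0 < t) : driftV t * cholD t = scoreB t := by
  have h1 := (cholD_pos ht).ne'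
  have hX := covXX_pos ht
  have h2 : cholD t ^ 2 = covDet t / covXX t :=
    Real.sq_sqrt (div_nonneg (covDet_pos ht).le hX.le)
  have h3 := (covDet_pos ht).ne'
  have hR := (cholR_pos ht).ne'
  have h4 := cholR_sq ht.le
  have h5 := cholR_mul_cholQ ht.le
  have h6 : cholQ t * scoreA t = covXV t * (1 - Real.exp (-t)) / covXX t := by
    rw [scoreA, ← h4, ← h5]; field_simp
  rw [scoreB, h6, eq_div_iff h1, mul_assoc, ← sq, h2, driftV]
  field_simp

theorem driftX_mul_cholR_add {t : ℝ} (ht : 0 < t) :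
    driftX t * cholR t + driftV t * cholQ t = scoreA t := by
  have hR := (cholR_pos ht).ne'
  have h3 := (covDet_pos ht).ne'
  have h4 := cholR_sq ht.le
  have h5 := cholR_mul_cholQ ht.le
  rw [scoreA, eq_div_iff hR, add_mul, mul_assoc, mul_assoc, ← sq, h4, mul_comm (cholQ t), h5,
    driftX, driftV]
  field_simp
  rw [covDet]; ring

/-- The gradient in the initial velocity of the Gaussian density. -/
def gradDensity (t : ℝ) (ξ η : Vel N) : Vel N :=
  gaussDensity t ξ η • (driftX t • ξ + driftV t • η)

theorem hasFDerivAt_gaussDensity {t : ℝ} (ht : 0 < t) (ξ v w : Vel N) :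
    HasFDerivAt (fun w => gaussDensity t (ξ - (1 - Real.exp (-t)) • w) (v - Real.exp (-t) • w))
      (innerSL ℝ (gradDensity t (ξ - (1 - Real.exp (-t)) • w) (v - Real.exp (-t) • w))) w := by
  have hD := (covDet_pos ht).ne'
  set a := 1 - Real.exp (-t) with ha
  set b := Real.exp (-t) with hb
  have h1 : HasFDerivAt (fun w : Vel N => ξ - a • w) (-(a • ContinuousLinearMap.id ℝ (Vel N))) w := by
    simpa using ((hasFDerivAt_id (𝕜 := ℝ) w).const_smul a).const_sub ξ
  have h2 : HasFDerivAt (fun w : Vel N => v - b • w) (-(b • ContinuousLinearMap.id ℝ (Vel N))) w := by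
    simpa using ((hasFDerivAt_id (𝕜 := ℝ) w).const_smul b).const_sub v
  have h3 := ((((((h1.norm_sq.const_mul (covVV t)).sub ((h1.inner ℝ h2).const_mul (2 * covXV t))).add
    (h2.norm_sq.const_mul (covXX t))).neg.mul_const (2 * covDet t)⁻¹).exp).const_mul
    ((2 * Real.pi) ^ N * √(covDet t) ^ N)⁻¹)
  refine (h3.congr_fderiv ?_).congr_of_eventuallyEq (Eventually.of_forall fun w => ?_)
  · ext h
    simp only [gradDensity, gaussDensity, driftX, driftV, innerSL_apply_apply, inner_smul_left,
      inner_add_left, _root_.smul_apply, _root_.add_apply,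
      _root_.sub_apply, _root_.neg_apply, ContinuousLinearMap.comp_apply,
      ContinuousLinearMap.prod_apply, ContinuousLinearMap.id_apply, fderivInnerCLM_apply,
      smul_eq_mul, inner_neg_right, inner_neg_left, inner_smul_right, RCLike.conj_to_real,
      nsmul_eq_mul, Nat.cast_ofNat, ← ha, ← hb, div_eq_mul_inv,
      Pi.neg_apply, Pi.add_apply, Pi.sub_apply, real_inner_comm h (v - b • w)]
    generalize Real.exp (_ * _) = e
    field_simp
    ring
  · simp only [gaussDensity, div_eq_mul_inv]
    rfl

end Lattice

/-! ### The kernel and its gradient, pointwise -/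

section Kernel

variable {N : ℕ}

/-- The fluctuation that leads from `(ξ, w)` to `(·, v)` in the time `t`. -/
def fluct (t : ℝ) (v : Vel N) (a : Vel N × Vel N) : Vel N × Vel N :=
  (a.1 - (1 - Real.exp (-t)) • a.2, v - Real.exp (-t) • a.2)

theorem norm_gradDensity_le (t : ℝ) (ξ η : Vel N) : ‖gradDensity t ξ η‖ ≤
    gaussDensity t ξ η * ((|driftX t| + |driftV t|) * (1 + ‖ξ‖ + ‖η‖)) := by
  rw [gradDensity, norm_smul, Real.norm_of_nonneg (gaussDensity_nonneg t ξ η)]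
  refine mul_le_mul_of_nonneg_left ((norm_add_le _ _).trans ?_) (gaussDensity_nonneg t ξ η)
  rw [norm_smul, norm_smul, Real.norm_eq_abs, Real.norm_eq_abs]
  nlinarith [abs_nonneg (driftX t), abs_nonneg (driftV t), norm_nonneg ξ, norm_nonneg η,
    mul_nonneg (abs_nonneg (driftX t)) (norm_nonneg η),
    mul_nonneg (abs_nonneg (driftV t)) (norm_nonneg ξ)]

/-- Uniform bounds for the terms of the lattice sums. -/
theorem exists_summable_bound {t : ℝ} (ht : 0 < t) (ξ₀ : Vel N) (w₀ : Vel N) (k : ℕ) :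
    ∃ u : (Fin N → ℤ) → ℝ, Summable u ∧ ∀ (n : Fin N → ℤ), ∀ w ∈ Metric.ball w₀ 1, ∀ η : Vel N,
      gaussDensity t (ξ₀ + latVec n - (1 - Real.exp (-t)) • w) η *
        (1 + ‖ξ₀ + latVec n - (1 - Real.exp (-t)) • w‖ + ‖η‖) ^ k ≤ u n := by
  -- The k powers belong to the statement; the other N + 1 are spent on making the sum over ℤ^N
  -- converge.
  obtain ⟨C, hC, hCle⟩ := exists_gaussDensity_mul_pow_le (N := N) ht (k + (N + 1))
  set a := 1 - Real.exp (-t) with ha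
  set M := |a| * (‖w₀‖ + 1) with hM
  have hM0 : 0 ≤ M := by positivity
  refine ⟨fun n => C * (1 + M) ^ (N + 1) * ((1 + ‖latVec n - (-ξ₀)‖) ^ (N + 1))⁻¹,
    (summable_one_add_latVec (Nat.lt_succ_self N) (-ξ₀)).mul_left _, fun n w hw η => ?_⟩
  set p := ξ₀ + latVec n - a • w with hp
  have hw' : ‖w‖ ≤ ‖w₀‖ + 1 := by
    have := norm_le_norm_add_norm_sub' w w₀
    have h2 : ‖w - w₀‖ < 1 := by simpa [dist_eq_norm] using hw
    linarith
  have h1 : ‖latVec n - (-ξ₀)‖ ≤ ‖p‖ + M := by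
    have h2 : latVec n - (-ξ₀) = p + a • w := by rw [hp]; abel
    rw [h2]
    refine (norm_add_le _ _).trans (add_le_add le_rfl ?_)
    rw [norm_smul, Real.norm_eq_abs]
    exact mul_le_mul_of_nonneg_left hw' (abs_nonneg a)
  have h3 : 1 + ‖latVec n - (-ξ₀)‖ ≤ (1 + M) * (1 + ‖p‖ + ‖η‖) := by
    nlinarith [norm_nonneg p, norm_nonneg η]
  have h4 : 0 < 1 + ‖p‖ + ‖η‖ := by positivity
  beta_reduce
  rw [← div_eq_mul_inv, le_div_iff₀ (by positivity)]
  calc _ ≤ gaussDensity t p η * (1 + ‖p‖ + ‖η‖) ^ k *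
        ((1 + M) * (1 + ‖p‖ + ‖η‖)) ^ (N + 1) := by
        have := gaussDensity_nonneg t p η
        gcongr
    _ = gaussDensity t p η * (1 + ‖p‖ + ‖η‖) ^ (k + (N + 1)) * (1 + M) ^ (N + 1) := by
        rw [mul_pow, pow_add]; ring
    _ ≤ _ := by gcongr; exact hCle p η

/-- The lattice sum may be differentiated term by term: on the unit ball around w the derivatives
are dominated by a summable sequence, by Gaussian decay. -/
theorem inner_gradient_kernel {t : ℝ} (ht : 0 < t) (x : Torus N) (v : Vel N) (y : Torus N)
    (w g : Vel N) : inner ℝ (gradient (fun w => kernel t x v y w) w) g =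
      ∑' ξ : {ξ : Vel N // toTorus ξ = x - y}, inner ℝ
        (gradDensity t (fluct t v (ξ, w)).1 (fluct t v (ξ, w)).2) g := by
  set ξ₀ := torusSection (x - y) with hξ₀
  let e := liftsEquiv ξ₀ (toTorus_torusSection (x - y))
  set a := 1 - Real.exp (-t) with ha
  set b := Real.exp (-t) with hb
  let F : (Fin N → ℤ) → Vel N → ℝ := fun n w =>
    gaussDensity t (ξ₀ + latVec n - a • w) (v - b • w)
  let F' : (Fin N → ℤ) → Vel N → Vel N →L[ℝ] ℝ := fun n w =>
    innerSL ℝ (gradDensity t (ξ₀ + latVec n - a • w) (v - b • w))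
  have hker : (fun w => kernel t x v y w) = fun w => ∑' n, F n w := by
    ext1 w
    rw [kernel, ← e.tsum_eq]
    rfl
  obtain ⟨u₀, hu₀, hu₀le⟩ := exists_summable_bound ht ξ₀ w 0
  obtain ⟨u₁, hu₁, hu₁le⟩ := exists_summable_bound ht ξ₀ w 1
  have hF' : ∀ n, ∀ w' ∈ Metric.ball w 1, ‖F' n w'‖ ≤ (|driftX t| + |driftV t|) * u₁ n := by
    intro n w' hw'
    rw [innerSL_apply_norm]
    refine (norm_gradDensity_le _ _ _).trans ?_
    have := hu₁le n w' hw' (v - b • w')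
    rw [pow_one] at this
    calc _ = (|driftX t| + |driftV t|) * (gaussDensity t (ξ₀ + latVec n - a • w') (v - b • w') *
          (1 + ‖ξ₀ + latVec n - a • w'‖ + ‖v - b • w'‖)) := by ring
      _ ≤ _ := by gcongr
  have hw : w ∈ Metric.ball w 1 := Metric.mem_ball_self one_pos
  have hF0 : Summable fun n => F n w := by
    refine Summable.of_nonneg_of_le (fun n => gaussDensity_nonneg _ _ _) (fun n => ?_) hu₀
    simpa using hu₀le n w hw (v - b • w)
  have hder : HasFDerivAt (fun w => ∑' n, F n w) (∑' n, F' n w) w :=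
    hasFDerivAt_tsum_of_isPreconnected (hu₁.mul_left _) Metric.isOpen_ball
      (convex_ball w 1).isPreconnected (fun n w' _ => hasFDerivAt_gaussDensity ht _ v w') hF' hw
      hF0 hw
  have hsum : Summable fun n => F' n w :=
    Summable.of_norm_bounded (hu₁.mul_left _) fun n => hF' n w hw
  rw [hker, gradient, InnerProductSpace.toDual_symm_apply, hder.fderiv,
    ← ContinuousLinearMap.apply_apply g (∑' n, F' n w), ContinuousLinearMap.map_tsum _ hsum,
    ← e.tsum_eq]
  rfl

/-- For a fixed endpoint (x, v), the starting point and the fluctuation determine one another. This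
is the change of variables between the kernel and the Gaussian average. -/
theorem backward_fluct (t : ℝ) (x : Torus N) (v : Vel N) (a : Vel N × Vel N) :
    backward t (fluct t v a) (x, v) = (x - toTorus a.1, a.2) := by
  have h1 : Real.exp t * Real.exp (-t) = 1 := by rw [← Real.exp_add]; simp
  simp only [backward, flow, fluct, toPhase, Prod.mk_sub_mk, neg_neg, sub_sub_cancel, smul_smul,
    h1, one_smul, sub_mul, one_mul]
  congr 1
  rw [toTorus_sub, sub_smul, one_smul, toTorus_sub, sub_smul, one_smul, toTorus_sub]
  abel

/-- With the two coordinates exchanged, the map is lower triangular with diagonal (e^{-t}, 1), up to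
a reflection and a translation; its Jacobian yields the factor e^{Nt} of the transport operators. -/
theorem map_fluct_volume (t : ℝ) (v : Vel N) :
    (volume : Measure (Vel N × Vel N)).map (fluct t v) =
      ENNReal.ofReal (Real.exp (N * t)) • volume := by
  have hcomp : fluct t v = (Prod.map id (fun η => v - η)) ∘ Prod.swap ∘
      (fun z : Vel N × Vel N => (Real.exp (-t) • z.1, (-(1 - Real.exp (-t))) • z.1 + (1 : ℝ) • z.2)) ∘
        Prod.swap := by
    ext1 a
    simp only [fluct, Function.comp_apply, Prod.map, Prod.swap, id, one_smul, neg_smul]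
    rw [neg_add_eq_sub]
  have h1 : MeasurePreserving (Prod.map id (fun η => v - η) : Vel N × Vel N → Vel N × Vel N)
      volume volume :=
    (MeasurePreserving.id (volume : Measure (Vel N))).prod
      (Measure.measurePreserving_sub_left (volume : Measure (Vel N)) v)
  have hs : MeasurePreserving (Prod.swap : Vel N × Vel N → Vel N × Vel N) volume volume :=
    Measure.measurePreserving_swap
  rw [hcomp, ← Measure.map_map h1.measurable (by fun_prop),
    ← Measure.map_map measurable_swap (by fun_prop), ← Measure.map_map (by fun_prop) measurable_swap,
    hs.map_eq, map_lowerTriangular_volume (Real.exp_pos _) one_pos, Measure.map_smul, hs.map_eq,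
    Measure.map_smul, h1.map_eq]
  congr 2
  rw [mul_one, ← Real.exp_nat_mul, ← Real.exp_neg]
  congr 1; ring

theorem measurable_gaussDensity (t : ℝ) :
    Measurable fun a : Vel N × Vel N => gaussDensity t a.1 a.2 := by
  unfold gaussDensity; fun_prop

/-- Integrals of lattice sums against the Gaussian density, as Gaussian averages. -/
theorem integral_tsum_gaussDensity {t : ℝ} (ht : 0 < t) (x : Torus N) (v : Vel N)
    {Φ : Vel N × Vel N → ℝ} (hΦ : Measurable Φ)
    (hint : Integrable (fun a => Real.exp (N * t) * Φ (gaussMap t a)) (gaussLaw N)) :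
    ∫ z : Phase N, ∑' ξ : {ξ : Vel N // toTorus ξ = x - z.1},
        gaussDensity t (fluct t v (ξ, z.2)).1 (fluct t v (ξ, z.2)).2 * Φ (fluct t v (ξ, z.2)) =
      ∫ a, Real.exp (N * t) * Φ (gaussMap t a) ∂(gaussLaw N) := by
  let Ψ : Vel N × Vel N → ℝ := fun a => gaussDensity t a.1 a.2 * Φ a
  have hΨm : Measurable Ψ := (measurable_gaussDensity t).mul hΦ
  have hfm : Measurable (fluct (N := N) t v) := by unfold fluct; fun_prop
  have h0 : Integrable (fun a => Φ (gaussMap t a)) (gaussLaw N) := by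
    refine (hint.const_mul (Real.exp (N * t))⁻¹).congr (Eventually.of_forall fun a => ?_)
    simp [(Real.exp_pos _).ne']
  have h1 : Integrable Φ ((gaussLaw N).map (gaussMap t)) :=
    (integrable_map_measure hΦ.aestronglyMeasurable (by fun_prop)).2 h0
  rw [map_gaussMap_eq_withDensity ht] at h1
  have h2 : Integrable Ψ := by
    rw [integrable_withDensity_iff_integrable_smul' (measurable_gaussDensity t).ennreal_ofReal
      (Eventually.of_forall fun _ => ENNReal.ofReal_lt_top)] at h1
    refine h1.congr (Eventually.of_forall fun a => ?_)
    simp only [Ψ, ENNReal.toReal_ofReal (gaussDensity_nonneg t a.1 a.2), smul_eq_mul]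
  have h3 : ∫ a, Ψ a = ∫ a, Φ (gaussMap t a) ∂(gaussLaw N) := by
    rw [← integral_map (f := Φ) (by fun_prop) hΦ.aestronglyMeasurable,
      map_gaussMap_eq_withDensity ht, integral_withDensity_eq_integral_toReal_smul
        (measurable_gaussDensity t).ennreal_ofReal
        (Eventually.of_forall fun _ => ENNReal.ofReal_lt_top)]
    refine integral_congr_ae (Eventually.of_forall fun a => ?_)
    simp only [Ψ, ENNReal.toReal_ofReal (gaussDensity_nonneg t a.1 a.2), smul_eq_mul]
  have h4 : Integrable (Ψ ∘ fluct t v) := by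
    rw [← integrable_map_measure hΨm.aestronglyMeasurable hfm.aemeasurable, map_fluct_volume]
    exact h2.smul_measure ENNReal.ofReal_ne_top
  have h5 := integral_tsum_lifts x h4
  have h6 : ∫ a, (Ψ ∘ fluct t v) a = Real.exp (N * t) * ∫ a, Ψ a := by
    have := integral_map (f := Ψ) (μ := volume) hfm.aemeasurable hΨm.aestronglyMeasurable
    rw [map_fluct_volume, integral_smul_measure, ENNReal.toReal_ofReal (Real.exp_pos _).le] at this
    exact this.symm
  rw [integral_const_mul, ← h3, ← h6, ← h5]
  rfl

theorem measurable_comp_backward {γ : Phase N → ℝ} (hγ : Measurable γ) (t : ℝ) (z : Phase N) :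
    Measurable fun a => γ (backward t a z) :=
  hγ.comp (continuous_backward.comp
    (by fun_prop : Continuous fun a : Vel N × Vel N => ((t, a), z))).measurable

/-- All lifts ξ of x - y, with their fluctuations, lead back to the same starting point z', so γ
factors out of the lattice sum; unfolding and the change of variables then produce the Gaussian law.
This is the pointwise counterpart of `kineticOp`. -/
theorem kernelOp_eq_integral {t : ℝ} (ht : 0 < t) {γ : Phase N → ℝ} (hγ : Measurable γ)
    (z : Phase N) (hint : Integrable (fun a => Real.exp (N * t) * γ (backward t (gaussMap t a) z))
      (gaussLaw N)) :
    kernelOp t γ z = ∫ a, Real.exp (N * t) * γ (backward t (gaussMap t a) z) ∂(gaussLaw N) := by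
  rw [kernelOp, if_neg ht.ne',
    ← integral_tsum_gaussDensity ht z.1 z.2 (measurable_comp_backward hγ t z) hint]
  refine integral_congr_ae (Eventually.of_forall fun z' => ?_)
  simp only [kernel, ← tsum_mul_right]
  refine tsum_congr fun ξ => ?_
  have h1 : backward t (fluct t z.2 (ξ, z'.2)) z = z' := by
    have h2 := backward_fluct t z.1 z.2 (ξ.1, z'.2)
    rw [ξ.2, sub_sub_cancel] at h2
    exact h2
  rw [h1]
  rfl

/-- The velocity score. -/
theorem drift_gaussMap {t : ℝ} (ht : 0 < t) (a : Vel N × Vel N) (i : Fin N) :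
    driftX t * (gaussMap t a).1 i + driftV t * (gaussMap t a).2 i =
      affScore 0 (scoreDir t (torusDir i)) a := by
  have h1 : ∀ u : Vel N, inner ℝ (torusDir i) u = u i := fun u => by
    simp [torusDir, EuclideanSpace.inner_single_left]
  simp only [gaussMap_apply, affScore, scoreDir, inner_smul_left, h1, RCLike.conj_to_real,
    PiLp.smul_apply, PiLp.add_apply, smul_eq_mul, zero_add]
  rw [← driftX_mul_cholR_add ht, ← driftV_mul_cholD ht]
  ring

/-- The same unfolding with the logarithmic derivative of the density, which `drift_gaussMap`
identifies with the score. The field g is only required to agree almost everywhere with measurable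
functions, since the force and the solution are classes. -/
theorem gradKernelOp_eq_integral {t : ℝ} (ht : 0 < t) {g : Phase N → Vel N}
    {γ : Fin N → Phase N → ℝ} (hγ : ∀ i, Measurable (γ i)) (hg : ∀ᵐ z, ∀ i, g z i = γ i z)
    (z : Phase N) (hint : ∀ i, Integrable (fun a => affScore 0 (scoreDir t (torusDir i)) a *
      (Real.exp (N * t) * γ i (backward t (gaussMap t a) z))) (gaussLaw N)) :
    gradKernelOp t g z = ∑ i, ∫ a, affScore 0 (scoreDir t (torusDir i)) a *
      (Real.exp (N * t) * γ i (backward t (gaussMap t a) z)) ∂(gaussLaw N) := by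
  let Φ : Vel N × Vel N → ℝ := fun a =>
    ∑ i, (driftX t * a.1 i + driftV t * a.2 i) * γ i (backward t a z)
  have hΦ : Measurable Φ := by
    refine Finset.measurable_sum _ fun i _ => Measurable.mul (by fun_prop) ?_
    exact measurable_comp_backward (hγ i) t z
  have hΦ' : ∀ a, Real.exp (N * t) * Φ (gaussMap t a) =
      ∑ i, affScore 0 (scoreDir t (torusDir i)) a *
        (Real.exp (N * t) * γ i (backward t (gaussMap t a) z)) := fun a => by
    simp only [Φ, drift_gaussMap ht, Finset.mul_sum]
    exact Finset.sum_congr rfl fun i _ => by ring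
  have hint' : Integrable (fun a => Real.exp (N * t) * Φ (gaussMap t a)) (gaussLaw N) := by
    simp only [hΦ']
    exact integrable_finsetSum _ fun i _ => hint i
  rw [← integral_finsetSum _ fun i _ => hint i]
  simp only [← hΦ']
  rw [gradKernelOp, ← integral_tsum_gaussDensity ht z.1 z.2 hΦ hint']
  refine integral_congr_ae ?_
  filter_upwards [hg] with z' hz'
  simp only [inner_gradient_kernel ht]
  refine tsum_congr fun ξ => ?_
  have h1 : backward t (fluct t z.2 (ξ, z'.2)) z = z' := by
    have h2 := backward_fluct t z.1 z.2 (ξ.1, z'.2)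
    rw [ξ.2, sub_sub_cancel] at h2
    exact h2
  simp only [Φ, h1, gradDensity, inner_smul_left, RCLike.conj_to_real]
  congr 1
  simp only [PiLp.inner_apply, PiLp.add_apply, PiLp.smul_apply, smul_eq_mul, hz',
    RCLike.inner_apply, RCLike.conj_to_real]
  exact Finset.sum_congr rfl fun i _ => by ring

end Kernel

/-! ### Jointly measurable representatives -/

section JointRep

variable {Ω α : Type*} [MeasurableSpace Ω] [MeasurableSpace α] {μ : Measure Ω} {ν : Measure α}
  {p : ℝ≥0∞} [Fact (1 ≤ p)]

theorem ae_prod_of_ae_fst [SFinite ν] {P : Ω → Prop} (h : ∀ᵐ o ∂μ, P o) :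
    ∀ᵐ q ∂(μ.prod ν), P q.1 :=
  Measure.quasiMeasurePreserving_fst.ae h

/-- Representatives chosen separately for each o need not be jointly measurable. Since r has almost
surely a separable range, it is approximated within 2^{-n} by a measurable selection from a
countable family; the geometric rate forces almost everywhere convergence of the approximations. -/
theorem exists_measurable_rep {r : Ω → Lp ℝ p ν} (hr : AEStronglyMeasurable r μ) :
    ∃ F : Ω × α → ℝ, Measurable F ∧ ∀ᵐ o ∂μ, ∀ᵐ z ∂ν, F (o, z) = r o z := by
  obtain ⟨r', hr', hrr'⟩ := hr
  rcases isEmpty_or_nonempty Ω with hΩ | ⟨⟨o₀⟩⟩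
  · exact ⟨fun _ => 0, measurable_const, Eventually.of_forall fun o => (hΩ.false o).elim⟩
  obtain ⟨c, hc, hcl⟩ := hr'.isSeparable_range
  have hcne : c.Nonempty := by
    rw [← closure_nonempty_iff]; exact ⟨r' o₀, hcl (mem_range_self o₀)⟩
  obtain ⟨d, rfl⟩ := hc.exists_eq_range hcne
  have hex : ∀ (n : ℕ) (o : Ω), ∃ k, dist (r' o) (d k) < (1 / 2) ^ n := fun n o => by
    obtain ⟨_, ⟨k, rfl⟩, hk⟩ := Metric.mem_closure_iff.1 (hcl (mem_range_self o)) ((1 / 2) ^ n)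
      (by positivity)
    exact ⟨k, hk⟩
  classical
  let κ : ℕ → Ω → ℕ := fun n o => Nat.find (hex n o)
  have hκ : ∀ n, Measurable (κ n) := fun n => measurable_find (hex n) fun k =>
    measurableSet_lt (hr'.dist stronglyMeasurable_const).measurable measurable_const
  let F : ℕ → Ω × α → ℝ := fun n q => d (κ n q.1) q.2
  have hF : ∀ n, Measurable (F n) := fun n => by
    have h1 : Measurable fun q : ℕ × α => d q.1 q.2 :=
      measurable_from_prod_countable_right fun k => (Lp.stronglyMeasurable (d k)).measurable
    exact h1.comp (((hκ n).comp measurable_fst).prodMk measurable_snd)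
  -- The limsup is measurable everywhere and equals the limit wherever the limit exists.
  refine ⟨fun q => limsup (fun n => F n q) atTop, Measurable.limsup hF, ?_⟩
  filter_upwards [hrr'] with o ho
  have hd : ∀ n, ‖r' o - d (κ n o)‖ < (1 / 2) ^ n := fun n => by
    rw [← dist_eq_norm]; exact Nat.find_spec (hex n o)
  have hlim : Tendsto (fun n => d (κ n o)) atTop (𝓝 (r' o)) := by
    rw [tendsto_iff_norm_sub_tendsto_zero]
    refine squeeze_zero (fun _ => norm_nonneg _) (fun n => ?_)
      (tendsto_pow_atTop_nhds_zero_of_lt_one (by norm_num) (by norm_num : (1 / 2 : ℝ) < 1))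
    rw [norm_sub_rev]; exact (hd n).le
  obtain ⟨ns, hns, hae⟩ := (tendstoInMeasure_of_tendsto_Lp hlim).exists_seq_tendsto_ae
  have hcau : ∀ᵐ z ∂ν, ∃ l, Tendsto (fun n => d (κ n o) z) atTop (𝓝 l) := by
    refine Lp.ae_tendsto_of_cauchy_eLpNorm (p := p) (fun n => Lp.aestronglyMeasurable _) Fact.out
      (B := fun n => 4 * 2⁻¹ ^ n) ?_ fun n₀ n m hn hm => ?_
    · rw [ENNReal.tsum_mul_left, ENNReal.tsum_geometric, ENNReal.one_sub_inv_two, inv_inv]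
      norm_num
    · have h1 : eLpNorm (⇑(d (κ n o)) - ⇑(d (κ m o))) p ν = ‖d (κ n o) - d (κ m o)‖ₑ := by
        rw [Lp.enorm_def]; exact eLpNorm_congr_ae (Lp.coeFn_sub _ _).symm
      have h2 : ‖d (κ n o) - d (κ m o)‖ < 4 * (1 / 2) ^ n₀ := by
        have h3 : d (κ n o) - d (κ m o) = (r' o - d (κ m o)) - (r' o - d (κ n o)) := by abel
        have h4 : ∀ j, n₀ ≤ j → ((1 / 2 : ℝ)) ^ j ≤ (1 / 2) ^ n₀ := fun j hj =>
          pow_le_pow_of_le_one (by norm_num) (by norm_num) hj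
        have h5 : (0 : ℝ) < (1 / 2) ^ n₀ := by positivity
        rw [h3]
        linarith [norm_sub_le (r' o - d (κ m o)) (r' o - d (κ n o)), hd n, hd m, h4 n hn, h4 m hm]
      rw [h1, ← ofReal_norm]
      refine ((ENNReal.ofReal_lt_ofReal_iff (by positivity)).2 h2).trans_le (le_of_eq ?_)
      rw [ENNReal.ofReal_mul (by norm_num), ENNReal.ofReal_pow (by norm_num),
        one_div, ENNReal.ofReal_inv_of_pos two_pos, ENNReal.ofReal_ofNat, ENNReal.ofReal_ofNat]
  filter_upwards [hae, hcau] with z h1 h2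
  obtain ⟨l, hl⟩ := h2
  have h3 : l = r' o z := tendsto_nhds_unique (hl.comp hns.tendsto_atTop) h1
  rw [ho, ← h3]
  exact hl.limsup_eq

end JointRep

/-! ### The operators of the mild formulation as operators on `L^p` -/

section Bridge

variable {N : ℕ} {p : ℝ≥0∞} [Fact (1 ≤ p)] [Fact (p ≠ ⊤)]

theorem kernelOp_ae {t : ℝ} (ht : 0 ≤ t) (f : State N p) :
    ∀ᵐ z : Phase N, kernelOp t f z = kineticOp p t f z := by
  rcases ht.eq_or_lt with rfl | ht
  · exact Eventually.of_forall fun z => by rw [kernelOp, if_pos rfl, kineticOp_zero]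
  have hm : Measurable fun q : (Vel N × Vel N) × Phase N =>
      Real.exp (N * t) * f (backward t (gaussMap t q.1) q.2) := by
    refine Measurable.const_mul ((Lp.stronglyMeasurable f).measurable.comp ?_) _
    exact (continuous_backward.comp (by fun_prop : Continuous fun q : (Vel N × Vel N) × Phase N =>
      ((t, gaussMap t q.1), q.2))).measurable
  have h := integral_Lp_ae_eq (μ := gaussLaw N) (integrable_kineticOp t f)
    (h := fun a z => Real.exp (N * t) * f (backward t (gaussMap t a) z)) hm.aestronglyMeasurable
    (Eventually.of_forall fun a => (coeFn_transport t (gaussMap t a) f).symm)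
  filter_upwards [h] with z hz
  rw [kernelOp_eq_integral ht (Lp.stronglyMeasurable f).measurable z hz.1, hz.2, kineticOp_apply]

theorem continuous_transport_uncurry : Continuous fun q : (ℝ × (Vel N × Vel N)) × State N p =>
    transport p q.1.1 q.1.2 q.2 := by
  rw [continuous_iff_continuousAt]
  rintro ⟨c₀, f₀⟩
  rw [ContinuousAt, tendsto_iff_norm_sub_tendsto_zero]
  have h1 : Continuous fun q : (ℝ × (Vel N × Vel N)) × State N p =>
      Real.exp (N * |q.1.1|) * ‖q.2 - f₀‖ +
        ‖transport p q.1.1 q.1.2 f₀ - transport p c₀.1 c₀.2 f₀‖ := by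
    refine Continuous.add (by fun_prop) (Continuous.norm (Continuous.sub ?_ continuous_const))
    exact (continuous_transport Fact.out f₀).comp continuous_fst
  have h2 := h1.tendsto (c₀, f₀)
  simp only [sub_self, norm_zero, mul_zero, add_zero] at h2
  refine squeeze_zero (fun _ => norm_nonneg _) (fun q => ?_) h2
  have h3 : transport p q.1.1 q.1.2 q.2 - transport p c₀.1 c₀.2 f₀ =
      transport p q.1.1 q.1.2 (q.2 - f₀) +
        (transport p q.1.1 q.1.2 f₀ - transport p c₀.1 c₀.2 f₀) := by
    rw [map_sub]; abel
  simp only [h3]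
  exact (norm_add_le _ _).trans (add_le_add (norm_transport_apply_le _ _ _) le_rfl)

theorem measurable_cholR : Measurable cholR := by
  unfold cholR; exact continuous_covXX.sqrt.measurable

theorem measurable_cholQ : Measurable cholQ := by
  unfold cholQ; exact continuous_covXV.measurable.div continuous_covXX.sqrt.measurable

theorem measurable_cholD : Measurable cholD := by
  unfold cholD
  exact (continuous_covDet.measurable.div continuous_covXX.measurable).sqrt

theorem measurable_scoreA : Measurable scoreA := by
  unfold scoreA; exact Measurable.div (by fun_prop) measurable_cholR

theorem measurable_scoreB : Measurable scoreB := by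
  unfold scoreB
  exact Measurable.div (Measurable.sub (by fun_prop) (measurable_cholQ.mul measurable_scoreA))
    measurable_cholD

theorem measurable_gaussMap_uncurry :
    Measurable fun q : ℝ × (Vel N × Vel N) => gaussMap q.1 q.2 := by
  simp only [gaussMap_apply]
  exact ((measurable_cholR.comp measurable_fst).smul (by fun_prop)).prodMk
    (((measurable_cholQ.comp measurable_fst).smul (by fun_prop)).add
      ((measurable_cholD.comp measurable_fst).smul (by fun_prop)))

theorem measurable_affScore_uncurry (e : Vel N) :
    Measurable fun q : ℝ × (Vel N × Vel N) => affScore 0 (scoreDir q.1 e) q.2 := by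
  simp only [affScore, scoreDir, inner_smul_left, RCLike.conj_to_real, zero_add]
  exact ((measurable_scoreA.comp measurable_fst).mul (by fun_prop)).add
    ((measurable_scoreB.comp measurable_fst).mul (by fun_prop))

theorem measurable_prodMk_shift (t : ℝ) : Measurable fun q : ℝ × (Vel N × Vel N) =>
    ((t - q.1, q.2) : ℝ × (Vel N × Vel N)) :=
  (measurable_const.sub measurable_fst).prodMk measurable_snd

theorem measurable_gaussMap_shift (t : ℝ) :
    Measurable fun q : ℝ × (Vel N × Vel N) => gaussMap (t - q.1) q.2 :=
  Measurable.comp (g := fun q : ℝ × (Vel N × Vel N) => gaussMap q.1 q.2)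
    (f := fun q : ℝ × (Vel N × Vel N) => ((t - q.1, q.2) : ℝ × (Vel N × Vel N)))
    measurable_gaussMap_uncurry (measurable_prodMk_shift t)

theorem measurable_affScore_shift (t : ℝ) (e : Vel N) :
    Measurable fun q : ℝ × (Vel N × Vel N) => affScore 0 (scoreDir (t - q.1) e) q.2 :=
  Measurable.comp (g := fun q : ℝ × (Vel N × Vel N) => affScore 0 (scoreDir q.1 e) q.2)
    (f := fun q : ℝ × (Vel N × Vel N) => ((t - q.1, q.2) : ℝ × (Vel N × Vel N)))
    (measurable_affScore_uncurry e) (measurable_prodMk_shift t)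

theorem aestronglyMeasurable_transport_gaussMap (t : ℝ) {r : ℝ → State N p} {μ : Measure ℝ} [SFinite μ]
    (hr : AEStronglyMeasurable r μ) : AEStronglyMeasurable (fun q : ℝ × (Vel N × Vel N) =>
      transport p (t - q.1) (gaussMap (t - q.1) q.2) (r q.1)) (μ.prod (gaussLaw N)) := by
  have h0 : Measurable (fun q : ℝ × (Vel N × Vel N) =>
      ((t - q.1, gaussMap (t - q.1) q.2) : ℝ × (Vel N × Vel N))) :=
    (measurable_const.sub measurable_fst).prodMk (measurable_gaussMap_shift t)
  have h1 : AEStronglyMeasurable (fun q : ℝ × (Vel N × Vel N) => r q.1) (μ.prod (gaussLaw N)) :=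
    hr.comp_fst
  have h2 : AEStronglyMeasurable (fun q : ℝ × (Vel N × Vel N) =>
      (((t - q.1, gaussMap (t - q.1) q.2), r q.1) : (ℝ × (Vel N × Vel N)) × State N p))
      (μ.prod (gaussLaw N)) := h0.aestronglyMeasurable.prodMk h1
  exact Continuous.comp_aestronglyMeasurable
    (g := fun q : (ℝ × (Vel N × Vel N)) × State N p => transport p q.1.1 q.1.2 q.2)
    (f := fun q : ℝ × (Vel N × Vel N) => ((t - q.1, gaussMap (t - q.1) q.2), r q.1))
    continuous_transport_uncurry h2

/-- The Volterra integral of `dirKineticOp`, computed pointwise. -/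
theorem integral_dirKineticOp_ae {t : ℝ} (ht : 0 ≤ t) (e : Vel N) {r : ℝ → State N p}
    (hr : AEStronglyMeasurable r (volume.restrict (Ioc 0 t))) {B : ℝ}
    (hB : ∀ s ∈ Icc 0 t, ‖r s‖ ≤ B) {F : ℝ × Phase N → ℝ} (hF : Measurable F)
    (hFr : ∀ᵐ s ∂(volume.restrict (Ioc 0 t)), ∀ᵐ z, F (s, z) = r s z) :
    Integrable (fun s => dirKineticOp p (t - s) e (r s)) (volume.restrict (Ioc 0 t)) ∧
    ∀ᵐ z : Phase N, Integrable (fun q : ℝ × (Vel N × Vel N) => affScore 0 (scoreDir (t - q.1) e) q.2 *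
        (Real.exp (N * (t - q.1)) * F (q.1, backward (t - q.1) (gaussMap (t - q.1) q.2) z)))
        ((volume.restrict (Ioc 0 t)).prod (gaussLaw N)) ∧
      ∫ q : ℝ × (Vel N × Vel N), affScore 0 (scoreDir (t - q.1) e) q.2 *
        (Real.exp (N * (t - q.1)) * F (q.1, backward (t - q.1) (gaussMap (t - q.1) q.2) z))
        ∂((volume.restrict (Ioc 0 t)).prod (gaussLaw N)) =
      (∫ s in Ioc 0 t, dirKineticOp p (t - s) e (r s) : State N p) z := by
  have hB0 : 0 ≤ B := (norm_nonneg _).trans (hB 0 ⟨le_rfl, ht⟩)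
  let H : ℝ × (Vel N × Vel N) → State N p := fun q =>
    affScore 0 (scoreDir (t - q.1) e) q.2 • transport p (t - q.1) (gaussMap (t - q.1) q.2) (r q.1)
  have hsm := measurable_affScore_shift t e
  have hgm := measurable_gaussMap_shift (N := N) t
  have hHm : AEStronglyMeasurable H ((volume.restrict (Ioc 0 t)).prod (gaussLaw N)) :=
    hsm.aestronglyMeasurable.smul (aestronglyMeasurable_transport_gaussMap t hr)
  have hH : Integrable H ((volume.restrict (Ioc 0 t)).prod (gaussLaw N)) := by
    have h1 : Integrable (fun s => (t - s) ^ (-(1 / 2) : ℝ)) (volume.restrict (Ioc 0 t)) :=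
      (intervalIntegrable_iff_integrableOn_Ioc_of_le ht).1 (intervalIntegrable_singular t)
    refine Integrable.mono' ((h1.mul_prod (integrable_norm_gaussLaw N)).const_mul
      (2 * √(2 * Real.exp t) * ‖e‖ * (Real.exp (N * t) * B))) hHm ?_
    have h2 : ∀ᵐ s ∂(volume.restrict (Ioc 0 t)), s ∈ Ioo 0 t := by
      rw [← restrict_Ioo_eq_restrict_Ioc]; exact ae_restrict_mem measurableSet_Ioo
    have h3 : ∀ᵐ q ∂((volume.restrict (Ioc 0 t)).prod (gaussLaw N)), q.1 ∈ Ioo 0 t :=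
      ae_prod_of_ae_fst h2
    filter_upwards [h3] with q hq
    refine (norm_affScore_smul_transport_le _ _ _ _ _ _).trans ?_
    have h4 : t - q.1 ∈ Ioc 0 t := ⟨sub_pos.2 hq.2, by linarith [hq.1]⟩
    have h5 := score_le h4
    simp only [scoreDir, norm_smul, Real.norm_eq_abs, abs_zero, zero_add, abs_of_pos h4.1]
    calc _ = (|scoreA (t - q.1)| + |scoreB (t - q.1)|) * (‖e‖ * ‖q.2‖) *
          (Real.exp (N * (t - q.1)) * ‖r q.1‖) := by ring
      _ ≤ (2 * √(2 * Real.exp t) * (t - q.1) ^ (-(1 / 2) : ℝ)) * (‖e‖ * ‖q.2‖) *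
          (Real.exp (N * t) * B) := by
        have h6 : Real.exp (N * (t - q.1)) ≤ Real.exp (N * t) := by gcongr; exact h4.2
        have h7 : 0 ≤ (t - q.1) ^ (-(1 / 2) : ℝ) := Real.rpow_nonneg h4.1.le _
        exact mul_le_mul (mul_le_mul_of_nonneg_right h5 (by positivity))
          (mul_le_mul h6 (hB _ ⟨hq.1.le, hq.2.le⟩) (norm_nonneg _) (Real.exp_pos _).le)
          (by positivity) (by positivity)
      _ = _ := by ring
  have hslice : ∀ s, ∫ a, H (s, a) ∂(gaussLaw N) = dirKineticOp p (t - s) e (r s) := fun s => rfl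
  have hhm : Measurable fun o : (ℝ × (Vel N × Vel N)) × Phase N =>
      affScore 0 (scoreDir (t - o.1.1) e) o.1.2 * (Real.exp (N * (t - o.1.1)) *
        F (o.1.1, backward (t - o.1.1) (gaussMap (t - o.1.1) o.1.2) o.2)) := by
    have h0 : Measurable fun o : (ℝ × (Vel N × Vel N)) × Phase N => t - o.1.1 :=
      measurable_const.sub (measurable_fst.comp measurable_fst)
    have h1 : Measurable fun o : (ℝ × (Vel N × Vel N)) × Phase N =>
        (((t - o.1.1, gaussMap (t - o.1.1) o.1.2), o.2) : (ℝ × (Vel N × Vel N)) × Phase N) :=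
      (h0.prodMk (hgm.comp measurable_fst)).prodMk measurable_snd
    have h2 := Measurable.comp
      (g := fun q : (ℝ × (Vel N × Vel N)) × Phase N => backward q.1.1 q.1.2 q.2)
      continuous_backward.measurable h1
    exact (hsm.comp measurable_fst).mul (((h0.const_mul _).exp).mul
      (hF.comp ((measurable_fst.comp measurable_fst).prodMk h2)))
  have hae : ∀ᵐ q ∂((volume.restrict (Ioc 0 t)).prod (gaussLaw N)), (fun z : Phase N =>
      affScore 0 (scoreDir (t - q.1) e) q.2 * (Real.exp (N * (t - q.1)) *
        F (q.1, backward (t - q.1) (gaussMap (t - q.1) q.2) z))) =ᵐ[volume] H q := by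
    have h1 : ∀ᵐ q ∂((volume.restrict (Ioc 0 t)).prod (gaussLaw N)),
        ∀ᵐ z, F (q.1, z) = r q.1 z := ae_prod_of_ae_fst hFr
    filter_upwards [h1] with q hq
    filter_upwards [(quasiMeasurePreserving_backward (t - q.1) (gaussMap (t - q.1) q.2)).ae hq,
      coeFn_transport (t - q.1) (gaussMap (t - q.1) q.2) (r q.1),
      Lp.coeFn_smul (affScore 0 (scoreDir (t - q.1) e) q.2)
        (transport p (t - q.1) (gaussMap (t - q.1) q.2) (r q.1))] with z h2 h3 h4
    rw [h4, Pi.smul_apply, h3, h2, smul_eq_mul]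
  have hmain := integral_Lp_ae_eq hH (h := fun q z =>
    affScore 0 (scoreDir (t - q.1) e) q.2 * (Real.exp (N * (t - q.1)) *
      F (q.1, backward (t - q.1) (gaussMap (t - q.1) q.2) z))) hhm.aestronglyMeasurable hae
  refine ⟨hH.integral_prod_left, ?_⟩
  rw [integral_prod H hH] at hmain
  simp only [hslice] at hmain
  exact hmain

/-- The time integral of the mild formulation, computed pointwise and in `L^p`. -/
theorem integral_gradKernelOp_ae {t : ℝ} (ht : 0 ≤ t) {r : ℝ → Fin N → State N p}
    (hr : AEStronglyMeasurable r (volume.restrict (Ioc 0 t))) {B : ℝ}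
    (hB : ∀ s ∈ Icc 0 t, ‖r s‖ ≤ B) {g : ℝ → Phase N → Vel N}
    (hg : ∀ s ∈ Ioc 0 t, ∀ i, ∀ᵐ z, g s z i = r s i z) :
    ∀ᵐ z : Phase N, IntervalIntegrable (fun s => gradKernelOp (t - s) (g s) z) volume 0 t ∧
      ∫ s in (0 : ℝ)..t, gradKernelOp (t - s) (g s) z =
        (∫ s in (0 : ℝ)..t, gradOp p (t - s) (r s) : State N p) z := by
  have hri : ∀ i, AEStronglyMeasurable (fun s => r s i) (volume.restrict (Ioc 0 t)) := fun i =>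
    (continuous_apply i).comp_aestronglyMeasurable hr
  -- Joint measurability in time and phase space is needed to apply Fubini to the time integral and
  -- the Gaussian average together.
  choose F hF hFr using fun i => exists_measurable_rep (hri i)
  have hdir := fun i => integral_dirKineticOp_ae ht (torusDir i) (hri i)
    (fun s hs => (norm_le_pi_norm _ i).trans (hB s hs)) (hF i) (hFr i)
  have hsum : (∫ s in (0 : ℝ)..t, gradOp p (t - s) (r s) : State N p) =
      ∑ i, ∫ s in Ioc 0 t, dirKineticOp p (t - s) (torusDir i) (r s i) := by
    rw [intervalIntegral.integral_of_le ht, ← integral_finsetSum _ fun i _ => (hdir i).1]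
    simp only [gradOp_apply]
  have hcoe : ∀ᵐ z : Phase N, (∫ s in (0 : ℝ)..t, gradOp p (t - s) (r s) : State N p) z =
      ∑ i, (∫ s in Ioc 0 t, dirKineticOp p (t - s) (torusDir i) (r s i) : State N p) z := by
    rw [hsum]
    filter_upwards [Lp.coeFn_finsetSum Finset.univ fun i =>
      (∫ s in Ioc 0 t, dirKineticOp p (t - s) (torusDir i) (r s i) : State N p)] with z hz
    rw [hz, Finset.sum_apply]
  have hae : ∀ᵐ z : Phase N, ∀ i, _ := ae_all_iff.2 fun i => (hdir i).2
  filter_upwards [hcoe, hae] with z hz hi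
  have hslice : ∀ᵐ s ∂(volume.restrict (Ioc 0 t)), gradKernelOp (t - s) (g s) z =
      ∑ i, ∫ a, affScore 0 (scoreDir (t - s) (torusDir i)) a * (Real.exp (N * (t - s)) *
        F i (s, backward (t - s) (gaussMap (t - s) a) z)) ∂(gaussLaw N) := by
    have h1 : ∀ᵐ s ∂(volume.restrict (Ioc 0 t)), ∀ i, Integrable (fun a =>
        affScore 0 (scoreDir (t - s) (torusDir i)) a * (Real.exp (N * (t - s)) *
        F i (s, backward (t - s) (gaussMap (t - s) a) z))) (gaussLaw N) :=
      ae_all_iff.2 fun i => (hi i).1.prod_right_ae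
    have h2 : ∀ᵐ s ∂(volume.restrict (Ioc 0 t)), s ∈ Ioo 0 t := by
      rw [← restrict_Ioo_eq_restrict_Ioc]; exact ae_restrict_mem measurableSet_Ioo
    filter_upwards [h1, h2, ae_all_iff.2 hFr] with s h3 h4 h5
    refine gradKernelOp_eq_integral (sub_pos.2 h4.2) (γ := fun i z => F i (s, z))
      (fun i => (hF i).comp (by fun_prop)) ?_ z h3
    refine ae_all_iff.2 fun i => ?_
    filter_upwards [h5 i, hg s ⟨h4.1, h4.2.le⟩ i] with z' h6 h7
    rw [h7, h6]
  have hint : ∀ i, Integrable (fun s => ∫ a, affScore 0 (scoreDir (t - s) (torusDir i)) a *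
      (Real.exp (N * (t - s)) * F i (s, backward (t - s) (gaussMap (t - s) a) z)) ∂(gaussLaw N))
      (volume.restrict (Ioc 0 t)) := fun i => (hi i).1.integral_prod_left
  constructor
  · rw [intervalIntegrable_iff_integrableOn_Ioc_of_le ht]
    exact (integrable_finsetSum _ fun i _ => hint i).congr (hslice.mono fun s hs => hs.symm)
  · rw [hz, intervalIntegral.integral_of_le ht, integral_congr_ae hslice,
      integral_finsetSum _ fun i _ => hint i]
    refine Finset.sum_congr rfl fun i _ => ?_
    rw [← (hi i).2, integral_prod _ (hi i).1]

end Bridge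

/-! ### Fourier series on the torus -/

section Fourier

variable {N : ℕ}

open UnitAddTorus Complex

/-- The factor by which the translation by `b` acts on the `n`-th character. -/
def character (n : Fin N → ℤ) (b : Vel N) : ℂ :=
  Complex.exp ((2 * Real.pi * inner ℝ (latVec n) b : ℝ) * I)

theorem norm_character (n : Fin N → ℤ) (b : Vel N) : ‖character n b‖ = 1 :=
  norm_exp_ofReal_mul_I _

theorem mFourier_add_toTorus (n : Fin N → ℤ) (x : Torus N) (b : Vel N) :
    mFourier n (x + toTorus b) = character n b * mFourier n x := by
  simp only [mFourier, ContinuousMap.coe_mk, character, Pi.add_apply]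
  have h : ∀ i, fourier (n i) (x i + toTorus b i) =
      Complex.exp ((2 * Real.pi * (n i * b i) : ℝ) * I) * fourier (n i) (x i) := fun i => by
    rw [fourier_apply, smul_add, AddCircle.toCircle_add, Circle.coe_mul, ← fourier_apply,
      ← fourier_apply, mul_comm]
    congr 1
    rw [toTorus, fourier_coe_apply]
    congr 1
    push_cast
    ring
  rw [Finset.prod_congr rfl fun i _ => h i, Finset.prod_mul_distrib, ← Complex.exp_sum]
  congr 2
  rw [← Finset.sum_mul, PiLp.inner_apply, Finset.mul_sum]
  push_cast
  congr 1
  refine Finset.sum_congr rfl fun i _ => ?_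
  simp [latVec_apply]
  ring

theorem norm_mFourier_apply (n : Fin N → ℤ) (x : Torus N) : ‖mFourier n x‖ = 1 := by
  simp only [mFourier, ContinuousMap.coe_mk, fourier_apply, norm_prod, Circle.norm_coe,
    Finset.prod_const_one]

/-- An integrable function which is orthogonal to the continuous functions vanishes. -/
theorem ae_eq_zero_of_integral_mul_continuous {f : Torus N → ℝ} (hf : Integrable f)
    (h : ∀ φ : C(Torus N, ℝ), ∫ x, f x * φ x = 0) : f =ᵐ[volume] 0 := by
  refine ae_eq_zero_of_forall_setIntegral_isClosed_eq_zero hf fun s hs => ?_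
  have h1 : ∀ n, ∫ x, f x * (hs.apprSeq n x : ℝ) = 0 := fun n =>
    h ⟨fun x => (hs.apprSeq n x : ℝ), by fun_prop⟩
  have h2 : Tendsto (fun n => ∫ x, f x * (hs.apprSeq n x : ℝ)) atTop
      (𝓝 (∫ x, f x * s.indicator (fun _ => (1 : ℝ)) x)) := by
    refine tendsto_integral_of_dominated_convergence (fun x => ‖f x‖) (fun n => ?_) hf.norm
      (fun n => ae_of_all _ fun x => ?_) (ae_of_all _ fun x => ?_)
    · exact hf.1.mul (by fun_prop : Continuous fun x => (hs.apprSeq n x : ℝ)).aestronglyMeasurable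
    · rw [norm_mul]
      refine mul_le_of_le_one_right (norm_nonneg _) ?_
      rw [Real.norm_of_nonneg (NNReal.coe_nonneg _)]
      exact_mod_cast HasOuterApproxClosed.apprSeq_apply_le_one hs n x
    · have h3 := tendsto_pi_nhds.1 (HasOuterApproxClosed.tendsto_apprSeq hs) x
      have h4 := (NNReal.tendsto_coe.2 h3).const_mul (f x)
      convert h4 using 2
      by_cases hx : x ∈ s <;> simp [hx]
  have h5 := tendsto_nhds_unique h2 (by simp only [h1]; exact tendsto_const_nhds)
  rw [← h5, ← integral_indicator hs.measurableSet]
  refine integral_congr_ae (ae_of_all _ fun x => ?_)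
  by_cases hx : x ∈ s <;> simp [hx]

/-- An integrable function is determined by its Fourier coefficients. -/
theorem ae_eq_zero_of_integral_mul_mFourier {f : Torus N → ℝ} (hf : Integrable f)
    (h : ∀ n, ∫ x, (f x : ℂ) * mFourier n x = 0) : f =ᵐ[volume] 0 := by
  have hint : ∀ φ : C(Torus N, ℂ), Integrable fun x => (f x : ℂ) * φ x := fun φ =>
    hf.ofReal.mul_bdd (c := ‖φ‖) φ.continuous.aestronglyMeasurable
      (ae_of_all _ fun x => φ.norm_coe_le_norm x)
  let L : C(Torus N, ℂ) →ₗ[ℂ] ℂ :=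
    { toFun := fun φ => ∫ x, (f x : ℂ) * φ x
      map_add' := fun φ ψ => by
        rw [← integral_add (hint φ) (hint ψ)]
        exact integral_congr_ae (ae_of_all _ fun x => by simp [mul_add])
      map_smul' := fun c φ => by
        rw [RingHom.id_apply, smul_eq_mul, ← integral_const_mul]
        exact integral_congr_ae (ae_of_all _ fun x => by simp; ring) }
  let L' : C(Torus N, ℂ) →L[ℂ] ℂ := L.mkContinuous (∫ x, ‖f x‖) fun φ => by
    refine (norm_integral_le_integral_norm _).trans ?_
    rw [← integral_mul_const]
    refine integral_mono (hint φ).norm (hf.norm.mul_const _) fun x => ?_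
    simp only [norm_mul, Complex.norm_real]
    exact mul_le_mul_of_nonneg_left (φ.norm_coe_le_norm x) (norm_nonneg _)
  have hL : L' = 0 := by
    refine ContinuousLinearMap.ext_on
      (s := range (mFourier (d := Fin N))) ?_ ?_
    · rw [Submodule.dense_iff_topologicalClosure_eq_top]
      exact span_mFourier_closure_eq_top
    · rintro _ ⟨n, rfl⟩
      exact h n
  refine ae_eq_zero_of_integral_mul_continuous hf fun φ => ?_
  have h1 : L' ⟨fun x => (φ x : ℂ), by fun_prop⟩ = 0 := by rw [hL]; rfl
  have h2 : ∫ x, (f x : ℂ) * (φ x : ℂ) = 0 := h1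
  have h3 : ∫ x, ((f x * φ x : ℝ) : ℂ) = 0 := by simpa using h2
  exact Complex.ofReal_eq_zero.1 (integral_ofReal.symm.trans h3)

/-! ### Absolutely convergent Fourier series -/

/-- The real part of `w` times the `n`-th character. -/
def reMode (n : Fin N → ℤ) (w : ℂ) : C(Torus N, ℝ) where
  toFun x := (w * mFourier n x).re
  continuous_toFun := by fun_prop

theorem reMode_apply (n : Fin N → ℤ) (w : ℂ) (x : Torus N) :
    reMode n w x = (w * mFourier n x).re := rfl

theorem norm_reMode_le (n : Fin N → ℤ) (w : ℂ) : ‖reMode n w‖ ≤ ‖w‖ := by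
  refine (ContinuousMap.norm_le _ (norm_nonneg _)).2 fun x => ?_
  refine (Complex.abs_re_le_norm _).trans ?_
  rw [norm_mul, norm_mFourier_apply, mul_one]

theorem reMode_sub (n : Fin N → ℤ) (w w' : ℂ) : reMode n (w - w') = reMode n w - reMode n w' := by
  ext x; simp [reMode_apply, sub_mul]

theorem reMode_add (n : Fin N → ℤ) (w w' : ℂ) : reMode n (w + w') = reMode n w + reMode n w' := by
  ext x; simp [reMode_apply, add_mul]

theorem reMode_smul (n : Fin N → ℤ) (r : ℝ) (w : ℂ) : reMode n (r * w) = r • reMode n w := by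
  ext x; simp [reMode_apply]; ring

/-- The sum of a Fourier series. -/
def synth (c : (Fin N → ℤ) → ℂ) : C(Torus N, ℝ) := ∑' n, reMode n (c n)

theorem summable_reMode {c : (Fin N → ℤ) → ℂ} (hc : Summable fun n => ‖c n‖) :
    Summable fun n => reMode n (c n) :=
  Summable.of_norm_bounded hc fun n => norm_reMode_le n (c n)

theorem synth_apply {c : (Fin N → ℤ) → ℂ} (hc : Summable fun n => ‖c n‖) (x : Torus N) :
    synth c x = ∑' n, reMode n (c n) x :=
  (ContinuousMap.evalCLM ℝ x).map_tsum (summable_reMode hc)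

theorem norm_synth_le {c : (Fin N → ℤ) → ℂ} (hc : Summable fun n => ‖c n‖) :
    ‖synth c‖ ≤ ∑' n, ‖c n‖ :=
  tsum_of_norm_bounded hc.hasSum fun n => norm_reMode_le n (c n)

theorem synth_sub {c d : (Fin N → ℤ) → ℂ} (hc : Summable fun n => ‖c n‖)
    (hd : Summable fun n => ‖d n‖) : synth (fun n => c n - d n) = synth c - synth d := by
  simp only [synth, reMode_sub]
  exact (summable_reMode hc).tsum_sub (summable_reMode hd)

theorem synth_add {c d : (Fin N → ℤ) → ℂ} (hc : Summable fun n => ‖c n‖)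
    (hd : Summable fun n => ‖d n‖) : synth (fun n => c n + d n) = synth c + synth d := by
  simp only [synth, reMode_add]
  exact (summable_reMode hc).tsum_add (summable_reMode hd)

theorem synth_smul {c : (Fin N → ℤ) → ℂ} (r : ℝ) :
    synth (fun n => r * c n) = r • synth c := by
  simp only [synth, reMode_smul]
  exact tsum_const_smul'' _

theorem torusShift_synth {c : (Fin N → ℤ) → ℂ} (hc : Summable fun n => ‖c n‖) (a : Vel N) :
    torusShift a (synth c) = synth fun n => character n (-a) * c n := by
  ext x
  rw [synth_apply (by simpa [norm_character] using hc)]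
  change synth c (x - toTorus a) = _
  rw [synth_apply hc]
  refine tsum_congr fun n => ?_
  rw [reMode_apply, reMode_apply, sub_eq_add_neg, ← toTorus_neg, mFourier_add_toTorus]
  ring_nf

/-! ### Weighted sums of Fourier coefficients -/

/-- The weight `(1 + |n|)³`. -/
def weight (n : Fin N → ℤ) : ℝ := (1 + ‖latVec n‖) ^ 3

theorem one_le_weight (n : Fin N → ℤ) : 1 ≤ weight n :=
  one_le_pow₀ (by linarith [norm_nonneg (latVec n)])

theorem norm_latVec_pow_le_weight (n : Fin N → ℤ) {k : ℕ} (hk : k ≤ 3) :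
    ‖latVec n‖ ^ k ≤ weight n := by
  have h : 0 ≤ ‖latVec n‖ := norm_nonneg _
  exact (pow_le_pow_left₀ h (by linarith) k).trans (pow_le_pow_right₀ (by linarith) hk)

/-- `∑ (1 + |n|)³ |c_n|`. -/
def wnorm (c : (Fin N → ℤ) → ℂ) : ℝ := ∑' n, weight n * ‖c n‖

/-- The series defining `wnorm c` converges. -/
def WSummable (c : (Fin N → ℤ) → ℂ) : Prop := Summable fun n => weight n * ‖c n‖

theorem wnorm_nonneg (c : (Fin N → ℤ) → ℂ) : 0 ≤ wnorm c :=
  tsum_nonneg fun n => mul_nonneg (zero_le_one.trans (one_le_weight n)) (norm_nonneg _)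

theorem WSummable.sub {c d : (Fin N → ℤ) → ℂ} (hc : WSummable c) (hd : WSummable d) :
    WSummable fun n => c n - d n := by
  refine Summable.of_nonneg_of_le
    (fun n => mul_nonneg (zero_le_one.trans (one_le_weight n)) (norm_nonneg _)) (fun n => ?_)
    (Summable.add hc hd)
  rw [← mul_add]
  exact mul_le_mul_of_nonneg_left (norm_sub_le _ _) (zero_le_one.trans (one_le_weight n))

theorem WSummable.summable_of_le {c d : (Fin N → ℤ) → ℂ} (hc : WSummable c) {B : ℝ}
    (h : ∀ n, ‖d n‖ ≤ B * (weight n * ‖c n‖)) : Summable fun n => ‖d n‖ :=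
  Summable.of_nonneg_of_le (fun _ => norm_nonneg _) h (Summable.mul_left B hc)

theorem WSummable.norm_synth_le {c d : (Fin N → ℤ) → ℂ} (hc : WSummable c) {B : ℝ}
    (h : ∀ n, ‖d n‖ ≤ B * (weight n * ‖c n‖)) : ‖synth d‖ ≤ B * wnorm c := by
  refine (KineticFP.norm_synth_le (hc.summable_of_le h)).trans ?_
  rw [wnorm, ← tsum_mul_left]
  exact (hc.summable_of_le h).tsum_le_tsum h (Summable.mul_left B hc)

/-- The Fourier multiplier of the derivative in the direction `b`. -/
def derivSymbol (b : Vel N) (n : Fin N → ℤ) : ℂ := (2 * Real.pi * inner ℝ (latVec n) b : ℝ) * I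

theorem norm_derivSymbol_le (b : Vel N) (n : Fin N → ℤ) :
    ‖derivSymbol b n‖ ≤ 2 * Real.pi * ‖b‖ * ‖latVec n‖ := by
  rw [derivSymbol, norm_mul, Complex.norm_I, mul_one, Complex.norm_real, norm_mul,
    Real.norm_of_nonneg Real.two_pi_pos.le, mul_assoc (2 * Real.pi), mul_comm ‖b‖]
  refine mul_le_mul_of_nonneg_left ?_ Real.two_pi_pos.le
  exact norm_inner_le_norm _ _

theorem norm_derivSymbol_mul_le (b : Vel N) (n : Fin N → ℤ) (w : ℂ) :
    ‖derivSymbol b n * w‖ ≤ 2 * Real.pi * ‖b‖ * (weight n * ‖w‖) := by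
  have h1 := norm_latVec_pow_le_weight n (k := 1) (by norm_num)
  rw [norm_mul, ← mul_assoc]
  refine mul_le_mul_of_nonneg_right ((norm_derivSymbol_le b n).trans ?_) (norm_nonneg _)
  exact mul_le_mul_of_nonneg_left (by simpa using h1) (by positivity)

theorem norm_derivSymbol_mul_mul_le (b b' : Vel N) (n : Fin N → ℤ) (w : ℂ) :
    ‖derivSymbol b n * (derivSymbol b' n * w)‖ ≤
      (2 * Real.pi * ‖b‖) * (2 * Real.pi * ‖b'‖) * (weight n * ‖w‖) := by
  have h1 := norm_latVec_pow_le_weight n (k := 2) (by norm_num)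
  rw [← mul_assoc, norm_mul, norm_mul, ← mul_assoc]
  refine mul_le_mul_of_nonneg_right ((mul_le_mul (norm_derivSymbol_le b n)
    (norm_derivSymbol_le b' n) (norm_nonneg _) (by positivity)).trans ?_) (norm_nonneg _)
  calc _ = (2 * Real.pi * ‖b‖) * (2 * Real.pi * ‖b'‖) * ‖latVec n‖ ^ 2 := by ring
    _ ≤ _ := mul_le_mul_of_nonneg_left h1 (by positivity)

/-- The quadratic Taylor remainder |e^{iy} - 1 - iy| ≤ 2y²: for |y| ≤ 1 by the exponential series,
for |y| > 1 because |e^{iy} - 1| ≤ |y| ≤ y². -/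
theorem norm_character_sub_one_sub_le (n : Fin N → ℤ) (b : Vel N) :
    ‖character n b - 1 - derivSymbol b n‖ ≤ 2 * (2 * Real.pi * ‖b‖ * ‖latVec n‖) ^ 2 := by
  have h : ∀ y : ℝ, ‖Complex.exp (y * I) - 1 - y * I‖ ≤ 2 * |y| ^ 2 := fun y => by
    by_cases hy : |y| ≤ 1
    · have h1 := Complex.norm_exp_sub_one_sub_id_le (x := y * I) (by simpa using hy)
      simp only [norm_mul, Complex.norm_I, mul_one, Complex.norm_real, Real.norm_eq_abs] at h1
      linarith [sq_nonneg |y|]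
    · push Not at hy
      have h2 := Real.norm_exp_I_mul_ofReal_sub_one_le (x := y)
      rw [mul_comm, Real.norm_eq_abs] at h2
      refine (norm_sub_le _ _).trans ?_
      simp only [norm_mul, Complex.norm_I, mul_one, Complex.norm_real, Real.norm_eq_abs]
      nlinarith
  have h3 := norm_derivSymbol_le b n
  refine (h _).trans ?_
  have h4 : |2 * Real.pi * inner ℝ (latVec n) b| = ‖derivSymbol b n‖ := by
    rw [derivSymbol, norm_mul, Complex.norm_I, mul_one, Complex.norm_real, Real.norm_eq_abs]
  rw [h4]
  exact mul_le_mul_of_nonneg_left (pow_le_pow_left₀ (norm_nonneg _) h3 2) zero_le_two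

theorem derivSymbol_neg (b : Vel N) (n : Fin N → ℤ) : derivSymbol (-b) n = -derivSymbol b n := by
  simp [derivSymbol]

theorem derivSymbol_smul (r : ℝ) (b : Vel N) (n : Fin N → ℤ) :
    derivSymbol (r • b) n = r * derivSymbol b n := by
  simp [derivSymbol, inner_smul_right]; ring

/-- The derivative in the direction `b` of the function with the Fourier coefficients `c`. -/
def synthDeriv (b : Vel N) (c : (Fin N → ℤ) → ℂ) : C(Torus N, ℝ) :=
  synth fun n => derivSymbol b n * c n

/-- The second derivative, in the directions `b` and `b'`. -/
def synthDeriv₂ (b b' : Vel N) (c : (Fin N → ℤ) → ℂ) : C(Torus N, ℝ) :=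
  synth fun n => derivSymbol b n * (derivSymbol b' n * c n)

theorem WSummable.le {c : (Fin N → ℤ) → ℂ} (n : Fin N → ℤ) :
    ‖c n‖ ≤ 1 * (weight n * ‖c n‖) := by
  rw [one_mul]
  exact le_mul_of_one_le_left (norm_nonneg _) (one_le_weight n)

variable {c d : (Fin N → ℤ) → ℂ}

theorem WSummable.norm_synth_self_le (hc : WSummable c) : ‖synth c‖ ≤ wnorm c := by
  simpa using hc.norm_synth_le WSummable.le

theorem WSummable.summable (hc : WSummable c) : Summable fun n => ‖c n‖ :=
  hc.summable_of_le WSummable.le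

theorem WSummable.norm_synthDeriv_le (hc : WSummable c) (b : Vel N) :
    ‖synthDeriv b c‖ ≤ 2 * Real.pi * ‖b‖ * wnorm c :=
  hc.norm_synth_le fun n => norm_derivSymbol_mul_le b n (c n)

theorem WSummable.norm_synthDeriv₂_le (hc : WSummable c) (b b' : Vel N) :
    ‖synthDeriv₂ b b' c‖ ≤ (2 * Real.pi * ‖b‖) * (2 * Real.pi * ‖b'‖) * wnorm c :=
  hc.norm_synth_le fun n => norm_derivSymbol_mul_mul_le b b' n (c n)

theorem WSummable.synth_sub (hc : WSummable c) (hd : WSummable d) :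
    synth c - synth d = synth fun n => c n - d n :=
  (KineticFP.synth_sub hc.summable hd.summable).symm

theorem WSummable.synthDeriv_sub (hc : WSummable c) (hd : WSummable d) (b : Vel N) :
    synthDeriv b c - synthDeriv b d = synthDeriv b fun n => c n - d n := by
  simp only [synthDeriv, mul_sub]
  exact (KineticFP.synth_sub (hc.summable_of_le fun n => norm_derivSymbol_mul_le b n (c n))
    (hd.summable_of_le fun n => norm_derivSymbol_mul_le b n (d n))).symm

theorem WSummable.synthDeriv₂_sub (hc : WSummable c) (hd : WSummable d) (b b' : Vel N) :
    synthDeriv₂ b b' c - synthDeriv₂ b b' d = synthDeriv₂ b b' fun n => c n - d n := by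
  simp only [synthDeriv₂, mul_sub]
  exact (KineticFP.synth_sub (hc.summable_of_le fun n => norm_derivSymbol_mul_mul_le b b' n (c n))
    (hd.summable_of_le fun n => norm_derivSymbol_mul_mul_le b b' n (d n))).symm

/-- A first-order Taylor expansion, mode by mode. The derivative has a plus sign because
`torusShift` evaluates at x - b. -/
theorem WSummable.norm_torusShift_sub_le (hc : WSummable c) (b : Vel N) :
    ‖torusShift b (synth c) - synth c + synthDeriv b c‖ ≤ 8 * (Real.pi * ‖b‖) ^ 2 * wnorm c := by
  have h1 : Summable fun n => ‖character n (-b) * c n‖ := by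
    simpa [norm_character] using hc.summable
  have h2 := hc.summable_of_le fun n => norm_derivSymbol_mul_le b n (c n)
  have h3 : Summable fun n => ‖character n (-b) * c n - c n‖ :=
    Summable.of_nonneg_of_le (fun _ => norm_nonneg _) (fun n => norm_sub_le _ _)
      (h1.add hc.summable)
  rw [torusShift_synth hc.summable, synthDeriv, ← KineticFP.synth_sub h1 hc.summable, ← synth_add h3 h2]
  refine hc.norm_synth_le fun n => ?_
  have h4 : character n (-b) * c n - c n + derivSymbol b n * c n =
      (character n (-b) - 1 - derivSymbol (-b) n) * c n := by rw [derivSymbol_neg]; ring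
  have h5 := norm_latVec_pow_le_weight n (k := 2) (by norm_num)
  rw [h4, norm_mul, ← mul_assoc]
  refine mul_le_mul_of_nonneg_right ((norm_character_sub_one_sub_le n (-b)).trans ?_)
    (norm_nonneg _)
  rw [norm_neg]
  calc _ = 8 * (Real.pi * ‖b‖) ^ 2 * ‖latVec n‖ ^ 2 := by ring
    _ ≤ _ := mul_le_mul_of_nonneg_left h5 (by positivity)

/-- The expansion of a first derivative consumes all three powers in `weight`: two in the quadratic
remainder and one in the derivative itself. -/
theorem WSummable.norm_torusShift_synthDeriv_sub_le (hc : WSummable c) (b b' : Vel N) :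
    ‖torusShift b (synthDeriv b' c) - synthDeriv b' c + synthDeriv₂ b b' c‖ ≤
      16 * Real.pi ^ 3 * ‖b‖ ^ 2 * ‖b'‖ * wnorm c := by
  have h0 := hc.summable_of_le fun n => norm_derivSymbol_mul_le b' n (c n)
  have h1 : Summable fun n => ‖character n (-b) * (derivSymbol b' n * c n)‖ := by
    refine h0.congr fun n => ?_
    rw [norm_mul (character n (-b)), norm_character, one_mul]
  have h2 := hc.summable_of_le fun n => norm_derivSymbol_mul_mul_le b b' n (c n)
  have h3 : Summable fun n => ‖character n (-b) * (derivSymbol b' n * c n) - derivSymbol b' n * c n‖ :=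
    Summable.of_nonneg_of_le (fun _ => norm_nonneg _) (fun n => norm_sub_le _ _) (h1.add h0)
  rw [synthDeriv, torusShift_synth h0, synthDeriv₂, ← KineticFP.synth_sub h1 h0, ← synth_add h3 h2]
  refine hc.norm_synth_le fun n => ?_
  have h4 : character n (-b) * (derivSymbol b' n * c n) - derivSymbol b' n * c n +
      derivSymbol b n * (derivSymbol b' n * c n) =
      (character n (-b) - 1 - derivSymbol (-b) n) * derivSymbol b' n * c n := by
    rw [derivSymbol_neg]; ring
  have h5 := norm_latVec_pow_le_weight n (k := 3) (by norm_num)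
  rw [h4, norm_mul, norm_mul, ← mul_assoc]
  refine mul_le_mul_of_nonneg_right ((mul_le_mul (norm_character_sub_one_sub_le n (-b))
    (norm_derivSymbol_le b' n) (norm_nonneg _) (by positivity)).trans ?_) (norm_nonneg _)
  rw [norm_neg]
  calc _ = 16 * Real.pi ^ 3 * ‖b‖ ^ 2 * ‖b'‖ * ‖latVec n‖ ^ 3 := by ring
    _ ≤ _ := mul_le_mul_of_nonneg_left h5 (by positivity)

end Fourier

/-! ### Multi-index derivatives -/

section MultiDeriv

variable {V G ι : Type*} [SMul ℝ V] [Add G] (π : V → G) (e : ι → V)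

theorem multiDeriv_zero [Fintype ι] (φ : G → ℝ) : multiDeriv π e 0 φ = φ := by
  have h : ∀ l : List ι, l.foldr (fun i ψ => (dirDeriv π (e i))^[(0 : ι → ℕ) i] ψ) φ = φ := fun l => by
    induction l with
    | nil => rfl
    | cons a l ih => rw [List.foldr_cons, ih]; rfl
  exact h _

variable [DecidableEq ι]

theorem foldr_single_of_notMem (j : ι) (r : ℕ) (φ : G → ℝ) {l : List ι} (hl : j ∉ l) :
    l.foldr (fun i ψ => (dirDeriv π (e i))^[(Pi.single j r : ι → ℕ) i] ψ) φ = φ := by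
  induction l with
  | nil => rfl
  | cons a l ih =>
    simp only [List.mem_cons, not_or] at hl
    rw [List.foldr_cons, ih hl.2, Pi.single_eq_of_ne (Ne.symm hl.1)]
    rfl

theorem foldr_single (j : ι) (r : ℕ) (φ : G → ℝ) {l : List ι} (hn : l.Nodup) (hl : j ∈ l) :
    l.foldr (fun i ψ => (dirDeriv π (e i))^[(Pi.single j r : ι → ℕ) i] ψ) φ =
      (dirDeriv π (e j))^[r] φ := by
  induction l with
  | nil => simp at hl
  | cons a l ih =>
    rw [List.nodup_cons] at hn
    rw [List.foldr_cons]
    rcases List.mem_cons.1 hl with rfl | h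
    · rw [foldr_single_of_notMem π e j r φ hn.1, Pi.single_eq_same]
    · rw [ih hn.2 h, Pi.single_eq_of_ne (fun h' : a = j => hn.1 (by rw [h']; exact h))]
      rfl

theorem multiDeriv_single [Fintype ι] (j : ι) (r : ℕ) (φ : G → ℝ) :
    multiDeriv π e (Pi.single j r) φ = (dirDeriv π (e j))^[r] φ :=
  foldr_single π e j r φ (Finset.nodup_toList _) (by simp)

end MultiDeriv

/-! ### The Fourier coefficients of a force field -/

section ForceCoeff

variable {N : ℕ}

open UnitAddTorus Complex

theorem hasDerivAt_character (n : Fin N → ℤ) (b : Vel N) :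
    HasDerivAt (fun s : ℝ => character n (s • b)) (derivSymbol b n) 0 := by
  have h : (fun s : ℝ => character n (s • b)) = fun s : ℝ => Complex.exp (s * derivSymbol b n) := by
    ext s
    simp only [character, derivSymbol, inner_smul_right]
    congr 1
    push_cast
    ring
  rw [h]
  have h1 : HasDerivAt (fun s : ℝ => (s : ℂ) * derivSymbol b n) (1 * derivSymbol b n) 0 :=
    (Complex.ofRealCLM.hasDerivAt (x := (0 : ℝ))).mul_const _
  simpa using h1.cexp

theorem dirDeriv_reMode (n : Fin N → ℤ) (w : ℂ) (b : Vel N) :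
    dirDeriv toTorus b (reMode n w) = reMode n (w * derivSymbol b n) := by
  ext x
  have h1 := ((hasDerivAt_character n b).const_mul w).mul_const (mFourier n x)
  have h2 := (Complex.reCLM.hasFDerivAt.comp_hasDerivAt (0 : ℝ) h1).deriv
  rw [dirDeriv]
  convert! h2 using 2
  ext s
  rw [reMode_apply, mFourier_add_toTorus]
  simp [mul_assoc]

theorem iterate_dirDeriv_reMode (n : Fin N → ℤ) (b : Vel N) (r : ℕ) (w : ℂ) :
    (dirDeriv toTorus b)^[r] (reMode n w) = reMode n (w * derivSymbol b n ^ r) := by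
  induction r generalizing w with
  | zero => simp
  | succ r ih => rw [Function.iterate_succ_apply, dirDeriv_reMode, ih]; congr 2; ring

theorem isTestFunction_reMode (n : Fin N → ℤ) (w : ℂ) :
    IsTestFunction (toTorus (N := N)) (reMode n w) := by
  refine ⟨?_, HasCompactSupport.of_compactSpace _⟩
  have h : (reMode n w) ∘ toTorus (N := N) = fun ξ => (w * (character n ξ * mFourier n 0)).re := by
    ext ξ
    rw [Function.comp_apply, reMode_apply, ← zero_add (toTorus ξ), mFourier_add_toTorus]
  rw [h]
  suffices h1 : ContDiff ℝ ∞ fun ξ : Vel N => w * (character n ξ * mFourier n 0) from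
    Complex.reCLM.contDiff.comp h1
  refine contDiff_const.mul (ContDiff.mul ?_ contDiff_const)
  unfold character
  refine ContDiff.cexp (ContDiff.mul ?_ contDiff_const)
  exact Complex.ofRealCLM.contDiff.comp (contDiff_const.mul
    ((innerSL ℝ (latVec n)).contDiff : ContDiff ℝ ∞ fun ξ : Vel N => inner ℝ (latVec n) ξ))

theorem integrable_of_locallyIntegrable {f : Torus N → ℝ} (hf : LocallyIntegrable f) :
    Integrable f :=
  integrableOn_univ.1 (hf.integrableOn_isCompact isCompact_univ)

/-- The Fourier coefficients of a function on the torus. -/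
def fourierCoeffs (f : Torus N → ℝ) (n : Fin N → ℤ) : ℂ := ∫ x, (f x : ℂ) * mFourier (-n) x

theorem integrable_mul_mFourier {f : Torus N → ℝ} (hf : Integrable f) (n : Fin N → ℤ) :
    Integrable fun x => (f x : ℂ) * mFourier n x :=
  hf.ofReal.mul_bdd (c := 1) (mFourier n).continuous.aestronglyMeasurable
    (ae_of_all _ fun x => (norm_mFourier_apply n x).le)

theorem integral_mul_reMode {f : Torus N → ℝ} (hf : Integrable f) (n : Fin N → ℤ) (w : ℂ) :
    ∫ x, f x * reMode (-n) w x = (w * fourierCoeffs f n).re := by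
  rw [fourierCoeffs, ← integral_const_mul]
  rw [← RCLike.re_eq_complex_re, ← integral_re ((integrable_mul_mFourier hf (-n)).const_mul w)]
  refine integral_congr_ae (ae_of_all _ fun x => ?_)
  simp only [reMode_apply, RCLike.re_eq_complex_re]
  rw [← Complex.re_ofReal_mul]
  congr 1
  ring

theorem norm_fourierCoeffs_le (f : Torus N → ℝ) (n : Fin N → ℤ) :
    ‖fourierCoeffs f n‖ₑ ≤ eLpNorm f 1 volume := by
  refine (enorm_integral_le_lintegral_enorm _).trans ?_
  rw [eLpNorm_one_eq_lintegral_enorm]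
  refine lintegral_mono fun x => ?_
  rw [enorm_mul]
  have h : ‖mFourier (-n) x‖ₑ = 1 := by
    rw [← ofReal_norm, norm_mFourier_apply, ENNReal.ofReal_one]
  rw [h, mul_one]
  exact le_of_eq (by rw [← ofReal_norm, ← ofReal_norm, Complex.norm_real])

/-- The weak derivative is tested against real parts of multiples of a character; the multiples 1
and -i recover the real and imaginary parts of the complex identity. Only norms are kept, so the
sign (-1)^r disappears. -/
theorem pow_mul_fourierCoeffs {f g : Torus N → ℝ} {j : Fin N} {r : ℕ}
    (h : HasWeakDeriv toTorus torusDir (Pi.single j r) f g) (n : Fin N → ℤ) :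
    ‖derivSymbol (torusDir j) (-n) ^ r * fourierCoeffs f n‖ = ‖fourierCoeffs g n‖ := by
  have hf : Integrable f := (integrable_of_locallyIntegrable h.1)
  have hg : Integrable g := (integrable_of_locallyIntegrable h.2.1)
  have h1 : ∀ w : ℂ, (w * (derivSymbol (torusDir j) (-n) ^ r * fourierCoeffs f n)).re =
      (w * ((-1 : ℝ) ^ r * fourierCoeffs g n)).re := fun w => by
    have h2 := h.2.2 _ (isTestFunction_reMode (-n) w)
    rw [multiDeriv_single, iterate_dirDeriv_reMode, integral_mul_reMode hf, integral_mul_reMode hg,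
      Finset.sum_pi_single'] at h2
    simp only [Finset.mem_univ, if_true] at h2
    rw [← mul_assoc, h2, mul_left_comm]
    rw [← Complex.re_ofReal_mul]
    push_cast
    rfl
  have h3 : derivSymbol (torusDir j) (-n) ^ r * fourierCoeffs f n =
      ((-1 : ℝ) : ℂ) ^ r * fourierCoeffs g n := by
    refine Complex.ext (by simpa using h1 1) ?_
    have h4 := h1 (-I)
    simpa [Complex.mul_re] using h4
  rw [h3]
  simp

theorem weakDerivNorm_le_forceNorm {m r : ℕ} (hr : r ≤ 2 * m) (e : Torus N → Vel N)
    (i j : Fin N) :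
    weakDerivNorm toTorus torusDir (Pi.single j r) 2 (fun x => e x i) ≤ forceNorm m e := by
  have h1 : weakDerivNorm toTorus torusDir (Pi.single j r) 2 (fun x => e x i) ^ 2 ≤
      ∑ n ∈ Finset.range (2 * m + 1), ∑ α ∈ Finset.piAntidiag (Finset.univ : Finset (Fin N)) n,
        ∑ i : Fin N, weakDerivNorm toTorus torusDir α 2 (fun x => e x i) ^ 2 := by
    refine le_trans ?_ (Finset.single_le_sum (fun _ _ => zero_le)
      (Finset.mem_range.2 (Nat.lt_succ_of_le hr)))
    have h2 : Pi.single j r ∈ Finset.piAntidiag (Finset.univ : Finset (Fin N)) r := by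
      simp [Finset.mem_piAntidiag]
    refine le_trans ?_ (Finset.single_le_sum (fun _ _ => zero_le) h2)
    exact Finset.single_le_sum (f := fun i =>
      weakDerivNorm toTorus torusDir (Pi.single j r) 2 (fun x => e x i) ^ 2)
      (fun _ _ => zero_le) (Finset.mem_univ i)
  have h3 := ENNReal.rpow_le_rpow h1 (by norm_num : (0 : ℝ) ≤ 1 / 2)
  refine le_trans (le_of_eq ?_) h3
  rw [← ENNReal.rpow_natCast, ← ENNReal.rpow_mul]
  norm_num

theorem enorm_pow_mul_fourierCoeffs_le {m r : ℕ} (hr : r ≤ 2 * m) (e : Torus N → Vel N)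
    (i j : Fin N) (n : Fin N → ℤ) :
    ‖derivSymbol (torusDir j) (-n) ^ r * fourierCoeffs (fun x => e x i) n‖ₑ ≤ forceNorm m e := by
  refine le_trans ?_ (weakDerivNorm_le_forceNorm hr e i j)
  refine le_iInf₂ fun g hg => ?_
  rw [← ofReal_norm, pow_mul_fourierCoeffs hg, ofReal_norm]
  refine (norm_fourierCoeffs_le g n).trans ?_
  exact eLpNorm_le_eLpNorm_of_exponent_le (by norm_num)
    (integrable_of_locallyIntegrable hg.2.1).aestronglyMeasurable

theorem integrable_of_forceNorm {m : ℕ} {e : Torus N → Vel N} (he : forceNorm m e < ⊤)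
    (i : Fin N) : Integrable fun x => e x i := by
  have h1 := (weakDerivNorm_le_forceNorm (Nat.zero_le (2 * m)) e i i).trans_lt he
  obtain ⟨g, hg⟩ := iInf_lt_top.1 h1
  obtain ⟨hg', -⟩ := iInf_lt_top.1 hg
  exact (integrable_of_locallyIntegrable hg'.1)

/-- If neither alternative held, adding the inequalities (N + 1)|n_j| < 1 + |n| would give |n| ≤ N,
against the first one. Hence pure derivatives in the coordinate directions control every power of 1
+ |n|. -/
theorem one_add_norm_latVec_le (n : Fin N → ℤ) :
    1 + ‖latVec n‖ ≤ N + 1 ∨ ∃ j, 1 + ‖latVec n‖ ≤ (N + 1) * |(n j : ℝ)| := by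
  by_contra! h
  obtain ⟨h1, h2⟩ := h
  have h3 : ‖latVec n‖ ≤ ∑ j, |(n j : ℝ)| := by
    have h4 : latVec n = ∑ j, (n j : ℝ) • torusDir j := by
      ext k
      simp [torusDir, latVec_apply, Pi.single_apply]
    rw [h4]
    refine (norm_sum_le _ _).trans (Finset.sum_le_sum fun j _ => ?_)
    rw [norm_smul, norm_torusDir, mul_one, Real.norm_eq_abs]
  have h5 : (N + 1 : ℝ) * ∑ j, |(n j : ℝ)| ≤ N * (1 + ‖latVec n‖) := by
    rw [Finset.mul_sum]
    refine (Finset.sum_le_sum fun j _ => (h2 j).le).trans (le_of_eq ?_)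
    simp only [Finset.sum_const, Finset.card_univ, Fintype.card_fin, nsmul_eq_mul]
  nlinarith

/-- The constant in the estimate of the Fourier coefficients. -/
def fourierConst (N m : ℕ) : ℝ :=
  (N + 1) ^ (2 * m) * ∑' n : Fin N → ℤ, ((1 + ‖latVec n - 0‖) ^ (2 * m - 3))⁻¹

theorem fourierConst_nonneg (N m : ℕ) : 0 ≤ fourierConst N m :=
  mul_nonneg (by positivity) (tsum_nonneg fun n => by positivity)

/-- The derivatives of order 2m bound (1 + |n|)^{2m}|c_n|. Three powers pay for the weight, and the
remaining 2m - 3 exceed N, so that the right side is summable over ℤ^N. -/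
theorem weight_mul_fourierCoeffs_le {m : ℕ} (hm : N + 1 < m) {e : Torus N → Vel N}
    (he : forceNorm m e < ⊤) (i : Fin N) (n : Fin N → ℤ) :
    weight n * ‖fourierCoeffs (fun x => e x i) n‖ ≤
      ((N + 1) ^ (2 * m) * (forceNorm m e).toReal) * ((1 + ‖latVec n - 0‖) ^ (2 * m - 3))⁻¹ := by
  set c := fourierCoeffs (fun x => e x i) n
  have h0 : ∀ j, ∀ r ≤ 2 * m, (2 * Real.pi * |(n j : ℝ)|) ^ r * ‖c‖ ≤ (forceNorm m e).toReal := by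
    intro j r hr
    have h1 := enorm_pow_mul_fourierCoeffs_le hr e i j n
    have h2 := ENNReal.toReal_mono he.ne h1
    rw [toReal_enorm, norm_mul, norm_pow] at h2
    convert h2 using 3
    rw [derivSymbol, norm_mul, Complex.norm_I, mul_one, Complex.norm_real, norm_mul,
      Real.norm_of_nonneg Real.two_pi_pos.le]
    simp [torusDir, EuclideanSpace.inner_single_right, latVec_apply]
  have h1 : (1 + ‖latVec n‖) ^ (2 * m) * ‖c‖ ≤ (N + 1) ^ (2 * m) * (forceNorm m e).toReal := by
    rcases one_add_norm_latVec_le n with h | ⟨j, h⟩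
    · refine mul_le_mul (pow_le_pow_left₀ (by positivity) h _) ?_ (norm_nonneg _) (by positivity)
      simpa using h0 i 0 (by omega)
    · refine (mul_le_mul_of_nonneg_right (pow_le_pow_left₀ (by positivity) h (2 * m))
        (norm_nonneg _)).trans ?_
      rw [mul_pow, mul_assoc]
      refine mul_le_mul_of_nonneg_left (le_trans ?_ (h0 j (2 * m) le_rfl)) (by positivity)
      refine mul_le_mul_of_nonneg_right (pow_le_pow_left₀ (by positivity) ?_ _) (norm_nonneg _)
      nlinarith [Real.pi_gt_three, abs_nonneg (n j : ℝ)]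
  rw [sub_zero, ← div_eq_mul_inv, le_div_iff₀ (by positivity)]
  refine le_trans (le_of_eq ?_) h1
  rw [weight, mul_right_comm, ← pow_add]
  congr 2
  omega

theorem wSummable_fourierCoeffs {m : ℕ} (hm : N + 1 < m) {e : Torus N → Vel N}
    (he : forceNorm m e < ⊤) (i : Fin N) : WSummable (fourierCoeffs fun x => e x i) :=
  Summable.of_nonneg_of_le
    (fun n => mul_nonneg (zero_le_one.trans (one_le_weight n)) (norm_nonneg _))
    (weight_mul_fourierCoeffs_le hm he i)
    ((summable_one_add_latVec (by omega) 0).mul_left _)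

theorem wnorm_fourierCoeffs_le {m : ℕ} (hm : N + 1 < m) {e : Torus N → Vel N}
    (he : forceNorm m e < ⊤) (i : Fin N) :
    wnorm (fourierCoeffs fun x => e x i) ≤ fourierConst N m * (forceNorm m e).toReal := by
  refine ((wSummable_fourierCoeffs hm he i).tsum_le_tsum (weight_mul_fourierCoeffs_le hm he i)
    ((summable_one_add_latVec (by omega) 0).mul_left _)).trans (le_of_eq ?_)
  rw [tsum_mul_left, fourierConst]
  ring

/-- If n_j ≠ 0, a translation by 1/(2n_j) in the j-th coordinate changes the sign of the character
but not the integral. -/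
theorem integral_mFourier (n : Fin N → ℤ) :
    ∫ x : Torus N, mFourier n x = if n = 0 then 1 else 0 := by
  split_ifs with h
  · rw [h, mFourier_zero]; simp
  · obtain ⟨j, hj⟩ := Function.ne_iff.1 h
    have h1 := integral_add_right_eq_self (μ := (volume : Measure (Torus N)))
      (fun x => mFourier n x) (toTorus ((1 / (2 * (n j : ℝ))) • torusDir j))
    simp only [mFourier_add_toTorus] at h1
    rw [integral_const_mul] at h1
    have h2 : character n ((1 / (2 * (n j : ℝ))) • torusDir j) = -1 := by
      rw [character, inner_smul_right]
      have h3 : (n j : ℝ) ≠ 0 := by exact_mod_cast hj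
      have h4 : 2 * Real.pi * (1 / (2 * (n j : ℝ)) * inner ℝ (latVec n) (torusDir j)) = Real.pi := by
        simp only [torusDir, EuclideanSpace.inner_single_right, latVec_apply]
        simp
        field_simp
      rw [h4, Complex.exp_pi_mul_I]
    rw [h2] at h1
    linear_combination (-1 / 2 : ℂ) * h1

theorem integral_reMode_mul_mFourier (n k : Fin N → ℤ) (w : ℂ) :
    ∫ x, (reMode k w x : ℂ) * mFourier (-n) x =
      (if k = n then w / 2 else 0) + if k = -n then (starRingEnd ℂ) w / 2 else 0 := by
  have h1 : ∀ x : Torus N, (reMode k w x : ℂ) * mFourier (-n) x =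
      w / 2 * mFourier (k - n) x + (starRingEnd ℂ) w / 2 * mFourier (-k - n) x := fun x => by
    rw [reMode_apply, Complex.re_eq_add_conj, map_mul, ← mFourier_neg, sub_eq_add_neg,
      sub_eq_add_neg, mFourier_add, mFourier_add]
    ring
  have h2 : ∀ n, Integrable fun x : Torus N => mFourier n x := fun n =>
    (mFourier n).continuous.integrable_of_hasCompactSupport (HasCompactSupport.of_compactSpace _)
  rw [integral_congr_ae (ae_of_all _ h1), integral_add ((h2 _).const_mul _) ((h2 _).const_mul _),
    integral_const_mul, integral_const_mul, integral_mFourier, integral_mFourier]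
  have h3 : k - n = 0 ↔ k = n := sub_eq_zero
  have h4 : -k - n = 0 ↔ k = -n := by rw [sub_eq_zero, neg_eq_iff_eq_neg]
  simp only [h3, h4]
  split_ifs <;> simp

theorem fourierCoeffs_neg (f : Torus N → ℝ) (n : Fin N → ℤ) :
    (starRingEnd ℂ) (fourierCoeffs f (-n)) = fourierCoeffs f n := by
  rw [fourierCoeffs, ← integral_conj, fourierCoeffs]
  refine integral_congr_ae (ae_of_all _ fun x => ?_)
  simp only [map_mul, Complex.conj_ofReal, ← mFourier_neg, neg_neg]

/-- The n-th coefficient of the sum of real parts receives c_n/2 from the mode n and the conjugate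
of c_{-n}/2 from the mode -n; these are equal because f is real. Uniqueness of Fourier coefficients
concludes. -/
theorem ae_eq_synth {f : Torus N → ℝ} (hf : Integrable f) (hc : WSummable (fourierCoeffs f)) :
    f =ᵐ[volume] synth (fourierCoeffs f) := by
  set c := fourierCoeffs f with hcdef
  have hint : ∀ φ : C(Torus N, ℝ), Integrable φ := fun φ =>
    φ.continuous.integrable_of_hasCompactSupport (HasCompactSupport.of_compactSpace _)
  have h1 : ∀ n, ∫ x, (synth c x : ℂ) * mFourier (-n) x = c n := fun n => by
    let L : C(Torus N, ℝ) →ₗ[ℝ] ℂ :=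
      { toFun := fun φ => ∫ x, (φ x : ℂ) * mFourier (-n) x
        map_add' := fun φ ψ => by
          rw [← integral_add (integrable_mul_mFourier (hint φ) _)
            (integrable_mul_mFourier (hint ψ) _)]
          exact integral_congr_ae (ae_of_all _ fun x => by simp [add_mul])
        map_smul' := fun r φ => by
          rw [RingHom.id_apply, Complex.real_smul, ← integral_const_mul]
          exact integral_congr_ae (ae_of_all _ fun x => by simp; ring) }
    let L' : C(Torus N, ℝ) →L[ℝ] ℂ := L.mkContinuous 1 fun φ => by
      refine (norm_integral_le_of_norm_le_const (C := ‖φ‖)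
        (ae_of_all _ fun x => ?_)).trans (le_of_eq ?_)
      · rw [norm_mul, norm_mFourier_apply, mul_one, Complex.norm_real]
        exact φ.norm_coe_le_norm x
      · simp
    have h2 : HasSum (fun k => L' (reMode k (c k))) (L' (synth c)) :=
      L'.hasSum (summable_reMode hc.summable).hasSum
    have h3 : HasSum (fun k => L' (reMode k (c k)))
        (c n / 2 + (starRingEnd ℂ) (c (-n)) / 2) := by
      have h4 : ∀ k, L' (reMode k (c k)) = (if k = n then c n / 2 else 0) +
          if k = -n then (starRingEnd ℂ) (c (-n)) / 2 else 0 := fun k => by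
        refine (integral_reMode_mul_mFourier n k (c k)).trans ?_
        congr 1
        · split_ifs with h <;> simp [h]
        · split_ifs with h <;> simp [h]
      simp only [h4]
      exact (hasSum_ite_eq n _).add (hasSum_ite_eq (-n) _)
    have h5 : L' (synth c) = c n := by
      rw [h2.unique h3, hcdef, fourierCoeffs_neg]
      ring
    exact h5
  have h2 := ae_eq_zero_of_integral_mul_mFourier (hf.sub (hint (synth c))) fun n => by
    have h3 := h1 (-n)
    rw [neg_neg] at h3
    have h4 : ∫ x, (f x : ℂ) * mFourier n x = c (-n) := by rw [hcdef, fourierCoeffs, neg_neg]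
    rw [← sub_eq_zero.2 (h4.trans h3.symm), ← integral_sub (integrable_mul_mFourier hf n)
      (integrable_mul_mFourier (hint _) n)]
    exact integral_congr_ae (ae_of_all _ fun x => by simp [sub_mul])
  filter_upwards [h2] with x hx
  exact sub_eq_zero.1 hx

theorem fourierCoeffs_sub {f g : Torus N → ℝ} (hf : Integrable f) (hg : Integrable g)
    (n : Fin N → ℤ) :
    fourierCoeffs (fun x => f x - g x) n = fourierCoeffs f n - fourierCoeffs g n := by
  rw [fourierCoeffs, fourierCoeffs, fourierCoeffs, ← integral_sub (integrable_mul_mFourier hf _)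
    (integrable_mul_mFourier hg _)]
  exact integral_congr_ae (ae_of_all _ fun x => by simp [sub_mul])

end ForceCoeff

/-! ### Time-dependent Fourier coefficients -/

section TimeDependent

variable {N : ℕ}

/-- A right-continuous function on `[0, ∞)` is strongly measurable. -/
theorem aestronglyMeasurable_of_rightCont {X : Type*} [TopologicalSpace X]
    [TopologicalSpace.PseudoMetrizableSpace X] {g : ℝ → X}
    (hg : ∀ t, 0 ≤ t → Tendsto g (𝓝[>] t) (𝓝 (g t))) (T : ℝ) :
    AEStronglyMeasurable g (volume.restrict (Ioc 0 T)) := by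
  -- The function is sampled at the grid point of mesh 1/(n + 1) strictly to the right of s, at
  -- distance at most one mesh, so right continuity gives convergence at every s.
  have h1 : ∀ n : ℕ, StronglyMeasurable fun s : ℝ =>
      g (((⌊((n : ℝ) + 1) * s⌋ : ℝ) + 1) / ((n : ℝ) + 1)) := fun n => by
    have h2 : StronglyMeasurable fun k : ℤ => g (((k : ℝ) + 1) / ((n : ℝ) + 1)) :=
      StronglyMeasurable.of_discrete
    exact h2.comp_measurable (Int.measurable_floor.comp (measurable_const_mul _))
  refine aestronglyMeasurable_of_tendsto_ae atTop (fun n => (h1 n).aestronglyMeasurable) ?_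
  rw [ae_restrict_iff' measurableSet_Ioc]
  refine ae_of_all _ fun s hs => (hg s hs.1.le).comp ?_
  rw [tendsto_nhdsWithin_iff]
  constructor
  · have h3 : Tendsto (fun n : ℕ => s + 1 / ((n : ℝ) + 1)) atTop (𝓝 s) := by
      simpa using tendsto_one_div_add_atTop_nhds_zero_nat.const_add s
    refine tendsto_of_tendsto_of_tendsto_of_le_of_le tendsto_const_nhds h3 (fun n => ?_)
      fun n => ?_
    · have h4 : (0 : ℝ) < (n : ℝ) + 1 := by positivity
      have h5 := Int.lt_floor_add_one (((n : ℝ) + 1) * s)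
      change s ≤ _ / _
      rw [le_div_iff₀ h4]
      linarith
    · have h4 : (0 : ℝ) < (n : ℝ) + 1 := by positivity
      have h5 := Int.floor_le (((n : ℝ) + 1) * s)
      change _ / _ ≤ s + 1 / _
      rw [div_le_iff₀ h4, add_mul _ _ ((n : ℝ) + 1), div_mul_cancel₀ _ h4.ne']
      linarith
  · refine Eventually.of_forall fun n => ?_
    have h4 : (0 : ℝ) < (n : ℝ) + 1 := by positivity
    have h5 := Int.lt_floor_add_one (((n : ℝ) + 1) * s)
    rw [mem_Ioi, lt_div_iff₀ h4]
    linarith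

theorem derivSymbol_sub (b b' : Vel N) (n : Fin N → ℤ) :
    derivSymbol (b - b') n = derivSymbol b n - derivSymbol b' n := by
  simp [derivSymbol, inner_sub_right, mul_sub, sub_mul]

variable {c : (Fin N → ℤ) → ℂ}

theorem WSummable.synthDeriv_sub_left (hc : WSummable c) (b b' : Vel N) :
    synthDeriv b c - synthDeriv b' c = synthDeriv (b - b') c := by
  simp only [synthDeriv, derivSymbol_sub, sub_mul]
  exact (KineticFP.synth_sub (hc.summable_of_le fun n => norm_derivSymbol_mul_le b n (c n))
    (hc.summable_of_le fun n => norm_derivSymbol_mul_le b' n (c n))).symm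

theorem WSummable.synthDeriv₂_sub_left (hc : WSummable c) (a a' b : Vel N) :
    synthDeriv₂ a b c - synthDeriv₂ a' b c = synthDeriv₂ (a - a') b c := by
  simp only [synthDeriv₂, derivSymbol_sub, sub_mul]
  exact (KineticFP.synth_sub (hc.summable_of_le fun n => norm_derivSymbol_mul_mul_le a b n (c n))
    (hc.summable_of_le fun n => norm_derivSymbol_mul_mul_le a' b n (c n))).symm

theorem synthDeriv₂_comm (a b : Vel N) : synthDeriv₂ a b c = synthDeriv₂ b a c := by
  simp only [synthDeriv₂, mul_left_comm]

theorem synthDeriv_smul (r : ℝ) (b : Vel N) : synthDeriv (r • b) c = r • synthDeriv b c := by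
  rw [synthDeriv, synthDeriv, ← synth_smul]
  simp only [derivSymbol_smul, mul_assoc]

theorem synthDeriv₂_smul_left (r : ℝ) (a b : Vel N) :
    synthDeriv₂ (r • a) b c = r • synthDeriv₂ a b c := by
  rw [synthDeriv₂, synthDeriv₂, ← synth_smul]
  simp only [derivSymbol_smul, mul_assoc]

section RightCont

variable {c : ℝ → (Fin N → ℤ) → ℂ}

theorem tendsto_synth (hc : ∀ t, 0 ≤ t → WSummable (c t))
    (hr : ∀ t, 0 ≤ t → Tendsto (fun s => wnorm fun n => c s n - c t n) (𝓝[>] t) (𝓝 0))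
    {t : ℝ} (ht : 0 ≤ t) :
    Tendsto (fun s => synth (c s)) (𝓝[>] t) (𝓝 (synth (c t))) := by
  rw [tendsto_iff_norm_sub_tendsto_zero]
  refine squeeze_zero' (Eventually.of_forall fun s => norm_nonneg _) ?_ (hr t ht)
  filter_upwards [self_mem_nhdsWithin] with s hs
  have h := hc s (ht.trans (mem_Ioi.1 hs).le)
  rw [h.synth_sub (hc t ht)]
  exact (h.sub (hc t ht)).norm_synth_self_le

theorem tendsto_synthDeriv (hc : ∀ t, 0 ≤ t → WSummable (c t))
    (hr : ∀ t, 0 ≤ t → Tendsto (fun s => wnorm fun n => c s n - c t n) (𝓝[>] t) (𝓝 0))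
    {t : ℝ} (ht : 0 ≤ t) {b : ℝ → Vel N} (hb : Continuous b) :
    Tendsto (fun s => synthDeriv (b s) (c s)) (𝓝[>] t) (𝓝 (synthDeriv (b t) (c t))) := by
  rw [tendsto_iff_norm_sub_tendsto_zero]
  have hb' : Tendsto b (𝓝[>] t) (𝓝 (b t)) := hb.continuousAt.tendsto.mono_left inf_le_left
  have h1 : Tendsto (fun s => 2 * Real.pi * ‖b s‖ * wnorm (fun n => c s n - c t n) +
      2 * Real.pi * ‖b s - b t‖ * wnorm (c t)) (𝓝[>] t) (𝓝 0) := by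
    have h2 := ((hb'.norm.const_mul (2 * Real.pi)).mul (hr t ht)).add
      (((tendsto_iff_norm_sub_tendsto_zero.1 hb').const_mul (2 * Real.pi)).mul_const (wnorm (c t)))
    simpa using h2
  refine squeeze_zero' (Eventually.of_forall fun s => norm_nonneg _) ?_ h1
  filter_upwards [self_mem_nhdsWithin] with s hs
  have h := hc s (ht.trans (mem_Ioi.1 hs).le)
  have h3 : synthDeriv (b s) (c s) - synthDeriv (b t) (c t) =
      synthDeriv (b s) (fun n => c s n - c t n) + synthDeriv (b s - b t) (c t) := by
    rw [← h.synthDeriv_sub (hc t ht), ← (hc t ht).synthDeriv_sub_left]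
    abel
  rw [h3]
  exact (norm_add_le _ _).trans (add_le_add ((h.sub (hc t ht)).norm_synthDeriv_le _)
    ((hc t ht).norm_synthDeriv_le _))

theorem tendsto_synthDeriv₂ (hc : ∀ t, 0 ≤ t → WSummable (c t))
    (hr : ∀ t, 0 ≤ t → Tendsto (fun s => wnorm fun n => c s n - c t n) (𝓝[>] t) (𝓝 0))
    {t : ℝ} (ht : 0 ≤ t) {a b : ℝ → Vel N} (ha : Continuous a)
    (hb : Continuous b) :
    Tendsto (fun s => synthDeriv₂ (a s) (b s) (c s)) (𝓝[>] t)
      (𝓝 (synthDeriv₂ (a t) (b t) (c t))) := by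
  rw [tendsto_iff_norm_sub_tendsto_zero]
  have ha' : Tendsto a (𝓝[>] t) (𝓝 (a t)) := ha.continuousAt.tendsto.mono_left inf_le_left
  have hb' : Tendsto b (𝓝[>] t) (𝓝 (b t)) := hb.continuousAt.tendsto.mono_left inf_le_left
  have h1 : Tendsto (fun s =>
      (2 * Real.pi * ‖a s‖) * (2 * Real.pi * ‖b s‖) * wnorm (fun n => c s n - c t n) +
      ((2 * Real.pi * ‖a s - a t‖) * (2 * Real.pi * ‖b s‖) * wnorm (c t) +
      (2 * Real.pi * ‖b s - b t‖) * (2 * Real.pi * ‖a t‖) * wnorm (c t))) (𝓝[>] t) (𝓝 0) := by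
    have h2 := (((ha'.norm.const_mul (2 * Real.pi)).mul (hb'.norm.const_mul (2 * Real.pi))).mul
      (hr t ht)).add
      (((((tendsto_iff_norm_sub_tendsto_zero.1 ha').const_mul (2 * Real.pi)).mul
        (hb'.norm.const_mul (2 * Real.pi))).mul_const (wnorm (c t))).add
      ((((tendsto_iff_norm_sub_tendsto_zero.1 hb').const_mul (2 * Real.pi)).mul_const
        (2 * Real.pi * ‖a t‖)).mul_const (wnorm (c t))))
    simpa using h2
  refine squeeze_zero' (Eventually.of_forall fun s => norm_nonneg _) ?_ h1
  filter_upwards [self_mem_nhdsWithin] with s hs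
  have h := hc s (ht.trans (mem_Ioi.1 hs).le)
  have h3 : synthDeriv₂ (a s) (b s) (c s) - synthDeriv₂ (a t) (b t) (c t) =
      synthDeriv₂ (a s) (b s) (fun n => c s n - c t n) +
      (synthDeriv₂ (a s - a t) (b s) (c t) + synthDeriv₂ (b s - b t) (a t) (c t)) := by
    rw [← h.synthDeriv₂_sub (hc t ht), ← (hc t ht).synthDeriv₂_sub_left,
      ← (hc t ht).synthDeriv₂_sub_left, synthDeriv₂_comm (b s), synthDeriv₂_comm (b t)]
    abel
  rw [h3]
  exact (norm_add_le _ _).trans (add_le_add ((h.sub (hc t ht)).norm_synthDeriv₂_le _ _)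
    ((norm_add_le _ _).trans (add_le_add ((hc t ht).norm_synthDeriv₂_le _ _)
      ((hc t ht).norm_synthDeriv₂_le _ _))))

end RightCont

/-- Coefficients of a force field on `[0, T]`, bounded by `B`, as functions of the time. -/
structure ForceField (T B : ℝ) (c : ℝ → Fin N → (Fin N → ℤ) → ℂ) : Prop where
  summable : ∀ s, 0 ≤ s → ∀ i, WSummable (c s i)
  rightCont : ∀ t, 0 ≤ t → ∀ i, Tendsto (fun s => wnorm fun n => c s i n - c t i n) (𝓝[>] t) (𝓝 0)
  bound : ∀ s ∈ Icc 0 T, ∀ i, wnorm (c s i) ≤ B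

/-- The Fourier coefficients of a time-dependent force field. -/
def forceCoeffs (E : ℝ → Torus N → Vel N) (s : ℝ) (i : Fin N) : (Fin N → ℤ) → ℂ :=
  fourierCoeffs fun x => E s x i

variable {m : ℕ} {E : ℝ → Torus N → Vel N}

theorem forceCoeffs_ae (hm : N + 1 < m) (hE : IsCadlagForce m E) {s : ℝ} (hs : 0 ≤ s)
    (i : Fin N) : (fun x => E s x i) =ᵐ[volume] synth (forceCoeffs E s i) :=
  ae_eq_synth (integrable_of_forceNorm (hE.1 s hs) i) (wSummable_fourierCoeffs hm (hE.1 s hs) i)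

theorem forceCoeffs_sub (hE : IsCadlagForce m E) {s : ℝ} (hs : 0 ≤ s) {l : Torus N → Vel N}
    (hl : forceNorm m l < ⊤) (i : Fin N) :
    (fun n => forceCoeffs E s i n - fourierCoeffs (fun x => l x i) n) =
      fourierCoeffs (fun x => (E s - l) x i) := by
  ext n
  exact (fourierCoeffs_sub (integrable_of_forceNorm (hE.1 s hs) i)
    (integrable_of_forceNorm hl i) n).symm

/-- The filter is arbitrary so that the lemma serves both right continuity and left limits. -/
theorem wnorm_forceCoeffs_sub_tendsto (hm : N + 1 < m) (hE : IsCadlagForce m E) {𝓕 : Filter ℝ}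
    (h𝓕 : ∀ᶠ s in 𝓕, 0 ≤ s) {l : Torus N → Vel N} (hl : forceNorm m l < ⊤)
    (h : Tendsto (fun s => forceNorm m (E s - l)) 𝓕 (𝓝 0)) (i : Fin N) :
    Tendsto (fun s => wnorm fun n => forceCoeffs E s i n - fourierCoeffs (fun x => l x i) n) 𝓕
      (𝓝 0) := by
  have h1 := ((ENNReal.tendsto_toReal ENNReal.zero_ne_top).comp h).const_mul (fourierConst N m)
  rw [ENNReal.toReal_zero, mul_zero] at h1
  refine squeeze_zero' (Eventually.of_forall fun s => wnorm_nonneg _) ?_ h1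
  filter_upwards [h𝓕, h.eventually (gt_mem_nhds (zero_lt_one' ℝ≥0∞))] with s hs hs1
  rw [forceCoeffs_sub hE hs hl]
  exact wnorm_fourierCoeffs_le hm (hs1.trans ENNReal.one_lt_top) i

theorem wnorm_le_add {c d : (Fin N → ℤ) → ℂ} (hc : WSummable c) (hd : WSummable d) :
    wnorm c ≤ wnorm (fun n => c n - d n) + wnorm d := by
  rw [wnorm, wnorm, wnorm, ← Summable.tsum_add (hc.sub hd) hd]
  refine Summable.tsum_le_tsum (fun n => ?_) hc (Summable.add (hc.sub hd) hd)
  rw [← mul_add]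
  refine mul_le_mul_of_nonneg_left ?_ (zero_le_one.trans (one_le_weight n))
  simpa using norm_add_le (c n - d n) (d n)

/-- A càdlàg function is bounded on a one-sided neighbourhood on each side of every time, hence on a
neighbourhood, and [0, T] is compact. At t = 0 only the right side exists. -/
theorem exists_bound_forceCoeffs (hm : N + 1 < m) (hE : IsCadlagForce m E) (T : ℝ) (i : Fin N) :
    ∃ B : ℝ, ∀ s ∈ Icc 0 T, wnorm (forceCoeffs E s i) ≤ B := by
  have key : ∀ 𝓕 : Filter ℝ, (∀ᶠ s in 𝓕, 0 ≤ s) → ∀ l : Torus N → Vel N,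
      forceNorm m l < ⊤ → Tendsto (fun s => forceNorm m (E s - l)) 𝓕 (𝓝 0) →
      ∃ U ∈ 𝓕, ∃ B : ℝ, ∀ s ∈ U, wnorm (forceCoeffs E s i) ≤ B := fun 𝓕 h𝓕 l hl h => by
    have h1 := (wnorm_forceCoeffs_sub_tendsto hm hE h𝓕 hl h i).eventually
      (gt_mem_nhds (zero_lt_one' ℝ))
    refine ⟨_, h1.and h𝓕, 1 + wnorm (fourierCoeffs fun x => l x i), fun s hs => ?_⟩
    refine (wnorm_le_add (wSummable_fourierCoeffs hm (hE.1 s hs.2) i)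
      (wSummable_fourierCoeffs hm hl i)).trans ?_
    exact add_le_add hs.1.le le_rfl
  refine isCompact_Icc.induction_on (p := fun S => ∃ B : ℝ, ∀ s ∈ S, wnorm (forceCoeffs E s i) ≤ B)
    ⟨0, by simp⟩ (fun S S' h ⟨B, hB⟩ => ⟨B, fun s hs => hB s (h hs)⟩) ?_ fun t ht => ?_
  · rintro S S' ⟨B, hB⟩ ⟨B', hB'⟩
    exact ⟨max B B', fun s hs => hs.elim (fun h => (hB s h).trans (le_max_left _ _))
      fun h => (hB' s h).trans (le_max_right _ _)⟩
  · obtain ⟨U, hU, B, hB⟩ := key (𝓝[>] t)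
      (by filter_upwards [self_mem_nhdsWithin] with s hs using ht.1.trans (mem_Ioi.1 hs).le)
      (E t) (hE.1 t ht.1) (hE.2.1 t ht.1)
    rcases ht.1.eq_or_lt with rfl | h0
    · refine ⟨insert 0 U, ?_, max B (wnorm (forceCoeffs E 0 i)), ?_⟩
      · have h1 : insert 0 U ∈ 𝓝[≥] (0 : ℝ) := by
          rw [← Ioi_insert, nhdsWithin_insert]
          exact ⟨by simp, mem_of_superset hU (subset_insert _ _)⟩
        exact nhdsWithin_mono _ (fun x hx => hx.1) h1
      · rintro s (rfl | hs)
        · exact le_max_right _ _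
        · exact (hB s hs).trans (le_max_left _ _)
    · obtain ⟨l, hl, hlt⟩ := hE.2.2 t h0
      obtain ⟨U', hU', B', hB'⟩ := key (𝓝[<] t)
        (nhdsWithin_le_nhds ((lt_mem_nhds h0).mono fun s hs => hs.le)) l hl hlt
      refine ⟨insert t (U' ∪ U), nhdsWithin_le_nhds ?_,
        max (max B B') (wnorm (forceCoeffs E t i)), ?_⟩
      · rw [← nhdsNE_sup_pure, ← nhdsLT_sup_nhdsGT]
        refine ⟨⟨mem_of_superset hU' ?_, mem_of_superset hU ?_⟩, by simp⟩
        · exact subset_union_left.trans (subset_insert _ _)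
        · exact subset_union_right.trans (subset_insert _ _)
      · rintro s (rfl | hs | hs)
        · exact le_max_right _ _
        · exact (hB' s hs).trans ((le_max_right _ _).trans (le_max_left _ _))
        · exact (hB s hs).trans ((le_max_left _ _).trans (le_max_left _ _))

theorem forceField_of_bound (hm : N + 1 < m) (hE : IsCadlagForce m E) {T B : ℝ}
    (hB : ∀ s ∈ Icc 0 T, ∀ i, wnorm (forceCoeffs E s i) ≤ B) :
    ForceField T B (forceCoeffs E) where
  summable s hs i := wSummable_fourierCoeffs hm (hE.1 s hs) i
  rightCont t ht i := wnorm_forceCoeffs_sub_tendsto hm hE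
    (by filter_upwards [self_mem_nhdsWithin] with s hs using ht.trans (mem_Ioi.1 hs).le)
    (hE.1 t ht) (hE.2.1 t ht) i
  bound := hB

theorem exists_forceField (hm : N + 1 < m) (hE : IsCadlagForce m E) (T : ℝ) :
    ∃ B, 0 ≤ B ∧ ForceField T B (forceCoeffs E) := by
  choose B hB using exists_bound_forceCoeffs hm hE T
  refine ⟨∑ i, |B i|, Finset.sum_nonneg fun i _ => abs_nonneg _,
    forceField_of_bound hm hE fun s hs i => ?_⟩
  exact (hB i s hs).trans ((le_abs_self _).trans
    (Finset.single_le_sum (f := fun i => |B i|) (fun _ _ => abs_nonneg _) (Finset.mem_univ i)))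

theorem forceField_of_forceNorm_le (hm : N + 1 < m) (hE : IsCadlagForce m E) {T : ℝ} {R : ℝ≥0}
    (hR : ∀ t ∈ Icc 0 T, forceNorm m (E t) ≤ R) :
    ForceField T (fourierConst N m * R) (forceCoeffs E) :=
  forceField_of_bound hm hE fun s hs i =>
    (wnorm_fourierCoeffs_le hm (hE.1 s hs.1) i).trans
      (mul_le_mul_of_nonneg_left (ENNReal.toReal_le_of_le_ofReal R.2 (by simpa using hR s hs))
        (fourierConst_nonneg N m))

end TimeDependent

/-! ### The Cauchy problem -/

section Cauchy

variable {N : ℕ} {p : ℝ≥0∞} [Fact (1 ≤ p)]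

/-- A measurable and bounded force field, continuous in the space variable. -/
structure BddForce (T B : ℝ) (e : ℝ → Fin N → C(Torus N, ℝ)) : Prop where
  nonneg : 0 ≤ B
  meas : ∀ i, AEStronglyMeasurable (fun s => e s i) (volume.restrict (Ioc 0 T))
  bound : ∀ s ∈ Icc 0 T, ∀ i, ‖e s i‖ ≤ B

/-- The product of a function with a force field. -/
def multOp (p : ℝ≥0∞) [Fact (1 ≤ p)] (e : Fin N → C(Torus N, ℝ)) :
    State N p →L[ℝ] (Fin N → State N p) :=
  ContinuousLinearMap.pi fun i => mulOp p (e i)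

theorem multOp_apply (e : Fin N → C(Torus N, ℝ)) (f : State N p) (i : Fin N) :
    multOp p e f i = mulOp p (e i) f := rfl

theorem norm_multOp_apply_le {e : Fin N → C(Torus N, ℝ)} {B : ℝ} (hB0 : 0 ≤ B)
    (hB : ∀ i, ‖e i‖ ≤ B) (f : State N p) : ‖multOp p e f‖ ≤ B * ‖f‖ := by
  refine (pi_norm_le_iff_of_nonneg (by positivity)).2 fun i => ?_
  exact (norm_mulOp_apply_le _ _).trans (mul_le_mul_of_nonneg_right (hB i) (norm_nonneg _))

theorem norm_multOp_le {e : Fin N → C(Torus N, ℝ)} {B : ℝ} (hB0 : 0 ≤ B)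
    (hB : ∀ i, ‖e i‖ ≤ B) : ‖multOp p e‖ ≤ B :=
  ContinuousLinearMap.opNorm_le_bound _ hB0 fun f => norm_multOp_apply_le hB0 hB f

variable {T B : ℝ} {e : ℝ → Fin N → C(Torus N, ℝ)}

theorem aestronglyMeasurable_mulOp {e : ℝ → C(Torus N, ℝ)}
    (he : AEStronglyMeasurable e (volume.restrict (Ioc 0 T))) {u : ℝ → State N p}
    (hu : ContinuousOn u (Icc 0 T)) :
    AEStronglyMeasurable (fun s => mulOp p (e s) (u s)) (volume.restrict (Ioc 0 T)) :=
  (mulOp p).aestronglyMeasurable_comp₂ he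
    ((hu.mono Ioc_subset_Icc_self).aestronglyMeasurable measurableSet_Ioc)

theorem aestronglyMeasurable_pi {μ : Measure ℝ} {X : Type*} [NormedAddCommGroup X]
    [NormedSpace ℝ X] {ι : Type*} [Fintype ι] {r : ℝ → ι → X}
    (h : ∀ i, AEStronglyMeasurable (fun s => r s i) μ) : AEStronglyMeasurable r μ := by
  classical
  have h1 : r = fun s => ∑ i, (ContinuousLinearMap.single ℝ (fun _ : ι => X) i) (r s i) := by
    ext1 s
    exact (Finset.univ_sum_single (r s)).symm
  rw [h1]
  exact Finset.aestronglyMeasurable_fun_sum _ fun i _ =>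
    (ContinuousLinearMap.continuous _).comp_aestronglyMeasurable (h i)

theorem BddForce.aestronglyMeasurable (he : BddForce T B e) {u : ℝ → State N p}
    (hu : ContinuousOn u (Icc 0 T)) :
    AEStronglyMeasurable (fun s => multOp p (e s) (u s)) (volume.restrict (Ioc 0 T)) :=
  aestronglyMeasurable_pi fun i => aestronglyMeasurable_mulOp (he.meas i) hu

theorem BddForce.norm_le (he : BddForce T B e) {s : ℝ} (hs : s ∈ Icc 0 T) :
    ‖multOp p (e s)‖ ≤ B := norm_multOp_le he.nonneg (he.bound s hs)

theorem BddForce.exists_bound (he : BddForce T B e) {u : ℝ → State N p}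
    (hu : ContinuousOn u (Icc 0 T)) :
    ∃ D, ∀ s ∈ Icc 0 T, ‖multOp p (e s) (u s)‖ ≤ D := by
  obtain ⟨D, hD⟩ := isCompact_Icc.exists_bound_of_continuousOn hu
  refine ⟨B * D, fun s hs => (norm_multOp_apply_le he.nonneg (he.bound s hs) _).trans ?_⟩
  exact mul_le_mul_of_nonneg_left (hD s hs) he.nonneg

theorem MomLe.intervalIntegral {l : ℕ} {b : ℝ → ℝ} {H : ℝ → State N p} {t : ℝ} (ht : 0 ≤ t)
    (hH : IntervalIntegrable H volume 0 t) (hb : IntervalIntegrable b volume 0 t)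
    (h : ∀ s ∈ Ioo 0 t, MomLe l (b s) (H s)) :
    MomLe l (∫ s in (0 : ℝ)..t, b s) (∫ s in (0 : ℝ)..t, H s) := by
  rw [intervalIntegral.integral_of_le ht, intervalIntegral.integral_of_le ht]
  refine MomLe.integral ((intervalIntegrable_iff_integrableOn_Ioc_of_le ht).1 hH)
    ((intervalIntegrable_iff_integrableOn_Ioc_of_le ht).1 hb) ?_
  rw [ae_restrict_iff' measurableSet_Ioc]
  filter_upwards [Measure.ae_ne volume t] with s hst hs
  exact h s ⟨hs.1, lt_of_le_of_ne hs.2 hst⟩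

variable [Fact (p ≠ ⊤)]

/-- The mild equation, with a source term `q`, as an equation in `L^p`. -/
structure MildEq (T : ℝ) (e : ℝ → Fin N → C(Torus N, ℝ)) (q : ℝ → Fin N → State N p)
    (fin : State N p) (f : ℝ → State N p) : Prop where
  cont : ContinuousOn f (Icc 0 T)
  eq : ∀ t ∈ Icc 0 T, f t = kineticOp p t fin +
    ∫ s in (0 : ℝ)..t, gradOp p (t - s) (multOp p (e s) (f s) + q s)

theorem continuousOn_kineticOp_Icc (T : ℝ) (f : State N p) :
    ContinuousOn (fun t => kineticOp p t f) (Icc 0 T) :=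
  (continuousOn_kineticOp f).mono fun _ ht => ht.1

theorem norm_kineticOp_apply_le {T t : ℝ} (ht : t ∈ Icc 0 T) (f : State N p) :
    ‖kineticOp p t f‖ ≤ Real.exp (N * T) * ‖f‖ := by
  refine (ContinuousLinearMap.le_opNorm _ _).trans (mul_le_mul_of_nonneg_right
    ((norm_kineticOp_le t).trans ?_) (norm_nonneg _))
  rw [abs_of_nonneg ht.1]
  exact Real.exp_le_exp.2 (mul_le_mul_of_nonneg_left ht.2 (Nat.cast_nonneg N))

/-- A solution which takes its values in a closed invariant set. -/
theorem exists_mildEq_mem (hT : 0 ≤ T) (he : BddForce T B e) (fin : State N p)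
    (F : ℝ → Set (State N p)) (hF : ∀ t, IsClosed (F t))
    (hF0 : ∀ t ∈ Icc 0 T, kineticOp p t fin ∈ F t)
    (hinv : ∀ v : ℝ → State N p, ContinuousOn v (Icc 0 T) → (∀ t ∈ Icc 0 T, v t ∈ F t) →
      ∀ t ∈ Icc 0 T, kineticOp p t fin +
        ∫ s in (0 : ℝ)..t, gradOp p (t - s) (multOp p (e s) (v s)) ∈ F t) :
    ∃ f, MildEq T e 0 fin f ∧ ∀ t ∈ Icc 0 T, f t ∈ F t := by
  obtain ⟨u, hu, huF, heq⟩ := (singularKernel_gradOp (N := N) (p := p) T).exists_solution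
    (gradConst_nonneg N T) hT he.nonneg (fun s hs => he.norm_le hs)
    (fun u hu => he.aestronglyMeasurable hu) (q := 0)
    aestronglyMeasurable_const (Q := 0) (fun s _ => by simp) (continuousOn_kineticOp_Icc T fin) F hF
    (continuousOn_kineticOp_Icc T fin) hF0 (fun v hv hvF t ht => by
      simpa only [Pi.zero_apply, add_zero] using hinv v hv hvF t ht)
  exact ⟨u, ⟨hu, heq⟩, huF⟩

theorem exists_mildEq (hT : 0 ≤ T) (he : BddForce T B e) (fin : State N p)
    {q : ℝ → Fin N → State N p} (hq : AEStronglyMeasurable q (volume.restrict (Ioc 0 T))) {Q : ℝ}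
    (hQ : ∀ s ∈ Icc 0 T, ‖q s‖ ≤ Q) : ∃ f, MildEq T e q fin f := by
  obtain ⟨u, hu, -, heq⟩ := (singularKernel_gradOp (N := N) (p := p) T).exists_solution
    (gradConst_nonneg N T) hT he.nonneg (fun s hs => he.norm_le hs)
    (fun u hu => he.aestronglyMeasurable hu) hq hQ (continuousOn_kineticOp_Icc T fin)
    (fun _ => univ) (fun _ => isClosed_univ)
    (continuousOn_kineticOp_Icc T fin) (fun _ _ => mem_univ _) (fun _ _ _ _ _ => mem_univ _)
  exact ⟨u, hu, heq⟩

/-- The constant in the stability estimate. -/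
def stabConst (N : ℕ) (T B : ℝ) : ℝ :=
  2 * (Real.exp (N * T) + 2 * gradConst N T * √T) * Real.exp (gronwallRate (gradConst N T * B) * T)

theorem stabConst_nonneg (N : ℕ) (T B : ℝ) : 0 ≤ stabConst N T B := by
  have := gradConst_nonneg N T
  unfold stabConst
  positivity

/-- The singular Gronwall inequality for the mild equation. It gives uniqueness and all derivative
estimates, with a constant that depends on N, T and B only. -/
theorem MildEq.norm_le (he : BddForce T B e) {q : ℝ → Fin N → State N p} {Q : ℝ} (hQ0 : 0 ≤ Q)
    (hQ : ∀ s ∈ Icc 0 T, ‖q s‖ ≤ Q) {fin : State N p} {f : ℝ → State N p}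
    (hf : MildEq T e q fin f) : ∀ t ∈ Icc 0 T, ‖f t‖ ≤ stabConst N T B * (‖fin‖ + Q) := by
  intro t ht
  have hC := gradConst_nonneg N T
  refine ((singularKernel_gradOp (N := N) (p := p) T).norm_le hC he.nonneg
    (fun s hs => he.norm_le hs) hQ0 hQ hf.cont (a := Real.exp (N * T) * ‖fin‖) (by positivity)
    (fun t ht => norm_kineticOp_apply_le ht fin) hf.eq t ht).trans ?_
  rw [stabConst, mul_right_comm _ (Real.exp (gronwallRate _ * T))]
  refine mul_le_mul_of_nonneg_right ?_ (Real.exp_pos _).le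
  have h1 := mul_nonneg (Real.exp_pos (N * T)).le hQ0
  have h2 := mul_nonneg (mul_nonneg (mul_nonneg zero_le_two hC) (Real.sqrt_nonneg T))
    (norm_nonneg fin)
  nlinarith

/-- The time integral of the mild equation is well-defined. -/
theorem intervalIntegrable_gradOp {r : ℝ → Fin N → State N p}
    (hr : AEStronglyMeasurable r (volume.restrict (Ioc 0 T))) {D : ℝ}
    (hD : ∀ s ∈ Icc 0 T, ‖r s‖ ≤ D) {t : ℝ} (ht : t ∈ Icc 0 T) :
    IntervalIntegrable (fun s => gradOp p (t - s) (r s)) volume 0 t :=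
  (singularKernel_gradOp T).intervalIntegrable (gradConst_nonneg N T) hr hD ht

theorem MildEq.sub (he : BddForce T B e) {q q' : ℝ → Fin N → State N p}
    (hq : AEStronglyMeasurable q (volume.restrict (Ioc 0 T))) {Q : ℝ}
    (hQ : ∀ s ∈ Icc 0 T, ‖q s‖ ≤ Q)
    (hq' : AEStronglyMeasurable q' (volume.restrict (Ioc 0 T))) {Q' : ℝ}
    (hQ' : ∀ s ∈ Icc 0 T, ‖q' s‖ ≤ Q') {fin fin' : State N p} {f f' : ℝ → State N p}
    (hf : MildEq T e q fin f) (hf' : MildEq T e q' fin' f') :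
    MildEq T e (fun s => q s - q' s) (fin - fin') (fun t => f t - f' t) := by
  have hi : ∀ {q : ℝ → Fin N → State N p}
      (_ : AEStronglyMeasurable q (volume.restrict (Ioc 0 T))) {Q : ℝ}
      (_ : ∀ s ∈ Icc 0 T, ‖q s‖ ≤ Q) {u : ℝ → State N p} (_ : ContinuousOn u (Icc 0 T)) {t : ℝ}
      (_ : t ∈ Icc 0 T),
      IntervalIntegrable (fun s => gradOp p (t - s) (multOp p (e s) (u s) + q s)) volume 0 t := by
    intro q hq Q hQ u hu t ht
    obtain ⟨D, hD⟩ := he.exists_bound hu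
    exact intervalIntegrable_gradOp ((he.aestronglyMeasurable hu).add hq)
      (fun s hs => (norm_add_le _ _).trans (add_le_add (hD s hs) (hQ s hs))) ht
  refine ⟨hf.cont.sub hf'.cont, fun t ht => ?_⟩
  rw [hf.eq t ht, hf'.eq t ht, map_sub, add_sub_add_comm,
    ← intervalIntegral.integral_sub (hi hq hQ hf.cont ht) (hi hq' hQ' hf'.cont ht)]
  congr 1
  refine intervalIntegral.integral_congr fun s _ => ?_
  rw [← map_sub, map_sub (multOp p (e s))]
  congr 1
  abel

theorem MildEq.eqOn (he : BddForce T B e) {fin : State N p} {f f' : ℝ → State N p}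
    (hf : MildEq T e 0 fin f) (hf' : MildEq T e 0 fin f') : EqOn f f' (Icc 0 T) := by
  intro t ht
  have hz : ∀ s ∈ Icc (0 : ℝ) T, ‖(0 : ℝ → Fin N → State N p) s‖ ≤ 0 := fun s _ => by simp
  have h := (hf.sub he aestronglyMeasurable_const hz aestronglyMeasurable_const hz hf').norm_le he
    le_rfl (by simp) t ht
  rw [sub_self, norm_zero, add_zero, mul_zero] at h
  exact sub_eq_zero.1 (norm_le_zero_iff.1 h)

theorem mildEq_zero_iff {fin : State N p} {f : ℝ → State N p} :
    MildEq T e 0 fin f ↔ ContinuousOn f (Icc 0 T) ∧ ∀ t ∈ Icc 0 T, f t = kineticOp p t fin +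
      ∫ s in (0 : ℝ)..t, gradOp p (t - s) (multOp p (e s) (f s)) := by
  constructor
  · exact fun h => ⟨h.cont, fun t ht => by simpa using h.eq t ht⟩
  · exact fun h => ⟨h.1, fun t ht => by simpa using h.2 t ht⟩

/-- The pointwise mild formulation is the mild equation in `L^p`. -/
theorem isMildSolution_iff (he : BddForce T B e) {E : ℝ → Torus N → Vel N}
    (hE : ∀ s ∈ Icc 0 T, ∀ i, (fun x => E s x i) =ᵐ[volume] e s i) {fin : State N p}
    {f : ℝ → State N p} : IsMildSolution T E fin f ↔ MildEq T e 0 fin f := by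
  rw [mildEq_zero_iff, IsMildSolution]
  refine and_congr_right fun hf => forall₂_congr fun t ht => ?_
  obtain ⟨D, hD⟩ := he.exists_bound hf
  have hsub : Icc 0 t ⊆ Icc 0 T := Icc_subset_Icc_right ht.2
  have h1 := integral_gradKernelOp_ae (p := p) ht.1 (r := fun s => multOp p (e s) (f s))
    ((he.aestronglyMeasurable hf).mono_measure
      (Measure.restrict_mono (Ioc_subset_Ioc_right ht.2) le_rfl))
    (fun s hs => hD s (hsub hs)) (g := fun s z' => f s z' • E s z'.1) fun s hs i => by
      have h2 : ∀ᵐ z : Phase N, E s z.1 i = e s i z.1 :=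
        Measure.quasiMeasurePreserving_fst.ae (hE s (hsub (Ioc_subset_Icc_self hs)) i)
      filter_upwards [h2, coeFn_mulOp (p := p) (e s i) (f s)] with z hz hz'
      rw [multOp_apply, hz', ← hz, PiLp.smul_apply, smul_eq_mul, mul_comm]
  have h3 := Lp.coeFn_add (kineticOp p t fin)
    (∫ s in (0 : ℝ)..t, gradOp p (t - s) (multOp p (e s) (f s)))
  constructor
  · intro h
    refine Lp.ext ?_
    filter_upwards [h, h1, h3, kernelOp_ae ht.1 fin] with z hz hz1 hz3 hz4
    rw [hz.2, hz1.2, hz3, hz4, Pi.add_apply]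
  · intro h
    rw [h]
    filter_upwards [h1, h3, kernelOp_ae ht.1 fin] with z hz1 hz3 hz4
    exact ⟨hz1.1, by rw [hz1.2, hz3, hz4, Pi.add_apply]⟩

theorem MildEq.massOp {fin : State N 1} {f : ℝ → State N 1} (he : BddForce T B e)
    (hf : MildEq T e 0 fin f) {t : ℝ} (ht : t ∈ Icc 0 T) : massOp N (f t) = massOp N fin := by
  obtain ⟨D, hD⟩ := he.exists_bound hf.cont
  rw [(mildEq_zero_iff.1 hf).2 t ht, map_add, massOp_kineticOp,
    ← ContinuousLinearMap.intervalIntegral_comp_comm _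
      (intervalIntegrable_gradOp (he.aestronglyMeasurable hf.cont) hD ht)]
  simp only [massOp_gradOp, intervalIntegral.integral_zero, add_zero]

/-- Moments are propagated. -/
theorem MildEq.memG (hT : 0 ≤ T) (he : BddForce T B e) {fin : State N p} {f : ℝ → State N p}
    (hf : MildEq T e 0 fin f) {l : ℕ} (h : MemG l fin) {t : ℝ} (ht : t ∈ Icc 0 T) :
    MemG l (f t) := by
  obtain ⟨b, hb, hbf⟩ := exists_momLe_of_memG h
  have hm := momConst_nonneg N l
  have hB := he.nonneg
  set D := 4 ^ l * momConst N l * b with hD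
  have hD0 : 0 ≤ D := by positivity
  set C := N * (2 * √(2 * Real.exp T) * (4 ^ l * momConst N l)) with hC
  have hC0 : 0 ≤ C := by positivity
  set lam := gronwallRate (C * B) with hlam
  have hl : 0 < lam := gronwallRate_pos _
  have hu0 : ∀ t ∈ Icc 0 T, MomLe l D (kineticOp p t fin) := fun t ht => hbf.kineticOp ht.1
  have hexp : ∀ t ∈ Icc 0 T, 1 ≤ Real.exp (lam * t) := fun t ht =>
    Real.one_le_exp (mul_nonneg hl.le ht.1)
  -- The bound 2De^{λt} is preserved: the datum contributes at most D, and λ is chosen so that the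
  -- integral contributes at most De^{λt}. Uniqueness then identifies the solution built inside
  -- these sets with f.
  obtain ⟨g, hg, hgF⟩ := exists_mildEq_mem hT he fin
    (fun t => {f | MomLe l (2 * D * Real.exp (lam * t)) f}) (fun t => isClosed_momLe _ _)
    (fun t ht => (hu0 t ht).mono (by nlinarith [hexp t ht])) fun v hv hvF t ht => by
      obtain ⟨D', hD'⟩ := he.exists_bound hv
      have h1 : ∀ s ∈ Ioo 0 t, MomLe l
          (C * (B * (2 * D)) * ((t - s) ^ (-(1 / 2) : ℝ) * Real.exp (lam * s)))
          (gradOp p (t - s) (multOp p (e s) (v s))) := fun s hs => by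
        have hsT : s ∈ Icc 0 T := ⟨hs.1.le, hs.2.le.trans ht.2⟩
        have h2 : ∀ i, MomLe l (B * (2 * D * Real.exp (lam * s))) (multOp p (e s) (v s) i) :=
          fun i => ((hvF s hsT).mulOp (e s i)).mono
            (mul_le_mul_of_nonneg_right (he.bound s hsT i) (by positivity))
        exact (MomLe.gradOp h2 (T := T) ⟨sub_pos.2 hs.2, by linarith [hs.1, ht.2]⟩).mono
          (le_of_eq (by rw [hC]; ring))
      have hbi : IntervalIntegrable (fun s => C * (B * (2 * D)) *
          ((t - s) ^ (-(1 / 2) : ℝ) * Real.exp (lam * s))) volume 0 t :=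
        ((intervalIntegrable_singular t).mul_continuousOn (by fun_prop)).const_mul _
      have h2 := (hu0 t ht).add (MomLe.intervalIntegral ht.1 (intervalIntegrable_gradOp
        (he.aestronglyMeasurable hv) hD' ht) hbi h1)
      refine h2.mono ?_
      rw [intervalIntegral.integral_const_mul]
      have h3 := integral_singular_exp_le hl ht.1
      have h4 : C * B * √(Real.pi / lam) ≤ 1 / 2 := mul_sqrt_gronwallRate_le _
      have h5 : C * (B * (2 * D)) * (∫ s in (0 : ℝ)..t, (t - s) ^ (-(1 / 2) : ℝ) *
          Real.exp (lam * s)) ≤ C * (B * (2 * D)) * (√(Real.pi / lam) * Real.exp (lam * t)) :=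
        mul_le_mul_of_nonneg_left h3 (by positivity)
      have h6 : C * (B * (2 * D)) * (√(Real.pi / lam) * Real.exp (lam * t)) ≤
          D * Real.exp (lam * t) := by
        calc _ = (C * B * √(Real.pi / lam)) * (2 * D * Real.exp (lam * t)) := by ring
          _ ≤ 1 / 2 * (2 * D * Real.exp (lam * t)) :=
              mul_le_mul_of_nonneg_right h4 (by positivity)
          _ = _ := by ring
      nlinarith [hexp t ht]
  rw [hf.eqOn he hg ht]
  exact memG_of_momLe (hgF t ht)

end Cauchy

/-! ### Positivity -/

section Tilt

variable {X : Type*} [NormedAddCommGroup X] [NormedSpace ℝ X] [CompleteSpace X]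

/-- An iterated integral over a triangle. -/
theorem integral_exp_smul_integral (lam : ℝ) {t : ℝ} (ht : 0 ≤ t) {κ : ℝ → X}
    (hκ : IntervalIntegrable κ volume 0 t) :
    ∫ s in (0 : ℝ)..t, (lam * Real.exp (-lam * (t - s))) • ∫ s' in (0 : ℝ)..s, κ s' =
      ∫ s in (0 : ℝ)..t, (1 - Real.exp (-lam * (t - s))) • κ s := by
  have hκ' : Integrable κ (volume.restrict (Ioc 0 t)) :=
    (intervalIntegrable_iff_integrableOn_Ioc_of_le ht).1 hκ
  let F : ℝ → ℝ → X := fun s s' => (Ici s').indicator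
    (fun s => lam * Real.exp (-lam * (t - s))) s • κ s'
  have hF : Integrable (Function.uncurry F)
      ((volume.restrict (Ioc 0 t)).prod (volume.restrict (Ioc 0 t))) := by
    have h1 : AEStronglyMeasurable (Function.uncurry F)
        ((volume.restrict (Ioc 0 t)).prod (volume.restrict (Ioc 0 t))) := by
      refine AEStronglyMeasurable.smul (f := fun q : ℝ × ℝ =>
        (Ici q.2).indicator (fun s => lam * Real.exp (-lam * (t - s))) q.1) ?_ hκ'.1.comp_snd
      have h2 : (fun q : ℝ × ℝ => (Ici q.2).indicator
          (fun s => lam * Real.exp (-lam * (t - s))) q.1) =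
          {q : ℝ × ℝ | q.2 ≤ q.1}.indicator fun q => lam * Real.exp (-lam * (t - q.1)) := by
        ext q
        by_cases h : q.2 ≤ q.1 <;> simp [indicator, h]
      rw [h2]
      exact (Measurable.indicator (by fun_prop)
        (measurableSet_le measurable_snd measurable_fst)).aestronglyMeasurable
    have h2 : Integrable (fun q : ℝ × ℝ => (|lam| * Real.exp (|lam| * t)) * ‖κ q.2‖)
        ((volume.restrict (Ioc 0 t)).prod (volume.restrict (Ioc 0 t))) :=
      (hκ'.norm.comp_snd _).const_mul _
    refine h2.mono' h1 ?_
    rw [Measure.prod_restrict, ae_restrict_iff' (measurableSet_Ioc.prod measurableSet_Ioc)]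
    refine ae_of_all _ fun q hq => ?_
    simp only [Function.uncurry, F, norm_smul]
    refine mul_le_mul_of_nonneg_right ((norm_indicator_le_norm_self _ _).trans ?_) (norm_nonneg _)
    rw [norm_mul, Real.norm_eq_abs, Real.norm_of_nonneg (Real.exp_pos _).le]
    refine mul_le_mul_of_nonneg_left (Real.exp_le_exp.2 ?_) (abs_nonneg _)
    have h3 : 0 ≤ t - q.1 := sub_nonneg.2 hq.1.2
    have h4 : t - q.1 ≤ t := by linarith [hq.1.1]
    calc -lam * (t - q.1) ≤ |lam| * (t - q.1) :=
          mul_le_mul_of_nonneg_right (neg_le_abs lam) h3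
      _ ≤ _ := mul_le_mul_of_nonneg_left h4 (abs_nonneg _)
  have hswap := integral_integral_swap hF
  rw [intervalIntegral.integral_of_le ht, intervalIntegral.integral_of_le ht]
  have h1 : ∫ s in Ioc 0 t, (lam * Real.exp (-lam * (t - s))) • ∫ s' in (0 : ℝ)..s, κ s' =
      ∫ s in Ioc 0 t, ∫ s' in Ioc 0 t, F s s' := by
    refine setIntegral_congr_fun measurableSet_Ioc fun s hs => ?_
    rw [intervalIntegral.integral_of_le hs.1.le, ← integral_smul]
    have h2 : ∀ s', F s s' = (Iic s).indicator
        (fun s' => (lam * Real.exp (-lam * (t - s))) • κ s') s' := fun s' => by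
      by_cases h : s' ≤ s <;> simp [F, indicator, h]
    simp only [h2]
    rw [integral_indicator measurableSet_Iic, Measure.restrict_restrict measurableSet_Iic]
    congr 2
    ext s'
    simp only [mem_Ioc, mem_inter_iff, mem_Iic]
    exact ⟨fun h => ⟨h.2, h.1, h.2.trans hs.2⟩, fun h => ⟨h.2.1, h.1⟩⟩
  rw [h1, hswap]
  refine setIntegral_congr_fun measurableSet_Ioc fun s' hs' => ?_
  simp only [F]
  rw [integral_smul_const]
  congr 1
  rw [integral_indicator measurableSet_Ici, Measure.restrict_restrict measurableSet_Ici]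
  have h2 : Ici s' ∩ Ioc 0 t = Icc s' t := by
    ext s
    simp only [mem_Ioc, mem_inter_iff, mem_Ici, mem_Icc]
    exact ⟨fun h => ⟨h.1, h.2.2⟩, fun h => ⟨h.1, hs'.1.trans_le h.1, h.2⟩⟩
  rw [h2, integral_Icc_eq_integral_Ioc, ← intervalIntegral.integral_of_le hs'.2]
  have h3 : ∀ s ∈ uIcc s' t, HasDerivAt (fun s => Real.exp (-lam * (t - s)))
      (lam * Real.exp (-lam * (t - s))) s := fun s _ => by
    have h4 : HasDerivAt (fun s => -lam * (t - s)) (-lam * (0 - 1)) s :=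
      ((hasDerivAt_const s t).sub (hasDerivAt_id s)).const_mul _
    convert h4.exp using 1
    ring
  rw [intervalIntegral.integral_eq_sub_of_hasDerivAt h3
    (Continuous.intervalIntegrable (by fun_prop) _ _)]
  simp

end Tilt

/-! ### Difference quotients in velocity and the tilted semigroup -/

section Positivity

variable {N : ℕ} {p : ℝ≥0∞} [Fact (1 ≤ p)] [Fact (p ≠ ⊤)]

/-- A Duhamel formula for the semigroup `K_t` is one for the semigroup `e^{-λt} K_t`. -/
theorem kineticOp_duhamel_tilt (lam : ℝ) {T : ℝ} {r w : ℝ → State N p} {fin : State N p}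
    (hr : AEStronglyMeasurable r (volume.restrict (Ioc 0 T))) {D : ℝ}
    (hD : ∀ s ∈ Icc 0 T, ‖r s‖ ≤ D) (hw : ContinuousOn w (Icc 0 T))
    (h : ∀ t ∈ Icc 0 T, w t = kineticOp p t fin + ∫ s in (0 : ℝ)..t, kineticOp p (t - s) (r s))
    {t : ℝ} (ht : t ∈ Icc 0 T) :
    w t = Real.exp (-lam * t) • kineticOp p t fin +
      ∫ s in (0 : ℝ)..t, Real.exp (-lam * (t - s)) • kineticOp p (t - s) (r s + lam • w s) := by
  have hC : 0 ≤ Real.exp (N * T) * √T := by positivity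
  have hK := singularKernel_kineticOp (N := N) (p := p) T
  have hi := hK.intervalIntegrable hC hr hD ht
  obtain ⟨W, hW⟩ := isCompact_Icc.exists_bound_of_continuousOn hw
  have hiw := hK.intervalIntegrable hC
    ((hw.mono Ioc_subset_Icc_self).aestronglyMeasurable measurableSet_Ioc) hW ht
  have hec : Continuous fun s => Real.exp (-lam * (t - s)) := by fun_prop
  -- By the semigroup property, propagating w(s) to time t gives the Duhamel formula at time t with
  -- the source switched off after s.
  have h1 : ∀ s ∈ Icc 0 t, kineticOp p (t - s) (w s) = kineticOp p t fin +
      ∫ s' in (0 : ℝ)..s, kineticOp p (t - s') (r s') := fun s hs => by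
    have hsT : s ∈ Icc 0 T := ⟨hs.1, hs.2.trans ht.2⟩
    have hts : 0 ≤ t - s := sub_nonneg.2 hs.2
    rw [h s hsT, map_add, kineticOp_kineticOp hts hs.1, sub_add_cancel,
      ← ContinuousLinearMap.intervalIntegral_comp_comm _ (hK.intervalIntegrable hC hr hD hsT)]
    congr 1
    refine intervalIntegral.integral_congr fun s' hs' => ?_
    rw [uIcc_of_le hs.1] at hs'
    beta_reduce
    rw [kineticOp_kineticOp hts (sub_nonneg.2 hs'.2), sub_add_sub_cancel]
  have hexp : ∫ s in (0 : ℝ)..t, lam * Real.exp (-lam * (t - s)) = 1 - Real.exp (-lam * t) := by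
    have h3 : ∀ s ∈ uIcc 0 t, HasDerivAt (fun s => Real.exp (-lam * (t - s)))
        (lam * Real.exp (-lam * (t - s))) s := fun s _ => by
      have h4 : HasDerivAt (fun s => -lam * (t - s)) (-lam * (0 - 1)) s :=
        ((hasDerivAt_const s t).sub (hasDerivAt_id s)).const_mul _
      convert h4.exp using 1
      ring
    rw [intervalIntegral.integral_eq_sub_of_hasDerivAt h3
      (Continuous.intervalIntegrable (by fun_prop) _ _)]
    simp
  -- Inserting `h1` and exchanging the order of integration. The coefficients 1 - e^{-λt} and 1 -
  -- e^{-λ(t-s)} are exactly what the tilted terms lack.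
  have h2 : ∫ s in (0 : ℝ)..t, Real.exp (-lam * (t - s)) • kineticOp p (t - s) (lam • w s) =
      (1 - Real.exp (-lam * t)) • kineticOp p t fin +
      ∫ s in (0 : ℝ)..t, (1 - Real.exp (-lam * (t - s))) • kineticOp p (t - s) (r s) := by
    rw [← integral_exp_smul_integral lam ht.1 hi, ← hexp, ← intervalIntegral.integral_smul_const,
      ← intervalIntegral.integral_add]
    · refine intervalIntegral.integral_congr fun s hs => ?_
      rw [uIcc_of_le ht.1] at hs
      beta_reduce
      rw [map_smul, h1 s hs, smul_smul, mul_comm _ lam, smul_add]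
    · exact Continuous.intervalIntegrable (by fun_prop) _ _
    · refine ContinuousOn.intervalIntegrable ?_
      rw [uIcc_of_le ht.1]
      refine ContinuousOn.smul (f := fun s => lam * Real.exp (-lam * (t - s)))
        (Continuous.continuousOn (by fun_prop)) ?_
      have := intervalIntegral.continuousOn_primitive_interval
        ((intervalIntegrable_iff_integrableOn_Icc_of_le ht.1).1 hi |>.mono_set (by rw [uIcc_of_le ht.1]))
      rwa [uIcc_of_le ht.1] at this
  have hi1 : IntervalIntegrable (fun s => Real.exp (-lam * (t - s)) • kineticOp p (t - s) (r s))
      volume 0 t := hi.continuousOn_smul hec.continuousOn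
  have hi2 : IntervalIntegrable
      (fun s => Real.exp (-lam * (t - s)) • kineticOp p (t - s) (lam • w s)) volume 0 t := by
    simp only [map_smul]
    exact (hiw.smul lam).continuousOn_smul hec.continuousOn
  have hi3 : IntervalIntegrable
      (fun s => (1 - Real.exp (-lam * (t - s))) • kineticOp p (t - s) (r s)) volume 0 t :=
    hi.continuousOn_smul (by fun_prop)
  have h5 : ∫ s in (0 : ℝ)..t, kineticOp p (t - s) (r s) =
      (∫ s in (0 : ℝ)..t, Real.exp (-lam * (t - s)) • kineticOp p (t - s) (r s)) +
      ∫ s in (0 : ℝ)..t, (1 - Real.exp (-lam * (t - s))) • kineticOp p (t - s) (r s) := by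
    rw [← intervalIntegral.integral_add hi1 hi3]
    refine intervalIntegral.integral_congr fun s _ => ?_
    beta_reduce
    rw [← add_smul, add_sub_cancel, one_smul]
  simp only [map_add, smul_add]
  rw [intervalIntegral.integral_add hi1 hi2, h2, h t ht, h5]
  module

/-- The positive and negative coordinate directions of the velocity space. -/
def signedDir (j : Fin N ⊕ Fin N) : Vel N := Sum.elim torusDir (fun i => -torusDir i) j

/-- The positive and negative parts of a force field. -/
def signedForce (e : Fin N → C(Torus N, ℝ)) (j : Fin N ⊕ Fin N) : C(Torus N, ℝ) :=
  Sum.elim (fun i => (e i)⁺) (fun i => (e i)⁻) j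

theorem signedForce_nonneg (e : Fin N → C(Torus N, ℝ)) (j : Fin N ⊕ Fin N) :
    0 ≤ signedForce e j := by
  rcases j with i | i
  · exact posPart_nonneg _
  · exact negPart_nonneg _

theorem norm_signedForce_le {e : Fin N → C(Torus N, ℝ)} {B : ℝ} (hB0 : 0 ≤ B)
    (hB : ∀ i, ‖e i‖ ≤ B) (j : Fin N ⊕ Fin N) : ‖signedForce e j‖ ≤ B := by
  refine (ContinuousMap.norm_le _ hB0).2 fun x => ?_
  have h : ∀ i, |e i x| ≤ B := fun i => ((e i).norm_coe_le_norm x).trans (hB i)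
  rcases j with i | i
  · change |max (e i x) 0| ≤ B
    rw [abs_of_nonneg (le_max_right _ _)]
    exact max_le ((le_abs_self _).trans (h i)) hB0
  · change |max (-(e i x)) 0| ≤ B
    rw [abs_of_nonneg (le_max_right _ _)]
    exact max_le ((neg_le_abs _).trans (h i)) hB0

/-- The products of a function with the positive and negative parts of a force field. -/
def signedMul (p : ℝ≥0∞) [Fact (1 ≤ p)] (e : Fin N → C(Torus N, ℝ)) :
    State N p →L[ℝ] (Fin N ⊕ Fin N → State N p) :=
  ContinuousLinearMap.pi fun j => mulOp p (signedForce e j)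

theorem signedMul_apply (e : Fin N → C(Torus N, ℝ)) (f : State N p) (j : Fin N ⊕ Fin N) :
    signedMul p e f j = mulOp p (signedForce e j) f := rfl

variable {T B : ℝ} {e : ℝ → Fin N → C(Torus N, ℝ)}

theorem BddForce.norm_signedMul_le (he : BddForce T B e) {s : ℝ} (hs : s ∈ Icc 0 T) :
    ‖signedMul p (e s)‖ ≤ B := by
  refine ContinuousLinearMap.opNorm_le_bound _ he.nonneg fun f => ?_
  refine (pi_norm_le_iff_of_nonneg (mul_nonneg he.nonneg (norm_nonneg f))).2 fun j => ?_
  exact (norm_mulOp_apply_le _ _).trans (mul_le_mul_of_nonneg_right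
    (norm_signedForce_le he.nonneg (he.bound s hs) j) (norm_nonneg _))

theorem BddForce.aestronglyMeasurable_signedMul (he : BddForce T B e) {u : ℝ → State N p}
    (hu : ContinuousOn u (Icc 0 T)) :
    AEStronglyMeasurable (fun s => signedMul p (e s) (u s)) (volume.restrict (Ioc 0 T)) := by
  refine aestronglyMeasurable_pi fun j => aestronglyMeasurable_mulOp ?_ hu
  rcases j with i | i
  · exact (ContinuousMap.continuous_postcomp (⟨fun y : ℝ => max y 0, by fun_prop⟩ :
      C(ℝ, ℝ))).comp_aestronglyMeasurable (he.meas i)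
  · exact (ContinuousMap.continuous_postcomp (⟨fun y : ℝ => max (-y) 0, by fun_prop⟩ :
      C(ℝ, ℝ))).comp_aestronglyMeasurable (he.meas i)

theorem dirKineticOp_neg (t : ℝ) (v : Vel N) (f : State N p) :
    dirKineticOp p t (-v) f = -dirKineticOp p t v f := by
  rw [dirKineticOp, dirKineticOp, gaussAvg_apply, gaussAvg_apply, ← integral_neg]
  refine integral_congr_ae (ae_of_all _ fun z => ?_)
  simp only [affScore, scoreDir, smul_neg, inner_neg_left]
  rw [← neg_smul]
  congr 1
  ring

/-- The sum of the derivatives of `K_t` in the signed directions. -/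
def signedGradOp (p : ℝ≥0∞) [Fact (1 ≤ p)] [Fact (p ≠ ⊤)] (t : ℝ)
    (g : Fin N ⊕ Fin N → State N p) : State N p :=
  ∑ j, dirKineticOp p t (signedDir j) (g j)

/-- The negative part of each component is attached to the opposite direction, so the same drift is
written with nonnegative coefficients only. -/
theorem signedGradOp_signedMul (t : ℝ) (e : Fin N → C(Torus N, ℝ)) (f : State N p) :
    signedGradOp p t (signedMul p e f) = gradOp p t (multOp p e f) := by
  rw [signedGradOp, gradOp_apply, Fintype.sum_sum_type, ← Finset.sum_add_distrib]
  refine Finset.sum_congr rfl fun i _ => ?_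
  simp only [signedDir, Sum.elim_inl, Sum.elim_inr, dirKineticOp_neg, signedMul_apply, signedForce,
    multOp_apply]
  rw [← sub_eq_add_neg, ← map_sub, ← sub_apply, ← map_sub, posPart_sub_negPart]

/-- The difference quotients in the signed directions. -/
def shiftOp (p : ℝ≥0∞) [Fact (1 ≤ p)] (h : ℝ) : (Fin N ⊕ Fin N → State N p) →L[ℝ] State N p :=
  ∑ j, h⁻¹ • ((transport p 0 (h • (0, signedDir j)) - ContinuousLinearMap.id ℝ _).comp
    (ContinuousLinearMap.proj j))

theorem shiftOp_apply (h : ℝ) (g : Fin N ⊕ Fin N → State N p) :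
    shiftOp p h g = ∑ j, h⁻¹ • (transport p 0 (h • (0, signedDir j)) (g j) - g j) := by
  simp [shiftOp, sum_apply]

theorem continuous_transport_dir (v : Vel N) (f : State N p) :
    Continuous fun θ : ℝ => transport p 0 (θ • ((0, v) : Vel N × Vel N)) f :=
  (continuous_transport Fact.out f).comp (by fun_prop : Continuous fun θ : ℝ =>
    ((0, θ • (0, v)) : ℝ × (Vel N × Vel N)))

/-- After K_t is applied, a difference quotient becomes an average over steps θ ∈ [0, h] of the
gradient operator on translates. So its norm is O(t^{-1/2}) uniformly in h, although the difference
quotient alone is of size 1/h. -/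
theorem kineticOp_shiftOp {t : ℝ} (ht : 0 < t) {h : ℝ} (hh : 0 < h)
    (g : Fin N ⊕ Fin N → State N p) :
    kineticOp p t (shiftOp p h g) = h⁻¹ • ∫ θ in (0 : ℝ)..h,
      signedGradOp p t fun j => transport p 0 (θ • (0, signedDir j)) (g j) := by
  simp only [signedGradOp]
  rw [intervalIntegral.integral_finsetSum (f := fun j θ => dirKineticOp p t (signedDir j)
      (transport p 0 (θ • (0, signedDir j)) (g j))) fun j _ => Continuous.intervalIntegrable
    ((dirKineticOp p t (signedDir j)).continuous.comp (continuous_transport_dir _ _)) _ _,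
    Finset.smul_sum, shiftOp_apply, map_sum]
  refine Finset.sum_congr rfl fun j _ => ?_
  rw [map_smul, map_sub, kineticOp_shift_sub ht _ _ hh.le]

theorem norm_signedGradOp_le {t : ℝ} (ht : t ∈ Ioc 0 T) {g : Fin N ⊕ Fin N → State N p} {D : ℝ}
    (hD : ∀ j, ‖g j‖ ≤ D) :
    ‖signedGradOp p t g‖ ≤ 2 * N * gradConst N T * t ^ (-(1 / 2) : ℝ) * D := by
  have h1 : ∀ i, ∀ f : State N p, ‖f‖ ≤ D →
      ‖dirKineticOp p t (torusDir i) f‖ ≤ gradConst N T * t ^ (-(1 / 2) : ℝ) * D := fun i f hf => by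
    have h2 : dirKineticOp p t (torusDir i) f = gradOp p t (Pi.single i f) := by
      rw [gradOp_apply, Finset.sum_eq_single i (fun k _ hk => by rw [Pi.single_eq_of_ne hk, map_zero])
        (by simp), Pi.single_eq_same]
    rw [h2]
    refine (ContinuousLinearMap.le_opNorm _ _).trans (mul_le_mul (norm_gradOp_le ht) ?_
      (norm_nonneg _) (mul_nonneg (gradConst_nonneg N T) (Real.rpow_nonneg ht.1.le _)))
    rw [Pi.norm_single]
    exact hf
  have h2 : ∀ j ∈ (Finset.univ : Finset (Fin N ⊕ Fin N)),
      ‖dirKineticOp p t (signedDir j) (g j)‖ ≤ gradConst N T * t ^ (-(1 / 2) : ℝ) * D := by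
    rintro (i | i) -
    · exact h1 i _ (hD _)
    · rw [signedDir, Sum.elim_inr, dirKineticOp_neg, norm_neg]
      exact h1 i _ (hD _)
  refine (norm_sum_le _ _).trans ((Finset.sum_le_sum h2).trans (le_of_eq ?_))
  rw [Finset.sum_const, Finset.card_univ, Fintype.card_sum, Fintype.card_fin, nsmul_eq_mul]
  push_cast
  ring

theorem norm_transport_zero_le (a : Vel N × Vel N) (f : State N p) : ‖transport p 0 a f‖ ≤ ‖f‖ := by
  simpa using norm_transport_apply_le 0 a f

/-- The kernels of the difference quotients are bounded uniformly in the step. -/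
theorem singularKernel_shiftOp (T : ℝ) {h : ℝ} (hh : 0 < h) :
    SingularKernel T (2 * N * gradConst N T)
      fun t => (kineticOp (N := N) p t).comp (shiftOp p h) where
  cont := (singularKernel_kineticOp (N := N) (p := p) T).cont.comp
    (f := fun q : ℝ × (Fin N ⊕ Fin N → State N p) => (q.1, shiftOp p h q.2)) (by fun_prop)
    fun q hq => ⟨hq.1, mem_univ _⟩
  bound τ hτ := by
    have hc := mul_nonneg (mul_nonneg (mul_nonneg zero_le_two (Nat.cast_nonneg N))
      (gradConst_nonneg N T)) (Real.rpow_nonneg hτ.1.le (-(1 / 2) : ℝ))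
    refine ContinuousLinearMap.opNorm_le_bound _ hc fun g => ?_
    rw [ContinuousLinearMap.comp_apply, kineticOp_shiftOp hτ.1 hh, norm_smul, norm_inv,
      Real.norm_of_nonneg hh.le]
    have h1 := intervalIntegral.norm_integral_le_of_norm_le_const (a := 0) (b := h)
      (f := fun θ : ℝ => signedGradOp p τ fun j => transport p 0 (θ • (0, signedDir j)) (g j))
      (C := 2 * N * gradConst N T * τ ^ (-(1 / 2) : ℝ) * ‖g‖) fun θ _ =>
        norm_signedGradOp_le hτ fun j =>
          (norm_transport_zero_le _ _).trans (norm_le_pi_norm g j)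
    rw [sub_zero, abs_of_pos hh] at h1
    rw [inv_mul_le_iff₀ hh, mul_comm h]
    exact h1

/-- The consistency error is governed by the modulus of continuity of g under translations alone, so
no derivative of g is needed. -/
theorem norm_kineticOp_shiftOp_sub_le {t : ℝ} (ht : t ∈ Ioc 0 T) {h : ℝ} (hh : 0 < h)
    {g : Fin N ⊕ Fin N → State N p} {ε : ℝ}
    (hε : ∀ θ ∈ Ioc 0 h, ∀ j, ‖transport p 0 (θ • (0, signedDir j)) (g j) - g j‖ ≤ ε) :
    ‖kineticOp p t (shiftOp p h g) - signedGradOp p t g‖ ≤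
      2 * N * gradConst N T * ε * t ^ (-(1 / 2) : ℝ) := by
  have hadd : ∀ θ : ℝ, signedGradOp p t (fun j => transport p 0 (θ • (0, signedDir j)) (g j)) -
      signedGradOp p t g =
      signedGradOp p t fun j => transport p 0 (θ • (0, signedDir j)) (g j) - g j := fun θ => by
    simp only [signedGradOp, ← Finset.sum_sub_distrib, map_sub]
  have hc : Continuous fun θ : ℝ =>
      signedGradOp p t fun j => transport p 0 (θ • (0, signedDir j)) (g j) :=
    continuous_finsetSum _ fun j _ =>
      (dirKineticOp p t (signedDir j)).continuous.comp (continuous_transport_dir _ _)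
  have h1 : kineticOp p t (shiftOp p h g) - signedGradOp p t g = h⁻¹ • ∫ θ in (0 : ℝ)..h,
      signedGradOp p t fun j => transport p 0 (θ • (0, signedDir j)) (g j) - g j := by
    simp only [← hadd]
    rw [intervalIntegral.integral_sub (hc.intervalIntegrable _ _)
      (continuous_const.intervalIntegrable _ _), smul_sub, ← kineticOp_shiftOp ht.1 hh,
      intervalIntegral.integral_const, sub_zero, smul_smul, inv_mul_cancel₀ hh.ne', one_smul]
  have h2 := intervalIntegral.norm_integral_le_of_norm_le_const (a := 0) (b := h)
    (f := fun θ : ℝ => signedGradOp p t fun j => transport p 0 (θ • (0, signedDir j)) (g j) - g j)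
    (C := 2 * N * gradConst N T * t ^ (-(1 / 2) : ℝ) * ε) fun θ hθ =>
      norm_signedGradOp_le ht fun j => hε θ (by rwa [uIoc_of_le hh.le] at hθ) j
  rw [sub_zero, abs_of_pos hh] at h2
  rw [h1, norm_smul, norm_inv, Real.norm_of_nonneg hh.le, inv_mul_le_iff₀ hh]
  exact h2.trans (le_of_eq (by ring))

theorem mulOp_one (f : State N p) : mulOp p 1 f = f := by
  refine Lp.ext ?_
  filter_upwards [coeFn_mulOp (p := p) 1 f] with z hz
  rw [hz, ContinuousMap.one_apply, one_mul]

/-- The difference quotients become positive after adding a multiple of the identity. -/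
theorem shiftOp_signedMul_add_nonneg {e : Fin N → C(Torus N, ℝ)} (hB0 : 0 ≤ B)
    (hB : ∀ i, ‖e i‖ ≤ B) {h : ℝ} (hh : 0 < h) {f : State N p} (hf : 0 ≤ f) :
    0 ≤ shiftOp p h (signedMul p e f) + (h⁻¹ * (2 * N * B)) • f := by
  -- The translated term has a nonnegative coefficient. The only negative term, -e_j f/h, is
  -- compensated by Bf/h in each of the 2N signed directions.
  have h1 : shiftOp p h (signedMul p e f) + (h⁻¹ * (2 * N * B)) • f =
      ∑ j : Fin N ⊕ Fin N, h⁻¹ • (transport p 0 (h • (0, signedDir j)) (signedMul p e f j) +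
        mulOp p (B • 1 - signedForce e j) f) := by
    have h2 : ∀ j : Fin N ⊕ Fin N,
        h⁻¹ • (transport p 0 (h • (0, signedDir j)) (signedMul p e f j) +
          mulOp p (B • 1 - signedForce e j) f) =
        h⁻¹ • (transport p 0 (h • (0, signedDir j)) (signedMul p e f j) - signedMul p e f j) +
          (h⁻¹ * B) • f := fun j => by
      rw [map_sub, map_smul, sub_apply, smul_apply, mulOp_one, signedMul_apply]
      module
    simp only [h2]
    rw [Finset.sum_add_distrib, ← shiftOp_apply, Finset.sum_const, Finset.card_univ,
      Fintype.card_sum, Fintype.card_fin, ← Nat.cast_smul_eq_nsmul ℝ, smul_smul]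
    congr 2
    push_cast
    ring
  rw [h1]
  refine Finset.sum_nonneg fun j _ => smul_nonneg (inv_nonneg.2 hh.le) (add_nonneg ?_ ?_)
  · exact transport_nonneg _ _ (mulOp_nonneg (signedForce_nonneg e j) hf)
  · refine mulOp_nonneg ?_ hf
    rw [sub_nonneg]
    intro x
    have h3 := ((signedForce e j).norm_coe_le_norm x).trans (norm_signedForce_le hB0 hB j)
    simpa using (le_abs_self _).trans h3

/-- A nonnegative solution of the mild equation for the difference quotients. -/
theorem exists_nonneg_shift_solution (hT : 0 ≤ T) (he : BddForce T B e) {h : ℝ} (hh : 0 < h)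
    {fin : State N p} (hfin : 0 ≤ fin) : ∃ g : ℝ → State N p, ContinuousOn g (Icc 0 T) ∧
      (∀ t ∈ Icc 0 T, 0 ≤ g t) ∧ ∀ t ∈ Icc 0 T, g t = kineticOp p t fin +
        ∫ s in (0 : ℝ)..t, kineticOp p (t - s) (shiftOp p h (signedMul p (e s) (g s))) := by
  set lam := h⁻¹ * (2 * N * B) with hlam
  have hB := he.nonneg
  have hl : 0 ≤ lam := by positivity
  have hC : 0 ≤ Real.exp (N * T) * √T := by positivity
  have hK := singularKernel_kineticOp (N := N) (p := p) T
  have hKt : SingularKernel T (Real.exp (N * T) * √T)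
      fun τ => Real.exp (-lam * τ) • kineticOp (N := N) p τ := by
    refine ⟨?_, fun τ hτ => ?_⟩
    · exact ContinuousOn.smul (f := fun q : ℝ × State N p => Real.exp (-lam * q.1))
        (Continuous.continuousOn (by fun_prop)) hK.cont
    · rw [norm_smul, Real.norm_of_nonneg (Real.exp_pos _).le]
      refine (mul_le_of_le_one_left (norm_nonneg _) (Real.exp_le_one_iff.2 ?_)).trans
        (hK.bound τ hτ)
      nlinarith [mul_nonneg hl hτ.1.le]
  let A : ℝ → State N p →L[ℝ] State N p := fun s =>
    (shiftOp p h).comp (signedMul p (e s)) + lam • ContinuousLinearMap.id ℝ _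
  have hA : ∀ s f, A s f = shiftOp p h (signedMul p (e s) f) + lam • f := fun s f => by
    simp [A]
  have hAn : ∀ s ∈ Icc 0 T, ‖A s‖ ≤ ‖shiftOp (N := N) p h‖ * B + lam := fun s hs => by
    refine ContinuousLinearMap.opNorm_le_bound _ (by positivity) fun f => ?_
    rw [hA, add_mul]
    refine (norm_add_le _ _).trans (add_le_add ?_ ?_)
    · rw [mul_assoc]
      refine (ContinuousLinearMap.le_opNorm _ _).trans
        (mul_le_mul_of_nonneg_left ?_ (norm_nonneg _))
      exact (ContinuousLinearMap.le_opNorm _ _).trans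
        (mul_le_mul_of_nonneg_right (he.norm_signedMul_le hs) (norm_nonneg _))
    · rw [norm_smul, Real.norm_of_nonneg hl]
  have hrm : ∀ u : ℝ → State N p, ContinuousOn u (Icc 0 T) → AEStronglyMeasurable
      (fun s => shiftOp p h (signedMul p (e s) (u s))) (volume.restrict (Ioc 0 T)) := fun u hu =>
    (shiftOp p h).continuous.comp_aestronglyMeasurable (he.aestronglyMeasurable_signedMul hu)
  have hum : ∀ u : ℝ → State N p, ContinuousOn u (Icc 0 T) → AEStronglyMeasurable
      (fun s => lam • u s) (volume.restrict (Ioc 0 T)) := fun u hu =>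
    ((hu.mono Ioc_subset_Icc_self).aestronglyMeasurable measurableSet_Ioc).const_smul lam
  have hu₀ : ContinuousOn (fun t => Real.exp (-lam * t) • kineticOp p t fin) (Icc 0 T) :=
    ContinuousOn.smul (f := fun t : ℝ => Real.exp (-lam * t))
      (Continuous.continuousOn (by fun_prop)) (continuousOn_kineticOp_Icc T fin)
  -- In the tilted equation both the kernel e^{-λτ}K_τ and the operator `A` are positive, so the
  -- cone of nonnegative functions is invariant; the iteration starts from 0.
  obtain ⟨g, hgc, hg0, hg⟩ := hKt.exists_solution hC hT (m := A) (by positivity) hAn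
    (fun u hu => by simp only [hA]; exact (hrm u hu).add (hum u hu)) (q := 0)
    aestronglyMeasurable_const (Q := 0) (fun s _ => by simp) hu₀ (fun _ => {f | 0 ≤ f})
    (fun _ => isClosed_Ici) (v₀ := 0) continuousOn_const (fun _ _ => le_refl (0 : State N p))
    fun v hv hv0 t ht => by
      refine add_nonneg (smul_nonneg (Real.exp_pos _).le (kineticOp_nonneg t hfin)) ?_
      rw [intervalIntegral.integral_of_le ht.1]
      refine integral_nonneg_of_ae ((ae_restrict_iff' measurableSet_Ioc).2
        (ae_of_all _ fun s hs => ?_))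
      have hsT : s ∈ Icc 0 T := ⟨hs.1.le, hs.2.trans ht.2⟩
      refine smul_nonneg (Real.exp_pos _).le (kineticOp_nonneg _ ?_)
      rw [Pi.zero_apply, add_zero, hA]
      exact shiftOp_signedMul_add_nonneg hB (he.bound s hsT) hh (hv0 s hsT)
  refine ⟨g, hgc, hg0, ?_⟩
  let r : ℝ → State N p := fun s => shiftOp p h (signedMul p (e s) (g s))
  have hrg : AEStronglyMeasurable r (volume.restrict (Ioc 0 T)) := hrm g hgc
  obtain ⟨D, hD⟩ := isCompact_Icc.exists_bound_of_continuousOn hgc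
  have hrb : ∀ s ∈ Icc 0 T, ‖r s‖ ≤ ‖shiftOp (N := N) p h‖ * (B * D) := fun s hs =>
    (ContinuousLinearMap.le_opNorm _ _).trans (mul_le_mul_of_nonneg_left
      ((ContinuousLinearMap.le_opNorm _ _).trans (mul_le_mul (he.norm_signedMul_le hs) (hD s hs)
        (norm_nonneg _) hB)) (norm_nonneg _))
  -- The untilted Duhamel expression of g. By the tilting formula, w - g solves a homogeneous
  -- Volterra equation and hence vanishes.
  let w : ℝ → State N p := fun t => kineticOp p t fin +
    ∫ s in (0 : ℝ)..t, kineticOp p (t - s) (r s)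
  have hwc : ContinuousOn w (Icc 0 T) :=
    (continuousOn_kineticOp_Icc T fin).add (hK.continuousOn_integral hC hrg hrb)
  have hwt := fun t ht => kineticOp_duhamel_tilt lam hrg hrb hwc (fun t _ => rfl) (t := t) ht
  obtain ⟨D', hD'⟩ := isCompact_Icc.exists_bound_of_continuousOn hwc
  have hint : ∀ u : ℝ → State N p, ContinuousOn u (Icc 0 T) → ∀ t ∈ Icc 0 T, IntervalIntegrable
      (fun s => Real.exp (-lam * (t - s)) • kineticOp p (t - s) (r s + lam • u s)) volume 0 t :=
    fun u hu t ht => by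
      obtain ⟨D'', hD''⟩ := isCompact_Icc.exists_bound_of_continuousOn hu
      exact hKt.intervalIntegrable hC (r := fun s => r s + lam • u s) (hrg.add (hum u hu))
        (B := ‖shiftOp (N := N) p h‖ * (B * D) + lam * D'')
        (fun s hs => (norm_add_le _ _).trans (add_le_add (hrb s hs) (by
          rw [norm_smul, Real.norm_of_nonneg hl]
          exact mul_le_mul_of_nonneg_left (hD'' s hs) hl))) ht
  have hd : ∀ t ∈ Icc 0 T, w t - g t = 0 + ∫ s in (0 : ℝ)..t,
      (Real.exp (-lam * (t - s)) • kineticOp (N := N) p (t - s))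
        ((lam • ContinuousLinearMap.id ℝ (State N p)) (w s - g s) + (0 : ℝ → State N p) s) :=
    fun t ht => by
      rw [hwt t ht, hg t ht, add_sub_add_left_eq_sub, zero_add]
      simp only [hA, Pi.zero_apply, add_zero, smul_apply]
      rw [← intervalIntegral.integral_sub (hint w hwc t ht) (hint g hgc t ht)]
      refine intervalIntegral.integral_congr fun s _ => ?_
      beta_reduce
      rw [← smul_sub, ← map_sub, add_sub_add_left_eq_sub, ← smul_sub]
      rfl
  intro t ht
  have h1 := hKt.norm_le hC (m := fun _ => lam • ContinuousLinearMap.id ℝ (State N p)) (M := lam) hl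
    (fun s _ => by
      refine ContinuousLinearMap.opNorm_le_bound _ hl fun f => ?_
      rw [smul_apply, norm_smul, Real.norm_of_nonneg hl]
      rfl) (q := 0) (Q := 0) le_rfl (fun s _ => by simp)
    (u := fun t => w t - g t) (hwc.sub hgc) (a := 0) le_rfl (u₀ := fun _ => 0)
    (fun _ _ => by simp) hd t ht
  rw [mul_zero, zero_mul, add_zero, mul_zero, zero_mul] at h1
  exact (sub_eq_zero.1 (norm_le_zero_iff.1 h1)).symm

/-- The translations in velocity are uniformly continuous along a continuous curve. -/
theorem eventually_norm_transport_sub_lt {f : ℝ → State N p} (hf : ContinuousOn f (Icc 0 T))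
    (v : Vel N) {ε : ℝ} (hε : 0 < ε) :
    ∀ᶠ θ : ℝ in 𝓝 0, ∀ s ∈ Icc 0 T, ‖transport p 0 (θ • (0, v)) (f s) - f s‖ < ε := by
  have h1 : Continuous fun q : ℝ × State N p => ‖transport p 0 (q.1 • (0, v)) q.2 - q.2‖ :=
    ((continuous_transport_uncurry.comp (f := fun q : ℝ × State N p =>
      (((0, q.1 • (0, v)), q.2) : (ℝ × (Vel N × Vel N)) × State N p)) (by fun_prop)).sub
        continuous_snd).norm
  have h2 := (isCompact_Icc.image_of_continuousOn hf).eventually_forall_of_forall_eventually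
    (x₀ := (0 : ℝ)) (P := fun θ y => ‖transport p 0 (θ • (0, v)) y - y‖ < ε) fun y _ => by
      refine h1.continuousAt.eventually (gt_mem_nhds ?_)
      simpa [transport_zero] using hε
  filter_upwards [h2] with θ hθ s hs using hθ _ (mem_image_of_mem f hs)

/-- Solutions with a nonnegative initial datum are nonnegative. -/
theorem MildEq.nonneg (hT : 0 ≤ T) (he : BddForce T B e) {fin : State N p} (hfin : 0 ≤ fin)
    {f : ℝ → State N p} (hf : MildEq T e 0 fin f) {t : ℝ} (ht : t ∈ Icc 0 T) : 0 ≤ f t := by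
  have hB := he.nonneg
  set C := 2 * N * gradConst N T with hCdef
  have hC : 0 ≤ C := mul_nonneg (by positivity) (gradConst_nonneg N T)
  set L := 2 * (2 * C * B * √T) * Real.exp (gronwallRate (C * B) * T) with hL
  have hL0 : 0 ≤ L := by positivity
  -- The step is chosen so small that all translates of f(s), s ∈ [0, T], move by less than ε. Then
  -- g - f solves a Volterra equation whose kernel is bounded independently of the step and whose
  -- free term is the consistency error, of order ε.
  have key : ∀ ε > 0, ∃ g : State N p, 0 ≤ g ∧ ‖g - f t‖ ≤ L * ε := fun ε hε => by
    have h1 : ∀ᶠ h : ℝ in 𝓝 0, ∀ j : Fin N ⊕ Fin N, ∀ s ∈ Icc 0 T,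
        ‖transport p 0 (h • (0, signedDir j)) (f s) - f s‖ < ε :=
      eventually_all.2 fun j => eventually_norm_transport_sub_lt hf.cont _ hε
    obtain ⟨δ, hδ, hδ'⟩ := Metric.eventually_nhds_iff.1 h1
    have hh : 0 < δ / 2 := half_pos hδ
    have hθ : ∀ θ ∈ Ioc 0 (δ / 2), ∀ s ∈ Icc 0 T, ∀ j : Fin N ⊕ Fin N,
        ‖transport p 0 (θ • (0, signedDir j)) (signedMul p (e s) (f s) j) -
          signedMul p (e s) (f s) j‖ ≤ B * ε := fun θ hθ s hs j => by
      rw [signedMul_apply, transport_mulOp]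
      -- A translation in velocity does not move the force, which depends on the position only.
      have h2 : torusShift (θ • ((0 : Vel N), signedDir j)).1 (signedForce (e s) j) =
          signedForce (e s) j := by simp [torusShift_zero]
      rw [h2, ← map_sub]
      refine (norm_mulOp_apply_le _ _).trans (mul_le_mul
        (norm_signedForce_le hB (he.bound s hs) j) (hδ' ?_ j s hs).le (norm_nonneg _) hB)
      rw [Real.dist_0_eq_abs, abs_of_pos hθ.1]
      linarith [hθ.2]
    obtain ⟨g, hgc, hg0, hg⟩ := exists_nonneg_shift_solution hT he hh hfin
    refine ⟨g t, hg0 t ht, ?_⟩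
    have hG := singularKernel_shiftOp (N := N) (p := p) T hh
    have hbd : ∀ u : ℝ → State N p, ContinuousOn u (Icc 0 T) →
        ∃ D, ∀ s ∈ Icc 0 T, ‖signedMul p (e s) (u s)‖ ≤ D := fun u hu => by
      obtain ⟨D, hD⟩ := isCompact_Icc.exists_bound_of_continuousOn hu
      exact ⟨B * D, fun s hs => (ContinuousLinearMap.le_opNorm _ _).trans
        (mul_le_mul (he.norm_signedMul_le hs) (hD s hs) (norm_nonneg _) hB)⟩
    have hint : ∀ u : ℝ → State N p, ContinuousOn u (Icc 0 T) → ∀ t ∈ Icc 0 T, IntervalIntegrable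
        (fun s => kineticOp p (t - s) (shiftOp p (δ / 2) (signedMul p (e s) (u s)))) volume 0 t :=
      fun u hu t ht => by
        obtain ⟨D, hD⟩ := hbd u hu
        exact hG.intervalIntegrable hC (he.aestronglyMeasurable_signedMul hu) hD ht
    let u₀ : ℝ → State N p := fun t => ∫ s in (0 : ℝ)..t,
      (kineticOp p (t - s) (shiftOp p (δ / 2) (signedMul p (e s) (f s))) -
        gradOp p (t - s) (multOp p (e s) (f s)))
    have hu₀ : ∀ t ∈ Icc 0 T, ‖u₀ t‖ ≤ 2 * C * B * ε * √T := fun t ht => by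
      have h3 := intervalIntegral.norm_integral_le_of_norm_le (f := fun s =>
        kineticOp p (t - s) (shiftOp p (δ / 2) (signedMul p (e s) (f s))) -
        gradOp p (t - s) (multOp p (e s) (f s)))
        (g := fun s => C * (B * ε) * (t - s) ^ (-(1 / 2) : ℝ)) (μ := volume) ht.1 (by
          filter_upwards [Measure.ae_ne volume t] with s hst hs
          rw [← signedGradOp_signedMul]
          exact norm_kineticOp_shiftOp_sub_le (T := T)
            ⟨sub_pos.2 (lt_of_le_of_ne hs.2 hst), by linarith [hs.1, ht.2]⟩ hh
            fun θ h4 j => hθ θ h4 s ⟨hs.1.le, hs.2.trans ht.2⟩ j)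
        ((intervalIntegrable_singular t).const_mul _)
      refine h3.trans ?_
      rw [intervalIntegral.integral_const_mul, integral_singular_Ioc ht.1, sub_zero]
      calc C * (B * ε) * (2 * √t) = 2 * C * B * ε * √t := by ring
        _ ≤ _ := mul_le_mul_of_nonneg_left (Real.sqrt_le_sqrt ht.2) (by positivity)
    have hd : ∀ t ∈ Icc 0 T, g t - f t = u₀ t + ∫ s in (0 : ℝ)..t,
        ((kineticOp (N := N) p (t - s)).comp (shiftOp p (δ / 2)))
          (signedMul p (e s) (g s - f s) + (0 : ℝ → Fin N ⊕ Fin N → State N p) s) := fun t ht => by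
      obtain ⟨D, hD⟩ := he.exists_bound hf.cont
      have h4 := intervalIntegrable_gradOp (he.aestronglyMeasurable hf.cont) hD ht
      rw [hg t ht, (mildEq_zero_iff.1 hf).2 t ht, add_sub_add_left_eq_sub]
      simp only [u₀, Pi.zero_apply, add_zero, map_sub, ContinuousLinearMap.comp_apply]
      rw [intervalIntegral.integral_sub (hint f hf.cont t ht) h4,
        intervalIntegral.integral_sub (hint g hgc t ht) (hint f hf.cont t ht)]
      abel
    refine (hG.norm_le hC hB (fun s hs => he.norm_signedMul_le hs) (Q := 0) le_rfl
      (fun s _ => by simp) (u := fun t => g t - f t) (hgc.sub hf.cont) (by positivity) hu₀ hd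
      t ht).trans (le_of_eq ?_)
    rw [hL]
    ring
  have hcl : IsClosed {g : State N p | 0 ≤ g} := isClosed_Ici
  change f t ∈ {g : State N p | 0 ≤ g}
  rw [← hcl.closure_eq, Metric.mem_closure_iff]
  intro ε hε
  obtain ⟨g, hg0, hg⟩ := key (ε / (2 * (L + 1))) (by positivity)
  refine ⟨g, hg0, ?_⟩
  rw [dist_comm, dist_eq_norm]
  refine hg.trans_lt ?_
  rw [mul_div_assoc', div_lt_iff₀ (by positivity)]
  nlinarith

/-- The `L¹` norm of a nonnegative solution is constant. -/
theorem MildEq.norm_eq (hT : 0 ≤ T) (he : BddForce T B e) {fin : State N 1} (hfin : 0 ≤ fin)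
    {f : ℝ → State N 1} (hf : MildEq T e 0 fin f) {t : ℝ} (ht : t ∈ Icc 0 T) :
    ‖f t‖ = ‖fin‖ := by
  rw [← massOp_eq_norm (hf.nonneg hT he hfin ht), hf.massOp he ht, massOp_eq_norm hfin]

/-- The `L¹` norm of a solution does not increase. -/
theorem MildEq.norm_le_norm (hT : 0 ≤ T) (he : BddForce T B e) {fin : State N 1}
    {f : ℝ → State N 1} (hf : MildEq T e 0 fin f) {t : ℝ} (ht : t ∈ Icc 0 T) :
    ‖f t‖ ≤ ‖fin‖ := by
  have hz : ∀ s ∈ Icc (0 : ℝ) T, ‖(0 : ℝ → Fin N → State N 1) s‖ ≤ 0 := fun s _ => by simp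
  -- By linearity and uniqueness f is the difference of the solutions with data the two parts of
  -- `fin`. Each of them keeps its norm, and the two norms add up to that of `fin`.
  obtain ⟨f₁, h₁⟩ := exists_mildEq hT he fin⁺ (q := 0) aestronglyMeasurable_const hz
  obtain ⟨f₂, h₂⟩ := exists_mildEq hT he fin⁻ (q := 0) aestronglyMeasurable_const hz
  have h₃ := h₁.sub he aestronglyMeasurable_const hz aestronglyMeasurable_const hz h₂
  rw [posPart_sub_negPart] at h₃
  have h₄ : MildEq T e 0 fin fun t => f₁ t - f₂ t :=
    ⟨h₃.cont, by simpa using h₃.eq⟩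
  have hp : 0 ≤ fin⁺ := posPart_nonneg _
  have hn : 0 ≤ fin⁻ := negPart_nonneg _
  rw [hf.eqOn he h₄ ht]
  refine (norm_sub_le _ _).trans ?_
  rw [h₁.norm_eq hT he hp ht, h₂.norm_eq hT he hn ht, ← massOp_eq_norm hp, ← massOp_eq_norm hn,
    ← map_add, posPart_add_negPart, massOp_eq_norm (abs_nonneg _), norm_abs_eq_norm]

end Positivity

/-! ### Test functions on the phase space -/

section TestFunctions

variable {N : ℕ}

/-- Test functions are smooth through their lifts; the quotient property transfers continuity, and
surjectivity reduces pointwise identities to the lifts. -/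
theorem isOpenQuotientMap_toPhase : IsOpenQuotientMap (toPhase (N := N)) := by
  have h1 : IsOpenMap (toTorus (N := N)) := by
    have h2 : IsOpenMap (Pi.map fun (_ : Fin N) (y : ℝ) => (y : UnitAddCircle)) :=
      IsOpenMap.piMap (fun _ => QuotientAddGroup.isOpenMap_coe)
        (Eventually.of_forall fun _ => QuotientAddGroup.mk_surjective)
    exact h2.comp (PiLp.homeomorph 2 _).isOpenMap
  have h3 : Function.Surjective (toTorus (N := N)) := fun x =>
    ⟨torusSection x, toTorus_torusSection x⟩
  exact ⟨fun z => ⟨(torusSection z.1, z.2), by simp [toPhase, toTorus_torusSection]⟩,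
    continuous_toPhase, h1.prodMap IsOpenMap.id⟩

variable {φ : Phase N → ℝ}

theorem IsTestFunction.continuous (h : IsTestFunction toPhase φ) : Continuous φ :=
  isOpenQuotientMap_toPhase.isQuotientMap.continuous_iff.2 h.1.continuous

theorem hasDerivAt_comp_add (h : IsTestFunction toPhase φ) (ζ e : Vel N × Vel N) (θ : ℝ) :
    HasDerivAt (fun s : ℝ => φ (toPhase ζ + toPhase (s • e)))
      (fderiv ℝ (φ ∘ toPhase) (ζ + θ • e) e) θ := by
  have h1 : HasDerivAt (fun s : ℝ => ζ + s • e) ((1 : ℝ) • e) θ :=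
    ((hasDerivAt_id θ).smul_const e).const_add ζ
  have h2 := (h.1.differentiable (by simp) (ζ + θ • e)).hasFDerivAt.comp_hasDerivAt θ h1
  rw [one_smul] at h2
  have h3 : (fun s : ℝ => φ (toPhase ζ + toPhase (s • e))) = (φ ∘ toPhase) ∘ fun s : ℝ => ζ + s • e :=
    funext fun s => by simp [toPhase_add]
  rw [h3]
  exact h2

theorem dirDeriv_toPhase (h : IsTestFunction toPhase φ) (e ζ : Vel N × Vel N) :
    dirDeriv toPhase e φ (toPhase ζ) = fderiv ℝ (φ ∘ toPhase) ζ e := by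
  rw [dirDeriv, (hasDerivAt_comp_add h ζ e 0).deriv, zero_smul, add_zero]

theorem dirDeriv_comp_toPhase (h : IsTestFunction toPhase φ) (e : Vel N × Vel N) :
    dirDeriv toPhase e φ ∘ toPhase = fun ζ => fderiv ℝ (φ ∘ toPhase) ζ e :=
  funext fun ζ => dirDeriv_toPhase h e ζ

theorem hasDerivAt_comp_add' (h : IsTestFunction toPhase φ) (z : Phase N) (e : Vel N × Vel N)
    (θ : ℝ) : HasDerivAt (fun s : ℝ => φ (z + toPhase (s • e)))
      (dirDeriv toPhase e φ (z + toPhase (θ • e))) θ := by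
  obtain ⟨ζ, rfl⟩ := isOpenQuotientMap_toPhase.surjective z
  rw [← toPhase_add, dirDeriv_toPhase h]
  exact hasDerivAt_comp_add h ζ e θ

theorem IsTestFunction.dirDeriv (h : IsTestFunction toPhase φ) (e : Vel N × Vel N) :
    IsTestFunction toPhase (dirDeriv toPhase e φ) := by
  refine ⟨?_, h.2.mono' fun z hz => ?_⟩
  · rw [dirDeriv_comp_toPhase h]
    exact (h.1.fderiv_right (m := ∞) (by simp)).clm_apply contDiff_const
  · by_contra hz'
    refine hz ?_
    have h1 : φ =ᶠ[𝓝 z] 0 := notMem_tsupport_iff_eventuallyEq.1 hz'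
    have h2 : Tendsto (fun s : ℝ => z + toPhase (s • e)) (𝓝 0) (𝓝 z) := by
      have h3 : Continuous fun s : ℝ => z + toPhase (s • e) :=
        continuous_const.add (continuous_toPhase.comp (by fun_prop))
      simpa [toPhase_zero] using h3.tendsto 0
    have h4 : (fun s : ℝ => φ (z + toPhase (s • e))) =ᶠ[𝓝 0] fun _ => 0 := h2.eventually h1
    rw [KineticFP.dirDeriv, h4.deriv_eq, deriv_const]

theorem IsTestFunction.add_right (h : IsTestFunction toPhase φ) (a : Vel N × Vel N) :
    IsTestFunction toPhase fun z => φ (z + toPhase a) := by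
  refine ⟨?_, h.2.comp_homeomorph (Homeomorph.addRight (toPhase a))⟩
  have h1 : (fun z => φ (z + toPhase a)) ∘ toPhase = (φ ∘ toPhase) ∘ fun ζ => ζ + a :=
    funext fun ζ => by simp [toPhase_add]
  rw [h1]
  exact h.1.comp (contDiff_id.add contDiff_const)

theorem dirDeriv_comm (h : IsTestFunction toPhase φ) (e e' : Vel N × Vel N) :
    dirDeriv toPhase e (dirDeriv toPhase e' φ) = dirDeriv toPhase e' (dirDeriv toPhase e φ) := by
  have key : ∀ a b ζ, dirDeriv toPhase a (dirDeriv toPhase b φ) (toPhase ζ) =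
      fderiv ℝ (fderiv ℝ (φ ∘ toPhase)) ζ a b := fun a b ζ => by
    rw [dirDeriv_toPhase (h.dirDeriv b), dirDeriv_comp_toPhase h]
    have h1 : DifferentiableAt ℝ (fderiv ℝ (φ ∘ toPhase)) ζ :=
      ((h.1.fderiv_right (m := ∞) (by simp)).differentiable (by simp)) ζ
    rw [fderiv_clm_apply h1 (differentiableAt_const b)]
    simp
  ext z
  obtain ⟨ζ, rfl⟩ := isOpenQuotientMap_toPhase.surjective z
  rw [key, key]
  exact ((contDiff_infty.1 h.1 2).contDiffAt.isSymmSndFDerivAt (by simp)) e e'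

theorem integrable_mul_test {F : Phase N → ℝ} (hF : LocallyIntegrable F)
    (h : IsTestFunction toPhase φ) : Integrable fun z => F z * φ z := by
  simpa [mul_comm] using hF.integrable_smul_left_of_hasCompactSupport h.continuous h.2

theorem isTestFunction_reMode_mul (n : Fin N → ℤ) (w : ℂ) {g : Vel N → ℝ} (hg : ContDiff ℝ ∞ g)
    (hg' : HasCompactSupport g) :
    IsTestFunction toPhase fun z : Phase N => reMode n w z.1 * g z.2 := by
  constructor
  · exact ((isTestFunction_reMode n w).1.comp contDiff_fst).mul (hg.comp contDiff_snd)
  · refine HasCompactSupport.intro (isCompact_univ.prod hg') fun z hz => ?_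
    rw [image_eq_zero_of_notMem_tsupport (f := g) (x := z.2) fun h => hz ⟨mem_univ _, h⟩, mul_zero]

/-- A locally integrable function is determined by its products with test functions. -/
theorem ae_eq_zero_of_integral_mul_test {F : Phase N → ℝ} (hF : LocallyIntegrable F)
    (h : ∀ φ, IsTestFunction toPhase φ → ∫ z, F z * φ z = 0) : F =ᵐ[volume] 0 := by
  -- Restricting to bounded velocities makes F integrable. Test functions of the form
  -- character(x)·g(v) then show that, for almost every v, all Fourier coefficients of F(·, v)
  -- vanish.
  have key : ∀ R : ℕ, ∀ᵐ z : Phase N, z.2 ∈ Metric.ball (0 : Vel N) R → F z = 0 := fun R => by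
    set U : Set (Vel N) := Metric.ball 0 R with hU
    set S : Set (Phase N) := univ ×ˢ U with hS
    have hSm : MeasurableSet S := MeasurableSet.univ.prod measurableSet_ball
    set G : Phase N → ℝ := S.indicator F with hG
    have hGi : Integrable G := by
      rw [hG, integrable_indicator_iff hSm]
      exact (hF.integrableOn_isCompact (isCompact_univ.prod
        (isCompact_closedBall (0 : Vel N) R))).mono_set (prod_mono le_rfl Metric.ball_subset_closedBall)
    have hGn : ∀ n, Integrable fun z : Phase N => (G z : ℂ) * UnitAddTorus.mFourier n z.1 := fun n =>
      hGi.ofReal.mul_bdd (c := 1) (by fun_prop : Continuous fun z : Phase N =>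
        UnitAddTorus.mFourier n z.1).aestronglyMeasurable
        (ae_of_all _ fun z => (norm_mFourier_apply n z.1).le)
    have h1 : ∀ n, ∀ᵐ v : Vel N, v ∈ U →
        ∫ x, (G (x, v) : ℂ) * UnitAddTorus.mFourier n x = 0 := fun n => by
      have hli : Integrable fun v => ∫ x, (G (x, v) : ℂ) * UnitAddTorus.mFourier n x :=
        (hGn n).integral_prod_right
      refine Metric.isOpen_ball.ae_eq_zero_of_integral_contDiff_smul_eq_zero
        (hli.locallyIntegrable.locallyIntegrableOn _) fun g hg hgc hgU => ?_
      obtain ⟨C, hC⟩ := hg.continuous.bounded_above_of_compact_support hgc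
      have h2 : Integrable fun z : Phase N =>
          (g z.2 : ℂ) * ((G z : ℂ) * UnitAddTorus.mFourier n z.1) :=
        (hGn n).bdd_mul (c := C) (Continuous.aestronglyMeasurable (by
          have := hg.continuous
          fun_prop)) (ae_of_all _ fun z => by simpa using hC z.2)
      have h3 : ∫ v, g v • ∫ x, (G (x, v) : ℂ) * UnitAddTorus.mFourier n x =
          ∫ z : Phase N, (g z.2 : ℂ) * ((G z : ℂ) * UnitAddTorus.mFourier n z.1) := by
        rw [Measure.volume_eq_prod, integral_prod_symm _ (by rwa [← Measure.volume_eq_prod])]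
        refine integral_congr_ae (ae_of_all _ fun v => ?_)
        refine Complex.real_smul.trans ?_
        exact (integral_const_mul _ _).symm
      rw [h3]
      have h4 : ∀ w : ℂ, (w * ∫ z : Phase N,
          (g z.2 : ℂ) * ((G z : ℂ) * UnitAddTorus.mFourier n z.1)).re = 0 := fun w => by
        rw [← integral_const_mul, ← RCLike.re_eq_complex_re, ← integral_re (h2.const_mul w),
          ← h _ (isTestFunction_reMode_mul n w hg hgc)]
        refine integral_congr_ae (ae_of_all _ fun z => ?_)
        simp only [reMode_apply, RCLike.re_eq_complex_re]
        by_cases hz : z.2 ∈ U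
        · have h5 : G z = F z := indicator_of_mem (s := S) ⟨mem_univ _, hz⟩ F
          rw [h5, show w * ((g z.2 : ℂ) * ((F z : ℂ) * UnitAddTorus.mFourier n z.1)) =
            ((g z.2 * F z : ℝ) : ℂ) * (w * UnitAddTorus.mFourier n z.1) by push_cast; ring,
            Complex.re_ofReal_mul]
          ring
        · have h5 : g z.2 = 0 := image_eq_zero_of_notMem_tsupport fun h6 => hz (hgU h6)
          simp [h5]
      refine Complex.ext (by simpa using h4 1) ?_
      simpa [Complex.mul_re] using h4 (-Complex.I)
    have h2 : ∀ᵐ v : Vel N, ∀ᵐ x : Torus N, G (x, v) = 0 := by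
      have hGi' : Integrable G ((volume : Measure (Torus N)).prod (volume : Measure (Vel N))) := hGi
      filter_upwards [ae_all_iff.2 h1, hGi'.prod_left_ae] with v hv hv'
      by_cases hvU : v ∈ U
      · exact ae_eq_zero_of_integral_mul_mFourier hv' fun n => hv n hvU
      · exact ae_of_all _ fun x => indicator_of_notMem (fun hx => hvU hx.2) F
    have h3 : ∫⁻ z : Phase N, ‖G z‖ₑ = 0 := by
      rw [Measure.volume_eq_prod, lintegral_prod_symm _
        (by rw [← Measure.volume_eq_prod]; exact hGi.1.enorm), lintegral_eq_zero_of_ae_eq_zero]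
      filter_upwards [h2] with v hv
      refine lintegral_eq_zero_of_ae_eq_zero ?_
      filter_upwards [hv] with x hx
      simp [hx]
    have h4 := (lintegral_eq_zero_iff' hGi.1.enorm).1 h3
    filter_upwards [h4] with z hz hzU
    have h5 : G z = F z := indicator_of_mem (s := S) ⟨mem_univ _, hzU⟩ F
    rw [← h5]
    simpa using hz
  filter_upwards [ae_all_iff.2 key] with z hz
  obtain ⟨R, hR⟩ := exists_nat_gt ‖z.2‖
  exact hz R (by simpa using hR)

/-- Differentiation of the product of a translated test function with a function. -/
theorem hasDerivAt_integral_mul_test {F : Phase N → ℝ} (hF : LocallyIntegrable F)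
    (h : IsTestFunction toPhase φ) (e : Vel N × Vel N) :
    HasDerivAt (fun θ : ℝ => ∫ z, F z * φ (z + toPhase (θ • e)))
      (∫ z, F z * dirDeriv toPhase e φ z) 0 := by
  have hd := h.dirDeriv e
  obtain ⟨C, hC⟩ := hd.continuous.bounded_above_of_compact_support hd.2
  have hc : Continuous fun q : ℝ × Phase N => q.2 - toPhase (q.1 • e) :=
    continuous_snd.sub (continuous_toPhase.comp (by fun_prop))
  set K : Set (Phase N) := (fun q : ℝ × Phase N => q.2 - toPhase (q.1 • e)) ''
    (Icc (-1) 1 ×ˢ tsupport (dirDeriv toPhase e φ)) with hK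
  have hKc : IsCompact K := (isCompact_Icc.prod hd.2).image hc
  have h1 := hasDerivAt_integral_of_dominated_loc_of_deriv_le (μ := (volume : Measure (Phase N)))
    (F := fun θ z => F z * φ (z + toPhase (θ • e)))
    (F' := fun θ z => F z * dirDeriv toPhase e φ (z + toPhase (θ • e)))
    (bound := fun z => K.indicator (fun z => C * ‖F z‖) z) (x₀ := (0 : ℝ)) (s := Ioo (-1) 1)
    (Ioo_mem_nhds (by norm_num) (by norm_num))
    (Eventually.of_forall fun θ => (integrable_mul_test hF (h.add_right (θ • e))).1)
    (integrable_mul_test hF (h.add_right _)) (integrable_mul_test hF (hd.add_right _)).1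
    (ae_of_all _ fun z θ hθ => ?_)
    ((integrable_indicator_iff hKc.measurableSet).2
      ((hF.integrableOn_isCompact hKc).norm.const_mul C))
    (ae_of_all _ fun z θ _ => (hasDerivAt_comp_add' h z e θ).const_mul (F z))
  · simpa [toPhase_zero] using h1.2
  · by_cases hz : z ∈ K
    · rw [indicator_of_mem hz, norm_mul, mul_comm]
      exact mul_le_mul_of_nonneg_right (hC _) (norm_nonneg _)
    · rw [indicator_of_notMem hz, image_eq_zero_of_notMem_tsupport (f := dirDeriv toPhase e φ),
        mul_zero, norm_zero]
      exact fun h2 => hz ⟨(θ, z + toPhase (θ • e)), ⟨Ioo_subset_Icc_self hθ, h2⟩, by simp⟩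

end TestFunctions

/-! ### Derivatives of translations -/

section TransDeriv

variable {N : ℕ} {p : ℝ≥0∞} [Fact (1 ≤ p)]

/-- The derivative of the translations of `f` in the direction `b`, i.e. `-∂_b f`. -/
def HasTransDeriv (b : Vel N × Vel N) (f u : State N p) : Prop :=
  HasDerivAt (fun θ : ℝ => transport p 0 (θ • b) f) u 0

theorem State.locallyIntegrable (f : State N p) : LocallyIntegrable (f : Phase N → ℝ) :=
  (Lp.memLp f).locallyIntegrable Fact.out

theorem exists_pairing {φ : Phase N → ℝ} (h : IsTestFunction toPhase φ) :
    ∃ Λ : State N p →L[ℝ] ℝ, ∀ f : State N p, Λ f = ∫ z, f z * φ z := by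
  have : ENNReal.HolderConjugate p p.conjExponent := .conjExponent Fact.out
  have : ENNReal.HolderConjugate p.conjExponent p := ENNReal.HolderConjugate.symm
  have : Fact (1 ≤ p.conjExponent) := ⟨ENNReal.HolderConjugate.one_le p.conjExponent p⟩
  have hm : MemLp φ p.conjExponent := h.continuous.memLp_of_hasCompactSupport h.2
  refine ⟨(massOp N).comp ((ContinuousLinearMap.mul ℝ ℝ).holderL volume p.conjExponent p 1
    hm.toLp), fun f => ?_⟩
  rw [ContinuousLinearMap.comp_apply, massOp_apply]
  refine integral_congr_ae ?_
  filter_upwards [ContinuousLinearMap.coeFn_holder (r := 1) (ContinuousLinearMap.mul ℝ ℝ) hm.toLp f,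
    hm.coeFn_toLp] with z h1 h2
  rw [mul_comm, ← h2]
  exact h1

theorem integral_transport_mul (a : Vel N × Vel N) (f : State N p) (φ : Phase N → ℝ) :
    ∫ z, transport p 0 a f z * φ z = ∫ z, f z * φ (z + toPhase a) := by
  rw [← integral_add_right_eq_self (fun z => transport p 0 a f z * φ z) (toPhase a)]
  have h1 : ∀ᵐ z : Phase N, transport p 0 a f (z + toPhase a) =
      Real.exp (N * 0) * f (backward 0 a (z + toPhase a)) :=
    (measurePreserving_add_right (volume : Measure (Phase N)) (toPhase a)).quasiMeasurePreserving.ae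
      (coeFn_transport 0 a f)
  refine integral_congr_ae ?_
  filter_upwards [h1] with z hz
  rw [hz]
  simp [backward, flow_zero]

theorem eq_of_integral_mul_test {f g : State N p}
    (h : ∀ φ, IsTestFunction toPhase φ → ∫ z, f z * φ z = ∫ z, g z * φ z) : f = g := by
  have h1 := ae_eq_zero_of_integral_mul_test (f.locallyIntegrable.sub g.locallyIntegrable)
    fun φ hφ => by
      have h2 := h φ hφ
      rw [← sub_eq_zero, ← integral_sub (integrable_mul_test f.locallyIntegrable hφ)
        (integrable_mul_test g.locallyIntegrable hφ)] at h2
      simpa [sub_mul] using h2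
  refine Lp.ext ?_
  filter_upwards [h1] with z hz
  exact sub_eq_zero.1 hz

/-- In the pairing with φ the translation can be moved onto φ, where the difference quotient
converges classically. There is no minus sign because u stands for -∂_b f. -/
theorem HasTransDeriv.integral_mul {b : Vel N × Vel N} {f u : State N p} (h : HasTransDeriv b f u)
    {φ : Phase N → ℝ} (hφ : IsTestFunction toPhase φ) :
    ∫ z, f z * dirDeriv toPhase b φ z = ∫ z, u z * φ z := by
  obtain ⟨Λ, hΛ⟩ := exists_pairing (p := p) hφ
  have h1 := Λ.hasFDerivAt.comp_hasDerivAt (0 : ℝ) h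
  have h2 := hasDerivAt_integral_mul_test f.locallyIntegrable hφ b
  rw [← hΛ u]
  refine h2.unique ?_
  convert! h1 using 1
  ext θ
  rw [Function.comp_apply, hΛ, integral_transport_mul]

/-- The converse. Testing shows that the translate of f by θb is f plus the integral over [0, θ] of
the translates of u. For p < ∞ translations are strongly continuous, so the integral is
differentiable at 0 in norm. -/
theorem hasTransDeriv_of_integral_mul (hp : p ≠ ⊤) {b : Vel N × Vel N} {f u : State N p}
    (h : ∀ φ, IsTestFunction toPhase φ → ∫ z, f z * dirDeriv toPhase b φ z = ∫ z, u z * φ z) :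
    HasTransDeriv b f u := by
  have hcont : Continuous fun s : ℝ => transport p 0 (s • b) u :=
    (continuous_transport hp u).comp (by fun_prop : Continuous fun s : ℝ =>
      ((0, s • b) : ℝ × (Vel N × Vel N)))
  have key : ∀ θ : ℝ, transport p 0 (θ • b) f = f + ∫ s in (0 : ℝ)..θ, transport p 0 (s • b) u := by
    intro θ
    refine eq_of_integral_mul_test fun φ hφ => ?_
    obtain ⟨Λ, hΛ⟩ := exists_pairing (p := p) hφ
    rw [← hΛ, ← hΛ, map_add, ← ContinuousLinearMap.intervalIntegral_comp_comm _
      (hcont.intervalIntegrable _ _)]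
    have h1 : ∀ s : ℝ, HasDerivAt (fun s => Λ (transport p 0 (s • b) f))
        (Λ (transport p 0 (s • b) u)) s := fun s => by
      have h2 := hasDerivAt_integral_mul_test f.locallyIntegrable (hφ.add_right (s • b)) b
      rw [h _ (hφ.add_right (s • b)), ← integral_transport_mul, ← hΛ] at h2
      have h3 : HasDerivAt (fun s' : ℝ => s' - s) 1 s := (hasDerivAt_id s).sub_const s
      have h2' : HasDerivAt (fun θ : ℝ => ∫ z, f z * φ (z + toPhase (θ • b) + toPhase (s • b)))
          (Λ (transport p 0 (s • b) u)) ((fun s' => s' - s) s) := by simpa only [sub_self] using h2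
      have h4 := HasDerivAt.scomp (h := fun s' => s' - s) s h2' h3
      rw [one_smul] at h4
      convert! h4 using 1
      ext s'
      rw [hΛ, integral_transport_mul, Function.comp_apply]
      refine integral_congr_ae (ae_of_all _ fun z => ?_)
      beta_reduce
      rw [add_assoc, ← toPhase_add, ← add_smul, sub_add_cancel]
    rw [intervalIntegral.integral_eq_sub_of_hasDerivAt (fun s _ => h1 s)
      ((Λ.continuous.comp hcont).intervalIntegrable _ _), zero_smul, transport_zero]
    ring
  have h1 := (intervalIntegral.integral_hasDerivAt_right (hcont.intervalIntegrable 0 0)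
    (hcont.stronglyMeasurableAtFilter _ _) hcont.continuousAt).const_add f
  rw [zero_smul, transport_zero] at h1
  rw [HasTransDeriv, funext key]
  exact h1

theorem HasTransDeriv.smul {b : Vel N × Vel N} {f u : State N p} (h : HasTransDeriv b f u) (r : ℝ) :
    HasTransDeriv (r • b) f (r • u) := by
  have h1 : HasDerivAt (fun θ : ℝ => θ * r) (1 * r) 0 := (hasDerivAt_id (0 : ℝ)).mul_const r
  have h2 : HasDerivAt (fun θ : ℝ => transport p 0 (θ • b) f) u (0 * r) := by rwa [zero_mul]
  have h3 := h2.scomp (0 : ℝ) h1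
  rw [one_mul] at h3
  rw [HasTransDeriv]
  simp only [smul_smul]
  exact h3

theorem HasTransDeriv.const_smul {b : Vel N × Vel N} {f u : State N p} (h : HasTransDeriv b f u)
    (r : ℝ) : HasTransDeriv b (r • f) (r • u) := by
  have h1 := HasDerivAt.const_smul r h
  rw [HasTransDeriv]
  simp only [map_smul]
  exact h1

theorem HasTransDeriv.zero (f : State N p) : HasTransDeriv (0 : Vel N × Vel N) f 0 := by
  rw [HasTransDeriv]
  simp only [smul_zero]
  exact hasDerivAt_const _ _

theorem HasTransDeriv.sum_left {ι : Type*} (S : Finset ι) {b : Vel N × Vel N}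
    {f u : ι → State N p} (h : ∀ i ∈ S, HasTransDeriv b (f i) (u i)) :
    HasTransDeriv b (∑ i ∈ S, f i) (∑ i ∈ S, u i) := by
  rw [HasTransDeriv]
  simp only [map_sum]
  exact HasDerivAt.fun_sum h

variable [Fact (p ≠ ⊤)]

/-- Additivity in the direction is not immediate for norm derivatives along single lines, but it is
evident in the weak formulation, which is equivalent. -/
theorem HasTransDeriv.add {b b' : Vel N × Vel N} {f u u' : State N p} (h : HasTransDeriv b f u)
    (h' : HasTransDeriv b' f u') : HasTransDeriv (b + b') f (u + u') := by
  refine hasTransDeriv_of_integral_mul Fact.out fun φ hφ => ?_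
  have h1 : ∀ z, dirDeriv toPhase (b + b') φ z = dirDeriv toPhase b φ z + dirDeriv toPhase b' φ z :=
    fun z => by
      obtain ⟨ζ, rfl⟩ := isOpenQuotientMap_toPhase.surjective z
      simp only [dirDeriv_toPhase hφ, map_add]
  simp only [h1, mul_add]
  rw [integral_add (integrable_mul_test f.locallyIntegrable (hφ.dirDeriv b))
    (integrable_mul_test f.locallyIntegrable (hφ.dirDeriv b')), h.integral_mul hφ,
    h'.integral_mul hφ, ← integral_add (integrable_mul_test u.locallyIntegrable hφ)
    (integrable_mul_test u'.locallyIntegrable hφ)]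
  refine integral_congr_ae ?_
  filter_upwards [Lp.coeFn_add u u'] with z hz
  rw [hz, Pi.add_apply, add_mul]

theorem HasTransDeriv.sum {ι : Type*} (S : Finset ι) {b : ι → Vel N × Vel N} {f : State N p}
    {u : ι → State N p} (h : ∀ i ∈ S, HasTransDeriv (b i) f (u i)) :
    HasTransDeriv (∑ i ∈ S, b i) f (∑ i ∈ S, u i) := by
  classical
  induction S using Finset.induction_on with
  | empty => simpa using HasTransDeriv.zero f
  | insert a S ha ih =>
    rw [Finset.sum_insert ha, Finset.sum_insert ha]
    exact (h a (Finset.mem_insert_self _ _)).add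
      (ih fun i hi => h i (Finset.mem_insert_of_mem hi))

end TransDeriv

/-! ### Differentiability with respect to a parameter -/

section UnifDeriv

variable {X : Type*} [NormedAddCommGroup X] [NormedSpace ℝ X] {T : ℝ}

/-- `F'` is the derivative of `h ↦ F h` at `0`, uniformly on `[0, T]`. -/
def HasUnifDeriv (T : ℝ) (F : ℝ → ℝ → X) (F' : ℝ → X) : Prop :=
  ∀ ε > 0, ∀ᶠ h in 𝓝 (0 : ℝ), ∀ s ∈ Icc 0 T, ‖F h s - F 0 s - h • F' s‖ ≤ ε * |h|

theorem hasUnifDeriv_of_le {F : ℝ → ℝ → X} {F' : ℝ → X} {K : ℝ} (hK : 0 ≤ K)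
    (h : ∀ ε > 0, ε ≤ 1 → ∀ᶠ h in 𝓝 (0 : ℝ), ∀ s ∈ Icc 0 T,
      ‖F h s - F 0 s - h • F' s‖ ≤ K * (ε * |h|)) : HasUnifDeriv T F F' := by
  intro ε hε
  have hε' : 0 < ε / (K + 1) := by positivity
  filter_upwards [h (min 1 (ε / (K + 1))) (lt_min one_pos hε') (min_le_left _ _)] with θ hθ s hs
  refine (hθ s hs).trans ?_
  have h1 : K * min 1 (ε / (K + 1)) ≤ ε := by
    calc K * min 1 (ε / (K + 1)) ≤ (K + 1) * (ε / (K + 1)) :=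
          mul_le_mul (by linarith) (min_le_right _ _) (by positivity) (by positivity)
      _ = ε := by field_simp
  rw [← mul_assoc]
  exact mul_le_mul_of_nonneg_right h1 (abs_nonneg _)

theorem hasUnifDeriv_of_sq_le {F : ℝ → ℝ → X} {F' : ℝ → X} {K : ℝ} (hK : 0 ≤ K)
    (h : ∀ h, ∀ s ∈ Icc 0 T, ‖F h s - F 0 s - h • F' s‖ ≤ K * h ^ 2) : HasUnifDeriv T F F' := by
  refine hasUnifDeriv_of_le hK fun ε hε _ => ?_
  filter_upwards [Metric.closedBall_mem_nhds (0 : ℝ) hε] with θ hθ s hs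
  rw [mem_closedBall_zero_iff, Real.norm_eq_abs] at hθ
  refine (h θ s hs).trans (mul_le_mul_of_nonneg_left ?_ hK)
  rw [← sq_abs, sq]
  exact mul_le_mul_of_nonneg_right hθ (abs_nonneg _)

theorem HasUnifDeriv.hasDerivAt {F : ℝ → ℝ → X} {F' : ℝ → X} (h : HasUnifDeriv T F F') {s : ℝ}
    (hs : s ∈ Icc 0 T) : HasDerivAt (fun θ => F θ s) (F' s) 0 := by
  rw [hasDerivAt_iff_isLittleO, Asymptotics.isLittleO_iff]
  intro ε hε
  filter_upwards [h ε hε] with θ hθ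
  simpa using hθ s hs

theorem HasUnifDeriv.pi {ι : Type*} [Fintype ι] {F : ℝ → ℝ → ι → X} {F' : ℝ → ι → X}
    (h : ∀ i, HasUnifDeriv T (fun θ s => F θ s i) fun s => F' s i) : HasUnifDeriv T F F' := by
  intro ε hε
  filter_upwards [eventually_all.2 fun i => h i ε hε] with θ hθ s hs
  exact (pi_norm_le_iff_of_nonneg (by positivity)).2 fun i => hθ i s hs

variable {N : ℕ} {p : ℝ≥0∞} [Fact (1 ≤ p)]

/-- The product rule with a remainder uniform in time. It is needed because the source of the
first-derivative equation is itself a product to be differentiated again. -/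
theorem HasUnifDeriv.mulOp {a : ℝ → ℝ → C(Torus N, ℝ)} {a' : ℝ → C(Torus N, ℝ)}
    {x : ℝ → ℝ → State N p} {x' : ℝ → State N p} (ha : HasUnifDeriv T a a')
    (hx : HasUnifDeriv T x x') {A A' D D' : ℝ} (hA : ∀ s ∈ Icc 0 T, ‖a 0 s‖ ≤ A)
    (hA' : ∀ s ∈ Icc 0 T, ‖a' s‖ ≤ A') (hD : ∀ h, ∀ s ∈ Icc 0 T, ‖x h s‖ ≤ D)
    (hD' : ∀ s ∈ Icc 0 T, ‖x' s‖ ≤ D') :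
    HasUnifDeriv T (fun h s => KineticFP.mulOp p (a h s) (x h s))
      fun s => KineticFP.mulOp p (a' s) (x 0 s) + KineticFP.mulOp p (a 0 s) (x' s) := by
  rcases (Icc (0 : ℝ) T).eq_empty_or_nonempty with h0 | ⟨s₀, hs₀⟩
  · exact fun ε _ => Eventually.of_forall fun h s hs => by simp [h0] at hs
  have hA0 := (norm_nonneg _).trans (hA s₀ hs₀)
  have hA'0 := (norm_nonneg _).trans (hA' s₀ hs₀)
  have hD0 := (norm_nonneg _).trans (hD 0 s₀ hs₀)
  have hD'0 := (norm_nonneg _).trans (hD' s₀ hs₀)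
  refine hasUnifDeriv_of_le (K := D + A' * (1 + D') + A) (by positivity) fun ε hε hε1 => ?_
  filter_upwards [ha ε hε, hx ε hε, Metric.closedBall_mem_nhds (0 : ℝ) hε] with h h1 h2 h3 s hs
  rw [mem_closedBall_zero_iff, Real.norm_eq_abs] at h3
  have e1 : KineticFP.mulOp p (a h s) (x h s) - KineticFP.mulOp p (a 0 s) (x 0 s) -
      h • (KineticFP.mulOp p (a' s) (x 0 s) + KineticFP.mulOp p (a 0 s) (x' s)) =
      KineticFP.mulOp p (a h s - a 0 s - h • a' s) (x h s) +
      h • KineticFP.mulOp p (a' s) (x h s - x 0 s) +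
      KineticFP.mulOp p (a 0 s) (x h s - x 0 s - h • x' s) := by
    simp only [map_sub, map_smul, _root_.sub_apply, _root_.smul_apply, smul_add, smul_sub]
    abel
  have h4 : ‖x h s - x 0 s‖ ≤ (1 + D') * |h| := by
    have : x h s - x 0 s = (x h s - x 0 s - h • x' s) + h • x' s := by abel
    rw [this, add_mul]
    refine (norm_add_le _ _).trans (add_le_add ((h2 s hs).trans
      (mul_le_mul_of_nonneg_right hε1 (abs_nonneg _))) ?_)
    rw [norm_smul, Real.norm_eq_abs, mul_comm]
    exact mul_le_mul_of_nonneg_right (hD' s hs) (abs_nonneg _)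
  rw [e1, add_mul, add_mul]
  refine norm_add₃_le.trans (add_le_add_three ?_ ?_ ?_)
  · refine (norm_mulOp_apply_le _ _).trans ?_
    rw [mul_comm D]
    exact mul_le_mul (h1 s hs) (hD h s hs) (norm_nonneg _) (by positivity)
  · rw [norm_smul, Real.norm_eq_abs]
    calc |h| * ‖KineticFP.mulOp p (a' s) (x h s - x 0 s)‖ ≤ ε * (A' * ((1 + D') * |h|)) := by
          refine mul_le_mul h3 ((norm_mulOp_apply_le _ _).trans ?_) (norm_nonneg _) hε.le
          exact mul_le_mul (hA' s hs) h4 (norm_nonneg _) hA'0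
      _ = _ := by ring
  · exact (norm_mulOp_apply_le _ _).trans (mul_le_mul (hA s hs) (h2 s hs) (norm_nonneg _) hA0)

theorem multOp_sub_apply (e e' : Fin N → C(Torus N, ℝ)) (f : State N p) :
    multOp p e f - multOp p e' f = multOp p (e - e') f := by
  ext1 i
  simp [multOp_apply]

theorem multOp_smul_apply (r : ℝ) (e : Fin N → C(Torus N, ℝ)) (f : State N p) :
    r • multOp p e f = multOp p (r • e) f := by
  ext1 i
  simp [multOp_apply]

end UnifDeriv

/-! ### Mild solutions depending on a parameter -/

section Volterra

variable {N : ℕ} {p : ℝ≥0∞} [Fact (1 ≤ p)] [Fact (p ≠ ⊤)] {T B : ℝ}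
  {e e' : ℝ → Fin N → C(Torus N, ℝ)} {q : ℝ → Fin N → State N p} {fin : State N p}
  {f : ℝ → State N p}

theorem MildEq.congr (hf : MildEq T e q fin f) {q' : ℝ → Fin N → State N p}
    (h : ∀ s, multOp p (e s) (f s) + q s = multOp p (e' s) (f s) + q' s) :
    MildEq T e' q' fin f :=
  ⟨hf.cont, fun t ht => by simpa only [h] using hf.eq t ht⟩

theorem MildEq.smul (hf : MildEq T e q fin f) (r : ℝ) :
    MildEq T e (fun s => r • q s) (r • fin) fun t => r • f t := by
  refine ⟨hf.cont.const_smul r, fun t ht => ?_⟩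
  simp only [map_smul, ← smul_add, intervalIntegral.integral_smul]
  rw [← hf.eq t ht]

/-- Mild solutions depend differentiably on the force field, the source term and the datum. -/
theorem MildEq.hasUnifDeriv {e : ℝ → ℝ → Fin N → C(Torus N, ℝ)} (he : ∀ h, BddForce T B (e h))
    {B' : ℝ} (he' : BddForce T B' e') (hd : HasUnifDeriv T e e')
    {q : ℝ → ℝ → Fin N → State N p}
    (hq : ∀ h, AEStronglyMeasurable (q h) (volume.restrict (Ioc 0 T))) {Q : ℝ}
    (hQ : ∀ h, ∀ s ∈ Icc 0 T, ‖q h s‖ ≤ Q) {q' : ℝ → Fin N → State N p}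
    (hq' : AEStronglyMeasurable q' (volume.restrict (Ioc 0 T))) {Q' : ℝ}
    (hQ' : ∀ s ∈ Icc 0 T, ‖q' s‖ ≤ Q') (hqd : HasUnifDeriv T q q')
    {fin : ℝ → State N p} {fin' : State N p} (hfin : HasDerivAt fin fin' 0)
    {f : ℝ → ℝ → State N p} (hf : ∀ h, MildEq T (e h) (q h) (fin h) (f h)) {u : ℝ → State N p}
    (hu : MildEq T (e 0) (fun s => multOp p (e' s) (f 0 s) + q' s) fin' u) :
    HasUnifDeriv T f u := by
  obtain ⟨D₀, hD₀⟩ := isCompact_Icc.exists_bound_of_continuousOn (hf 0).cont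
  obtain ⟨D₁, hD₁⟩ := isCompact_Icc.exists_bound_of_continuousOn hu.cont
  obtain ⟨D, hD, hD0, hD1⟩ : ∃ D, 0 ≤ D ∧ D₀ ≤ D ∧ D₁ ≤ D :=
    ⟨max 0 (max D₀ D₁), le_max_left _ _, (le_max_left _ _).trans (le_max_right _ _),
      (le_max_right _ _).trans (le_max_right _ _)⟩
  have hB := (he 0).nonneg
  have hB' := he'.nonneg
  have hS := stabConst_nonneg N T B
  have hdiff : ∀ (h : ℝ) {g : ℝ → State N p}, ContinuousOn g (Icc 0 T) →
      AEStronglyMeasurable (fun s => multOp p (e 0 s) (g s) - multOp p (e h s) (g s))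
        (volume.restrict (Ioc 0 T)) ∧
      ∃ K, ∀ s ∈ Icc 0 T, ‖multOp p (e 0 s) (g s) - multOp p (e h s) (g s)‖ ≤ K := fun h g hg => by
    obtain ⟨K, hK⟩ := (he 0).exists_bound hg
    obtain ⟨K', hK'⟩ := (he h).exists_bound hg
    exact ⟨((he 0).aestronglyMeasurable hg).sub ((he h).aestronglyMeasurable hg), K + K',
      fun s hs => (norm_sub_le _ _).trans (add_le_add (hK s hs) (hK' s hs))⟩
  -- The Taylor remainder f_h - f_0 - hu solves the mild equation with force e_h: the equations of
  -- f_0 and u are rewritten with e_h in place of e_0 and the difference goes into the source. The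
  -- source is then o(h), and stability finishes.
  have key : ∀ h, MildEq T (e h)
      (fun s => (q h s - ((multOp p (e 0 s) (f 0 s) - multOp p (e h s) (f 0 s)) + q 0 s)) -
        h • ((multOp p (e 0 s) (u s) - multOp p (e h s) (u s)) +
          (multOp p (e' s) (f 0 s) + q' s)))
      (fin h - fin 0 - h • fin') (fun s => f h s - f 0 s - h • u s) := fun h => by
    obtain ⟨hm0, K0, hK0⟩ := hdiff h (hf 0).cont
    obtain ⟨hm1, K1, hK1⟩ := hdiff h hu.cont
    obtain ⟨K2, hK2⟩ := he'.exists_bound (hf 0).cont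
    have h1 : MildEq T (e h)
        (fun s => (multOp p (e 0 s) (f 0 s) - multOp p (e h s) (f 0 s)) + q 0 s) (fin 0) (f 0) :=
      (hf 0).congr fun s => by abel
    have h2 : MildEq T (e h) (fun s => (multOp p (e 0 s) (u s) - multOp p (e h s) (u s)) +
        (multOp p (e' s) (f 0 s) + q' s)) fin' u := hu.congr fun s => by abel
    have hb0 : ∀ s ∈ Icc 0 T,
        ‖(multOp p (e 0 s) (f 0 s) - multOp p (e h s) (f 0 s)) + q 0 s‖ ≤ K0 + Q :=
      fun s hs => (norm_add_le _ _).trans (add_le_add (hK0 s hs) (hQ 0 s hs))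
    refine MildEq.sub (he h) ((hq h).sub (hm0.add (hq 0)))
      (fun s hs => (norm_sub_le _ _).trans (add_le_add (hQ h s hs) (hb0 s hs))) ?_
      (Q' := |h| * (K1 + (K2 + Q'))) (fun s hs => ?_)
      (MildEq.sub (he h) (hq h) (hQ h) (hm0.add (hq 0)) hb0 (hf h) h1) (h2.smul h)
    · exact (hm1.add ((he'.aestronglyMeasurable (hf 0).cont).add hq')).const_smul h
    · rw [norm_smul, Real.norm_eq_abs]
      refine mul_le_mul_of_nonneg_left ?_ (abs_nonneg h)
      exact (norm_add_le _ _).trans (add_le_add (hK1 s hs)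
        ((norm_add_le _ _).trans (add_le_add (hK2 s hs) (hQ' s hs))))
  refine hasUnifDeriv_of_le (K := stabConst N T B * (1 + (1 + D + (1 + B') * D)))
    (by positivity) fun ε hε hε1 => ?_
  have hfin' := (hasDerivAt_iff_isLittleO.1 hfin)
  rw [Asymptotics.isLittleO_iff] at hfin'
  filter_upwards [hd ε hε, hqd ε hε, hfin' hε, Metric.closedBall_mem_nhds (0 : ℝ) hε]
    with h h1 h2 h3 h4 t ht
  rw [mem_closedBall_zero_iff, Real.norm_eq_abs] at h4
  rw [sub_zero, Real.norm_eq_abs] at h3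
  have hsrc : ∀ s ∈ Icc 0 T,
      ‖(q h s - ((multOp p (e 0 s) (f 0 s) - multOp p (e h s) (f 0 s)) + q 0 s)) -
        h • ((multOp p (e 0 s) (u s) - multOp p (e h s) (u s)) +
          (multOp p (e' s) (f 0 s) + q' s))‖ ≤ (1 + D + (1 + B') * D) * (ε * |h|) := by
    intro s hs
    have e1 : (q h s - ((multOp p (e 0 s) (f 0 s) - multOp p (e h s) (f 0 s)) + q 0 s)) -
        h • ((multOp p (e 0 s) (u s) - multOp p (e h s) (u s)) +
          (multOp p (e' s) (f 0 s) + q' s)) =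
        (q h s - q 0 s - h • q' s) + multOp p (e h s - e 0 s - h • e' s) (f 0 s) +
          h • multOp p (e h s - e 0 s) (u s) := by
      simp only [← multOp_sub_apply, ← multOp_smul_apply, smul_add, smul_sub]
      abel
    have h5 : ‖e h s - e 0 s‖ ≤ (1 + B') * |h| := by
      have : e h s - e 0 s = (e h s - e 0 s - h • e' s) + h • e' s := by abel
      rw [this, add_mul]
      refine (norm_add_le _ _).trans (add_le_add ((h1 s hs).trans
        (mul_le_mul_of_nonneg_right hε1 (abs_nonneg _))) ?_)
      rw [norm_smul, Real.norm_eq_abs, mul_comm]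
      exact mul_le_mul_of_nonneg_right
        ((pi_norm_le_iff_of_nonneg hB').2 (he'.bound s hs)) (abs_nonneg _)
    have hmul : ∀ (a : Fin N → C(Torus N, ℝ)) (g : State N p), ‖multOp p a g‖ ≤ ‖a‖ * ‖g‖ :=
      fun a g => norm_multOp_apply_le (norm_nonneg _) (norm_le_pi_norm a) g
    rw [e1, add_mul, add_mul, one_mul]
    refine norm_add₃_le.trans (add_le_add_three (h2 s hs) ?_ ?_)
    · refine (hmul _ _).trans ?_
      rw [mul_comm D]
      exact mul_le_mul (h1 s hs) ((hD₀ s hs).trans hD0) (norm_nonneg _) (by positivity)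
    · rw [norm_smul, Real.norm_eq_abs]
      calc |h| * ‖multOp p (e h s - e 0 s) (u s)‖ ≤ ε * ((1 + B') * |h| * D) := by
            refine mul_le_mul h4 ((hmul _ _).trans ?_) (norm_nonneg _) hε.le
            exact mul_le_mul h5 ((hD₁ s hs).trans hD1) (norm_nonneg _) (by positivity)
        _ = _ := by ring
  refine ((key h).norm_le (he h) (by positivity) hsrc t ht).trans ?_
  rw [mul_assoc]
  refine mul_le_mul_of_nonneg_left ?_ hS
  exact (add_le_add h3 le_rfl).trans_eq (by ring)

end Volterra

/-! ### Translation of mild solutions -/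

section Translation

variable {N : ℕ}

/-- Joint continuity for the sup norm makes the translated force measurable in time. -/
theorem continuous_torusShift_uncurry :
    Continuous fun q : Vel N × C(Torus N, ℝ) => torusShift q.1 q.2 := by
  have h1 : Continuous fun a : Vel N => (⟨fun x => x - toTorus a, by fun_prop⟩ :
      C(Torus N, Torus N)) :=
    ContinuousMap.continuous_of_continuous_uncurry _
      (continuous_snd.sub (continuous_toTorus.comp continuous_fst))
  exact continuous_snd.compCM (h1.comp continuous_fst)

theorem continuous_linFlow_left (b : Vel N × Vel N) : Continuous fun s => linFlow s b :=
  continuous_linFlow.comp (by fun_prop : Continuous fun s : ℝ => (s, b))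

variable {T B : ℝ} {e : ℝ → Fin N → C(Torus N, ℝ)}

/-- The force field, translated along the free flow. -/
def shiftForce (b : Vel N × Vel N) (e : ℝ → Fin N → C(Torus N, ℝ)) (s : ℝ) (i : Fin N) :
    C(Torus N, ℝ) := torusShift (linFlow s b).1 (e s i)

theorem BddForce.shiftForce (he : BddForce T B e) (b : Vel N × Vel N) :
    BddForce T B (shiftForce b e) where
  nonneg := he.nonneg
  meas i := continuous_torusShift_uncurry.comp_aestronglyMeasurable
    ((continuous_linFlow_left b).fst.aestronglyMeasurable.prodMk (he.meas i))
  bound s hs i := (norm_torusShift_le _ _).trans (he.bound s hs i)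

variable {p : ℝ≥0∞} [Fact (1 ≤ p)]

theorem multOp_shiftForce (b : Vel N × Vel N) (s : ℝ) (g : State N p) :
    multOp p (shiftForce b e s) (transport p 0 (linFlow s b) g) =
      fun i => transport p 0 (linFlow s b) (multOp p (e s) g i) :=
  funext fun i => (transport_mulOp (linFlow s b) (e s i) g).symm

variable [Fact (p ≠ ⊤)]

theorem continuous_transport_zero_uncurry :
    Continuous fun q : (Vel N × Vel N) × State N p => transport p 0 q.1 q.2 :=
  continuous_transport_uncurry.comp (by fun_prop :
    Continuous fun q : (Vel N × Vel N) × State N p => (((0 : ℝ), q.1), q.2))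

/-- The translation moves with the flow: `gradOp` over the time t - s carries the translation by
`linFlow s b` to that by `linFlow t b`. So it passes under the integral with the vector appropriate
to each time. -/
theorem MildEq.eq_translate (he : BddForce T B e) {q : ℝ → Fin N → State N p}
    (hq : AEStronglyMeasurable q (volume.restrict (Ioc 0 T))) {Q : ℝ}
    (hQ : ∀ s ∈ Icc 0 T, ‖q s‖ ≤ Q) {fin : State N p} {f : ℝ → State N p}
    (hf : MildEq T e q fin f) (b : Vel N × Vel N) {t : ℝ} (ht : t ∈ Icc 0 T) :
    transport p 0 (linFlow t b) (f t) =
      kineticOp p t (transport p 0 b fin) + ∫ s in (0 : ℝ)..t, gradOp p (t - s)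
        (multOp p (shiftForce b e s) (transport p 0 (linFlow s b) (f s)) +
          fun i => transport p 0 (linFlow s b) (q s i)) := by
  obtain ⟨D, hD⟩ := he.exists_bound hf.cont
  have hi : IntervalIntegrable (fun s => gradOp p (t - s) (multOp p (e s) (f s) + q s))
      volume 0 t := intervalIntegrable_gradOp ((he.aestronglyMeasurable hf.cont).add hq)
    (fun s hs => (norm_add_le _ _).trans (add_le_add (hD s hs) (hQ s hs))) ht
  have h1 : ∀ s, transport p 0 (linFlow t b)
      (gradOp p (t - s) (multOp p (e s) (f s) + q s)) = gradOp p (t - s)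
        (multOp p (shiftForce b e s) (transport p 0 (linFlow s b) (f s)) +
          fun i => transport p 0 (linFlow s b) (q s i)) := fun s => by
    rw [show linFlow t b = linFlow (t - s) (linFlow s b) by
      rw [linFlow_linFlow, sub_add_cancel], ← gradOp_transport, multOp_shiftForce]
    congr 1
    ext1 i
    simp only [Pi.add_apply, map_add]
  rw [hf.eq t ht, map_add, kineticOp_transport,
    ← ContinuousLinearMap.intervalIntegral_comp_comm _ hi]
  simp only [h1]

theorem MildEq.translate (he : BddForce T B e) {q : ℝ → Fin N → State N p}
    (hq : AEStronglyMeasurable q (volume.restrict (Ioc 0 T))) {Q : ℝ}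
    (hQ : ∀ s ∈ Icc 0 T, ‖q s‖ ≤ Q) {fin : State N p} {f : ℝ → State N p}
    (hf : MildEq T e q fin f) (b : Vel N × Vel N) :
    MildEq T (shiftForce b e) (fun s i => transport p 0 (linFlow s b) (q s i))
      (transport p 0 b fin) fun s => transport p 0 (linFlow s b) (f s) := by
  constructor
  · have hc : ContinuousOn (fun s => (linFlow s b, f s)) (Icc 0 T) :=
      (continuous_linFlow_left b).continuousOn.prodMk hf.cont
    have h1 := Continuous.comp_continuousOn (f := fun s => (linFlow s b, f s))
      (continuous_transport_zero_uncurry (p := p)) hc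
    exact h1
  · intro t ht
    exact hf.eq_translate he hq hQ b ht

end Translation

/-! ### Derivatives of mild solutions -/

section Flow

variable {N : ℕ}

theorem norm_linFlow_fst_le {s : ℝ} (hs : 0 ≤ s) (b : Vel N × Vel N) :
    ‖(linFlow s b).1‖ ≤ 2 * ‖b‖ := by
  have h1 : Real.exp (-s) ≤ 1 := Real.exp_le_one_iff.2 (by linarith)
  have h2 := Real.exp_pos (-s)
  calc ‖(linFlow s b).1‖ ≤ ‖b.1‖ + ‖(1 - Real.exp (-s)) • b.2‖ := norm_add_le _ _
    _ ≤ ‖b‖ + 1 * ‖b‖ := by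
        rw [norm_smul]
        refine add_le_add (norm_fst_le b) (mul_le_mul ?_ (norm_snd_le b) (norm_nonneg _) zero_le_one)
        rw [Real.norm_eq_abs, abs_of_nonneg] <;> linarith
    _ = _ := by ring

theorem norm_linFlow_neg_le {t : ℝ} (ht : 0 ≤ t) (b : Vel N × Vel N) :
    ‖linFlow (-t) b‖ ≤ Real.exp t * ‖b‖ := by
  have h1 : 1 ≤ Real.exp t := Real.one_le_exp ht
  have h2 : linFlow (-t) b = (b.1 + (1 - Real.exp t) • b.2, Real.exp t • b.2) := by
    simp [linFlow]
  rw [h2, norm_prod_le_iff]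
  constructor
  · calc ‖b.1 + (1 - Real.exp t) • b.2‖ ≤ ‖b.1‖ + ‖(1 - Real.exp t) • b.2‖ := norm_add_le _ _
      _ ≤ ‖b‖ + (Real.exp t - 1) * ‖b‖ := by
        rw [norm_smul, Real.norm_eq_abs, abs_of_nonpos (by linarith), neg_sub]
        exact add_le_add (norm_fst_le b)
          (mul_le_mul_of_nonneg_left (norm_snd_le b) (by linarith))
      _ = _ := by ring
  · change ‖Real.exp t • b.2‖ ≤ _
    rw [norm_smul, Real.norm_eq_abs, Real.abs_exp]
    exact mul_le_mul_of_nonneg_left (norm_snd_le b) (Real.exp_pos t).le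

theorem norm_phaseDir (j : Fin N ⊕ Fin N) : ‖(phaseDir j : Vel N × Vel N)‖ = 1 := by
  rcases j with j | j <;> simp [phaseDir, Prod.norm_def]

/-- The coordinates of a vector of `ℝ^N × ℝ^N`. -/
def phaseCoord (b : Vel N × Vel N) : Fin N ⊕ Fin N → ℝ := Sum.elim (fun i => b.1 i) fun i => b.2 i

theorem abs_phaseCoord_le (b : Vel N × Vel N) (j : Fin N ⊕ Fin N) : |phaseCoord b j| ≤ ‖b‖ := by
  rcases j with j | j
  · exact (PiLp.norm_apply_le b.1 j).trans (norm_fst_le b)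
  · exact (PiLp.norm_apply_le b.2 j).trans (norm_snd_le b)

theorem sum_phaseCoord_smul (b : Vel N × Vel N) : ∑ j, phaseCoord b j • phaseDir j = b := by
  have h : ∀ w : Vel N, ∑ i, w i • EuclideanSpace.single i (1 : ℝ) = w := fun w => by
    ext k
    simp [Finset.sum_apply, Pi.single_apply]
  refine Prod.ext ?_ ?_
  · simpa [Fintype.sum_sum_type, phaseCoord, phaseDir, Prod.fst_sum] using h b.1
  · simpa [Fintype.sum_sum_type, phaseCoord, phaseDir, Prod.snd_sum] using h b.2

end Flow

/-! ### Translation derivatives of the force field and of the solution -/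

section SynthForce

variable {N : ℕ} {T B : ℝ} {c : ℝ → Fin N → (Fin N → ℤ) → ℂ}

/-- The force field with given Fourier coefficients. -/
def synthForce (c : ℝ → Fin N → (Fin N → ℤ) → ℂ) (s : ℝ) (i : Fin N) : C(Torus N, ℝ) :=
  synth (c s i)

/-- The derivative of the translations of a force field. -/
def synthForceDeriv (b : Vel N × Vel N) (c : ℝ → Fin N → (Fin N → ℤ) → ℂ) (s : ℝ) (i : Fin N) :
    C(Torus N, ℝ) := -synthDeriv (linFlow s b).1 (c s i)

/-- The second derivative of the translations of a force field. -/
def synthForceDeriv₂ (b b' : Vel N × Vel N) (c : ℝ → Fin N → (Fin N → ℤ) → ℂ) (s : ℝ)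
    (i : Fin N) : C(Torus N, ℝ) := synthDeriv₂ (linFlow s b').1 (linFlow s b).1 (c s i)

theorem ForceField.bddForce (hc : ForceField T B c) (hB : 0 ≤ B) :
    BddForce T B (synthForce c) where
  nonneg := hB
  meas i := aestronglyMeasurable_of_rightCont (fun _ ht => tendsto_synth
    (fun t ht => hc.summable t ht i) (fun t ht => hc.rightCont t ht i) ht) T
  bound s hs i := (hc.summable s hs.1 i).norm_synth_self_le.trans (hc.bound s hs i)

theorem ForceField.bddForce_deriv (hc : ForceField T B c) (hB : 0 ≤ B) (b : Vel N × Vel N) :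
    BddForce T (2 * Real.pi * (2 * ‖b‖) * B) (synthForceDeriv b c) where
  nonneg := by positivity
  meas i := (aestronglyMeasurable_of_rightCont (fun _ ht => tendsto_synthDeriv
    (fun t ht => hc.summable t ht i) (fun t ht => hc.rightCont t ht i) ht
    (continuous_linFlow_left b).fst) T).neg
  bound s hs i := by
    rw [synthForceDeriv, norm_neg]
    refine ((hc.summable s hs.1 i).norm_synthDeriv_le _).trans ?_
    exact mul_le_mul (mul_le_mul_of_nonneg_left (norm_linFlow_fst_le hs.1 b) (by positivity))
      (hc.bound s hs i) (wnorm_nonneg _) (by positivity)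

theorem ForceField.bddForce_deriv₂ (hc : ForceField T B c) (hB : 0 ≤ B) (b b' : Vel N × Vel N) :
    BddForce T ((2 * Real.pi * (2 * ‖b'‖)) * (2 * Real.pi * (2 * ‖b‖)) * B)
      (synthForceDeriv₂ b b' c) where
  nonneg := by positivity
  meas i := aestronglyMeasurable_of_rightCont (fun _ ht => tendsto_synthDeriv₂
    (fun t ht => hc.summable t ht i) (fun t ht => hc.rightCont t ht i) ht
    (continuous_linFlow_left b').fst (continuous_linFlow_left b).fst) T
  bound s hs i := by
    refine ((hc.summable s hs.1 i).norm_synthDeriv₂_le _ _).trans ?_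
    refine mul_le_mul (mul_le_mul ?_ ?_ (by positivity) (by positivity))
      (hc.bound s hs i) (wnorm_nonneg _) (by positivity)
    · exact mul_le_mul_of_nonneg_left (norm_linFlow_fst_le hs.1 b') (by positivity)
    · exact mul_le_mul_of_nonneg_left (norm_linFlow_fst_le hs.1 b) (by positivity)

theorem shiftForce_smul_apply (h : ℝ) (b : Vel N × Vel N) (e : ℝ → Fin N → C(Torus N, ℝ)) (s : ℝ)
    (i : Fin N) : shiftForce (h • b) e s i = torusShift (h • (linFlow s b).1) (e s i) := by
  rw [shiftForce, linFlow_smul, Prod.smul_fst]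

theorem shiftForce_zero_smul (b : Vel N × Vel N) (e : ℝ → Fin N → C(Torus N, ℝ)) :
    shiftForce ((0 : ℝ) • b) e = e := by
  ext1 s
  ext1 i
  rw [shiftForce_smul_apply, zero_smul, torusShift_zero]

theorem torusShift_neg (a : Vel N) (e : C(Torus N, ℝ)) : torusShift a (-e) = -torusShift a e := rfl

/-- The Taylor remainder is quadratic, and uniform in time because the flowed displacement stays
below 2‖b‖ for s ≥ 0. -/
theorem ForceField.hasUnifDeriv (hc : ForceField T B c) (hB : 0 ≤ B) (b : Vel N × Vel N) :
    HasUnifDeriv T (fun h => shiftForce (h • b) (synthForce c)) (synthForceDeriv b c) := by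
  refine HasUnifDeriv.pi fun i => hasUnifDeriv_of_sq_le (K := 8 * (Real.pi * (2 * ‖b‖)) ^ 2 * B)
    (by positivity) fun h s hs => ?_
  rw [shiftForce_zero_smul, shiftForce_smul_apply, synthForceDeriv, smul_neg, sub_neg_eq_add,
    ← synthDeriv_smul]
  refine ((hc.summable s hs.1 i).norm_torusShift_sub_le _).trans ?_
  calc _ ≤ 8 * (Real.pi * (|h| * (2 * ‖b‖))) ^ 2 * B := by
        refine mul_le_mul (mul_le_mul_of_nonneg_left (pow_le_pow_left₀ (by positivity)
          (mul_le_mul_of_nonneg_left ?_ Real.pi_pos.le) 2) (by norm_num)) (hc.bound s hs i)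
          (wnorm_nonneg _) (by positivity)
        rw [norm_smul, Real.norm_eq_abs]
        exact mul_le_mul_of_nonneg_left (norm_linFlow_fst_le hs.1 b) (abs_nonneg h)
    _ = _ := by rw [← sq_abs h]; ring

theorem ForceField.hasUnifDeriv_deriv (hc : ForceField T B c) (hB : 0 ≤ B) (b b' : Vel N × Vel N) :
    HasUnifDeriv T (fun h => shiftForce (h • b') (synthForceDeriv b c))
      (synthForceDeriv₂ b b' c) := by
  refine HasUnifDeriv.pi fun i => hasUnifDeriv_of_sq_le
    (K := 16 * Real.pi ^ 3 * (2 * ‖b'‖) ^ 2 * (2 * ‖b‖) * B) (by positivity) fun h s hs => ?_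
  rw [shiftForce_zero_smul, shiftForce_smul_apply, synthForceDeriv, synthForceDeriv₂,
    torusShift_neg, ← synthDeriv₂_smul_left, ← norm_neg]
  rw [show ∀ x y z : C(Torus N, ℝ), -(-x - -y - z) = x - y + z from fun x y z => by abel]
  refine ((hc.summable s hs.1 i).norm_torusShift_synthDeriv_sub_le _ _).trans ?_
  calc _ ≤ 16 * Real.pi ^ 3 * (|h| * (2 * ‖b'‖)) ^ 2 * (2 * ‖b‖) * B := by
        refine mul_le_mul (mul_le_mul (mul_le_mul_of_nonneg_left (pow_le_pow_left₀ (by positivity)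
          ?_ 2) (by positivity)) (norm_linFlow_fst_le hs.1 b) (norm_nonneg _) (by positivity))
          (hc.bound s hs i) (wnorm_nonneg _) (by positivity)
        rw [norm_smul, Real.norm_eq_abs]
        exact mul_le_mul_of_nonneg_left (norm_linFlow_fst_le hs.1 b') (abs_nonneg h)
    _ = _ := by rw [← sq_abs h]; ring

variable {p : ℝ≥0∞} [Fact (1 ≤ p)] [Fact (p ≠ ⊤)]

theorem aestronglyMeasurable_transport {μ : Measure ℝ} {β : ℝ → Vel N × Vel N} (hβ : Continuous β)
    {r : ℝ → State N p} (hr : AEStronglyMeasurable r μ) :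
    AEStronglyMeasurable (fun s => transport p 0 (β s) (r s)) μ := by
  have h1 : AEStronglyMeasurable (fun s => (β s, r s)) μ := hβ.aestronglyMeasurable.prodMk hr
  have h2 := Continuous.comp_aestronglyMeasurable (f := fun s => (β s, r s))
    (continuous_transport_zero_uncurry (p := p)) h1
  exact h2

/-- Translation derivatives of the solution of a mild equation with a source term. -/
theorem MildEq.hasUnifDeriv_transport {e e' : ℝ → Fin N → C(Torus N, ℝ)} (he : BddForce T B e)
    {B' : ℝ} (he' : BddForce T B' e') {b : Vel N × Vel N}
    (hd : HasUnifDeriv T (fun h => shiftForce (h • b) e) e') {q q' : ℝ → Fin N → State N p}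
    (hq : AEStronglyMeasurable q (volume.restrict (Ioc 0 T))) {Q : ℝ}
    (hQ : ∀ s ∈ Icc 0 T, ‖q s‖ ≤ Q) (hq' : AEStronglyMeasurable q' (volume.restrict (Ioc 0 T)))
    {Q' : ℝ} (hQ' : ∀ s ∈ Icc 0 T, ‖q' s‖ ≤ Q')
    (hqd : HasUnifDeriv T (fun h s i => transport p 0 (linFlow s (h • b)) (q s i)) q')
    {fin g : State N p} (hg : HasTransDeriv b fin g) {f u : ℝ → State N p}
    (hf : MildEq T e q fin f) (hu : MildEq T e (fun s => multOp p (e' s) (f s) + q' s) g u) :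
    HasUnifDeriv T (fun h s => transport p 0 (linFlow s (h • b)) (f s)) u := by
  have h0 : ∀ s, linFlow s ((0 : ℝ) • b) = 0 := fun s => by rw [linFlow_smul, zero_smul]
  refine MildEq.hasUnifDeriv (e := fun h => shiftForce (h • b) e) (fun h => he.shiftForce _) he' hd
    (q := fun h s i => transport p 0 (linFlow s (h • b)) (q s i)) (fun h => ?_) (Q := Q)
    (fun h s hs => ?_) hq' hQ' hqd (fin := fun h => transport p 0 (h • b) fin) (fin' := g) hg
    (fun h => hf.translate he hq hQ (h • b)) ?_
  · exact aestronglyMeasurable_pi fun i => aestronglyMeasurable_transport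
      (continuous_linFlow_left (h • b)) ((continuous_apply i).comp_aestronglyMeasurable hq)
  · refine (pi_norm_le_iff_of_nonneg ((norm_nonneg _).trans (hQ s hs))).2 fun i => ?_
    exact (norm_transport_zero_le _ _).trans ((norm_le_pi_norm _ i).trans (hQ s hs))
  · simpa only [shiftForce_zero_smul, h0, transport_zero] using hu

variable {fin g g' gg : State N p} {f u u' : ℝ → State N p} {b b' : Vel N × Vel N}

/-- Differentiating the translated equation at h = 0: the derivative solves the same equation with
the differentiated force times f as a source, and the differentiated datum. -/
theorem MildEq.hasUnifDeriv_one (hc : ForceField T B c) (hB : 0 ≤ B)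
    (hf : MildEq T (synthForce c) 0 fin f) (hg : HasTransDeriv b fin g)
    (hu : MildEq T (synthForce c) (fun s => multOp p (synthForceDeriv b c s) (f s)) g u) :
    HasUnifDeriv T (fun h s => transport p 0 (linFlow s (h • b)) (f s)) u := by
  refine hf.hasUnifDeriv_transport (hc.bddForce hB) (hc.bddForce_deriv hB b)
    (hc.hasUnifDeriv hB b) (q' := 0) aestronglyMeasurable_const (Q := 0) (fun s _ => norm_zero.le)
    aestronglyMeasurable_const (Q' := 0) (fun s _ => norm_zero.le)
    (HasUnifDeriv.pi fun i ε hε => Eventually.of_forall fun h s _ => ?_) hg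
    (hu.congr fun s => by simp only [Pi.zero_apply, add_zero])
  simp only [Pi.zero_apply, map_zero, sub_zero, smul_zero, norm_zero]
  positivity

/-- The source term in the equation of the second derivatives. -/
def derivSource (c : ℝ → Fin N → (Fin N → ℤ) → ℂ) (b b' : Vel N × Vel N) (f u u' : ℝ → State N p)
    (s : ℝ) : Fin N → State N p :=
  multOp p (synthForceDeriv b' c s) (u s) + (multOp p (synthForceDeriv₂ b b' c s) (f s) +
    multOp p (synthForceDeriv b c s) (u' s))

/-- The same argument for the equation of u. The first term of `derivSource` comes from translating
the force that acts on u; the other two are the product rule for the source of u. -/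
theorem MildEq.hasUnifDeriv_two (hc : ForceField T B c) (hB : 0 ≤ B)
    (hf : MildEq T (synthForce c) 0 fin f) (hg' : HasTransDeriv b' fin g')
    (hgg : HasTransDeriv b' g gg)
    (hu : MildEq T (synthForce c) (fun s => multOp p (synthForceDeriv b c s) (f s)) g u)
    (hu' : MildEq T (synthForce c) (fun s => multOp p (synthForceDeriv b' c s) (f s)) g' u')
    {w : ℝ → State N p} (hw : MildEq T (synthForce c) (derivSource c b b' f u u') gg w) :
    HasUnifDeriv T (fun h s => transport p 0 (linFlow s (h • b')) (u s)) w := by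
  have hb := hc.bddForce_deriv hB b
  have hb2 := hc.bddForce_deriv₂ hB b b'
  obtain ⟨Q, hQ⟩ := hb.exists_bound hf.cont
  obtain ⟨Q1, hQ1⟩ := hb2.exists_bound hf.cont
  obtain ⟨Q2, hQ2⟩ := hb.exists_bound hu'.cont
  obtain ⟨D, hD⟩ := isCompact_Icc.exists_bound_of_continuousOn hf.cont
  obtain ⟨D', hD'⟩ := isCompact_Icc.exists_bound_of_continuousOn hu'.cont
  have h0 : ∀ s, linFlow s ((0 : ℝ) • b') = 0 := fun s => by rw [linFlow_smul, zero_smul]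
  refine hu.hasUnifDeriv_transport (hc.bddForce hB) (hc.bddForce_deriv hB b')
    (hc.hasUnifDeriv hB b') (q' := fun s => multOp p (synthForceDeriv₂ b b' c s) (f s) +
      multOp p (synthForceDeriv b c s) (u' s)) (hb.aestronglyMeasurable hf.cont) hQ
    ((hb2.aestronglyMeasurable hf.cont).add (hb.aestronglyMeasurable hu'.cont)) (Q' := Q1 + Q2)
    (fun s hs => (norm_add_le _ _).trans (add_le_add (hQ1 s hs) (hQ2 s hs)))
    (HasUnifDeriv.pi fun i => ?_) hgg hw
  have h1 : HasUnifDeriv T (fun h s => shiftForce (h • b') (synthForceDeriv b c) s i)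
      fun s => synthForceDeriv₂ b b' c s i := fun ε hε => by
    filter_upwards [hc.hasUnifDeriv_deriv hB b b' ε hε] with h hh s hs
    exact (norm_le_pi_norm _ i).trans (hh s hs)
  have h2 := h1.mulOp (hf.hasUnifDeriv_one hc hB hg' hu')
    (A := 2 * Real.pi * (2 * ‖b‖) * B) (fun s hs => by
      rw [shiftForce_zero_smul]
      exact hb.bound s hs i) (fun s hs => hb2.bound s hs i)
    (fun h s hs => (norm_transport_zero_le _ _).trans (hD s hs)) hD'
  simp only [shiftForce_zero_smul, h0, transport_zero] at h2
  have h3 : (fun (h : ℝ) s => transport p 0 (linFlow s (h • b')) (multOp p (synthForceDeriv b c s) (f s) i))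
      = fun h s => mulOp p (shiftForce (h • b') (synthForceDeriv b c) s i)
        (transport p 0 (linFlow s (h • b')) (f s)) := by
    ext1 h
    ext1 s
    exact transport_mulOp _ _ _
  rw [h3]
  exact h2

end SynthForce

/-! ### Propagation of regularity -/

section TransBound

variable {N : ℕ} {p : ℝ≥0∞} [Fact (1 ≤ p)]

/-- All the derivatives of `f` of order at most `k` exist in `L^p` and have norm at most `σ`. -/
def TransBound : ℕ → ℝ → State N p → Prop
  | 0, σ, f => ‖f‖ ≤ σ
  | k + 1, σ, f => ‖f‖ ≤ σ ∧ ∀ j, ∃ u, HasTransDeriv (phaseDir j) f u ∧ TransBound k σ u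

theorem TransBound.norm_le {k : ℕ} {σ : ℝ} {f : State N p} (h : TransBound k σ f) : ‖f‖ ≤ σ := by
  cases k with
  | zero => exact h
  | succ k => exact h.1

theorem TransBound.mono {k : ℕ} {σ σ' : ℝ} {f : State N p} (h : TransBound k σ f) (hσ : σ ≤ σ') :
    TransBound k σ' f := by
  induction k generalizing f with
  | zero => exact h.norm_le.trans hσ
  | succ k ih =>
    refine ⟨h.1.trans hσ, fun j => ?_⟩
    obtain ⟨u, hu, hu'⟩ := h.2 j
    exact ⟨u, hu, ih hu'⟩

theorem TransBound.const_smul {k : ℕ} {σ : ℝ} {f : State N p} (h : TransBound k σ f) (r : ℝ) :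
    TransBound k (|r| * σ) (r • f) := by
  have h0 : ‖r • f‖ ≤ |r| * σ := by
    rw [norm_smul, Real.norm_eq_abs]
    exact mul_le_mul_of_nonneg_left h.norm_le (abs_nonneg r)
  induction k generalizing f with
  | zero => exact h0
  | succ k ih =>
    refine ⟨h0, fun j => ?_⟩
    obtain ⟨u, hu, hu'⟩ := h.2 j
    refine ⟨r • u, hu.const_smul r, ih hu' ?_⟩
    rw [norm_smul, Real.norm_eq_abs]
    exact mul_le_mul_of_nonneg_left hu'.norm_le (abs_nonneg r)

theorem TransBound.sum {ι : Type*} (S : Finset ι) {k : ℕ} {σ : ι → ℝ} {f : ι → State N p}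
    (h : ∀ i, TransBound k (σ i) (f i)) : TransBound k (∑ i ∈ S, σ i) (∑ i ∈ S, f i) := by
  induction k generalizing f with
  | zero => exact norm_sum_le_of_le S fun i _ => h i
  | succ k ih =>
    refine ⟨norm_sum_le_of_le S fun i _ => (h i).1, fun j => ?_⟩
    choose u hu hu' using fun i => (h i).2 j
    exact ⟨∑ i ∈ S, u i, HasTransDeriv.sum_left S fun i _ => hu i, ih hu'⟩

variable [Fact (p ≠ ⊤)]

/-- The direction is expanded in the 2N coordinate directions, hence the constant. Arbitrary
directions are needed because the flow mixes positions and velocities. -/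
theorem TransBound.exists_deriv {k : ℕ} {σ : ℝ} {f : State N p} (h : TransBound (k + 1) σ f)
    (b : Vel N × Vel N) : ∃ g, HasTransDeriv b f g ∧ TransBound k (2 * N * ‖b‖ * σ) g := by
  choose u hu hu' using h.2
  have hσ : 0 ≤ σ := (norm_nonneg _).trans h.1
  refine ⟨∑ j, phaseCoord b j • u j, ?_, (TransBound.sum Finset.univ fun j =>
    (hu' j).const_smul (phaseCoord b j)).mono ?_⟩
  · have h1 := HasTransDeriv.sum Finset.univ fun j _ => (hu j).smul (phaseCoord b j)
    rwa [sum_phaseCoord_smul] at h1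
  · refine (Finset.sum_le_card_nsmul _ _ (‖b‖ * σ) fun j _ =>
      mul_le_mul_of_nonneg_right (abs_phaseCoord_le b j) hσ).trans (le_of_eq ?_)
    rw [Finset.card_univ, Fintype.card_sum, Fintype.card_fin, nsmul_eq_mul]
    push_cast
    ring

end TransBound

/-! ### Estimates of the first and second derivatives of solutions -/

section Regularity

variable {N : ℕ} {T B : ℝ} {c : ℝ → Fin N → (Fin N → ℤ) → ℂ} {p : ℝ≥0∞} [Fact (1 ≤ p)]

theorem norm_multOp_synthForceDeriv_le (hc : ForceField T B c) (hB : 0 ≤ B)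
    {b : Vel N × Vel N} {β : ℝ} (hb : ‖b‖ ≤ β) {g : State N p} {D : ℝ} (hg : ‖g‖ ≤ D)
    {s : ℝ} (hs : s ∈ Icc 0 T) :
    ‖multOp p (synthForceDeriv b c s) g‖ ≤ 2 * Real.pi * (2 * β) * B * D := by
  have h0 : 0 ≤ β := (norm_nonneg b).trans hb
  have h := hc.bddForce_deriv hB b
  refine (norm_multOp_apply_le h.nonneg (h.bound s hs) g).trans ?_
  refine mul_le_mul (mul_le_mul_of_nonneg_right ?_ hB) hg (norm_nonneg _) (by positivity)
  exact mul_le_mul_of_nonneg_left (by linarith) (by positivity)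

theorem norm_multOp_synthForceDeriv₂_le (hc : ForceField T B c) (hB : 0 ≤ B)
    {b b' : Vel N × Vel N} {β : ℝ} (hb : ‖b‖ ≤ β) (hb' : ‖b'‖ ≤ β) {g : State N p} {D : ℝ}
    (hg : ‖g‖ ≤ D) {s : ℝ} (hs : s ∈ Icc 0 T) : ‖multOp p (synthForceDeriv₂ b b' c s) g‖ ≤
      (2 * Real.pi * (2 * β)) * (2 * Real.pi * (2 * β)) * B * D := by
  have h0 : 0 ≤ β := (norm_nonneg b).trans hb
  have h := hc.bddForce_deriv₂ hB b b'
  refine (norm_multOp_apply_le h.nonneg (h.bound s hs) g).trans ?_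
  refine mul_le_mul (mul_le_mul_of_nonneg_right ?_ hB) hg (norm_nonneg _) (by positivity)
  refine mul_le_mul ?_ ?_ (by positivity) (by positivity)
  · exact mul_le_mul_of_nonneg_left (by linarith) (by positivity)
  · exact mul_le_mul_of_nonneg_left (by linarith) (by positivity)

variable [Fact (p ≠ ⊤)] {fin : State N p} {f : ℝ → State N p}

/-- The constant in the estimate of the first derivatives, in directions of norm at most `β`. -/
def derivConst (N : ℕ) (T B β : ℝ) : ℝ :=
  stabConst N T B * (2 * N * β + 2 * Real.pi * (2 * β) * B * stabConst N T B)

/-- The constant in the estimate of the second derivatives. -/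
def derivConst₂ (N : ℕ) (T B β : ℝ) : ℝ :=
  stabConst N T B * (2 * N * β * (2 * N * β) + (2 * Real.pi * (2 * β) * B * derivConst N T B β +
    ((2 * Real.pi * (2 * β)) * (2 * Real.pi * (2 * β)) * B * stabConst N T B +
      2 * Real.pi * (2 * β) * B * derivConst N T B β)))

theorem derivConst_nonneg (N : ℕ) (T : ℝ) {B β : ℝ} (hB : 0 ≤ B) (hβ : 0 ≤ β) :
    0 ≤ derivConst N T B β := by
  have := stabConst_nonneg N T B
  unfold derivConst
  positivity

theorem derivConst₂_nonneg (N : ℕ) (T : ℝ) {B β : ℝ} (hB : 0 ≤ B) (hβ : 0 ≤ β) :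
    0 ≤ derivConst₂ N T B β := by
  have h1 := stabConst_nonneg N T B
  have h2 := derivConst_nonneg N T hB hβ
  unfold derivConst₂
  positivity

theorem MildEq.norm_le_stabConst (hc : ForceField T B c) (hB : 0 ≤ B)
    (hf : MildEq T (synthForce c) 0 fin f) {σ : ℝ} (hσ : ‖fin‖ ≤ σ) {t : ℝ} (ht : t ∈ Icc 0 T) :
    ‖f t‖ ≤ stabConst N T B * σ := by
  refine (hf.norm_le (hc.bddForce hB) le_rfl (fun s _ => norm_zero.le) t ht).trans ?_
  rw [add_zero]
  exact mul_le_mul_of_nonneg_left hσ (stabConst_nonneg _ _ _)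

/-- First derivatives of mild solutions. -/
theorem MildEq.exists_deriv (hT : 0 ≤ T) (hc : ForceField T B c) (hB : 0 ≤ B)
    (hf : MildEq T (synthForce c) 0 fin f) {b : Vel N × Vel N} {β σ : ℝ} (hb : ‖b‖ ≤ β)
    (hσ : ‖fin‖ ≤ σ) {g : State N p} (hgσ : ‖g‖ ≤ 2 * N * β * σ) :
    ∃ u, MildEq T (synthForce c) (fun s => multOp p (synthForceDeriv b c s) (f s)) g u ∧
      ∀ t ∈ Icc 0 T, ‖u t‖ ≤ derivConst N T B β * σ := by
  have he := hc.bddForce_deriv hB b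
  have hQ := fun (s : ℝ) (hs : s ∈ Icc 0 T) => norm_multOp_synthForceDeriv_le hc hB hb
    (hf.norm_le_stabConst hc hB hσ hs) hs
  have h0 : 0 ≤ β := (norm_nonneg b).trans hb
  have hσ0 : 0 ≤ σ := (norm_nonneg _).trans hσ
  have hS := stabConst_nonneg N T B
  obtain ⟨u, hu⟩ := exists_mildEq hT (hc.bddForce hB) g (he.aestronglyMeasurable hf.cont) hQ
  refine ⟨u, hu, fun t ht => (hu.norm_le (hc.bddForce hB) (by positivity) hQ t ht).trans ?_⟩
  rw [derivConst, mul_assoc (stabConst N T B) _ σ]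
  refine mul_le_mul_of_nonneg_left ?_ hS
  linarith

/-- Second derivatives of mild solutions. -/
theorem MildEq.exists_deriv₂ (hT : 0 ≤ T) (hc : ForceField T B c) (hB : 0 ≤ B)
    (hf : MildEq T (synthForce c) 0 fin f) {b b' : Vel N × Vel N} {β σ : ℝ} (hb : ‖b‖ ≤ β)
    (hb' : ‖b'‖ ≤ β) (hσ : ‖fin‖ ≤ σ) {g g' gg : State N p}
    (hg' : HasTransDeriv b' fin g') (hgg : HasTransDeriv b' g gg)
    (hgσ' : ‖g'‖ ≤ 2 * N * β * σ) (hggσ : ‖gg‖ ≤ 2 * N * β * (2 * N * β * σ)) {u : ℝ → State N p}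
    (hu : MildEq T (synthForce c) (fun s => multOp p (synthForceDeriv b c s) (f s)) g u)
    (huσ : ∀ t ∈ Icc 0 T, ‖u t‖ ≤ derivConst N T B β * σ) :
    ∀ t ∈ Icc 0 T, ∃ w, HasTransDeriv (linFlow t b') (u t) w ∧ ‖w‖ ≤ derivConst₂ N T B β * σ := by
  obtain ⟨u', hu', huσ'⟩ := hf.exists_deriv hT hc hB hb' hσ hgσ'
  have h0 : 0 ≤ β := (norm_nonneg b).trans hb
  have hσ0 : 0 ≤ σ := (norm_nonneg _).trans hσ
  have hS := stabConst_nonneg N T B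
  have hD := derivConst_nonneg N T hB h0
  have hQ : ∀ s ∈ Icc 0 T, ‖derivSource c b b' f u u' s‖ ≤
      2 * Real.pi * (2 * β) * B * (derivConst N T B β * σ) +
      ((2 * Real.pi * (2 * β)) * (2 * Real.pi * (2 * β)) * B * (stabConst N T B * σ) +
        2 * Real.pi * (2 * β) * B * (derivConst N T B β * σ)) := fun s hs =>
    (norm_add_le _ _).trans (add_le_add
      (norm_multOp_synthForceDeriv_le hc hB hb' (huσ s hs) hs) ((norm_add_le _ _).trans (add_le_add
        (norm_multOp_synthForceDeriv₂_le hc hB hb hb' (hf.norm_le_stabConst hc hB hσ hs) hs)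
        (norm_multOp_synthForceDeriv_le hc hB hb (huσ' s hs) hs))))
  obtain ⟨w, hw⟩ := exists_mildEq hT (hc.bddForce hB) gg
    (((hc.bddForce_deriv hB b').aestronglyMeasurable hu.cont).add
      (((hc.bddForce_deriv₂ hB b b').aestronglyMeasurable hf.cont).add
        ((hc.bddForce_deriv hB b).aestronglyMeasurable hu'.cont))) hQ
  refine fun t ht => ⟨w t, ?_, (hw.norm_le (hc.bddForce hB) (by positivity) hQ t ht).trans ?_⟩
  · have h1 := (hf.hasUnifDeriv_two hc hB hg' hgg hu hu' hw).hasDerivAt ht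
    simp only [linFlow_smul] at h1
    exact h1
  · rw [derivConst₂, mul_assoc (stabConst N T B) _ σ]
    refine mul_le_mul_of_nonneg_left ?_ hS
    linarith

/-- The constant in the estimate of the derivatives of order at most two. -/
def regConst (N : ℕ) (T B : ℝ) : ℝ :=
  stabConst N T B + (derivConst N T B (Real.exp T) + derivConst₂ N T B (Real.exp T))

theorem regConst_nonneg (N : ℕ) (T : ℝ) {B : ℝ} (hB : 0 ≤ B) : 0 ≤ regConst N T B := by
  have h1 := stabConst_nonneg N T B
  have h2 := derivConst_nonneg N T hB (Real.exp_pos T).le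
  have h3 := derivConst₂_nonneg N T hB (Real.exp_pos T).le
  unfold regConst
  positivity

/-- The derivatives of order at most two of mild solutions. -/
theorem MildEq.transBound (hT : 0 ≤ T) (hc : ForceField T B c) (hB : 0 ≤ B)
    (hf : MildEq T (synthForce c) 0 fin f) {k : ℕ} (hk : k ≤ 2) {σ : ℝ}
    (hσ : TransBound k σ fin) {t : ℝ} (ht : t ∈ Icc 0 T) :
    TransBound k (regConst N T B * σ) (f t) := by
  have hσ0 : 0 ≤ σ := (norm_nonneg _).trans hσ.norm_le
  have hβ := (Real.exp_pos T).le
  have hs1 := stabConst_nonneg N T B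
  have hs2 := derivConst_nonneg N T hB hβ
  have hs3 := derivConst₂_nonneg N T hB hβ
  have hC0 : stabConst N T B * σ ≤ regConst N T B * σ :=
    mul_le_mul_of_nonneg_right (by unfold regConst; linarith) hσ0
  have hC1 : derivConst N T B (Real.exp T) * σ ≤ regConst N T B * σ :=
    mul_le_mul_of_nonneg_right (by unfold regConst; linarith) hσ0
  have hC2 : derivConst₂ N T B (Real.exp T) * σ ≤ regConst N T B * σ :=
    mul_le_mul_of_nonneg_right (by unfold regConst; linarith) hσ0
  have hn := (hf.norm_le_stabConst hc hB hσ.norm_le ht).trans hC0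
  -- For a derivative in a coordinate direction at time t, the datum is differentiated in that
  -- direction pulled back by the flow; the pullback costs at most e^T.
  have hdir : ∀ j : Fin N ⊕ Fin N, ‖linFlow (-t) (phaseDir j)‖ ≤ Real.exp T := fun j => by
    refine (norm_linFlow_neg_le ht.1 _).trans ?_
    rw [norm_phaseDir, mul_one]
    exact Real.exp_le_exp.2 ht.2
  have hflow : ∀ j : Fin N ⊕ Fin N, linFlow t (linFlow (-t) (phaseDir j)) = phaseDir j := fun j => by
    rw [linFlow_linFlow, add_neg_cancel, linFlow_zero]
  have key : ∀ {l : ℕ}, TransBound (l + 1) σ fin → ∀ j, ∃ g u,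
      HasTransDeriv (linFlow (-t) (phaseDir j)) fin g ∧
      TransBound l (2 * N * Real.exp T * σ) g ∧
      MildEq T (synthForce c)
        (fun s => multOp p (synthForceDeriv (linFlow (-t) (phaseDir j)) c s) (f s)) g u ∧
      HasTransDeriv (phaseDir j) (f t) (u t) ∧
      ∀ t ∈ Icc 0 T, ‖u t‖ ≤ derivConst N T B (Real.exp T) * σ := fun {l} h j => by
    obtain ⟨g, hg, hgσ⟩ := h.exists_deriv (linFlow (-t) (phaseDir j))
    have hgσ' : TransBound l (2 * N * Real.exp T * σ) g := hgσ.mono (mul_le_mul_of_nonneg_right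
      (mul_le_mul_of_nonneg_left (hdir j) (by positivity)) hσ0)
    obtain ⟨u, hu, huσ⟩ := hf.exists_deriv hT hc hB (hdir j) h.norm_le hgσ'.norm_le
    refine ⟨g, u, hg, hgσ', hu, ?_, huσ⟩
    have h1 := (hf.hasUnifDeriv_one hc hB hg hu).hasDerivAt ht
    simp only [linFlow_smul, hflow] at h1
    exact h1
  interval_cases k
  · exact hn
  · refine ⟨hn, fun j => ?_⟩
    obtain ⟨g, u, -, -, -, hu, huσ⟩ := key hσ j
    exact ⟨u t, hu, (huσ t ht).trans hC1⟩
  · refine ⟨hn, fun j => ?_⟩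
    obtain ⟨g, u, hg, hgσ, hu, hut, huσ⟩ := key hσ j
    refine ⟨u t, hut, (huσ t ht).trans hC1, fun l => ?_⟩
    obtain ⟨g', -, hg', hgσ', -⟩ := key hσ l
    obtain ⟨gg, hgg, hggσ⟩ := hgσ.exists_deriv (linFlow (-t) (phaseDir l))
    have hggσ' : ‖gg‖ ≤ 2 * N * Real.exp T * (2 * N * Real.exp T * σ) := hggσ.norm_le.trans
      (mul_le_mul_of_nonneg_right (mul_le_mul_of_nonneg_left (hdir l) (by positivity))
        (by positivity))
    obtain ⟨w, hw, hwσ⟩ := hf.exists_deriv₂ hT hc hB (hdir j) (hdir l) hσ.norm_le hg' hgg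
      hgσ'.norm_le hggσ' hu huσ t ht
    rw [hflow] at hw
    exact ⟨w, hw, hwσ.trans hC2⟩

end Regularity

/-! ### Translation derivatives and weak derivatives -/

section MultiDeriv

variable {N : ℕ} {φ : Phase N → ℝ}

theorem IsTestFunction.iterate (h : IsTestFunction toPhase φ) (e : Vel N × Vel N) (r : ℕ) :
    IsTestFunction toPhase ((KineticFP.dirDeriv toPhase e)^[r] φ) := by
  induction r with
  | zero => exact h
  | succ r ih =>
    rw [Function.iterate_succ_apply']
    exact ih.dirDeriv e

theorem iterate_dirDeriv_comm (h : IsTestFunction toPhase φ) (e e' : Vel N × Vel N) (r : ℕ) :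
    (dirDeriv toPhase e)^[r] (dirDeriv toPhase e' φ) =
      dirDeriv toPhase e' ((dirDeriv toPhase e)^[r] φ) := by
  induction r with
  | zero => rfl
  | succ r ih =>
    rw [Function.iterate_succ_apply', ih, dirDeriv_comm (h.iterate e r),
      Function.iterate_succ_apply']

/-- The composition of derivatives along a list of directions. -/
def listDeriv (α : Fin N ⊕ Fin N → ℕ) (l : List (Fin N ⊕ Fin N)) (φ : Phase N → ℝ) : Phase N → ℝ :=
  l.foldr (fun i ψ => (dirDeriv toPhase (phaseDir i))^[α i] ψ) φ

theorem IsTestFunction.listDeriv (h : IsTestFunction toPhase φ) (α : Fin N ⊕ Fin N → ℕ)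
    (l : List (Fin N ⊕ Fin N)) : IsTestFunction toPhase (listDeriv α l φ) := by
  induction l with
  | nil => exact h
  | cons i l ih => exact ih.iterate _ _

theorem listDeriv_dirDeriv (h : IsTestFunction toPhase φ) (α : Fin N ⊕ Fin N → ℕ)
    (l : List (Fin N ⊕ Fin N)) (e : Vel N × Vel N) :
    listDeriv α l (dirDeriv toPhase e φ) = dirDeriv toPhase e (listDeriv α l φ) := by
  induction l with
  | nil => rfl
  | cons i l ih =>
    change (dirDeriv toPhase _)^[α i] (listDeriv α l _) = dirDeriv toPhase e
      ((dirDeriv toPhase _)^[α i] (listDeriv α l φ))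
    rw [ih, iterate_dirDeriv_comm (h.listDeriv α l)]

theorem listDeriv_single_add (h : IsTestFunction toPhase φ) (α : Fin N ⊕ Fin N → ℕ)
    {l : List (Fin N ⊕ Fin N)} (hl : l.Nodup) {j : Fin N ⊕ Fin N} (hj : j ∈ l) :
    listDeriv (Pi.single j 1 + α) l φ = dirDeriv toPhase (phaseDir j) (listDeriv α l φ) := by
  induction l with
  | nil => simp at hj
  | cons i l ih =>
    rw [List.nodup_cons] at hl
    change (dirDeriv toPhase _)^[(Pi.single j 1 + α : Fin N ⊕ Fin N → ℕ) i] (listDeriv _ l _) =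
      dirDeriv toPhase (phaseDir j) ((dirDeriv toPhase _)^[α i] (listDeriv α l φ))
    by_cases hij : i = j
    · subst hij
      have h1 : listDeriv (Pi.single i 1 + α) l φ = listDeriv α l φ := by
        refine List.foldr_ext _ _ _ fun k hk ψ => ?_
        have h2 : k ≠ i := fun hki => hl.1 (hki ▸ hk)
        simp [h2]
      rw [h1, Pi.add_apply, Pi.single_eq_same, add_comm, Function.iterate_succ_apply']
    · have h1 : j ∈ l := by simpa [Ne.symm hij] using hj
      rw [ih hl.2 h1, iterate_dirDeriv_comm (h.listDeriv α l)]
      simp [hij]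

theorem IsTestFunction.multiDeriv (h : IsTestFunction toPhase φ) (α : Fin N ⊕ Fin N → ℕ) :
    IsTestFunction toPhase (multiDeriv toPhase phaseDir α φ) := h.listDeriv α _

theorem multiDeriv_dirDeriv (h : IsTestFunction toPhase φ) (α : Fin N ⊕ Fin N → ℕ)
    (e : Vel N × Vel N) : multiDeriv toPhase phaseDir α (dirDeriv toPhase e φ) =
      dirDeriv toPhase e (multiDeriv toPhase phaseDir α φ) := listDeriv_dirDeriv h α _ e

theorem multiDeriv_single_add (h : IsTestFunction toPhase φ) (α : Fin N ⊕ Fin N → ℕ)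
    (j : Fin N ⊕ Fin N) : multiDeriv toPhase phaseDir (Pi.single j 1 + α) φ =
      dirDeriv toPhase (phaseDir j) (multiDeriv toPhase phaseDir α φ) :=
  listDeriv_single_add h α (Finset.nodup_toList _) (by simp)

theorem sum_single_add (α : Fin N ⊕ Fin N → ℕ) (j : Fin N ⊕ Fin N) :
    ∑ i, (Pi.single j 1 + α : Fin N ⊕ Fin N → ℕ) i = ∑ i, α i + 1 := by
  simp [Finset.sum_add_distrib, add_comm]

theorem integral_neg_coe_mul {p : ℝ≥0∞} (w : State N p) (φ : Phase N → ℝ) :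
    ∫ z, (-w : State N p) z * φ z = -∫ z, w z * φ z := by
  rw [← integral_neg]
  refine integral_congr_ae ?_
  filter_upwards [Lp.coeFn_neg w] with z hz
  rw [hz, Pi.neg_apply, neg_mul]

theorem exists_single_add {α : Fin N ⊕ Fin N → ℕ} (h : α ≠ 0) :
    ∃ (j : Fin N ⊕ Fin N) (α' : Fin N ⊕ Fin N → ℕ), α = Pi.single j 1 + α' := by
  obtain ⟨j, hj⟩ := Function.ne_iff.1 h
  refine ⟨j, α - Pi.single j 1, funext fun i => ?_⟩
  by_cases hi : i = j
  · subst hi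
    have : 1 ≤ α i := Nat.one_le_iff_ne_zero.2 hj
    simp
    omega
  · simp [hi]

end MultiDeriv

/-! ### Comparison with the Sobolev norm -/

section WeakDeriv

variable {N : ℕ} {p : ℝ≥0∞} [Fact (1 ≤ p)]

/-- Weak derivatives are unique almost everywhere, so all competitors in the infimum have the same
norm and any one of them attains it. -/
theorem HasWeakDeriv.exists_state {α : Fin N ⊕ Fin N → ℕ} {f : State N p}
    (h : weakDerivNorm toPhase phaseDir α p f ≠ ⊤) :
    ∃ w : State N p, HasWeakDeriv toPhase phaseDir α f w ∧
      ‖w‖ₑ ≤ weakDerivNorm toPhase phaseDir α p f := by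
  obtain ⟨g, hg⟩ := iInf_lt_iff.1 (lt_top_iff_ne_top.2 h)
  obtain ⟨hg, hg'⟩ := iInf_lt_iff.1 hg
  have hm : MemLp g p volume := ⟨hg.2.1.aestronglyMeasurable, hg'⟩
  have hae : (hm.toLp : Phase N → ℝ) =ᵐ[volume] g := hm.coeFn_toLp
  refine ⟨hm.toLp, ⟨hg.1, State.locallyIntegrable _, fun φ hφ => ?_⟩, ?_⟩
  · rw [hg.2.2 φ hφ]
    congr 1
    refine integral_congr_ae ?_
    filter_upwards [hae] with z hz
    rw [hz]
  · rw [Lp.enorm_def, eLpNorm_congr_ae hae]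
    refine le_iInf₂ fun g' hg' => le_of_eq (eLpNorm_congr_ae ?_)
    have h1 := ae_eq_zero_of_integral_mul_test (hg.2.1.sub hg'.2.1) fun φ hφ => by
      have h2 := (hg.2.2 φ hφ).symm.trans (hg'.2.2 φ hφ)
      have h3 := mul_left_cancel₀ (pow_ne_zero _ (by norm_num)) h2
      rw [← sub_eq_zero, ← integral_sub (integrable_mul_test hg.2.1 hφ)
        (integrable_mul_test hg'.2.1 hφ)] at h3
      simpa [sub_mul] using h3
    filter_upwards [h1] with z hz
    exact sub_eq_zero.1 hz

/-- One derivative is removed at a time. A translation derivative is minus the weak derivative,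
hence the witness -w. -/
theorem TransBound.exists_hasWeakDeriv {k : ℕ} {σ : ℝ} {f : State N p} (h : TransBound k σ f)
    {α : Fin N ⊕ Fin N → ℕ} (hα : ∑ i, α i ≤ k) :
    ∃ u : State N p, HasWeakDeriv toPhase phaseDir α f u ∧ ‖u‖ ≤ σ := by
  induction k generalizing f α with
  | zero =>
    have : α = 0 := funext fun i => by simpa using (Finset.sum_eq_zero_iff.1 (Nat.le_zero.1 hα)) i
    subst this
    exact ⟨f, ⟨f.locallyIntegrable, f.locallyIntegrable, fun φ _ => by simp [multiDeriv_zero]⟩, h⟩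
  | succ k ih =>
    by_cases h0 : α = 0
    · subst h0
      exact ⟨f, ⟨f.locallyIntegrable, f.locallyIntegrable, fun φ _ => by simp [multiDeriv_zero]⟩,
        h.1⟩
    · obtain ⟨j, α', rfl⟩ := exists_single_add h0
      rw [sum_single_add] at hα
      obtain ⟨u, hu, huσ⟩ := h.2 j
      obtain ⟨w, hw, hwσ⟩ := ih huσ (Nat.le_of_succ_le_succ hα)
      refine ⟨-w, ⟨f.locallyIntegrable, State.locallyIntegrable _, fun φ hφ => ?_⟩, by
        rwa [norm_neg]⟩
      rw [multiDeriv_single_add hφ, hu.integral_mul (hφ.multiDeriv α'), hw.2.2 φ hφ,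
        integral_neg_coe_mul, sum_single_add, pow_succ]
      ring

theorem sobolevNorm_le {k : ℕ} {σ : ℝ} {f : State N p} (h : TransBound k σ f) :
    sobolevNorm k p f ≤ (∑ n ∈ Finset.range (k + 1),
      (Finset.piAntidiag (Finset.univ : Finset (Fin N ⊕ Fin N)) n).card : ℕ) * ENNReal.ofReal σ := by
  rw [Nat.cast_sum, Finset.sum_mul]
  refine Finset.sum_le_sum fun n hn => ?_
  rw [← nsmul_eq_mul]
  refine Finset.sum_le_card_nsmul _ _ _ fun α hα => ?_
  obtain ⟨u, hu, huσ⟩ := h.exists_hasWeakDeriv (α := α) (by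
    rw [(Finset.mem_piAntidiag.1 hα).1]
    exact Nat.lt_succ_iff.1 (Finset.mem_range.1 hn))
  refine (iInf₂_le (u : Phase N → ℝ) hu).trans ?_
  rw [← Lp.enorm_def, ← ofReal_norm]
  exact ENNReal.ofReal_le_ofReal huσ

/-- With w α the weak derivative of order α, the translation derivative of w α in the direction j is
minus the weak derivative of the index raised by one at j. Induction on the number of derivatives
still available gives the bound at α = 0. -/
theorem transBound_of_sobolevNorm (hp : p ≠ ⊤) {k : ℕ} {f : State N p}
    (h : sobolevNorm k p f < ⊤) : TransBound k (sobolevNorm k p f).toReal f := by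
  set σ := (sobolevNorm k p f).toReal with hσ
  have h1 : ∀ α : Fin N ⊕ Fin N → ℕ, ∑ i, α i ≤ k →
      weakDerivNorm toPhase phaseDir α p f ≤ sobolevNorm k p f := fun α hα =>
    (Finset.single_le_sum (f := fun α => weakDerivNorm toPhase phaseDir α p (f : Phase N → ℝ))
      (fun _ _ => zero_le)
      (Finset.mem_piAntidiag.2 ⟨rfl, fun _ _ => Finset.mem_univ _⟩)).trans
      (Finset.single_le_sum (f := fun n => ∑ α ∈ Finset.piAntidiag
        (Finset.univ : Finset (Fin N ⊕ Fin N)) n, weakDerivNorm toPhase phaseDir α p f)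
        (fun _ _ => zero_le) (Finset.mem_range.2 (Nat.lt_succ_of_le hα)))
  have h2 : ∀ α : Fin N ⊕ Fin N → ℕ, ∑ i, α i ≤ k → ∃ w : State N p,
      HasWeakDeriv toPhase phaseDir α f w ∧ ‖w‖ ≤ σ := fun α hα => by
    obtain ⟨w, hw, hw'⟩ := HasWeakDeriv.exists_state ((h1 α hα).trans_lt h).ne
    refine ⟨w, hw, ?_⟩
    rw [hσ, ← toReal_enorm]
    exact ENNReal.toReal_mono h.ne (hw'.trans (h1 α hα))
  choose! w hw hwσ using h2
  have h3 : ∀ n α, ∑ i, α i + n ≤ k → TransBound n σ (w α) := by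
    intro n
    induction n with
    | zero => exact fun α hα => hwσ α hα
    | succ n ih =>
      refine fun α hα => ⟨hwσ α (by omega), fun j => ?_⟩
      have hs := sum_single_add α j
      have hα' : ∑ i, (Pi.single j 1 + α : Fin N ⊕ Fin N → ℕ) i ≤ k := by omega
      have h4 := (ih (Pi.single j 1 + α) (by omega)).const_smul (-1)
      rw [abs_neg, abs_one, one_mul, neg_one_smul] at h4
      refine ⟨-w (Pi.single j 1 + α), hasTransDeriv_of_integral_mul hp fun φ hφ => ?_, h4⟩
      have h5 := (hw α (by omega)).2.2 _ (hφ.dirDeriv (phaseDir j))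
      have h6 := (hw _ hα').2.2 φ hφ
      rw [multiDeriv_dirDeriv hφ, ← multiDeriv_single_add hφ, h6, hs, pow_succ, mul_assoc] at h5
      rw [integral_neg_coe_mul, ← mul_left_cancel₀ (pow_ne_zero _ (by norm_num)) h5]
      ring
  have h4 : w 0 = f := eq_of_integral_mul_test fun φ hφ => by
    simpa [multiDeriv_zero] using ((hw 0 (by simp)).2.2 φ hφ).symm
  rw [← h4]
  exact h3 k 0 (by simp)

end WeakDeriv
end KineticFP

end

/-! ### The Cauchy problem: assembly of the results -/

theorem mainTheorem7 (N m : ℕ) (hN : 1 ≤ N) (hm : N + 1 < m) (T : ℝ) (hT : 0 < T) :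
    (∀ (E : ℝ → KineticFP.Torus N → KineticFP.Vel N), KineticFP.IsCadlagForce m E →
      ∀ (p : ℝ≥0∞) [Fact (1 ≤ p)], p ≠ ⊤ →
      ∀ fin : Lp ℝ p (volume : Measure (KineticFP.Phase N)),
      ∃ f : ℝ → Lp ℝ p (volume : Measure (KineticFP.Phase N)),
        KineticFP.IsMildSolution T E fin f ∧
        (∀ g : ℝ → Lp ℝ p (volume : Measure (KineticFP.Phase N)),
          KineticFP.IsMildSolution T E fin g → EqOn g f (Icc 0 T)) ∧
        (0 ≤ fin → ∀ t ∈ Icc 0 T, 0 ≤ f t) ∧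
        (p = 1 → 0 ≤ fin → ∀ t ∈ Icc 0 T, ‖f t‖ = ‖fin‖) ∧
        (p = 1 → ∀ t ∈ Icc 0 T, ‖f t‖ ≤ ‖fin‖) ∧
        (∀ l : ℕ, KineticFP.MemG l fin → ∀ t ∈ Icc 0 T, KineticFP.MemG l (f t))) ∧
    (∀ k : ℕ, k ≤ 2 → ∀ R : ℝ≥0, ∃ C : ℝ≥0,
      ∀ (E : ℝ → KineticFP.Torus N → KineticFP.Vel N), KineticFP.IsCadlagForce m E →
      (∀ t ∈ Icc 0 T, KineticFP.forceNorm m (E t) ≤ R) →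
      ∀ (p : ℝ≥0∞) [Fact (1 ≤ p)], p ≠ ⊤ →
      ∀ (fin : Lp ℝ p (volume : Measure (KineticFP.Phase N)))
        (f : ℝ → Lp ℝ p (volume : Measure (KineticFP.Phase N))),
        KineticFP.IsMildSolution T E fin f →
        KineticFP.sobolevNorm k p fin < ⊤ →
        ∀ t ∈ Icc 0 T, KineticFP.sobolevNorm k p (f t) ≤ C * KineticFP.sobolevNorm k p fin) := by
  refine ⟨fun E hE p _ hp fin => ?_, fun k hk R => ?_⟩
  · have : Fact (p ≠ ⊤) := ⟨hp⟩
    -- Here the bound may depend on E: none of the assertions of this part involves a uniform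
    -- constant.
    obtain ⟨B, hB, hc⟩ := KineticFP.exists_forceField hm hE T
    have he := hc.bddForce hB
    have hiff : ∀ g, KineticFP.IsMildSolution T E fin g ↔
        KineticFP.MildEq T (KineticFP.synthForce (KineticFP.forceCoeffs E)) 0 fin g := fun g =>
      KineticFP.isMildSolution_iff he fun s hs i => KineticFP.forceCoeffs_ae hm hE hs.1 i
    obtain ⟨f, hf⟩ := KineticFP.exists_mildEq hT.le he fin (q := 0) aestronglyMeasurable_const
      (Q := 0) fun s _ => norm_zero.le
    refine ⟨f, (hiff f).2 hf, fun g hg => ((hiff g).1 hg).eqOn he hf,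
      fun hfin t ht => hf.nonneg hT.le he hfin ht, ?_, ?_,
      fun l hl t ht => hf.memG hT.le he hl ht⟩
    · rintro rfl hfin t ht
      exact hf.norm_eq hT.le he hfin ht
    · rintro rfl t ht
      exact hf.norm_le_norm hT.le he ht
  -- The bound is fixed before E, p and the datum are introduced and depends on N, m and R only; so
  -- does the constant, apart from k and T.
  · set B : ℝ := KineticFP.fourierConst N m * R with hBdef
    have hB : 0 ≤ B := mul_nonneg (KineticFP.fourierConst_nonneg N m) R.2
    -- The number of multi-indices of order at most k, times the bound for each single derivative.
    refine ⟨(∑ n ∈ Finset.range (k + 1),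
      (Finset.piAntidiag (Finset.univ : Finset (Fin N ⊕ Fin N)) n).card : ℕ) *
      (KineticFP.regConst N T B).toNNReal, fun E hE hR p _ hp fin f hf hfin t ht => ?_⟩
    have : Fact (p ≠ ⊤) := ⟨hp⟩
    have hc := KineticFP.forceField_of_forceNorm_le hm hE hR
    have hf' : KineticFP.MildEq T (KineticFP.synthForce (KineticFP.forceCoeffs E)) 0 fin f :=
      (KineticFP.isMildSolution_iff (hc.bddForce hB) fun s hs i =>
        KineticFP.forceCoeffs_ae hm hE hs.1 i).1 hf
    refine (KineticFP.sobolevNorm_le (hf'.transBound hT.le hc hB hk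
      (KineticFP.transBound_of_sobolevNorm hp hfin) ht)).trans (le_of_eq ?_)
    rw [ENNReal.ofReal_mul (KineticFP.regConst_nonneg N T hB), ENNReal.ofReal_toReal hfin.ne,
      ← mul_assoc, ENNReal.coe_mul, ENNReal.coe_natCast]
    rfl
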